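/- All objects are smooth ($C^\infty$). Write $[\![\alpha^1,\dots,\alpha^r]\!]$ for the subbundle of a cotangent bundle spanned by $1$-forms. For a subbundle $F\subset T^*M$, a *Cauchy characteristic vector* of $F$ is a tangent vector $v$ with $F(v)=0$ and $v\lrcorner\, d\alpha\in F$ for all sections $\alpha$ of $F$; the *Cartan system* $\mathcal C(F)$ is the annihilator of these vectors; the *derived system* $F^{(1)}$ consists of the sections $\alpha$ of $F$ with $d\alpha\equiv 0 \bmod F$; $F^{(k+1)}=(F^{(k)})^{(1)}$; $F$ is *Frobenius* if $F^{(1)}=F$. A *system* $(M,I;\tau)$ is a manifold $M$, a subbundle $I\subset T^*M$ and an exact $1$-form $\tau$, nowhere in $I$, such that $I$ has no nonzero Cauchy characteristic vectors and no integral surface $S\hookrightarrow M$ on which $\tau$ pulls back to a nonzero form. It has *type* $(n,m)$ if $\dim M=n+m+1$ and $\operatorname{rank} I=n$. It is *control-type* (a CTS) if $[\![ I,\tau]\!]$ is Frobenius, and *strongly linear* if moreover its derived systems have constant rank, $I^{(k)}=0$ for some $k$, and every $[\![ I^{(k)},\tau]\!]$ is Frobenius. Integral curves of $(M,I;\tau)$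 are curves $\gamma:(-\epsilon,\epsilon)\to M$ with $\gamma^*I=0$ and $\gamma^*\tau$ nowhere zero. A *Cartan prolongation* $\pi:(N,J;\sigma)\to(M,I;\tau)$ is a submersion with dense image between systems such that $\pi^*I\subset J$, $\pi^*\tau=\sigma$, and every generic integral curve of $(M,I;\tau)$ has a unique lifting to an integral curve of $(N,J;\sigma)$ on the same interval. Here genericity is local: a curve is generic if all its jets lie in some fixed set $W$ of jets of integral curves of $(M,I;\tau)$, given by an open condition on finite jets, such that every integral curve of $(N,J;\sigma)$ can be approximated at time $0$, to any finite order, by integral curves of $(N,J;\sigma)$ whose projections are generic. Two systems are *absolutely equivalent* if some system is a Cartan prolongation of both; a system is *dynamically linearizable* if it is absolutely equivalent to a strongly linear CTS. For a Cartan prolongation $\pi$ put $I_0=\pi^*I$ and $I_{k+1}=\mathcal C(I_k)\cap J$. The *reduction* of a subbundle $F\subset T^*N$ and $\sigma$ on an open set $U\subset N$ is a system whose manifold is the leaf space of $\mathcal C(F)$ on $U$ (the base of a submersion $U\to M$ whose fibers are connected with tangent spaces the Cauchy characteristic vectors of $F$), and whose bundle and $1$-form pull back to $F$ and $\sigma$.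 The prolongation is *$\mathcal C$-regular with extension length $K$* if $I_0\subsetneq I_1\subsetneq\dots\subsetneq I_K=J$, $\sigma$ is a section of every $\mathcal C(I_k)$, each $(I_k,\sigma)$ has a reduction $(M_k,I_k;\sigma_k)$ on $N$ that is a system, and the maps $N\to M_{k+1}$, $N\to M_k$ induce Cartan prolongations $M_{k+1}\to M_k$. It is *linearizing* if, in addition, $(N,J;\sigma)$ is strongly linear, each $[\![ I_k,\sigma]\!]$ is Frobenius, and $\operatorname{rank}(I_{k+1}/I_k)=1$ for $0\le k<K$. The *class* of a CTS of type $(n,2)$ is the minimal $K$ for which it has a linearizing $\mathcal C$-regular Cartan prolongation with extension length $K$ if it is dynamically linearizable, and $\infty$ otherwise. **Theorem.** Let $n\ge 2$ and $K\ge 0$. (a) Let $(M,I;\tau)$ be a dynamically linearizable CTS of type $(n,2)$ and $\pi:(N,J;\sigma)\to(M,I;\tau)$ a linearizing $\mathcal C$-regular Cartan prolongation with extension length $K$. Then near every point of $N$ there is a local coframing $(\theta^1,\dots,\theta^n,\eta^1,\dots,\eta^K,\omega^1,\omega^2,\sigma)$ with $\pi^*I=[\![\theta^1,\dots,\theta^n]\!]$,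 $I_k=[\![\theta^1,\dots,\theta^n,\eta^1,\dots,\eta^k]\!]$ for $1\le k\le K$, and $$\begin{aligned} d\theta^1&\equiv\sigma\wedge\omega^1 && \bmod \theta^1,\dots,\theta^n,\\ d\theta^\alpha&\equiv 0 && \bmod \theta^1,\dots,\theta^n\quad(2\le\alpha\le n-1),\\ d\theta^n&\equiv\sigma\wedge\eta^1 && \bmod \theta^1,\dots,\theta^n,\\ d\eta^k&\equiv\sigma\wedge\eta^{k+1} && \bmod \theta^1,\dots,\theta^n,\eta^1,\dots,\eta^k\quad(1\le k\le K-1),\\ d\eta^K&\equiv\sigma\wedge\omega^2 && \bmod \theta^1,\dots,\theta^n,\eta^1,\dots,\eta^K, \end{aligned}$$ where for $K=0$ the last three lines are replaced by $d\theta^n\equiv\sigma\wedge\omega^2 \bmod \theta^1,\dots,\theta^n$. (b) Conversely, let $(N,J;\sigma)$ be a strongly linear system with a coframing $(\theta^1,\dots,\theta^n,\eta^1,\dots,\eta^K,\omega^1,\omega^2,\sigma)$ on $N$ that satisfies these structure equations and $J=[\![\theta^1,\dots,\theta^n,\eta^1,\dots,\eta^K]\!]$. Then every point of $N$ has an open neighborhood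 on which $I=[\![\theta^1,\dots,\theta^n]\!]$ and $\sigma$ have a reduction that is a CTS of type $(n,2)$ of class at most $K$. -/

import Mathlib

open scoped Manifold ContDiff Topology
open Set

universe u v

noncomputable section

namespace AbsEq

/-! ### Differential forms and Pfaffian bundles on a smooth manifold -/

section Forms

variable (d : ℕ) {M : Type u} [TopologicalSpace M] [ChartedSpace (EuclideanSpace ℝ (Fin d)) M]

/-- The cotangent space of `M` at `x`. -/
abbrev Cot (x : M) : Type := TangentSpace (𝓡 d) x →L[ℝ] ℝ

variable (M) in
/-- (Not necessarily smooth) differential `1`-forms on `M`. -/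
abbrev Form : Type u := (x : M) → Cot d x

variable (M) in
/-- Families of subspaces of the cotangent spaces. A Pfaffian system is such a family that is a
smooth subbundle, see `IsSubbundle`. -/
abbrev Family : Type u := (x : M) → Submodule ℝ (Cot d x)

variable {d}

/-- The `1`-form `ψ` is smooth on `U`, as a section of the cotangent bundle. -/
def SmoothFormOn [IsManifold (𝓡 d) ∞ M] (ψ : Form d M) (U : Set M) : Prop :=
  ContMDiffOn (𝓡 d) ((𝓡 d).prod 𝓘(ℝ, EuclideanSpace ℝ (Fin d) →L[ℝ] ℝ)) ∞
    (fun x => Bundle.TotalSpace.mk' (EuclideanSpace ℝ (Fin d) →L[ℝ] ℝ)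
      (E := fun x : M => TangentSpace (𝓡 d) x →L[ℝ] ℝ) x (ψ x)) U

/-- `ψ` written in the preferred chart at `x₀`: the pullback of `ψ` by the inverse chart. -/
def chartForm (ψ : Form d M) (x₀ : M) (y : EuclideanSpace ℝ (Fin d)) :
    EuclideanSpace ℝ (Fin d) →L[ℝ] ℝ :=
  (ψ ((extChartAt (𝓡 d) x₀).symm y)).comp
    (mfderiv 𝓘(ℝ, EuclideanSpace ℝ (Fin d)) (𝓡 d) (extChartAt (𝓡 d) x₀).symm y)

/-- The exterior derivative of the `1`-form `ψ` at `x`, an alternating bilinear form. It is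
computed in the preferred chart at `x`, whose derivative at `x` is the identity of the tangent
space at `x`: in a chart, `dψ (v, w) = (D_v ψ) w - (D_w ψ) v`. -/
def extD (ψ : Form d M) (x : M) (v w : TangentSpace (𝓡 d) x) : ℝ :=
  (fderiv ℝ (chartForm ψ x) (extChartAt (𝓡 d) x x) v) w -
    (fderiv ℝ (chartForm ψ x) (extChartAt (𝓡 d) x x) w) v

theorem extD_aux_add {E : Type} [NormedAddCommGroup E] [NormedSpace ℝ E]
    (L : E →L[ℝ] E →L[ℝ] ℝ) (a b w : E) :
    L (a + b) w - L w (a + b) = (L a w - L w a) + (L b w - L w b) := by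
  simp only [map_add, add_apply]
  ring

theorem extD_aux_smul {E : Type} [NormedAddCommGroup E] [NormedSpace ℝ E]
    (L : E →L[ℝ] E →L[ℝ] ℝ) (c : ℝ) (a w : E) :
    L (c • a) w - L w (c • a) = c * (L a w - L w a) := by
  simp only [map_smul, smul_apply, smul_eq_mul]
  ring

theorem extD_add_left (ψ : Form d M) (x : M) (a b w : TangentSpace (𝓡 d) x) :
    extD ψ x (a + b) w = extD ψ x a w + extD ψ x b w :=
  extD_aux_add _ _ _ _

theorem extD_smul_left (ψ : Form d M) (x : M) (c : ℝ) (a w : TangentSpace (𝓡 d) x) :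
    extD ψ x (c • a) w = c * extD ψ x a w :=
  extD_aux_smul _ _ _ _

/-- The wedge product `α ∧ β` of two covectors, with the convention that matches `extD`. -/
def wedge {x : M} (α β : Cot d x) (v w : TangentSpace (𝓡 d) x) : ℝ :=
  α v * β w - α w * β v

/-- `α ≡ β` modulo the algebraic ideal generated by the covectors in `A`, for alternating
bilinear forms `α`, `β` at `x`: the difference vanishes on the common kernel of `A`. -/
def CongrMod {x : M} (A : Submodule ℝ (Cot d x))
    (α β : TangentSpace (𝓡 d) x → TangentSpace (𝓡 d) x → ℝ) : Prop :=
  ∀ v w : TangentSpace (𝓡 d) x,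
    (∀ θ ∈ A, θ v = 0) → (∀ θ ∈ A, θ w = 0) → α v w = β v w

variable [IsManifold (𝓡 d) ∞ M]

/-- `F` is a smooth vector subbundle of rank `r` of the cotangent bundle. -/
def IsSubbundle (r : ℕ) (F : Family d M) : Prop :=
  ∀ x : M, ∃ U : Set M, IsOpen U ∧ x ∈ U ∧ ∃ θ : Fin r → Form d M,
    (∀ i, SmoothFormOn (θ i) U) ∧
    ∀ y ∈ U, LinearIndependent ℝ (fun i => θ i y) ∧
      Submodule.span ℝ (range fun i => θ i y) = F y

/-- `ψ` is a smooth section of `F` over the open set `U`. -/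
def IsSectionOn (F : Family d M) (ψ : Form d M) (U : Set M) : Prop :=
  IsOpen U ∧ SmoothFormOn ψ U ∧ ∀ y ∈ U, ψ y ∈ F y

/-- `F` is Frobenius (completely integrable): `dψ ≡ 0 mod F` for all sections `ψ` of `F`. -/
def IsFrobenius (F : Family d M) : Prop :=
  ∀ (U : Set M) (ψ : Form d M), IsSectionOn F ψ U →
    ∀ x ∈ U, CongrMod (F x) (extD ψ x) (fun _ _ => 0)

/-- The derived system: at `x` it consists of the values `ψ x` of sections `ψ` of `F` with
`dψ ≡ 0 mod F` at `x`. (If `F` is a subbundle, these values already form a subspace, the kernel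
at `x` of the bundle map induced by the exterior derivative.) -/
def derived (F : Family d M) : Family d M := fun x =>
  Submodule.span ℝ {α | ∃ (U : Set M) (ψ : Form d M), IsSectionOn F ψ U ∧ x ∈ U ∧ ψ x = α ∧
    CongrMod (F x) (extD ψ x) (fun _ _ => 0)}

/-- The Cauchy characteristic directions at `x` of the Pfaffian system `F`: the vectors `v`
annihilated by `F` such that the contraction of `v` with `dψ` is in `F`
(that is, kills every vector annihilated by `F`), for every section `ψ` of `F`. -/
def cauchy (F : Family d M) (x : M) : Submodule ℝ (TangentSpace (𝓡 d) x) where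
  carrier := {v | (∀ α ∈ F x, α v = 0) ∧
    ∀ (U : Set M) (ψ : Form d M), IsSectionOn F ψ U → x ∈ U →
      ∀ w : TangentSpace (𝓡 d) x, (∀ α ∈ F x, α w = 0) → extD ψ x v w = 0}
  add_mem' := by
    rintro a b ⟨ha, ha2⟩ ⟨hb, hb2⟩
    refine ⟨fun α hα => by rw [map_add, ha α hα, hb α hα, add_zero], ?_⟩
    intro U ψ h hx w hw
    rw [extD_add_left, ha2 U ψ h hx w hw, hb2 U ψ h hx w hw, add_zero]
  zero_mem' := by
    refine ⟨fun α _ => map_zero α, ?_⟩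
    intro U ψ h hx w hw
    have h1 := extD_smul_left ψ x 0 0 w
    rwa [zero_smul, zero_mul] at h1
  smul_mem' := by
    rintro c a ⟨ha, ha2⟩
    refine ⟨fun α hα => by rw [map_smul, ha α hα, smul_zero], ?_⟩
    intro U ψ h hx w hw
    rw [extD_smul_left, ha2 U ψ h hx w hw, mul_zero]

/-- The Cartan system: the annihilator of the Cauchy characteristic directions. -/
def cartan (F : Family d M) : Family d M := fun x =>
  { carrier := {α | ∀ v ∈ cauchy F x, α v = 0}
    add_mem' := by
      intro a b ha hb v hv
      rw [add_apply, ha v hv, hb v hv, add_zero]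
    zero_mem' := fun v _ => rfl
    smul_mem' := by
      intro c a ha v hv
      rw [smul_apply, ha v hv, smul_zero] }

/-- `⟦F, τ⟧`, the family generated by `F` and the `1`-form `τ`. -/
def adjoin (F : Family d M) (τ : Form d M) : Family d M := fun x =>
  F x ⊔ Submodule.span ℝ {τ x}

end Forms

section Pullback

variable {d e : ℕ} {N : Type v} {M : Type u}
  [TopologicalSpace N] [ChartedSpace (EuclideanSpace ℝ (Fin e)) N]
  [TopologicalSpace M] [ChartedSpace (EuclideanSpace ℝ (Fin d)) M]

/-- The pullback of a covector of `M` at `f x` to a covector of `N` at `x`. -/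
def pullCov (f : N → M) (x : N) (α : Cot d (f x)) : Cot e x :=
  α.comp (mfderiv (𝓡 e) (𝓡 d) f x)

/-- The pullback `f^* F` of a family. -/
def pullback (f : N → M) (F : Family d M) : Family e N := fun x =>
  { carrier := {α | ∃ β ∈ F (f x), α = pullCov f x β}
    add_mem' := by
      rintro _ _ ⟨a, ha, rfl⟩ ⟨b, hb, rfl⟩
      exact ⟨a + b, add_mem ha hb, (ContinuousLinearMap.add_comp _ _ _).symm⟩
    zero_mem' := ⟨0, zero_mem _, (ContinuousLinearMap.zero_comp _).symm⟩
    smul_mem' := by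
      rintro c _ ⟨a, ha, rfl⟩
      exact ⟨c • a, Submodule.smul_mem _ c ha, (ContinuousLinearMap.smul_comp _ _ _).symm⟩ }

end Pullback

/-! ### Systems -/

/-- A system `(M, I; τ)`: a Pfaffian system `I` on a smooth manifold `M` (Hausdorff and second
countable) with an exact independence condition `τ`, without Cauchy characteristics and without
integral surfaces on which `τ` does not vanish. -/
structure PfSystem : Type (u + 1) where
  /-- the underlying manifold -/
  M : Type u
  /-- its dimension -/
  dim : ℕ
  [top : TopologicalSpace M]
  [charted : ChartedSpace (EuclideanSpace ℝ (Fin dim)) M]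
  [smooth : IsManifold (𝓡 dim) ∞ M]
  [hausdorff : T2Space M]
  [countable : SecondCountableTopology M]
  /-- the Pfaffian system -/
  I : Family dim M
  /-- its rank -/
  rank : ℕ
  /-- the independence condition -/
  τ : Form dim M
  subbundle : IsSubbundle rank I
  exact : ∃ f : M → ℝ, ContMDiff (𝓡 dim) 𝓘(ℝ, ℝ) ∞ f ∧
    ∀ x, ∀ v : TangentSpace (𝓡 dim) x, τ x v = mfderiv (𝓡 dim) 𝓘(ℝ, ℝ) f x v
  independent : ∀ x, τ x ∉ I x
  noCauchy : ∀ x, cauchy I x = ⊥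
  noIntegralSurface : ¬ ∃ (V : Set (EuclideanSpace ℝ (Fin 2)))
    (s : EuclideanSpace ℝ (Fin 2) → M),
    IsOpen V ∧ ContMDiffOn (𝓡 2) (𝓡 dim) ∞ s V ∧
    (∀ y ∈ V, Function.Injective (mfderiv (𝓡 2) (𝓡 dim) s y)) ∧
    (∀ y ∈ V, ∀ α ∈ I (s y), (pullCov s y α : Cot 2 y) = 0) ∧
    ∃ y ∈ V, (pullCov s y (τ (s y)) : Cot 2 y) ≠ 0

attribute [instance] PfSystem.top PfSystem.charted PfSystem.smooth PfSystem.hausdorff PfSystem.countable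

/-- The system has type `(n, m)`. -/
def PfSystem.HasType (S : PfSystem.{u}) (n m : ℕ) : Prop :=
  S.dim = n + m + 1 ∧ S.rank = n

/-- Control-type systems: `⟦I, τ⟧` is Frobenius. -/
def PfSystem.IsCTS (S : PfSystem.{u}) : Prop :=
  IsFrobenius (adjoin S.I S.τ)

/-- Strongly linear systems: control-type systems whose derived systems `I^(k)` are subbundles
(of constant rank), eventually zero, with every `⟦I^(k), τ⟧` Frobenius. -/
def PfSystem.IsStronglyLinear (S : PfSystem.{u}) : Prop :=
  S.IsCTS ∧
  (∀ k : ℕ, ∃ r : ℕ, IsSubbundle r (derived^[k] S.I)) ∧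
  (∃ k : ℕ, ∀ x, (derived^[k] S.I) x = ⊥) ∧
  ∀ k : ℕ, IsFrobenius (adjoin (derived^[k] S.I) S.τ)

/-! ### Integral curves and Cartan prolongations -/

/-- The velocity of a curve. -/
def velocity (S : PfSystem.{u}) (γ : ℝ → S.M) (t : ℝ) : TangentSpace (𝓡 S.dim) (γ t) :=
  mfderiv 𝓘(ℝ, ℝ) (𝓡 S.dim) γ t (1 : ℝ)

/-- `γ` restricts to a smooth integral curve `(-ε, ε) → M` of `(M, I; τ)`. -/
def IsIntegralCurve (S : PfSystem.{u}) (γ : ℝ → S.M) (ε : ℝ) : Prop :=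
  ContMDiffOn 𝓘(ℝ, ℝ) (𝓡 S.dim) ∞ γ (Ioo (-ε) ε) ∧
  ∀ t ∈ Ioo (-ε) ε, (∀ α ∈ S.I (γ t), α (velocity S γ t) = 0) ∧
    S.τ (γ t) (velocity S γ t) ≠ 0

/-- The `r`-jets at time `0` of `γ₀` and `γ` are `δ`-close, in the preferred chart at `γ₀ 0`. -/
def JetNear (S : PfSystem.{u}) (r : ℕ) (δ : ℝ) (γ₀ γ : ℝ → S.M) : Prop :=
  γ 0 ∈ (chartAt (EuclideanSpace ℝ (Fin S.dim)) (γ₀ 0)).source ∧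
  ∀ k ≤ r, ‖iteratedDeriv k (fun t => extChartAt (𝓡 S.dim) (γ₀ 0) (γ t)) 0 -
    iteratedDeriv k (fun t => extChartAt (𝓡 S.dim) (γ₀ 0) (γ₀ t)) 0‖ < δ

/-- `W` is an open condition on the finite jets at time `0` of integral curves of `S`. -/
def IsJetOpen (S : PfSystem.{u}) (W : Set (ℝ → S.M)) : Prop :=
  ∀ γ₀ ∈ W, ∀ ε₀ > 0, IsIntegralCurve S γ₀ ε₀ → ∃ (r : ℕ) (δ : ℝ), 0 < δ ∧
    ∀ (γ : ℝ → S.M), ∀ ε > 0, IsIntegralCurve S γ ε → JetNear S r δ γ₀ γ → γ ∈ W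

/-- All jets of `γ` at times in `(-ε, ε)` satisfy the condition `W`. -/
def JetsIn (S : PfSystem.{u}) (W : Set (ℝ → S.M)) (γ : ℝ → S.M) (ε : ℝ) : Prop :=
  ∀ t ∈ Ioo (-ε) ε, (fun s => γ (t + s)) ∈ W

/-- `γ'` is a lifting of `γ` to an integral curve of `N` on `(-ε, ε)`. -/
def IsLifting (N S : PfSystem.{u}) (π : N.M → S.M) (γ : ℝ → S.M) (ε : ℝ) (γ' : ℝ → N.M) : Prop :=
  IsIntegralCurve N γ' ε ∧ ∀ t ∈ Ioo (-ε) ε, π (γ' t) = γ t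

/-- Any generic integral curve of `S` has a unique lifting to an integral curve of `N`. This is a
local notion (`N` may be a small open piece of a larger manifold) and a negligible set of curves
is disregarded: a generic integral curve is one whose jets all lie in a suitable open set `W` of
jets, which has to be dense in the sense that every integral curve of `N` is approximated at
time `0`, to any order, by integral curves of `N` that project to generic curves. -/
def GenericUniqueLifting (N S : PfSystem.{u}) (π : N.M → S.M) : Prop :=
  ∃ W : Set (ℝ → S.M), IsJetOpen S W ∧
    (∀ (γ : ℝ → S.M), ∀ ε > 0, IsIntegralCurve S γ ε → JetsIn S W γ ε →
      ∃ γ' : ℝ → N.M, IsLifting N S π γ ε γ' ∧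
        ∀ γ'' : ℝ → N.M, IsLifting N S π γ ε γ'' → EqOn γ'' γ' (Ioo (-ε) ε)) ∧
    (∀ (γ : ℝ → N.M), ∀ ε > 0, IsIntegralCurve N γ ε → ∀ (r : ℕ), ∀ δ > 0,
      ∃ (γ₁ : ℝ → N.M), ∃ ε₁ > 0, IsIntegralCurve N γ₁ ε₁ ∧ JetNear N r δ γ γ₁ ∧
        JetsIn S W (fun t => π (γ₁ t)) ε₁)

/-- `π : (N, J; σ) → (M, I; τ)` is a Cartan prolongation: a submersion (with dense image) such that
`π^* I ⊆ J`, `π^* τ = σ`, and generic integral curves have unique liftings. -/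
structure IsCartanProlongation (N S : PfSystem.{u}) (π : N.M → S.M) : Prop where
  smooth : ContMDiff (𝓡 N.dim) (𝓡 S.dim) ∞ π
  submersion : ∀ x, Function.Surjective (mfderiv (𝓡 N.dim) (𝓡 S.dim) π x)
  dense : DenseRange π
  pull_le : ∀ x, (pullback π S.I : Family N.dim N.M) x ≤ N.I x
  pull_indep : ∀ x, pullCov π x (S.τ (π x)) = N.τ x
  lifting : GenericUniqueLifting N S π

/-- Absolute equivalence, with matching independence conditions. -/
def AbsolutelyEquivalent (S T : PfSystem.{u}) : Prop :=
  ∃ (N : PfSystem.{u}) (π : N.M → S.M) (ϖ : N.M → T.M),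
    IsCartanProlongation N S π ∧ IsCartanProlongation N T ϖ

/-- `S` is dynamically linearizable: absolutely equivalent to a strongly linear system. -/
def PfSystem.IsDynLinearizable (S : PfSystem.{u}) : Prop :=
  ∃ T : PfSystem.{u}, T.IsStronglyLinear ∧ AbsolutelyEquivalent S T

/-- The relative extensions `I₀ = π^* I`, `I_{k+1} = C(I_k) ∩ J` on `N`. -/
def relExt (N S : PfSystem.{u}) (π : N.M → S.M) : ℕ → Family N.dim N.M
  | 0 => pullback π S.I
  | k + 1 => fun x => cartan (relExt N S π k) x ⊓ N.I x

/-- On the open set `U` of `N`, the system `S` is the Pfaffian system `F`, with the independence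
condition induced by `σ`, considered on the manifold determined by its Cartan system: `p : U → S.M`
is a submersion whose fibers are the leaves of the Cartan system of `F`, and `F`, `σ` are the
pullbacks of the data of `S`. -/
structure IsReduction {d : ℕ} {N : Type u} [TopologicalSpace N]
    [ChartedSpace (EuclideanSpace ℝ (Fin d)) N] [IsManifold (𝓡 d) ∞ N]
    (F : Family d N) (σ : Form d N) (U : Set N) (S : PfSystem.{u}) (p : N → S.M) : Prop where
  isOpen : IsOpen U
  smooth : ContMDiffOn (𝓡 d) (𝓡 S.dim) ∞ p U
  submersion : ∀ x ∈ U, Function.Surjective (mfderiv (𝓡 d) (𝓡 S.dim) p x)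
  ker : ∀ x ∈ U, ∀ v : TangentSpace (𝓡 d) x, mfderiv (𝓡 d) (𝓡 S.dim) p x v = 0 ↔ v ∈ cauchy F x
  fibers : ∀ y : S.M, IsConnected (U ∩ p ⁻¹' {y})
  pull : ∀ x ∈ U, (pullback p S.I : Family d N) x = F x
  pull_indep : ∀ x ∈ U, pullCov p x (S.τ (p x)) = σ x

/-- `π : N → S` is a `C`-regular Cartan prolongation with extension length `K`. -/
structure IsCRegular (N S : PfSystem.{u}) (π : N.M → S.M) (K : ℕ) : Prop where
  prolongation : IsCartanProlongation N S π
  strict : ∀ k < K, relExt N S π k < relExt N S π (k + 1)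
  top : relExt N S π K = N.I
  indep_mem : ∀ k ≤ K, ∀ x, N.τ x ∈ cartan (relExt N S π k) x
  chain : ∃ (T : ℕ → PfSystem.{u}) (p : (k : ℕ) → N.M → (T k).M),
    (∀ k ≤ K, IsReduction (relExt N S π k) N.τ univ (T k) (p k)) ∧
    ∀ k < K, ∃ q : (T (k + 1)).M → (T k).M,
      (∀ x, q (p (k + 1) x) = p k x) ∧ IsCartanProlongation (T (k + 1)) (T k) q

/-- A `C`-regular Cartan prolongation with extension length `K` such that `N` is strongly linear,
each relative extension is control-type, and the ranks of the extensions grow by one. -/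
structure IsLinearizing (N S : PfSystem.{u}) (π : N.M → S.M) (K : ℕ) : Prop where
  cRegular : IsCRegular N S π K
  stronglyLinear : N.IsStronglyLinear
  cts : ∀ k ≤ K, IsFrobenius (adjoin (relExt N S π k) N.τ)
  rank_one : ∀ k < K, ∀ x, Module.finrank ℝ (relExt N S π (k + 1) x) =
    Module.finrank ℝ (relExt N S π k x) + 1

/-- The class of `S`: the minimal extension length of a linearizing Cartan prolongation if `S` is
dynamically linearizable, and `∞` otherwise. -/
def PfSystem.cls (S : PfSystem.{u}) : ℕ∞ :=
  sInf {c : ℕ∞ | S.IsDynLinearizable ∧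
    ∃ (K : ℕ) (N : PfSystem.{u}) (π : N.M → S.M), IsLinearizing N S π K ∧ c = K}

/-! ### Adapted coframings -/

section Coframing

variable {d : ℕ} {N : Type u} [TopologicalSpace N] [ChartedSpace (EuclideanSpace ℝ (Fin d)) N]

/-- `⟦θ¹, …, θⁿ, η¹, …, η^k⟧`. The forms are numbered from `0`: `θ 0` is `θ¹`, `η 0` is `η¹`. -/
def spanUpTo {n K : ℕ} (θ : Fin n → Form d N) (η : Fin K → Form d N) (k : ℕ) : Family d N :=
  fun x => Submodule.span ℝ ({α | ∃ i, α = θ i x} ∪ {α | ∃ j : Fin K, j.val < k ∧ α = η j x})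

/-- The sequence `η¹, …, η^K, ω²`: `etaNext η ω₂ k` is `η^{k+1}` for `k < K`, and `ω²` for
`k = K`. -/
def etaNext {K : ℕ} (η : Fin K → Form d N) (ω₂ : Form d N) (k : ℕ) : Form d N :=
  if h : k < K then η ⟨k, h⟩ else ω₂

/-- `(θ¹, …, θⁿ, η¹, …, η^K, ω¹, ω², σ)` is a smooth coframing on `U` that satisfies the
structure equations
`dθ¹ ≡ σ ∧ ω¹`, `dθ^α ≡ 0` for `1 < α < n`, `dθⁿ ≡ σ ∧ η¹` modulo `θ¹, …, θⁿ`,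
`dη^k ≡ σ ∧ η^{k+1}` modulo `θ¹, …, θⁿ, η¹, …, η^k` for `1 ≤ k < K`, and
`dη^K ≡ σ ∧ ω²` modulo `θ¹, …, θⁿ, η¹, …, η^K`
(with `dθⁿ ≡ σ ∧ ω²` if `K = 0`). -/
structure IsAdaptedCoframing [IsManifold (𝓡 d) ∞ N] {n K : ℕ} (U : Set N)
    (θ : Fin n → Form d N) (η : Fin K → Form d N) (ω₁ ω₂ σ : Form d N) : Prop where
  smooth_θ : ∀ i, SmoothFormOn (θ i) U
  smooth_η : ∀ j, SmoothFormOn (η j) U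
  smooth_ω₁ : SmoothFormOn ω₁ U
  smooth_ω₂ : SmoothFormOn ω₂ U
  smooth_σ : SmoothFormOn σ U
  independent : ∀ x ∈ U, LinearIndependent ℝ
    (Sum.elim (fun i => θ i x) (Sum.elim (fun j => η j x) ![ω₁ x, ω₂ x, σ x]))
  dim_eq : d = n + K + 3
  d_θ_first : ∀ i : Fin n, i.val = 0 → ∀ x ∈ U,
    CongrMod (spanUpTo θ η 0 x) (extD (θ i) x) (wedge (σ x) (ω₁ x))
  d_θ_middle : ∀ i : Fin n, 0 < i.val → i.val + 1 < n → ∀ x ∈ U,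
    CongrMod (spanUpTo θ η 0 x) (extD (θ i) x) (fun _ _ => 0)
  d_θ_last : ∀ i : Fin n, i.val + 1 = n → ∀ x ∈ U,
    CongrMod (spanUpTo θ η 0 x) (extD (θ i) x) (wedge (σ x) (etaNext η ω₂ 0 x))
  d_η : ∀ k : Fin K, ∀ x ∈ U,
    CongrMod (spanUpTo θ η (k.val + 1) x) (extD (η k) x)
      (wedge (σ x) (etaNext η ω₂ (k.val + 1) x))

end Coframing

end AbsEq

end

open AbsEq

set_option linter.unusedSectionVars false

noncomputable section

/-! For (a), take a vector field `X` with `J(X) = 0` and `σ(X) = 1`. Since `⟦I_k, σ⟧` is Frobenius,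
`dκ ≡ σ ∧ (X ⌟ dκ)` modulo `I_k` for every section `κ` of `I_k`, so the Cartan system of `I_k` is
spanned by `I_k`, `σ` and the contractions `X ⌟ dκ` (`IsPfaffianFlag.structure_eq`,
`IsPfaffianFlag.perp_le`). The normal form thus becomes linear algebra of contractions, which modulo
`I_k` are linear in `κ` over functions (`contr_add_smul`). As `M` has dimension `n + 3` and no
Cauchy characteristics, the contractions on `I_0` contribute exactly two directions beyond `I_0` and
`σ`. Since `I_1 = C(I_0) ∩ J` exceeds `I_0` by one dimension at most, one of them, `ω¹`, stays
outside `J` (`IsPfaffianFlag.exists_frame_contr`). A change of frame concentrates the two directions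
on `θ¹` and `θⁿ`. Inductively, the form that `I_{k+1}` adds is, modulo `I_k`, a combination of `ω¹`
and the contraction of the last form; correcting the last form by a multiple of `θ¹` makes its
contraction the new form `η^{k+1}` (`IsPfaffianFlag.exists_adapted_succ`).

The forms so obtained span, hence `dim N ≤ n + K + 3`. Equality needs every step `M_{k+1} → M_k` to
raise the dimension (`IsCartanProlongation.rank_eq`): a submersion between manifolds of equal
dimension has countable fibers, so if the rank grew, the initial velocities of liftable curves
through a point would lie in countably many proper subspaces, a null set, whereas generic curves
realize an open set of velocities.

For (b), the structure equations make every `⟦I_k, σ⟧` integrable. The Frobenius theorem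
(`exists_first_integrals`, obtained from the inverse function theorem on a space of paths) yields
first integrals, and the time derivative of one of them is an integral of the Cartan systems
(`IsStructureCoframing.exists_cartan_integral`). In the resulting coordinates `I_k` is spanned by
the forms `dy_{l+2} - X_l dy_0` with `l < n + k`, where `X_l` depends only on the first `n + k + 3`
coordinates (`exists_controlFlag`). So `I_k` lives on `ℝ^{n+k+3}`, and the flag is a tower of
control systems in which each level turns the last control of the level below into a state. The
velocity of this state has nonzero derivative in the new control, so curves lift locally and
uniquely (`IsControlSystem.hasLocalLiftings`), and local liftings give Cartan prolongations
(`HasLocalLiftings.genericUniqueLifting`). The top of the tower is a piece of `N`, hence strongly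
linear, and the bottom is the reduction of `I`; the tower itself bounds its class by `K`. -/

namespace AbsEq

/-! ### Smooth first integrals of integrable Pfaffian systems on a normed space -/

/-- Continuous paths parametrized by the unit interval, with the supremum norm. -/
def Path (E : Type u) [NormedAddCommGroup E] : Type u := C(Icc (0 : ℝ) 1, E)

section Path

variable {E : Type u} [NormedAddCommGroup E]

instance : NormedAddCommGroup (Path E) := inferInstanceAs (NormedAddCommGroup C(Icc (0 : ℝ) 1, E))

instance [NormedSpace ℝ E] : NormedSpace ℝ (Path E) :=
  inferInstanceAs (NormedSpace ℝ C(Icc (0 : ℝ) 1, E))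

instance [CompleteSpace E] : CompleteSpace (Path E) :=
  inferInstanceAs (CompleteSpace C(Icc (0 : ℝ) 1, E))

instance : FunLike (Path E) (Icc (0 : ℝ) 1) E :=
  inferInstanceAs (FunLike C(Icc (0 : ℝ) 1, E) (Icc (0 : ℝ) 1) E)

/-- A continuous function on the unit interval as a path. -/
def Path.mk (f : Icc (0 : ℝ) 1 → E) (hf : Continuous f) : Path E :=
  (⟨f, hf⟩ : C(Icc (0 : ℝ) 1, E))

theorem Path.continuous (y : Path E) : Continuous y := ContinuousMap.continuous y

@[simp] theorem Path.mk_apply (f : Icc (0 : ℝ) 1 → E) (hf : Continuous f) (t : Icc (0 : ℝ) 1) :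
    Path.mk f hf t = f t := rfl

@[ext] theorem Path.ext {y z : Path E} (h : ∀ t, y t = z t) : y = z := ContinuousMap.ext h

@[simp] theorem Path.add_apply (y z : Path E) (t : Icc (0 : ℝ) 1) : (y + z) t = y t + z t := rfl

@[simp] theorem Path.sub_apply (y z : Path E) (t : Icc (0 : ℝ) 1) : (y - z) t = y t - z t := rfl

@[simp] theorem Path.zero_apply (t : Icc (0 : ℝ) 1) : (0 : Path E) t = 0 := rfl

@[simp] theorem Path.smul_apply [NormedSpace ℝ E] (c : ℝ) (y : Path E) (t : Icc (0 : ℝ) 1) :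
    (c • y) t = c • y t := rfl

theorem Path.norm_le (y : Path E) {C : ℝ} (hC : 0 ≤ C) : ‖y‖ ≤ C ↔ ∀ t, ‖y t‖ ≤ C :=
  ContinuousMap.norm_le y hC

theorem Path.norm_apply_le (y : Path E) (t : Icc (0 : ℝ) 1) : ‖y t‖ ≤ ‖y‖ :=
  ContinuousMap.norm_coe_le_norm y t

theorem Path.dist_apply_le_dist (y z : Path E) (t : Icc (0 : ℝ) 1) :
    dist (y t) (z t) ≤ dist y z :=
  ContinuousMap.dist_apply_le_dist (f := (y : C(Icc (0 : ℝ) 1, E))) t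

end Path

/-! ### Smooth composition and integration operators on path spaces -/

section Nemytskii

variable {E G : Type u} [NormedAddCommGroup E] [NormedSpace ℝ E]
  [NormedAddCommGroup G] [NormedSpace ℝ G]

/-- Pointwise application of a path of operators to a path of vectors. -/
def pathApply (E G : Type u) [NormedAddCommGroup E] [NormedSpace ℝ E]
    [NormedAddCommGroup G] [NormedSpace ℝ G] :
    Path (E →L[ℝ] G) →L[ℝ] Path E →L[ℝ] Path G :=
  LinearMap.mkContinuous₂
    (LinearMap.mk₂ ℝ (fun (a : Path (E →L[ℝ] G)) (u : Path E) =>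
      Path.mk (fun t => a t (u t)) (a.continuous.clm_apply u.continuous))
      (by intros; ext; simp) (by intros; ext; simp) (by intros; ext; simp)
      (by intros; ext; simp)) 1
    (by
      intro a u
      rw [Path.norm_le _ (by positivity)]
      intro t
      simp only [LinearMap.mk₂_apply, Path.mk_apply, one_mul]
      exact (a t).le_of_opNorm_le_of_le (a.norm_apply_le t) (u.norm_apply_le t))

@[simp] theorem pathApply_apply (a : Path (E →L[ℝ] G)) (u : Path E)
    (t : Icc (0 : ℝ) 1) : pathApply E G a u t = a t (u t) := rfl

theorem contDiff_pathApply {n : ℕ∞ω} : ContDiff ℝ n fun a => pathApply E G a :=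
  (pathApply E G).contDiff

theorem hasFDerivAt_pathApply (a : Path (E →L[ℝ] G)) :
    HasFDerivAt (fun a => pathApply E G a) (pathApply E G) a :=
  (pathApply E G).hasFDerivAt

/-- Constant paths. -/
def constPath (E : Type u) [NormedAddCommGroup E] [NormedSpace ℝ E] :
    E →L[ℝ] Path E :=
  LinearMap.mkContinuous
    { toFun := fun e => Path.mk (fun _ => e) continuous_const
      map_add' := fun _ _ => rfl
      map_smul' := fun _ _ => rfl } 1 (fun e => by
        rw [Path.norm_le _ (by positivity)]
        intro t
        exact (one_mul ‖e‖).ge)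

@[simp] theorem constPath_apply (e : E) (t : Icc (0 : ℝ) 1) : constPath E e t = e := rfl

theorem contDiff_constPath {n : ℕ∞ω} : ContDiff ℝ n fun a => constPath E a :=
  (constPath E).contDiff

theorem hasFDerivAt_constPath (a : E) :
    HasFDerivAt (fun a => constPath E a) (constPath E) a :=
  (constPath E).hasFDerivAt

/-- Composition of a path with a smooth map. -/
def nemytskii (f : E → G) (hf : ContDiff ℝ ∞ f) (γ : Path E) : Path G :=
  Path.mk (fun t => f (γ t)) (hf.continuous.comp γ.continuous)

@[simp] theorem nemytskii_apply (f : E → G) (hf : ContDiff ℝ ∞ f) (γ : Path E)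
    (t : Icc (0 : ℝ) 1) : nemytskii f hf γ t = f (γ t) := rfl

theorem continuous_nemytskii (f : E → G) (hf : ContDiff ℝ ∞ f) : Continuous (nemytskii f hf) :=
  ContinuousMap.continuous_postcomp (⟨f, hf.continuous⟩ : C(E, G))

/-- The map `γ ↦ Df ∘ γ` is continuous in the supremum norm, so on one ball around `γ` the
derivative of `f` varies by at most `c` at all times simultaneously. The mean value inequality at
each time then gives a remainder that is uniform in time. -/
theorem hasFDerivAt_nemytskii (f : E → G) (hf : ContDiff ℝ ∞ f) (γ : Path E) :
    HasFDerivAt (nemytskii f hf)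
      (pathApply E G (nemytskii (fderiv ℝ f) (hf.fderiv_right (by simp)) γ)) γ := by
  have hD := continuous_nemytskii (fderiv ℝ f) (hf.fderiv_right (m := ∞) (by simp))
  rw [hasFDerivAt_iff_isLittleO, Asymptotics.isLittleO_iff]
  intro c hc
  obtain ⟨δ, hδ, H⟩ := Metric.continuous_iff.1 hD γ c hc
  filter_upwards [Metric.ball_mem_nhds γ hδ] with γ' hγ'
  rw [Path.norm_le _ (by positivity)]
  intro t
  have hb : ∀ z ∈ Metric.ball (γ t) δ, ‖fderiv ℝ f z - fderiv ℝ f (γ t)‖ ≤ c := by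
    intro z hz
    -- Shifting `γ` by the constant path `z - γ t` turns the supremum-norm continuity into a bound
    -- at the single point `z`.
    have h1 : dist (γ + (Path.mk (fun _ => z - γ t) continuous_const)) γ < δ := by
      rw [dist_eq_norm, add_sub_cancel_left]
      refine lt_of_le_of_lt ?_ (mem_ball_iff_norm.1 hz)
      rw [Path.norm_le _ (norm_nonneg _)]
      intro s
      simp
    have h2 := (Path.dist_apply_le_dist _ _ t).trans (H _ h1).le
    simpa [dist_eq_norm] using h2
  have h3 : γ' t ∈ Metric.ball (γ t) δ :=
    (Path.dist_apply_le_dist _ _ t).trans_lt hγ'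
  have h4 := (convex_ball (γ t) δ).norm_image_sub_le_of_norm_hasFDerivWithin_le'
    (f := f) (f' := fderiv ℝ f) (φ := fderiv ℝ f (γ t)) (C := c)
    (fun x _ => ((hf.differentiable (by simp)) x).hasFDerivAt.hasFDerivWithinAt) hb
    (Metric.mem_ball_self hδ) h3
  have h5 : ‖γ' t - γ t‖ ≤ ‖γ' - γ‖ := (γ' - γ).norm_apply_le t
  exact h4.trans (mul_le_mul_of_nonneg_left h5 hc.le)

/-- The derivative of a composition operator is the composition operator of `fderiv ℝ f`, followed
by a bounded linear map. The induction runs over all targets because the new target is `E →L[ℝ] G`.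
-/
theorem contDiff_nemytskii_nat (m : ℕ) : ∀ (G : Type u) [NormedAddCommGroup G] [NormedSpace ℝ G]
    (f : E → G) (hf : ContDiff ℝ ∞ f), ContDiff ℝ m (nemytskii f hf) := by
  induction m with
  | zero =>
    intro G _ _ f hf
    exact contDiff_zero.2 (continuous_nemytskii f hf)
  | succ m ih =>
    intro G _ _ f hf
    rw [Nat.cast_succ, contDiff_succ_iff_hasFDerivAt]
    exact ⟨fun γ => pathApply E G (nemytskii (fderiv ℝ f) (hf.fderiv_right (by simp)) γ),
      contDiff_pathApply.comp (ih (E →L[ℝ] G) (fderiv ℝ f) (hf.fderiv_right (by simp))),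
      hasFDerivAt_nemytskii f hf⟩

theorem contDiff_nemytskii (f : E → G) (hf : ContDiff ℝ ∞ f) :
    ContDiff ℝ ∞ (nemytskii f hf) :=
  contDiff_infty.2 fun m => contDiff_nemytskii_nat m G f hf

end Nemytskii

section PathIntegral

variable (E : Type u) [NormedAddCommGroup E] [NormedSpace ℝ E]

theorem continuous_extend_path {E : Type u} [NormedAddCommGroup E] (y : Path E) :
    Continuous fun s : ℝ => y (projIcc 0 1 zero_le_one s) :=
  y.continuous.comp continuous_projIcc

/-- The primitive of a path vanishing at time `0`. -/
def pathInt : Path E →L[ℝ] Path E :=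
  LinearMap.mkContinuous
    { toFun := fun y => Path.mk (fun s => ∫ τ in (0 : ℝ)..s, y (projIcc 0 1 zero_le_one τ))
        ((intervalIntegral.continuous_primitive
          (fun a b => (continuous_extend_path y).intervalIntegrable a b) 0).comp
            continuous_subtype_val)
      map_add' := by
        intro a b
        ext s
        exact intervalIntegral.integral_add
          ((continuous_extend_path a).intervalIntegrable _ _)
          ((continuous_extend_path b).intervalIntegrable _ _)
      map_smul' := by
        intro c a
        ext s
        exact intervalIntegral.integral_smul c _ } 1
    (by
      intro y
      rw [Path.norm_le _ (by positivity)]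
      intro s
      have := intervalIntegral.norm_integral_le_of_norm_le_const (a := 0) (b := (s : ℝ))
        (f := fun τ => y (projIcc 0 1 zero_le_one τ)) (C := ‖y‖)
        (fun x _ => y.norm_apply_le _)
      refine this.trans ?_
      rw [sub_zero, abs_of_nonneg s.2.1, one_mul]
      exact mul_le_of_le_one_right (norm_nonneg _) s.2.2)

variable {E}

theorem pathInt_apply (y : Path E) (s : Icc (0 : ℝ) 1) :
    pathInt E y s = ∫ τ in (0 : ℝ)..s, y (projIcc 0 1 zero_le_one τ) := rfl

end PathIntegral

/-! ### Local inverses and joint flows of commuting vector fields -/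

section LocalInverse

variable {E F : Type*} [NormedAddCommGroup E] [NormedSpace ℝ E]
  [NormedAddCommGroup F] [NormedSpace ℝ F]

/-- The inverse function theorem, with smoothness of both maps on a whole neighborhood. -/
theorem exists_smooth_local_inverse [CompleteSpace E] {f : E → F} {a : E} {f' : E ≃L[ℝ] F}
    (hf : ∀ᶠ x in 𝓝 a, ContDiffAt ℝ ∞ f x) (hf' : HasFDerivAt f (f' : E →L[ℝ] F) a)
    {s : Set E} (hs : s ∈ 𝓝 a) :
    ∃ e : OpenPartialHomeomorph E F, a ∈ e.source ∧ e.source ⊆ s ∧ (e : E → F) = f ∧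
      (∀ x ∈ e.source, ContDiffAt ℝ ∞ f x) ∧
      (∀ x ∈ e.source, ∃ g : E ≃L[ℝ] F, HasFDerivAt f (g : E →L[ℝ] F) x) ∧
      ∀ y ∈ e.target, ContDiffAt ℝ ∞ e.symm y := by
  have ha := hf.self_of_nhds
  -- Invertible operators form an open set, so the source can be shrunk until the inverse is smooth
  -- on the whole target and not only at the image of `a`.
  have hinv : ∀ᶠ x in 𝓝 a, fderiv ℝ f x ∈ range ((↑) : (E ≃L[ℝ] F) → E →L[ℝ] F) := by
    have hc : ContinuousAt (fderiv ℝ f) a :=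
      (ha.fderiv_right (m := 0) (by simp)).continuousAt
    refine hc ?_
    rw [hf'.fderiv]
    exact ContinuousLinearEquiv.nhds f'
  obtain ⟨U, hU, hUo, haU⟩ := mem_nhds_iff.1 (Filter.inter_mem (Filter.inter_mem hf hinv) hs)
  let e₀ := ha.toOpenPartialHomeomorph f hf' (by simp)
  let e := e₀.restrOpen U hUo
  have hes : e.source = e₀.source ∩ U := e₀.restrOpen_source U hUo
  have hd : ∀ x ∈ e.source, ∃ g : E ≃L[ℝ] F, HasFDerivAt f (g : E →L[ℝ] F) x := by
    intro x hx
    rw [hes] at hx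
    obtain ⟨g, hg⟩ := (hU hx.2).1.2
    refine ⟨g, ?_⟩
    rw [hg]
    have h1 : ContDiffAt ℝ ∞ f x := (hU hx.2).1.1
    exact (h1.differentiableAt (by simp)).hasFDerivAt
  have hsm : ∀ x ∈ e.source, ContDiffAt ℝ ∞ f x := by
    intro x hx
    rw [hes] at hx
    exact (hU hx.2).1.1
  refine ⟨e, ?_, ?_, rfl, hsm, hd, ?_⟩
  · rw [hes]
    exact ⟨ha.mem_toOpenPartialHomeomorph_source hf' (by simp), haU⟩
  · rw [hes]
    exact fun x hx => (hU hx.2).2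
  · intro y hy
    obtain ⟨g, hg⟩ := hd _ (e.map_target hy)
    exact e.contDiffAt_symm hy hg (hsm _ (e.map_target hy))

end LocalInverse

section CommutingFlow

variable {E : Type u} [NormedAddCommGroup E] [NormedSpace ℝ E]

/-- The defect of the integral equation `y(s) = x₀ + A p + ∫₀ˢ L(y) (B p)`. -/
def flowDefect (L : E → E →L[ℝ] E) (hL : ContDiff ℝ ∞ L) (A B : E →L[ℝ] E) (x₀ : E)
    (z : E × Path E) : Path E :=
  z.2 - constPath E x₀ - constPath E (A z.1) -
    pathInt E (pathApply E E (nemytskii L hL z.2)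
      (constPath E (B z.1)))

/-- The derivative of `flowDefect`. -/
def flowDefectDeriv (L : E → E →L[ℝ] E) (hL : ContDiff ℝ ∞ L) (A B : E →L[ℝ] E)
    (z : E × Path E) : (E × Path E) →L[ℝ] Path E :=
  ContinuousLinearMap.snd ℝ _ _ -
    (constPath E) ∘L A ∘L ContinuousLinearMap.fst ℝ _ _ -
    (pathInt E) ∘L
      ((pathApply E E (nemytskii L hL z.2)) ∘L (constPath E) ∘L B ∘L
          ContinuousLinearMap.fst ℝ _ _ +
        ((pathApply E E).flip (constPath E (B z.1))) ∘L
          (pathApply E (E →L[ℝ] E) (nemytskii (fderiv ℝ L) (hL.fderiv_right (by simp)) z.2)) ∘L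
            ContinuousLinearMap.snd ℝ _ _)

variable (L : E → E →L[ℝ] E) (hL : ContDiff ℝ ∞ L) (A B : E →L[ℝ] E) (x₀ : E)

theorem contDiff_flowDefect : ContDiff ℝ ∞ (flowDefect L hL A B x₀) := by
  have h1 : ContDiff ℝ ∞ fun z : E × Path E => nemytskii L hL z.2 :=
    (contDiff_nemytskii L hL).comp contDiff_snd
  have h2 : ContDiff ℝ ∞ fun z : E × Path E =>
      constPath E (B z.1) :=
    contDiff_constPath.comp (B.contDiff.comp contDiff_fst)
  have h3 : ContDiff ℝ ∞ fun z : E × Path E =>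
      constPath E (A z.1) :=
    contDiff_constPath.comp (A.contDiff.comp contDiff_fst)
  have h4 : ContDiff ℝ ∞ fun z : E × Path E =>
      pathApply E E (nemytskii L hL z.2) (constPath E (B z.1)) :=
    (contDiff_pathApply.comp h1).clm_apply h2
  exact ((contDiff_snd.sub contDiff_const).sub h3).sub ((pathInt E).contDiff.comp h4)

theorem hasFDerivAt_flowDefect (z : E × Path E) :
    HasFDerivAt (flowDefect L hL A B x₀) (flowDefectDeriv L hL A B z) z := by
  have h1 : HasFDerivAt (fun z : E × Path E => nemytskii L hL z.2) _ z :=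
    (hasFDerivAt_nemytskii L hL z.2).comp z (hasFDerivAt_snd)
  have h2 : HasFDerivAt (fun z : E × Path E =>
      constPath E (B z.1)) 
      ((constPath E) ∘L B ∘L ContinuousLinearMap.fst ℝ _ _) z :=
    (hasFDerivAt_constPath _).comp z
      (B.hasFDerivAt.comp z hasFDerivAt_fst)
  have h3 : HasFDerivAt (fun z : E × Path E =>
      constPath E (A z.1)) 
      ((constPath E) ∘L A ∘L ContinuousLinearMap.fst ℝ _ _) z :=
    (hasFDerivAt_constPath _).comp z
      (A.hasFDerivAt.comp z hasFDerivAt_fst)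
  have h1' : HasFDerivAt (fun z : E × Path E => pathApply E E (nemytskii L hL z.2))
      ((pathApply E E) ∘L
        (pathApply E (E →L[ℝ] E) (nemytskii (fderiv ℝ L) (hL.fderiv_right (by simp)) z.2)) ∘L
            ContinuousLinearMap.snd ℝ _ _) z :=
    (hasFDerivAt_pathApply _).comp z h1
  have h4 := h1'.clm_apply h2
  exact (((hasFDerivAt_snd).sub (hasFDerivAt_const _ _)).sub h3).sub
    ((pathInt E).hasFDerivAt.comp z h4) |>.congr_fderiv (by
      simp only [flowDefectDeriv, sub_zero]
      rfl)

theorem flowDefect_apply (z : E × Path E) (s : Icc (0 : ℝ) 1) :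
    flowDefect L hL A B x₀ z s = z.2 s - x₀ - A z.1 -
      ∫ τ in (0 : ℝ)..s, L (z.2 (projIcc 0 1 zero_le_one τ)) (B z.1) := rfl

theorem flowDefectDeriv_apply (z w : E × Path E) (s : Icc (0 : ℝ) 1) :
    flowDefectDeriv L hL A B z w s = w.2 s - A w.1 -
      ∫ τ in (0 : ℝ)..s, (L (z.2 (projIcc 0 1 zero_le_one τ)) (B w.1) +
        fderiv ℝ L (z.2 (projIcc 0 1 zero_le_one τ)) (w.2 (projIcc 0 1 zero_le_one τ)) (B z.1)) :=
  rfl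

/-- Evaluation of a path at its end point. -/
def evalPath (E : Type u) [NormedAddCommGroup E] [NormedSpace ℝ E] : Path E →L[ℝ] E :=
  LinearMap.mkContinuous
    { toFun := fun y => y ⟨1, by simp⟩
      map_add' := fun _ _ => rfl
      map_smul' := fun _ _ => rfl } 1 (fun y => by
        rw [one_mul]
        exact y.norm_apply_le _)

@[simp] theorem evalPath_apply (y : Path E) : evalPath E y = y ⟨1, by simp⟩ := rfl

/-- For commuting vector fields, the variation `s ↦ s L(y) h` of a trajectory `y` solves the
linearized equation. -/
theorem flowDefectDeriv_variation [CompleteSpace E] (z : E × Path E)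
    (hz : flowDefect L hL A B x₀ z = 0)
    (hcomm : ∀ t, ∀ h k, fderiv ℝ L (z.2 t) (L (z.2 t) h) k = fderiv ℝ L (z.2 t) (L (z.2 t) k) h)
    (k : E) (hk : A k = 0) :
    flowDefectDeriv L hL A B z (k, Path.mk (fun s => (s : ℝ) • L (z.2 s) (B k))
      (continuous_subtype_val.smul
        ((hL.continuous.comp z.2.continuous).clm_apply continuous_const))) = 0 := by
  have hc : Continuous fun τ : ℝ => L (z.2 (projIcc 0 1 zero_le_one τ)) (B z.1) :=
    (hL.continuous.comp (continuous_extend_path z.2)).clm_apply continuous_const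
  have hy : ∀ τ, HasDerivAt
      (fun s => x₀ + A z.1 + ∫ r in (0 : ℝ)..s, L (z.2 (projIcc 0 1 zero_le_one r)) (B z.1))
      (L (z.2 (projIcc 0 1 zero_le_one τ)) (B z.1)) τ := fun τ =>
    ((hc.integral_hasStrictDerivAt 0 τ).hasDerivAt).const_add _
  set Y : ℝ → E :=
    fun s => x₀ + A z.1 + ∫ r in (0 : ℝ)..s, L (z.2 (projIcc 0 1 zero_le_one r)) (B z.1) with hY
  have hYz : ∀ τ (hτ : τ ∈ Icc (0 : ℝ) 1), Y τ = z.2 ⟨τ, hτ⟩ := by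
    intro τ hτ
    have h := congrArg (fun y : Path E => y ⟨τ, hτ⟩) hz
    simp only [flowDefect_apply, Path.zero_apply] at h
    rw [hY]
    have h2 := sub_eq_zero.1 h
    simp only at h2 ⊢
    rw [← h2]
    abel
  ext s
  rw [flowDefectDeriv_apply, Path.zero_apply, hk, sub_zero, sub_eq_zero]
  simp only [Path.mk_apply]
  -- The product rule produces `fderiv L` applied to the velocity `L (B z.1)` and to `B k`; the
  -- linearized equation has these two in the other order, and commutation exchanges them.
  have hU : ∀ τ ∈ uIcc 0 (s : ℝ), HasDerivAt (fun τ => τ • L (Y τ) (B k))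
      (L (z.2 (projIcc 0 1 zero_le_one τ)) (B k) +
        fderiv ℝ L (z.2 (projIcc 0 1 zero_le_one τ))
          (((projIcc 0 1 zero_le_one τ : Icc (0 : ℝ) 1) : ℝ) •
            L (z.2 (projIcc 0 1 zero_le_one τ)) (B k)) (B z.1)) τ := by
    intro τ hτ
    rw [uIcc_of_le s.2.1] at hτ
    have hτ' : τ ∈ Icc (0 : ℝ) 1 := ⟨hτ.1, hτ.2.trans s.2.2⟩
    have h1 : HasDerivAt (fun τ => L (Y τ)) (fderiv ℝ L (Y τ)
        (L (z.2 (projIcc 0 1 zero_le_one τ)) (B z.1))) τ :=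
      ((hL.differentiable (by simp)) (Y τ)).hasFDerivAt.comp_hasDerivAt τ (hy τ)
    have h2 := (hasDerivAt_id τ).smul (h1.clm_apply (hasDerivAt_const τ (B k)))
    refine h2.congr_deriv ?_
    rw [projIcc_of_mem _ hτ', hYz τ hτ']
    simp only [id, map_zero, add_zero, one_smul, map_smul, smul_apply]
    rw [hcomm, add_comm]
  have hint := intervalIntegral.integral_eq_sub_of_hasDerivAt hU ?_
  · rw [hint, zero_smul, sub_zero, hYz s s.2]
  · refine Continuous.intervalIntegrable ?_ _ _
    have h3 := continuous_extend_path z.2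
    exact ((hL.continuous.comp h3).clm_apply continuous_const).add
      ((((hL.continuous_fderiv (by simp)).comp h3).clm_apply
        ((continuous_subtype_val.comp continuous_projIcc).smul
          ((hL.continuous.comp h3).clm_apply continuous_const))).clm_apply continuous_const)

/-- The joint flow of a family of commuting vector fields `x ↦ L x (B p)`, with initial points
`x₀ + A p`. -/
theorem exists_commuting_flow [CompleteSpace E] (hL : ContDiff ℝ ∞ L)
    (hcomm : ∀ᶠ x in 𝓝 x₀, ∀ h k, fderiv ℝ L x (L x h) k = fderiv ℝ L x (L x k) h) :
    ∃ Φ : E → E, Φ 0 = x₀ ∧ (∀ᶠ p in 𝓝 0, ContDiffAt ℝ ∞ Φ p) ∧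
      HasFDerivAt Φ (A + L x₀ ∘L B) 0 ∧
      ∀ᶠ p in 𝓝 0, ∀ k, A k = 0 → fderiv ℝ Φ p k = L (Φ p) (B k) := by
  set z₀ : E × Path E := (0, constPath E x₀) with hz₀
  -- Keeping the parameter as a first component makes the domain and codomain equal: trajectories
  -- with parameter `p` are the preimages of `(p, 0)`, and a smooth local inverse of `Ψ` gives
  -- smooth dependence on `p`.
  set Ψ : E × Path E → E × Path E := fun z => (z.1, flowDefect L hL A B x₀ z) with hΨ
  have hΨ0 : Ψ z₀ = (0, 0) := by
    rw [hΨ]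
    refine Prod.ext rfl ?_
    ext s
    simp [flowDefect_apply, hz₀]
  have hΨs : ContDiff ℝ ∞ Ψ := contDiff_fst.prodMk (contDiff_flowDefect L hL A B x₀)
  have hΨd : ∀ z, HasFDerivAt Ψ ((ContinuousLinearMap.fst ℝ _ _).prod
      (flowDefectDeriv L hL A B z)) z := fun z =>
    hasFDerivAt_fst.prodMk (hasFDerivAt_flowDefect L hL A B x₀ z)
  let T : E →L[ℝ] Path E := constPath E ∘L A +
    pathInt E ∘L pathApply E E (nemytskii L hL z₀.2) ∘L constPath E ∘L B
  -- At `z₀` the parameter vanishes, so the term with `fderiv L` is multiplied by `B 0 = 0`. The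
  -- derivative of `Ψ` is then triangular, with an explicit inverse.
  have hT : ∀ w, flowDefectDeriv L hL A B z₀ w = w.2 - T w.1 := by
    intro w
    ext s
    simp only [flowDefectDeriv_apply, hz₀, map_zero, add_zero, Path.sub_apply, T, add_apply,
      ContinuousLinearMap.comp_apply, Path.add_apply, constPath_apply, pathInt_apply,
      pathApply_apply, nemytskii_apply, sub_sub]
  let f₀ : (E × Path E) ≃L[ℝ] (E × Path E) :=
    ContinuousLinearEquiv.equivOfInverse
      ((ContinuousLinearMap.fst ℝ _ _).prod (flowDefectDeriv L hL A B z₀))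
      ((ContinuousLinearMap.fst ℝ _ _).prod
        (ContinuousLinearMap.snd ℝ _ _ + T ∘L ContinuousLinearMap.fst ℝ _ _))
      (fun w => by simp [hT]) (fun w => by simp [hT])
  obtain ⟨e, hz₀e, -, heΨ, -, hinv, hes⟩ := exists_smooth_local_inverse (f := Ψ) (a := z₀)
    (f' := f₀) (Filter.Eventually.of_forall fun z => hΨs.contDiffAt) (hΨd z₀) Filter.univ_mem
  set S : E → E × Path E := fun p => e.symm (p, 0) with hS
  have hS0 : S 0 = z₀ := by
    have := e.left_inv hz₀e
    rwa [heΨ, hΨ0] at this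
  have htar : ∀ᶠ p : E in 𝓝 0, (p, (0 : Path E)) ∈ e.target := by
    have h1 : ((0 : E), (0 : Path E)) ∈ e.target := by
      have := e.map_source hz₀e
      rwa [heΨ, hΨ0] at this
    have h2 : ContinuousAt (fun p : E => (p, (0 : Path E))) 0 := by fun_prop
    exact h2 (e.open_target.mem_nhds h1)
  have hSsm : ∀ᶠ p in 𝓝 0, ContDiffAt ℝ ∞ S p := by
    filter_upwards [htar] with p hp
    exact (hes _ hp).comp p (contDiff_id.prodMk contDiff_const).contDiffAt
  have hΨS : ∀ᶠ p in 𝓝 0, Ψ (S p) = (p, 0) := by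
    filter_upwards [htar] with p hp
    rw [← heΨ]
    exact e.right_inv hp
  have hkey : ∀ᶠ p in 𝓝 0, ∀ k, (fderiv ℝ S p k).1 = k ∧
      flowDefectDeriv L hL A B (S p) (fderiv ℝ S p k) = 0 := by
    filter_upwards [hΨS.eventually_nhds, hSsm] with p h1 h2 k
    have h3 := (hΨd (S p)).comp p (h2.differentiableAt (by simp)).hasFDerivAt
    have h4 : HasFDerivAt (Ψ ∘ S) (ContinuousLinearMap.inl ℝ E (Path E)) p := by
      refine (ContinuousLinearMap.hasFDerivAt (ContinuousLinearMap.inl ℝ E (Path E))).congr_of_eventuallyEq ?_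
      filter_upwards [h1] with q hq
      exact hq
    have h5 := congrArg (fun T : E →L[ℝ] E × Path E => T k) (h3.unique h4)
    simp only [ContinuousLinearMap.comp_apply, ContinuousLinearMap.prod_apply,
      ContinuousLinearMap.coe_fst', ContinuousLinearMap.inl_apply, Prod.mk.injEq] at h5
    exact h5
  have hev : ∀ᶠ p in 𝓝 0, ∀ k, fderiv ℝ (fun p => evalPath E (S p).2) p k =
      evalPath E (fderiv ℝ S p k).2 := by
    filter_upwards [hSsm] with p hp k
    have h1 := (hp.differentiableAt (by simp)).hasFDerivAt
    have h2 : HasFDerivAt (fun p => evalPath E (S p).2) _ p :=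
      (evalPath E).hasFDerivAt.comp p h1.snd
    rw [h2.fderiv]
    rfl
  have hΦs : ∀ᶠ p in 𝓝 0, ContDiffAt ℝ ∞ (fun p => evalPath E (S p).2) p := by
    filter_upwards [hSsm] with p hp
    exact (evalPath E).contDiff.contDiffAt.comp p hp.snd
  refine ⟨fun p => evalPath E (S p).2, ?_, hΦs, ?_, ?_⟩
  · simp [hS0, hz₀]
  · have h1 := (hΦs.self_of_nhds.differentiableAt (by simp)).hasFDerivAt
    refine h1.congr_fderiv ?_
    ext k
    obtain ⟨h2, h3⟩ := hkey.self_of_nhds k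
    rw [hev.self_of_nhds, evalPath_apply]
    rw [hS0, hT, sub_eq_zero, h2] at h3
    rw [h3]
    simp [T, pathInt_apply, hz₀]
  -- Commutation is required at every point of the trajectory; closeness to a constant path in the
  -- supremum norm keeps the whole trajectory in the good ball.
  · have hnear : ∀ᶠ p in 𝓝 0, ∀ t, ∀ h k, fderiv ℝ L ((S p).2 t) (L ((S p).2 t) h) k =
        fderiv ℝ L ((S p).2 t) (L ((S p).2 t) k) h := by
      obtain ⟨δ, hδ, hball⟩ := Metric.eventually_nhds_iff_ball.1 hcomm
      have h1 : ContinuousAt (fun p => (S p).2) 0 :=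
        hSsm.self_of_nhds.continuousAt.snd
      have h2 := h1 (Metric.ball_mem_nhds _ hδ)
      filter_upwards [h2] with p hp t
      refine hball _ ?_
      have h3 := (Path.dist_apply_le_dist (S p).2 (S 0).2 t).trans_lt hp
      rwa [hS0] at h3
    filter_upwards [hnear, hkey, hΨS, htar, hev] with p h1 h2 h3 h4 h5 k hk
    rw [h5]
    have hz : flowDefect L hL A B x₀ (S p) = 0 := congrArg Prod.snd h3
    have hp : (S p).1 = p := congrArg Prod.fst h3
    have h6 := flowDefectDeriv_variation L hL A B x₀ (S p) hz h1 k hk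
    obtain ⟨h7, h8⟩ := h2 k
    obtain ⟨g, hg⟩ := hinv (S p) (e.map_target h4)
    have h9 := hg.unique (hΨd (S p))
    -- Both sides are mapped to `(k, 0)` by the invertible derivative of `Ψ`: the left one because
    -- `Ψ ∘ S` is linear, the right one because it solves the linearized equation.
    have h10 : fderiv ℝ S p k = (k, Path.mk (fun s => (s : ℝ) • L ((S p).2 s) (B k))
      (continuous_subtype_val.smul
        ((hL.continuous.comp (S p).2.continuous).clm_apply continuous_const))) := by
      apply g.injective
      have h11 : ∀ w, g w = (w.1, flowDefectDeriv L hL A B (S p) w) := fun w =>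
        congrArg (fun T : E × Path E →L[ℝ] E × Path E => T w) h9
      rw [h11, h11, h8, h6, h7]
    rw [h10]
    simp

end CommutingFlow

/-! ### The Frobenius theorem near a point -/

section Frobenius

variable {E : Type u} [NormedAddCommGroup E] [NormedSpace ℝ E] [FiniteDimensional ℝ E]

/-- A map smooth near a point agrees near this point with a globally smooth map. -/
theorem exists_contDiff_eventuallyEq {G : Type*} [NormedAddCommGroup G] [NormedSpace ℝ G]
    {f : E → G} {x₀ : E} (hf : ∀ᶠ x in 𝓝 x₀, ContDiffAt ℝ ∞ f x) :
    ∃ g : E → G, ContDiff ℝ ∞ g ∧ g =ᶠ[𝓝 x₀] f := by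
  obtain ⟨r, hr, hball⟩ := Metric.eventually_nhds_iff_ball.1 hf
  let φ : ContDiffBump x₀ := ⟨r / 3, r / 2, by positivity, by linarith⟩
  refine ⟨fun x => φ x • f x, contDiff_iff_contDiffAt.2 fun x => ?_, ?_⟩
  · by_cases hx : x ∈ Metric.ball x₀ r
    · exact φ.contDiff.contDiffAt.smul (hball x hx)
    · have h1 : x ∉ tsupport φ := by
        rw [φ.tsupport_eq]
        intro h
        have h2 : dist x x₀ ≤ r / 2 := h
        rw [Metric.mem_ball] at hx
        linarith
      have h2 : (fun x => φ x • f x) =ᶠ[𝓝 x] fun _ => 0 := by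
        filter_upwards [(notMem_tsupport_iff_eventuallyEq.1 h1)] with y hy
        rw [hy, Pi.zero_apply, zero_smul]
      exact contDiffAt_const.congr_of_eventuallyEq h2
  · filter_upwards [Metric.closedBall_mem_nhds x₀ φ.rIn_pos] with x hx
    rw [φ.one_of_mem_closedBall hx, one_smul]

variable {G : Type*} [NormedAddCommGroup G] [NormedSpace ℝ G] [FiniteDimensional ℝ G]

/-- A smooth family of surjective operators has a smooth family of right inverses, with constant
range. -/
theorem exists_smooth_rightInverse {Θ : E → E →L[ℝ] G} {x₀ : E}
    (hΘ : ∀ᶠ x in 𝓝 x₀, ContDiffAt ℝ ∞ Θ x) (hsurj : Function.Surjective (Θ x₀)) :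
    ∃ ρ : E → G →L[ℝ] E, (∀ᶠ x in 𝓝 x₀, ContDiffAt ℝ ∞ ρ x) ∧
      ∀ᶠ x in 𝓝 x₀, (∀ g, Θ x (ρ x g) = g) ∧ (∀ g, ρ x₀ (Θ x₀ (ρ x g)) = ρ x g) ∧
        ∀ g, ρ x (Θ x (ρ x₀ g)) = ρ x₀ g := by
  obtain ⟨R', hR'⟩ := (Θ x₀ : E →ₗ[ℝ] G).exists_rightInverse_of_surjective
    (LinearMap.range_eq_top.2 hsurj)
  set R : G →L[ℝ] E := LinearMap.toContinuousLinearMap R' with hR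
  have hRi : ∀ g, Θ x₀ (R g) = g := fun g => congrArg (fun T : G →ₗ[ℝ] G => T g) hR'
  have hsm : ∀ᶠ x in 𝓝 x₀, ContDiffAt ℝ ∞ (fun x => Θ x ∘L R) x := by
    filter_upwards [hΘ] with x hx
    exact hx.clm_comp contDiffAt_const
  have h0 : Θ x₀ ∘L R = ((ContinuousLinearEquiv.refl ℝ G : G ≃L[ℝ] G) : G →L[ℝ] G) := by
    ext g
    simp [hRi]
  have hinv : ∀ᶠ x in 𝓝 x₀, Θ x ∘L R ∈ range ((↑) : (G ≃L[ℝ] G) → G →L[ℝ] G) := by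
    refine hsm.self_of_nhds.continuousAt ?_
    rw [h0]
    exact ContinuousLinearEquiv.nhds _
  have hρ0 : R ∘L (Θ x₀ ∘L R).inverse = R := by
    rw [h0, ContinuousLinearMap.inverse_equiv]
    ext g
    simp
  refine ⟨fun x => R ∘L (Θ x ∘L R).inverse, ?_, ?_⟩
  · filter_upwards [hsm, hinv] with x hx hxi
    obtain ⟨g, hg⟩ := hxi
    have h1 : ContDiffAt ℝ ∞ ContinuousLinearMap.inverse (Θ x ∘L R) := by
      rw [← hg]
      exact contDiffAt_map_inverse g
    have h2 : ContDiffAt ℝ ∞ (fun x => (Θ x ∘L R).inverse) x :=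
      ContDiffAt.comp (g := ContinuousLinearMap.inverse) (f := fun x => Θ x ∘L R) x h1 hx
    exact contDiffAt_const.clm_comp h2
  · filter_upwards [hinv] with x hxi
    obtain ⟨e, he⟩ := hxi
    have he' : ∀ g, Θ x (R g) = e g := fun g => congrArg (fun T : G →L[ℝ] G => T g) he.symm
    simp only [hρ0]
    rw [← he, ContinuousLinearMap.inverse_equiv]
    refine ⟨fun g => ?_, fun g => ?_, fun g => ?_⟩
    · simp [he']
    · simp [hRi]
    · simp [he']

/-- The **Frobenius theorem**: the system `ker Θ` is integrable, hence has first integrals. -/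
theorem exists_first_integrals {Θ : E → E →L[ℝ] G} {x₀ : E}
    (hΘ : ∀ᶠ x in 𝓝 x₀, ContDiffAt ℝ ∞ Θ x) (hsurj : Function.Surjective (Θ x₀))
    (hF : ∀ᶠ x in 𝓝 x₀, ∀ v w, Θ x v = 0 → Θ x w = 0 → fderiv ℝ Θ x v w = fderiv ℝ Θ x w v) :
    ∃ f : E → G, (∀ᶠ x in 𝓝 x₀, ContDiffAt ℝ ∞ f x) ∧ Function.Surjective (fderiv ℝ f x₀) ∧
      ∀ᶠ x in 𝓝 x₀, ∀ v, Θ x v = 0 → fderiv ℝ f x v = 0 := by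
  obtain ⟨ρ, hρ, hρΘ⟩ := exists_smooth_rightInverse hΘ hsurj
  set A : E →L[ℝ] E := ρ x₀ ∘L Θ x₀ with hA
  set P : E →L[ℝ] E := ContinuousLinearMap.id ℝ E - A with hP
  have hPv : ∀ v, P v = v - ρ x₀ (Θ x₀ v) := fun v => rfl
  have hΘρ0 := hρΘ.self_of_nhds.1
  have hΘP : ∀ v, Θ x₀ (P v) = 0 := fun v => by rw [hPv, map_sub, hΘρ0, sub_self]
  have hPP : ∀ v, P (P v) = P v := fun v => by rw [hPv (P v), hΘP, map_zero, sub_zero]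
  -- `P` projects to `ker Θ x₀` along the fixed complement `range (ρ x₀)`, and `L₀ x v` is the
  -- vector of `ker Θ x` that has the same `P`-component as `v`. The fields `x ↦ L₀ x v` span the
  -- distribution.
  set L₀ : E → E →L[ℝ] E := fun x => P - ρ x ∘L Θ x ∘L P with hL₀
  have hL₀v : ∀ x v, L₀ x v = P v - ρ x (Θ x (P v)) := fun x v => rfl
  have hL₀s : ∀ᶠ x in 𝓝 x₀, ContDiffAt ℝ ∞ L₀ x := by
    filter_upwards [hΘ, hρ] with x h1 h2
    exact contDiffAt_const.sub (h2.clm_comp (h1.clm_comp contDiffAt_const))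
  have hL₀P : ∀ x v, L₀ x (P v) = L₀ x v := fun x v => by simp only [hL₀v, hPP]
  have hΘL : ∀ᶠ x in 𝓝 x₀, ∀ v, Θ x (L₀ x v) = 0 := by
    filter_upwards [hρΘ] with x hx v
    rw [hL₀v, map_sub, hx.1, sub_self]
  have hPL : ∀ᶠ x in 𝓝 x₀, ∀ v, P (L₀ x v) = P v := by
    filter_upwards [hρΘ] with x hx v
    rw [hL₀v, map_sub, hPP, hPv (ρ x _), hx.2.1, sub_self, sub_zero]
  have hLker : ∀ᶠ x in 𝓝 x₀, ∀ v, Θ x v = 0 → L₀ x v = v := by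
    filter_upwards [hρΘ] with x hx v hv
    rw [hL₀v, hPv, map_sub, hv, zero_sub, map_neg, hx.2.2]
    abel
  -- The `P`-components of these fields are constant, so their brackets lie in the complement `range
  -- (ρ x₀)`. By integrability the brackets also lie in `ker Θ x`, which meets the complement
  -- trivially near `x₀`.
  have hcomm₀ : ∀ᶠ x in 𝓝 x₀, ∀ h k,
      fderiv ℝ L₀ x (L₀ x h) k = fderiv ℝ L₀ x (L₀ x k) h := by
    filter_upwards [hΘL.eventually_nhds, hPL.eventually_nhds, hΘ, hL₀s, hF, hρΘ]
      with x h1 h2 h3 h4 h5 h6 h k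
    have hdL := (h4.differentiableAt (by simp)).hasFDerivAt
    have hdΘ := (h3.differentiableAt (by simp)).hasFDerivAt
    have hd1 : ∀ u k, P (fderiv ℝ L₀ x u k) = 0 := by
      intro u k
      have ha : HasFDerivAt (fun x => P (L₀ x k)) _ x :=
        P.hasFDerivAt.comp x (hdL.clm_apply (hasFDerivAt_const k x))
      have hb : HasFDerivAt (fun x => P (L₀ x k)) (0 : E →L[ℝ] E) x := by
        refine (hasFDerivAt_const (P k) x).congr_of_eventuallyEq ?_
        filter_upwards [h2] with y hy using hy k
      simpa using congrArg (fun T : E →L[ℝ] E => T u) (ha.unique hb)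
    have hd2 : ∀ u k, Θ x (fderiv ℝ L₀ x u k) = - fderiv ℝ Θ x u (L₀ x k) := by
      intro u k
      have ha : HasFDerivAt (fun x => Θ x (L₀ x k)) _ x :=
        hdΘ.clm_apply (hdL.clm_apply (hasFDerivAt_const k x))
      have hb : HasFDerivAt (fun x => Θ x (L₀ x k)) (0 : E →L[ℝ] G) x := by
        refine (hasFDerivAt_const (0 : G) x).congr_of_eventuallyEq ?_
        filter_upwards [h1] with y hy using hy k
      have hc := congrArg (fun T : E →L[ℝ] G => T u) (ha.unique hb)
      simp at hc
      exact eq_neg_of_add_eq_zero_left hc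
    rw [← sub_eq_zero]
    set c := fderiv ℝ L₀ x (L₀ x h) k - fderiv ℝ L₀ x (L₀ x k) h with hc
    have hPc : P c = 0 := by rw [hc, map_sub, hd1, hd1, sub_zero]
    have hΘc : Θ x c = 0 := by
      rw [hc, map_sub, hd2, hd2, h5 _ _ (h1.self_of_nhds h) (h1.self_of_nhds k), sub_self]
    have h7 : c = ρ x₀ (Θ x₀ c) := by
      rw [hPv, sub_eq_zero] at hPc
      exact hPc
    have h8 := h6.2.2 (Θ x₀ c)
    rw [← h7, hΘc, map_zero] at h8
    exact h8.symm
  -- The path-space argument composes with a globally smooth field; only the germ of `L₀` at `x₀`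
  -- matters.
  obtain ⟨L, hL, hLL₀⟩ := exists_contDiff_eventuallyEq hL₀s
  have hcomm : ∀ᶠ x in 𝓝 x₀, ∀ h k, fderiv ℝ L x (L x h) k = fderiv ℝ L x (L x k) h := by
    filter_upwards [hLL₀.eventually_nhds, hcomm₀] with x h1 h2 h k
    have h3 : L =ᶠ[𝓝 x] L₀ := h1
    rw [h3.fderiv_eq, h3.self_of_nhds]
    exact h2 h k
  -- The parameter splits: its part `A p` moves the initial point across the leaves and its part `P
  -- p` flows inside a leaf. The derivative at `0` is the identity, and the transversal part of
  -- `Φ⁻¹` is a first integral.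
  obtain ⟨Φ, hΦ0, hΦs, hΦd, hΦ⟩ := exists_commuting_flow L A P x₀ hL hcomm
  have hd0 : A + L x₀ ∘L P = ((ContinuousLinearEquiv.refl ℝ E : E ≃L[ℝ] E) : E →L[ℝ] E) := by
    ext v
    rw [hLL₀.self_of_nhds]
    simp only [add_apply, ContinuousLinearMap.comp_apply, hL₀P, hL₀v, hΘP, map_zero, sub_zero]
    simp [hPv, hA]
  rw [hd0] at hΦd
  have hΦc : ContinuousAt Φ 0 := hΦs.self_of_nhds.continuousAt
  have hnear : ∀ᶠ p in 𝓝 0, (∀ v, Θ (Φ p) v = 0 → L₀ (Φ p) v = v) ∧ L (Φ p) = L₀ (Φ p) :=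
    hΦc (by rw [hΦ0]; exact hLker.and hLL₀)
  obtain ⟨e, h0e, hesub, heΦ, hsm, -, hes⟩ := exists_smooth_local_inverse hΦs hΦd
    (Filter.inter_mem hΦ hnear)
  have hx₀ : x₀ ∈ e.target := by
    have := e.map_source h0e
    rwa [heΦ, hΦ0] at this
  have hsym0 : e.symm x₀ = 0 := by
    have := e.left_inv h0e
    rwa [heΦ, hΦ0] at this
  have hfd : ∀ x ∈ e.target, HasFDerivAt (fun x => Θ x₀ (e.symm x))
      (Θ x₀ ∘L fderiv ℝ e.symm x) x := fun x hx =>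
    (Θ x₀).hasFDerivAt.comp x ((hes x hx).differentiableAt (by simp)).hasFDerivAt
  have hchain : ∀ x ∈ e.target, ∀ v, fderiv ℝ e.symm x (fderiv ℝ Φ (e.symm x) v) = v := by
    intro x hx v
    have hp := e.map_target hx
    have h1 : HasFDerivAt e.symm (fderiv ℝ e.symm x) (Φ (e.symm x)) := by
      rw [← heΦ, e.right_inv hx]
      exact ((hes x hx).differentiableAt (by simp)).hasFDerivAt
    have h2 := h1.comp (e.symm x)
      ((hsm _ hp).differentiableAt (by simp)).hasFDerivAt
    have h3 : HasFDerivAt (e.symm ∘ Φ) (ContinuousLinearMap.id ℝ E) (e.symm x) := by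
      refine (hasFDerivAt_id _).congr_of_eventuallyEq ?_
      filter_upwards [e.open_source.mem_nhds hp] with q hq
      rw [← heΦ]
      exact e.left_inv hq
    exact congrArg (fun T : E →L[ℝ] E => T v) (h2.unique h3)
  refine ⟨fun x => Θ x₀ (e.symm x), ?_, ?_, ?_⟩
  · filter_upwards [e.open_target.mem_nhds hx₀] with x hx
    exact (Θ x₀).contDiff.contDiffAt.comp x (hes x hx)
  · rw [(hfd x₀ hx₀).fderiv]
    intro g
    obtain ⟨v, hv⟩ := hsurj g
    refine ⟨v, ?_⟩
    have h1 := hchain x₀ hx₀ v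
    rw [hsym0, hΦd.fderiv] at h1
    rw [ContinuousLinearMap.comp_apply, ← hv]
    exact congrArg _ h1
  · filter_upwards [e.open_target.mem_nhds hx₀] with x hx v hv
    rw [(hfd x hx).fderiv, ContinuousLinearMap.comp_apply]
    have hp := hesub (e.map_target hx)
    have hxp : Φ (e.symm x) = x := by
      rw [← heΦ]
      exact e.right_inv hx
    -- A vector `v` tangent to the leaf at `x` is the image of the parameter direction `P v`, which
    -- `Θ x₀` kills.
    have h1 := hp.1 (P v) (by
      rw [hA, ContinuousLinearMap.comp_apply, hΘP, map_zero])
    rw [hPP, hp.2.2, hL₀P, hp.2.1 v (by rwa [hxp])] at h1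
    have h2 := hchain x hx (P v)
    rw [h1] at h2
    rw [h2, hΘP]

end Frobenius

/-- The model space of dimension `d`. -/
abbrev Eu (d : ℕ) : Type := EuclideanSpace ℝ (Fin d)

instance euChartedSpace (d : ℕ) : ChartedSpace (EuclideanSpace ℝ (Fin d)) (Eu d) :=
  chartedSpaceSelf (EuclideanSpace ℝ (Fin d))

instance euIsManifold (d : ℕ) : IsManifold (𝓡 d) ∞ (Eu d) :=
  instIsManifoldModelSpace

/-! ### Smooth one-forms in charts, and pullbacks -/

section FormCalculus

variable {d : ℕ} {M : Type u} [TopologicalSpace M] [ChartedSpace (EuclideanSpace ℝ (Fin d)) M]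

/-- All tangent spaces are the model space by definition, so a vector can be kept fixed while an
equality of base points is used that holds only propositionally. -/
theorem form_congr (ψ : Form d M) {x x' : M} (h : x' = x) (v : EuclideanSpace ℝ (Fin d)) :
    ψ x' v = ψ x v := by
  subst h
  rfl

variable [IsManifold (𝓡 d) ∞ M]

theorem isManifold_one : IsManifold (𝓡 d) 1 M := IsManifold.of_le (n := ∞) (by simp)

/-- The trivialization of the cotangent bundle at `x₀` composes a covector with the derivative of
the inverse chart, which is what `chartForm` does. Smoothness of sections thereby becomes smoothness
of maps between vector spaces. -/
theorem smoothForm_at_iff (ψ : Form d M) (x₀ : M) {y : EuclideanSpace ℝ (Fin d)}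
    (hy : y ∈ (extChartAt (𝓡 d) x₀).target) :
    ContMDiffAt (𝓡 d) ((𝓡 d).prod 𝓘(ℝ, EuclideanSpace ℝ (Fin d) →L[ℝ] ℝ)) ∞
      (fun x => Bundle.TotalSpace.mk' (EuclideanSpace ℝ (Fin d) →L[ℝ] ℝ)
        (E := fun x : M => TangentSpace (𝓡 d) x →L[ℝ] ℝ) x (ψ x)) ((extChartAt (𝓡 d) x₀).symm y) ↔
    ContDiffAt ℝ ∞ (chartForm ψ x₀) y := by
  have : IsManifold (𝓡 d) 1 M := isManifold_one
  set φ := extChartAt (𝓡 d) x₀ with hφ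
  have hx : φ.symm y ∈ φ.source := φ.map_target hy
  have hx' : φ.symm y ∈ (chartAt (EuclideanSpace ℝ (Fin d)) x₀).source := by
    rwa [hφ, extChartAt_source] at hx
  rw [(trivializationAt (EuclideanSpace ℝ (Fin d) →L[ℝ] ℝ)
    (fun x : M => TangentSpace (𝓡 d) x →L[ℝ] ℝ) x₀).contMDiffAt_section_iff (IB := 𝓡 d) (n := ∞)
    (s := ψ) (x₀ := φ.symm y) (by
      rw [hom_trivializationAt_baseSet]
      exact ⟨hx', mem_univ _⟩)]
  have hval : ∀ x ∈ φ.source, (trivializationAt (EuclideanSpace ℝ (Fin d) →L[ℝ] ℝ)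
      (fun x : M => TangentSpace (𝓡 d) x →L[ℝ] ℝ) x₀ ⟨x, ψ x⟩).2 = chartForm ψ x₀ (φ x) := by
    intro x hx
    have hx2 : x ∈ (chartAt (EuclideanSpace ℝ (Fin d)) x₀).source := by
      rwa [hφ, extChartAt_source] at hx
    ext v
    have hl : φ.symm (φ x) = x := φ.left_inv hx
    have h1 := TangentBundle.symmL_trivializationAt (I := 𝓡 d) hx2
    rw [ModelWithCorners.range_eq_univ, mfderivWithin_univ] at h1
    have h2 := congrArg (fun T : EuclideanSpace ℝ (Fin d) →L[ℝ] TangentSpace (𝓡 d) x => ψ x (T v)) h1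
    rw [hom_trivializationAt_apply]
    have h3 := Bundle.Trivial.continuousLinearMapAt_trivialization ℝ M ℝ x
    have h4 := congrArg (fun T : ℝ →L[ℝ] ℝ => T (ψ x (Bundle.Trivialization.symmL ℝ
      (trivializationAt (EuclideanSpace ℝ (Fin d)) (TangentSpace (𝓡 d)) x₀) x v))) h3
    exact h4.trans (h2.trans (form_congr ψ hl _).symm)
  have hev : ∀ᶠ x in 𝓝 (φ.symm y), x ∈ φ.source := by
    rw [hφ]
    exact extChartAt_source_mem_nhds' hx
  constructor
  · intro h
    have h1 : ContMDiffAt (𝓡 d) 𝓘(ℝ, EuclideanSpace ℝ (Fin d) →L[ℝ] ℝ) ∞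
        (fun x => chartForm ψ x₀ (φ x)) (φ.symm y) := by
      refine h.congr_of_eventuallyEq ?_
      filter_upwards [hev] with x hx using (hval x hx).symm
    have h2 : ContMDiffAt 𝓘(ℝ, EuclideanSpace ℝ (Fin d)) (𝓡 d) ∞ φ.symm y :=
      (contMDiffOn_extChartAt_symm x₀).contMDiffAt
        ((isOpen_extChartAt_target x₀).mem_nhds hy)
    have h3 := h1.comp y h2
    refine (h3.congr_of_eventuallyEq ?_).contDiffAt
    filter_upwards [(isOpen_extChartAt_target (I := 𝓡 d) x₀).mem_nhds hy] with z hz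
    simp only [Function.comp_apply]
    rw [φ.right_inv hz]
  · intro h
    have h1 : ContMDiffAt (𝓡 d) 𝓘(ℝ, EuclideanSpace ℝ (Fin d)) ∞ φ (φ.symm y) :=
      contMDiffAt_extChartAt' hx'
    have h2 : ContMDiffAt 𝓘(ℝ, EuclideanSpace ℝ (Fin d))
        𝓘(ℝ, EuclideanSpace ℝ (Fin d) →L[ℝ] ℝ) ∞ (chartForm ψ x₀) (φ (φ.symm y)) := by
      rw [φ.right_inv hy]
      exact h.contMDiffAt
    refine (h2.comp (φ.symm y) h1).congr_of_eventuallyEq ?_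
    filter_upwards [hev] with x hx using hval x hx

/-- The form `ψ` is smooth near `x`. -/
def SmoothFormNear (ψ : Form d M) (x : M) : Prop :=
  ∀ᶠ y in 𝓝 (extChartAt (𝓡 d) x x), ContDiffAt ℝ ∞ (chartForm ψ x) y

theorem SmoothFormOn.near {ψ : Form d M} {U : Set M} (h : SmoothFormOn ψ U) (hU : IsOpen U) {x : M}
    (hx : x ∈ U) : SmoothFormNear ψ x := by
  have h1 : ∀ᶠ y in 𝓝 (extChartAt (𝓡 d) x x), (extChartAt (𝓡 d) x).symm y ∈ U := by
    refine (continuousAt_extChartAt_symm (I := 𝓡 d) x) ?_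
    rw [extChartAt_to_inv]
    exact hU.mem_nhds hx
  filter_upwards [h1, extChartAt_target_mem_nhds (I := 𝓡 d) x] with y hy hy2
  exact (smoothForm_at_iff ψ x hy2).1 ((h _ hy).contMDiffAt (hU.mem_nhds hy))

theorem smoothFormOn_of_near {ψ : Form d M} {U : Set M} (h : ∀ x ∈ U, SmoothFormNear ψ x) :
    SmoothFormOn ψ U := by
  intro x hx
  have h1 := (smoothForm_at_iff ψ x (mem_extChartAt_target (I := 𝓡 d) x)).2 (h x hx).self_of_nhds
  rw [extChartAt_to_inv] at h1
  exact h1.contMDiffWithinAt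

theorem eventually_extChartAt_symm {p : M → Prop} {x : M} (h : ∀ᶠ z in 𝓝 x, p z) :
    ∀ᶠ y in 𝓝 (extChartAt (𝓡 d) x x), p ((extChartAt (𝓡 d) x).symm y) := by
  have h1 : Filter.Tendsto (extChartAt (𝓡 d) x).symm (𝓝 (extChartAt (𝓡 d) x x)) (𝓝 x) := by
    have := continuousAt_extChartAt_symm (I := 𝓡 d) x
    rwa [ContinuousAt, extChartAt_to_inv] at this
  exact h1.eventually h

/-- `SmoothFormNear` at `z` refers to the chart at `z` and not to the chart at `x`; the chart-free
notion `SmoothFormOn` mediates between the two. -/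
theorem SmoothFormNear.eventually_near {ψ : Form d M} {x : M} (hψ : SmoothFormNear ψ x) :
    ∀ᶠ z in 𝓝 x, SmoothFormNear ψ z := by
  obtain ⟨V, hV, hVo, hxV⟩ := mem_nhds_iff.1
    (Filter.inter_mem hψ (extChartAt_target_mem_nhds (I := 𝓡 d) x))
  have h1 : (extChartAt (𝓡 d) x).source ∩ extChartAt (𝓡 d) x ⁻¹' V ∈ 𝓝 x :=
    Filter.inter_mem (extChartAt_source_mem_nhds x)
      ((continuousAt_extChartAt x).preimage_mem_nhds (hVo.mem_nhds hxV))
  obtain ⟨U, hU, hUo, hxU⟩ := mem_nhds_iff.1 h1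
  have h2 : SmoothFormOn ψ U := by
    intro z hz
    have h3 := hV (hU hz).2
    have h4 := (smoothForm_at_iff ψ x h3.2).2 h3.1
    rw [(extChartAt (𝓡 d) x).left_inv (hU hz).1] at h4
    exact h4.contMDiffWithinAt
  filter_upwards [hUo.mem_nhds hxU] with z hz using h2.near hUo hz

end FormCalculus

section Euclidean

variable {d : ℕ}

theorem chartForm_euclidean (ψ : Form d (Eu d)) (x₀ : Eu d) : chartForm ψ x₀ = ψ := by
  funext y
  have h1 : ((extChartAt (𝓡 d) x₀).symm : Eu d → Eu d) = id := rfl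
  have h2 : mfderiv 𝓘(ℝ, Eu d) (𝓡 d) (extChartAt (𝓡 d) x₀).symm y =
      ContinuousLinearMap.id ℝ (Eu d) := by
    rw [h1]
    exact mfderiv_id
  ext v
  have h3 := form_congr ψ (congrFun h1 y) v
  have h4 := congrArg (fun T : Eu d →L[ℝ] Eu d => ψ ((extChartAt (𝓡 d) x₀).symm y) (T v)) h2
  exact h4.trans h3

theorem extD_euclidean (ψ : Eu d → Eu d →L[ℝ] ℝ) (x v w : Eu d) :
    extD (M := Eu d) ψ x v w = fderiv ℝ ψ x v w - fderiv ℝ ψ x w v := by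
  unfold extD
  rw [chartForm_euclidean (d := d) (ψ := ψ)]
  rfl

theorem smoothFormNear_euclidean (ψ : Eu d → Eu d →L[ℝ] ℝ) (x : Eu d) :
    SmoothFormNear (M := Eu d) ψ x ↔ ∀ᶠ y in 𝓝 x, ContDiffAt ℝ ∞ ψ y := by
  unfold SmoothFormNear
  rw [chartForm_euclidean (d := d) (ψ := ψ)]
  rfl

/-- The terms with the second derivative of `f` cancel by symmetry. This is the local form of the
compatibility of `d` with pullbacks. -/
theorem fderiv_pullback_antisymm {E F : Type*} [NormedAddCommGroup E] [NormedSpace ℝ E]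
    [NormedAddCommGroup F] [NormedSpace ℝ F] {β : F → F →L[ℝ] ℝ} {f : E → F} {y : E}
    (hβ : DifferentiableAt ℝ β (f y)) (hf : ContDiffAt ℝ ∞ f y) (v w : E) :
    fderiv ℝ (fun z => (β (f z)).comp (fderiv ℝ f z)) y v w -
      fderiv ℝ (fun z => (β (f z)).comp (fderiv ℝ f z)) y w v =
    fderiv ℝ β (f y) (fderiv ℝ f y v) (fderiv ℝ f y w) -
      fderiv ℝ β (f y) (fderiv ℝ f y w) (fderiv ℝ f y v) := by
  have h1 : HasFDerivAt (fun z => β (f z)) _ y :=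
    hβ.hasFDerivAt.comp y (hf.differentiableAt (by simp)).hasFDerivAt
  have h2 : HasFDerivAt (fderiv ℝ f) _ y :=
    ((hf.fderiv_right (m := 1) (by norm_cast)).differentiableAt (by simp)).hasFDerivAt
  have h3 := (h1.clm_comp h2).fderiv
  have hsymm : IsSymmSndFDerivAt ℝ f y :=
    hf.isSymmSndFDerivAt (by rw [minSmoothness_of_isRCLikeNormedField]; exact WithTop.coe_le_coe.2 le_top)
  rw [h3]
  simp
  rw [hsymm.eq v w]
  ring

end Euclidean

section PullForm

variable {d e : ℕ} {N : Type v} {M : Type u}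
  [TopologicalSpace N] [ChartedSpace (EuclideanSpace ℝ (Fin e)) N]
  [TopologicalSpace M] [ChartedSpace (EuclideanSpace ℝ (Fin d)) M]

/-- The pullback of a `1`-form. -/
def pullForm (f : N → M) (ψ : Form d M) : Form e N := fun x => pullCov f x (ψ (f x))

variable [IsManifold (𝓡 e) ∞ N] [IsManifold (𝓡 d) ∞ M]

/-- The map `f` is smooth near `x`. -/
def SmoothMapNear (f : N → M) (x : N) : Prop :=
  ∀ᶠ z in 𝓝 x, ContMDiffAt (𝓡 e) (𝓡 d) ∞ f z

theorem SmoothMapNear.written {f : N → M} {x : N} (hf : SmoothMapNear (d := d) (e := e) f x) :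
    ∀ᶠ y in 𝓝 (extChartAt (𝓡 e) x x),
      (y ∈ (extChartAt (𝓡 e) x).target ∧
        ContMDiffAt (𝓡 e) (𝓡 d) ∞ f ((extChartAt (𝓡 e) x).symm y) ∧
        f ((extChartAt (𝓡 e) x).symm y) ∈ (chartAt (EuclideanSpace ℝ (Fin d)) (f x)).source) ∧
      ContDiffAt ℝ ∞ (writtenInExtChartAt (𝓡 e) (𝓡 d) x f) y := by
  have h1 : ∀ᶠ z in 𝓝 x, ContMDiffAt (𝓡 e) (𝓡 d) ∞ f z ∧
      f z ∈ (chartAt (EuclideanSpace ℝ (Fin d)) (f x)).source :=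
    hf.and (hf.self_of_nhds.continuousAt.preimage_mem_nhds (chart_source_mem_nhds _ _))
  have h2 : ∀ᶠ y in 𝓝 (extChartAt (𝓡 e) x x),
      ContMDiffAt (𝓡 e) (𝓡 d) ∞ f ((extChartAt (𝓡 e) x).symm y) ∧
      f ((extChartAt (𝓡 e) x).symm y) ∈ (chartAt (EuclideanSpace ℝ (Fin d)) (f x)).source :=
    eventually_extChartAt_symm h1
  filter_upwards [h2, extChartAt_target_mem_nhds (I := 𝓡 e) x] with y hy hy2
  refine ⟨⟨hy2, hy⟩, ?_⟩
  have h3 : ContMDiffAt 𝓘(ℝ, EuclideanSpace ℝ (Fin e)) (𝓡 e) ∞ (extChartAt (𝓡 e) x).symm y :=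
    (contMDiffOn_extChartAt_symm x).contMDiffAt ((isOpen_extChartAt_target x).mem_nhds hy2)
  have h4 := (contMDiffAt_extChartAt' (I := 𝓡 d) (n := ∞) hy.2).comp y (hy.1.comp y h3)
  exact h4.contDiffAt

theorem chartForm_pullForm {f : N → M} {x : N} (hf : SmoothMapNear (d := d) (e := e) f x)
    (ψ : Form d M) :
    ∀ᶠ y in 𝓝 (extChartAt (𝓡 e) x x), chartForm (pullForm (e := e) f ψ) x y =
      (chartForm ψ (f x) (writtenInExtChartAt (𝓡 e) (𝓡 d) x f y)).comp
        (fderiv ℝ (writtenInExtChartAt (𝓡 e) (𝓡 d) x f) y) := by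
  have : IsManifold (𝓡 d) 1 M := isManifold_one
  have : IsManifold (𝓡 e) 1 N := isManifold_one
  filter_upwards [hf.written.eventually_nhds] with y hy
  obtain ⟨⟨hy1, hy2, hy3⟩, hy4⟩ := hy.self_of_nhds
  have hback : ∀ᶠ z in 𝓝 y, (extChartAt (𝓡 d) (f x)).symm
      (writtenInExtChartAt (𝓡 e) (𝓡 d) x f z) = f ((extChartAt (𝓡 e) x).symm z) := by
    filter_upwards [hy] with z hz
    rw [writtenInExtChartAt, Function.comp_apply, Function.comp_apply]
    exact (extChartAt (𝓡 d) (f x)).left_inv (by rw [extChartAt_source]; exact hz.1.2.2)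
  have hd1 : MDifferentiableAt 𝓘(ℝ, EuclideanSpace ℝ (Fin e)) (𝓡 e) (extChartAt (𝓡 e) x).symm y :=
    ((contMDiffOn_extChartAt_symm (n := ∞) x).contMDiffAt
      ((isOpen_extChartAt_target x).mem_nhds hy1)).mdifferentiableAt (by simp)
  have hF : writtenInExtChartAt (𝓡 e) (𝓡 d) x f y ∈ (extChartAt (𝓡 d) (f x)).target := by
    rw [writtenInExtChartAt, Function.comp_apply, Function.comp_apply]
    exact (extChartAt (𝓡 d) (f x)).map_source (by rw [extChartAt_source]; exact hy3)
  have hd2 : MDifferentiableAt 𝓘(ℝ, EuclideanSpace ℝ (Fin d)) (𝓡 d)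
      (extChartAt (𝓡 d) (f x)).symm (writtenInExtChartAt (𝓡 e) (𝓡 d) x f y) :=
    ((contMDiffOn_extChartAt_symm (n := ∞) (f x)).contMDiffAt
      ((isOpen_extChartAt_target (f x)).mem_nhds hF)).mdifferentiableAt (by simp)
  have hd3 : MDifferentiableAt 𝓘(ℝ, EuclideanSpace ℝ (Fin e)) 𝓘(ℝ, EuclideanSpace ℝ (Fin d))
      (writtenInExtChartAt (𝓡 e) (𝓡 d) x f) y :=
    (hy4.differentiableAt (by simp)).mdifferentiableAt
  have hc1 := mfderiv_comp y (hy2.mdifferentiableAt (by simp)) hd1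
  have hc2 := mfderiv_comp y hd2 hd3
  have hc3 : mfderiv 𝓘(ℝ, EuclideanSpace ℝ (Fin e)) (𝓡 d)
      ((extChartAt (𝓡 d) (f x)).symm ∘ writtenInExtChartAt (𝓡 e) (𝓡 d) x f) y =
      mfderiv 𝓘(ℝ, EuclideanSpace ℝ (Fin e)) (𝓡 d) (f ∘ (extChartAt (𝓡 e) x).symm) y :=
    Filter.EventuallyEq.mfderiv_eq hback
  rw [mfderiv_eq_fderiv] at hc2
  ext v
  have h5 := form_congr ψ hback.self_of_nhds
    (mfderiv 𝓘(ℝ, EuclideanSpace ℝ (Fin e)) (𝓡 d) (f ∘ (extChartAt (𝓡 e) x).symm) y v)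
  have h6 := congrArg (fun T : EuclideanSpace ℝ (Fin e) →L[ℝ] EuclideanSpace ℝ (Fin d) =>
    (ψ (f ((extChartAt (𝓡 e) x).symm y))) (T v)) hc1
  have h7 := congrArg (fun T : EuclideanSpace ℝ (Fin e) →L[ℝ] EuclideanSpace ℝ (Fin d) =>
    (ψ ((extChartAt (𝓡 d) (f x)).symm (writtenInExtChartAt (𝓡 e) (𝓡 d) x f y))) (T v))
      (hc3.symm.trans hc2)
  exact h6.symm.trans (h5.symm.trans h7)

theorem fderiv_written {f : N → M} {x : N} (hf : SmoothMapNear (d := d) (e := e) f x) :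
    fderiv ℝ (writtenInExtChartAt (𝓡 e) (𝓡 d) x f) (extChartAt (𝓡 e) x x) =
      mfderiv (𝓡 e) (𝓡 d) f x := by
  rw [(hf.self_of_nhds.mdifferentiableAt (by simp)).mfderiv,
    ModelWithCorners.range_eq_univ, fderivWithin_univ]

theorem SmoothFormNear.pullForm {f : N → M} {x : N} (hf : SmoothMapNear (d := d) (e := e) f x)
    {ψ : Form d M} (hψ : SmoothFormNear ψ (f x)) : SmoothFormNear (pullForm (e := e) f ψ) x := by
  have hc : ContinuousAt (writtenInExtChartAt (𝓡 e) (𝓡 d) x f) (extChartAt (𝓡 e) x x) :=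
    hf.written.self_of_nhds.2.continuousAt
  have h1 : ∀ᶠ y in 𝓝 (extChartAt (𝓡 e) x x),
      ContDiffAt ℝ ∞ (chartForm ψ (f x)) (writtenInExtChartAt (𝓡 e) (𝓡 d) x f y) := by
    refine hc.eventually (p := fun y => ContDiffAt ℝ ∞ (chartForm ψ (f x)) y) ?_
    have : writtenInExtChartAt (𝓡 e) (𝓡 d) x f (extChartAt (𝓡 e) x x) =
        extChartAt (𝓡 d) (f x) (f x) := by simp [writtenInExtChartAt]
    rw [this]
    exact hψ
  filter_upwards [(chartForm_pullForm hf ψ).eventually_nhds, hf.written, h1] with y h2 h3 h4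
  refine ContDiffAt.congr_of_eventuallyEq ?_ h2
  exact (h4.comp y h3.2).clm_comp (h3.2.fderiv_right (by simp))

/-- The exterior derivative commutes with pullbacks. -/
theorem extD_pullForm {f : N → M} {x : N} (hf : SmoothMapNear (d := d) (e := e) f x)
    {ψ : Form d M} (hψ : SmoothFormNear ψ (f x)) (v w : TangentSpace (𝓡 e) x) :
    extD (pullForm (e := e) f ψ) x v w =
      extD ψ (f x) (mfderiv (𝓡 e) (𝓡 d) f x v) (mfderiv (𝓡 e) (𝓡 d) f x w) := by
  have h0 : writtenInExtChartAt (𝓡 e) (𝓡 d) x f (extChartAt (𝓡 e) x x) =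
      extChartAt (𝓡 d) (f x) (f x) := by simp [writtenInExtChartAt]
  have h1 := (chartForm_pullForm hf ψ)
  have h2 := fderiv_pullback_antisymm (β := chartForm ψ (f x))
    (f := writtenInExtChartAt (𝓡 e) (𝓡 d) x f) (y := extChartAt (𝓡 e) x x)
    (by rw [h0]; exact hψ.self_of_nhds.differentiableAt (by simp)) hf.written.self_of_nhds.2 v w
  rw [h0, fderiv_written hf] at h2
  unfold extD
  rw [Filter.EventuallyEq.fderiv_eq h1]
  exact h2

end PullForm

/-! ### Local frames, Cauchy characteristics and derived systems -/

section Frames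

variable {d : ℕ} {M : Type u} [TopologicalSpace M] [ChartedSpace (EuclideanSpace ℝ (Fin d)) M]

theorem extD_antisymm (ψ : Form d M) (x : M) (v w : TangentSpace (𝓡 d) x) :
    extD ψ x v w = - extD ψ x w v := by
  unfold extD
  ring

theorem extD_add_right (ψ : Form d M) (x : M) (a b w : TangentSpace (𝓡 d) x) :
    extD ψ x w (a + b) = extD ψ x w a + extD ψ x w b := by
  rw [extD_antisymm, extD_add_left, extD_antisymm ψ x w a, extD_antisymm ψ x w b]
  ring

theorem extD_smul_right (ψ : Form d M) (x : M) (c : ℝ) (a w : TangentSpace (𝓡 d) x) :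
    extD ψ x w (c • a) = c * extD ψ x w a := by
  rw [extD_antisymm, extD_smul_left, extD_antisymm ψ x w a]
  ring

theorem mem_ker_span_iff {E ι : Type*} [AddCommGroup E] [Module ℝ E] [TopologicalSpace E]
    (θ : ι → E →L[ℝ] ℝ) (v : E) :
    (∀ α ∈ Submodule.span ℝ (range θ), α v = 0) ↔ ∀ i, θ i v = 0 := by
  refine ⟨fun h i => h _ (Submodule.subset_span ⟨i, rfl⟩), fun h α hα => ?_⟩
  induction hα using Submodule.span_induction with
  | mem α hα =>
    obtain ⟨i, rfl⟩ := hα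
    exact h i
  | zero => rfl
  | add a b _ _ ha hb => rw [add_apply, ha, hb, add_zero]
  | smul c a _ ha => rw [smul_apply, ha, smul_zero]

variable [IsManifold (𝓡 d) ∞ M]

theorem extD_eq_zero_of_eventually_zero {ψ : Form d M} {x : M} (h : ∀ᶠ z in 𝓝 x, ψ z = 0)
    (v w : TangentSpace (𝓡 d) x) : extD ψ x v w = 0 := by
  have h1 : chartForm ψ x =ᶠ[𝓝 (extChartAt (𝓡 d) x x)] fun _ => 0 := by
    filter_upwards [eventually_extChartAt_symm h] with y hy
    simp only [chartForm, hy]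
    exact ContinuousLinearMap.zero_comp _
  unfold extD
  rw [h1.fderiv_eq, fderiv_const_apply]
  exact sub_self (0 : ℝ)

theorem chartForm_self (ψ : Form d M) (x : M) (v : Eu d) :
    chartForm ψ x (extChartAt (𝓡 d) x x) v = ψ x v := by
  have : IsManifold (𝓡 d) 1 M := isManifold_one
  have h1 : mfderiv 𝓘(ℝ, Eu d) (𝓡 d) (extChartAt (𝓡 d) x).symm (extChartAt (𝓡 d) x x) =
      ContinuousLinearMap.id ℝ (Eu d) := by
    have := mfderivWithin_range_extChartAt_symm (I := 𝓡 d) (x := x)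
    rwa [ModelWithCorners.range_eq_univ, mfderivWithin_univ] at this
  have h2 := congrArg (fun T : Eu d →L[ℝ] Eu d =>
    ψ ((extChartAt (𝓡 d) x).symm (extChartAt (𝓡 d) x x)) (T v)) h1
  exact h2.trans (form_congr ψ (extChartAt_to_inv x) v)

theorem contDiffAt_clm_pi {E E' ι : Type*} [NormedAddCommGroup E] [NormedSpace ℝ E]
    [NormedAddCommGroup E'] [NormedSpace ℝ E'] [Fintype ι] {θ : ι → E → E' →L[ℝ] ℝ} {x : E}
    (h : ∀ i, ContDiffAt ℝ ∞ (θ i) x) :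
    ContDiffAt ℝ ∞ (fun y => ContinuousLinearMap.pi fun i => θ i y) x := by
  classical
  have h1 : (fun y => ContinuousLinearMap.pi fun i => θ i y) = fun y => ∑ i,
      (ContinuousLinearMap.single ℝ (fun _ : ι => ℝ) i).comp (θ i y) := by
    funext y
    ext v i
    simp [Pi.single_apply]
  rw [h1]
  exact ContDiffAt.sum fun i _ => contDiffAt_const.clm_comp (h i)

/-- The coefficients of a smooth section with respect to a smooth frame are smooth. -/
theorem exists_smooth_coeff {E : Type u} [NormedAddCommGroup E] [NormedSpace ℝ E]
    [FiniteDimensional ℝ E] {G : Type*} [NormedAddCommGroup G] [NormedSpace ℝ G]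
    [FiniteDimensional ℝ G] {Θ : E → E →L[ℝ] G} {x₀ : E}
    (hΘ : ∀ᶠ x in 𝓝 x₀, ContDiffAt ℝ ∞ Θ x) (hsurj : Function.Surjective (Θ x₀))
    {ψ : E → E →L[ℝ] ℝ} (hψ : ∀ᶠ x in 𝓝 x₀, ContDiffAt ℝ ∞ ψ x)
    (hker : ∀ᶠ x in 𝓝 x₀, ∀ v, Θ x v = 0 → ψ x v = 0) :
    ∃ c : E → G →L[ℝ] ℝ, (∀ᶠ x in 𝓝 x₀, ContDiffAt ℝ ∞ c x) ∧
      ∀ᶠ x in 𝓝 x₀, ψ x = (c x).comp (Θ x) := by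
  obtain ⟨ρ, hρ, hρΘ⟩ := exists_smooth_rightInverse hΘ hsurj
  refine ⟨fun x => (ψ x).comp (ρ x), ?_, ?_⟩
  · filter_upwards [hρ, hψ] with x h1 h2 using h2.clm_comp h1
  · filter_upwards [hρΘ, hker] with x h1 h2
    ext v
    have h3 := h2 (v - ρ x (Θ x v)) (by rw [map_sub, h1.1, sub_self])
    rw [map_sub, sub_eq_zero] at h3
    exact h3

/-- The terms in which the coefficient `c` is differentiated contain a factor `Θ x v` or `Θ x w`, so
modulo the system the exterior derivative is linear over functions. -/
theorem antisymm_fderiv_coeff {E : Type u} [NormedAddCommGroup E] [NormedSpace ℝ E]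
    {G : Type*} [NormedAddCommGroup G] [NormedSpace ℝ G] {Θ : E → E →L[ℝ] G} {x : E}
    (hΘ : ContDiffAt ℝ ∞ Θ x) {ψ : E → E →L[ℝ] ℝ} {c : E → G →L[ℝ] ℝ} (hc : ContDiffAt ℝ ∞ c x)
    (h : ψ =ᶠ[𝓝 x] fun x => (c x).comp (Θ x)) {v w : E} (hv : Θ x v = 0) (hw : Θ x w = 0) :
    fderiv ℝ ψ x v w - fderiv ℝ ψ x w v = c x (fderiv ℝ Θ x v w - fderiv ℝ Θ x w v) := by
  have h1 := ((hc.differentiableAt (by simp)).hasFDerivAt.clm_comp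
    (hΘ.differentiableAt (by simp)).hasFDerivAt).fderiv
  rw [h.fderiv_eq, h1]
  simp [hv, hw]

/-- Independent functionals define a surjective map. -/
theorem surjective_pi_of_linearIndependent {E ι : Type*} [NormedAddCommGroup E] [NormedSpace ℝ E]
    [FiniteDimensional ℝ E] [Finite ι] {θ : ι → E →L[ℝ] ℝ} (h : LinearIndependent ℝ θ) :
    Function.Surjective (ContinuousLinearMap.pi θ) := by
  have := Fintype.ofFinite ι
  classical
  rw [← ContinuousLinearMap.coe_coe, ← LinearMap.range_eq_top]
  by_contra hne
  obtain ⟨f, hf0, hf⟩ := Submodule.exists_le_ker_of_lt_top _ (lt_top_iff_ne_top.2 hne)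
  have h1 : ∀ v, ∑ i, θ i v * f (Pi.single i 1) = 0 := by
    intro v
    have h2 : f (ContinuousLinearMap.pi θ v) = 0 := hf ⟨v, rfl⟩
    rw [LinearMap.pi_apply_eq_sum_univ] at h2
    rw [← h2]
    refine Finset.sum_congr rfl fun i _ => ?_
    rw [smul_eq_mul]
    congr 2
    funext j
    simp [Pi.single_apply, eq_comm]
  have h3 := Fintype.linearIndependent_iff.1 h (fun i => f (Pi.single i 1)) (by
    ext v
    simpa [mul_comm] using h1 v)
  apply hf0
  apply LinearMap.pi_ext'
  intro i
  ext
  simpa using h3 i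

/-- `θ` is a smooth local frame of `F` near `x`. -/
structure IsFrameAt {ι : Type*} (F : Family d M) (θ : ι → Form d M) (x : M) : Prop where
  smooth : ∀ i, SmoothFormNear (θ i) x
  indep : ∀ᶠ z in 𝓝 x, LinearIndependent ℝ fun i => θ i z
  span : ∀ᶠ z in 𝓝 x, Submodule.span ℝ (range fun i => θ i z) = F z

theorem IsSubbundle.exists_frame {r : ℕ} {F : Family d M} (h : IsSubbundle r F) (x : M) :
    ∃ θ : Fin r → Form d M, IsFrameAt F θ x := by
  obtain ⟨U, hU, hx, θ, hθ, hF⟩ := h x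
  exact ⟨θ, fun i => (hθ i).near hU hx, by
    filter_upwards [hU.mem_nhds hx] with z hz using (hF z hz).1, by
    filter_upwards [hU.mem_nhds hx] with z hz using (hF z hz).2⟩

theorem exists_open_smoothFormOn {ι : Type*} [Finite ι] {θ : ι → Form d M} {x : M}
    (h : ∀ i, SmoothFormNear (θ i) x) {s : Set M} (hs : s ∈ 𝓝 x) :
    ∃ U, IsOpen U ∧ x ∈ U ∧ U ⊆ s ∧ ∀ i, SmoothFormOn (θ i) U := by
  have h1 : ∀ᶠ z in 𝓝 x, ∀ i, SmoothFormNear (θ i) z :=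
    Filter.eventually_all.2 fun i => (h i).eventually_near
  obtain ⟨U, hU, hUo, hxU⟩ := mem_nhds_iff.1 (Filter.inter_mem h1 hs)
  exact ⟨U, hUo, hxU, fun z hz => (hU hz).2, fun i => smoothFormOn_of_near fun z hz => (hU hz).1 i⟩

theorem isSubbundle_of_frames {r : ℕ} {F : Family d M}
    (h : ∀ x, ∃ θ : Fin r → Form d M, IsFrameAt F θ x) : IsSubbundle r F := by
  intro x
  obtain ⟨θ, h1⟩ := h x
  obtain ⟨U, hU, hx, hUs, hθ⟩ := exists_open_smoothFormOn h1.smooth (Filter.inter_mem h1.indep h1.span)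
  exact ⟨U, hU, hx, θ, hθ, fun y hy => hUs hy⟩

variable {ι : Type*} [Finite ι] {F : Family d M} {θ : ι → Form d M} {x : M}

theorem IsFrameAt.mem (h : IsFrameAt F θ x) (i : ι) : θ i x ∈ F x := by
  rw [← h.span.self_of_nhds]
  exact Submodule.subset_span ⟨i, rfl⟩

theorem IsFrameAt.ker_iff (h : IsFrameAt F θ x) (v : TangentSpace (𝓡 d) x) :
    (∀ α ∈ F x, α v = 0) ↔ ∀ i, θ i x v = 0 := by
  rw [← h.span.self_of_nhds]
  exact mem_ker_span_iff (E := Eu d) (fun i => θ i x) v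

theorem IsFrameAt.isSectionOn (h : IsFrameAt F θ x) (i : ι) :
    ∃ U, x ∈ U ∧ IsSectionOn F (θ i) U := by
  obtain ⟨U, hU, hx, hUs, hθ⟩ := exists_open_smoothFormOn h.smooth h.span
  refine ⟨U, hx, hU, hθ i, fun y hy => ?_⟩
  have : Submodule.span ℝ (range fun i => θ i y) = F y := hUs hy
  rw [← this]
  exact Submodule.subset_span ⟨i, rfl⟩

/-- Modulo `F`, the exterior derivative of a section of `F` is a combination of the exterior
derivatives of a frame. -/
theorem IsFrameAt.extD_section [Fintype ι] (h : IsFrameAt F θ x) {ψ : Form d M}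
    (hψ : SmoothFormNear ψ x) (hF : ∀ᶠ z in 𝓝 x, ψ z ∈ F z) :
    ∃ c : ι → ℝ, (∀ v, ψ x v = ∑ i, c i * θ i x v) ∧
      ∀ v w, (∀ i, θ i x v = 0) → (∀ i, θ i x w = 0) →
        extD ψ x v w = ∑ i, c i * extD (θ i) x v w := by
  classical
  set y₀ := extChartAt (𝓡 d) x x with hy₀
  set Θ : Eu d → Eu d →L[ℝ] (ι → ℝ) :=
    fun y => ContinuousLinearMap.pi fun i => chartForm (θ i) x y with hΘ
  have hΘs : ∀ᶠ y in 𝓝 y₀, ContDiffAt ℝ ∞ Θ y := by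
    have h1 : ∀ᶠ y in 𝓝 y₀, ∀ i, ContDiffAt ℝ ∞ (chartForm (θ i) x) y :=
      Filter.eventually_all.2 fun i => h.smooth i
    filter_upwards [h1] with y hy using contDiffAt_clm_pi hy
  have hsurj : Function.Surjective (Θ y₀) := by
    refine surjective_pi_of_linearIndependent ?_
    have h1 : (fun i => chartForm (θ i) x y₀) = fun i => θ i x := by
      funext i
      ext v
      exact chartForm_self (θ i) x v
    rw [h1]
    exact h.indep.self_of_nhds
  have hker : ∀ᶠ y in 𝓝 y₀, ∀ v, Θ y v = 0 → chartForm ψ x y v = 0 := by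
    filter_upwards [eventually_extChartAt_symm (h.span.and hF)] with y hy v hv
    have h1 := (mem_ker_span_iff (E := Eu d) (fun i => θ i ((extChartAt (𝓡 d) x).symm y))
      (mfderiv 𝓘(ℝ, EuclideanSpace ℝ (Fin d)) (𝓡 d) (extChartAt (𝓡 d) x).symm y v)).2
      (fun i => congrFun hv i)
    exact h1 _ (by
      have h2 := hy.2
      rw [← hy.1] at h2
      exact h2)
  obtain ⟨c, hc, hc'⟩ := exists_smooth_coeff hΘs hsurj hψ hker
  have hexp : ∀ g : ι → ℝ, c y₀ g = ∑ i, c y₀ (Pi.single i 1) * g i := by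
    intro g
    conv_lhs => rw [← Finset.univ_sum_single g]
    rw [map_sum]
    refine Finset.sum_congr rfl fun i _ => ?_
    have : Pi.single i (g i) = g i • (Pi.single i (1 : ℝ) : ι → ℝ) := by
      rw [← Pi.single_smul, smul_eq_mul, mul_one]
    rw [this, map_smul, smul_eq_mul, mul_comm]
  have hdΘ : ∀ v w i, (fderiv ℝ Θ y₀ v w) i = fderiv ℝ (chartForm (θ i) x) y₀ v w := by
    intro v w i
    have h1 := (ContinuousLinearMap.proj (R := ℝ) (φ := fun _ : ι => ℝ) i).hasFDerivAt.comp y₀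
      ((hΘs.self_of_nhds.differentiableAt (by simp)).hasFDerivAt.clm_apply
        (hasFDerivAt_const w y₀))
    have h2 := (((h.smooth i).self_of_nhds.differentiableAt (by simp)).hasFDerivAt.clm_apply
      (hasFDerivAt_const w y₀))
    have h3 := congrArg (fun T => T v) (h1.unique h2)
    have h4 : (Θ y₀ 0 + fderiv ℝ Θ y₀ v w) i =
      chartForm (θ i) x y₀ 0 + fderiv ℝ (chartForm (θ i) x) y₀ v w := h3
    rwa [map_zero, map_zero, zero_add, zero_add] at h4
  refine ⟨fun i => c y₀ (Pi.single i 1), fun v => ?_, fun v w hv hw => ?_⟩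
  · have h1 := congrArg (fun T => T v) hc'.self_of_nhds
    have h2 : chartForm ψ x y₀ v = ψ x v := chartForm_self ψ x v
    rw [← h2]
    refine h1.trans ((hexp _).trans ?_)
    refine Finset.sum_congr rfl fun i _ => ?_
    congr 1
    exact chartForm_self (θ i) x v
  · have hv' : Θ y₀ v = 0 := by
      funext i
      exact (chartForm_self (θ i) x v).trans (hv i)
    have hw' : Θ y₀ w = 0 := by
      funext i
      exact (chartForm_self (θ i) x w).trans (hw i)
    refine (antisymm_fderiv_coeff hΘs.self_of_nhds hc.self_of_nhds hc' hv' hw').trans ?_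
    rw [hexp]
    refine Finset.sum_congr rfl fun i _ => ?_
    congr 1
    exact congrArg₂ (· - ·) (hdΘ v w i) (hdΘ w v i)

theorem IsFrameAt.congrMod_iff (h : IsFrameAt F θ x)
    (α β : TangentSpace (𝓡 d) x → TangentSpace (𝓡 d) x → ℝ) :
    CongrMod (F x) α β ↔
      ∀ v w, (∀ i, θ i x v = 0) → (∀ i, θ i x w = 0) → α v w = β v w := by
  unfold CongrMod
  simp only [h.ker_iff]

/-- Modulo `F`, the exterior derivative of any section is a combination of those of the frame
(`IsFrameAt.extD_section`), so it is enough to test the contraction on finitely many forms. -/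
theorem IsFrameAt.mem_cauchy_iff (h : IsFrameAt F θ x) (v : TangentSpace (𝓡 d) x) :
    v ∈ cauchy F x ↔ (∀ i, θ i x v = 0) ∧
      ∀ i w, (∀ j, θ j x w = 0) → extD (θ i) x v w = 0 := by
  have := Fintype.ofFinite ι
  constructor
  · rintro ⟨h1, h2⟩
    refine ⟨(h.ker_iff v).1 h1, fun i w hw => ?_⟩
    obtain ⟨U, hxU, hU⟩ := h.isSectionOn i
    exact h2 U (θ i) hU hxU w ((h.ker_iff w).2 hw)
  · rintro ⟨h1, h2⟩
    refine ⟨(h.ker_iff v).2 h1, fun U ψ hU hxU w hw => ?_⟩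
    obtain ⟨c, -, hc⟩ := h.extD_section (hU.2.1.near hU.1 hxU) (by
      filter_upwards [hU.1.mem_nhds hxU] with z hz using hU.2.2 z hz)
    have hw' := (h.ker_iff w).1 hw
    rw [hc v w h1 hw']
    exact Finset.sum_eq_zero fun i _ => by rw [h2 i w hw', mul_zero]

theorem isFrobenius_iff_of_frames {F : Family d M} {ι : M → Type*} [∀ x, Finite (ι x)]
    {θ : (x : M) → ι x → Form d M} (h : ∀ x, IsFrameAt F (θ x) x) :
    IsFrobenius F ↔ ∀ x i, ∀ v w, (∀ j, θ x j x v = 0) → (∀ j, θ x j x w = 0) →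
      extD (θ x i) x v w = 0 := by
  constructor
  · intro hF x i v w hv hw
    obtain ⟨U, hxU, hU⟩ := (h x).isSectionOn i
    exact hF U _ hU x hxU v w (((h x).ker_iff v).2 hv) (((h x).ker_iff w).2 hw)
  · intro hF U ψ hU x hxU v w hv hw
    have := Fintype.ofFinite (ι x)
    obtain ⟨c, -, hc⟩ := (h x).extD_section (hU.2.1.near hU.1 hxU) (by
      filter_upwards [hU.1.mem_nhds hxU] with z hz using hU.2.2 z hz)
    have hv' := ((h x).ker_iff v).1 hv
    have hw' := ((h x).ker_iff w).1 hw
    rw [hc v w hv' hw']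
    exact Finset.sum_eq_zero fun i _ => by rw [hF x i v w hv' hw', mul_zero]

end Frames

section FrameAlgebra

variable {d : ℕ} {M : Type u} [TopologicalSpace M] [ChartedSpace (EuclideanSpace ℝ (Fin d)) M]
  [IsManifold (𝓡 d) ∞ M]

theorem chartForm_sum_smul {ι : Type*} [Fintype ι] (θ : ι → Form d M) (c : ι → ℝ) (x : M) :
    chartForm (fun z => ∑ i, c i • θ i z) x = fun y => ∑ i, c i • chartForm (θ i) x y := by
  funext y
  ext v
  simp only [chartForm]
  exact (_root_.sum_apply Finset.univ (fun i => c i • θ i _) _).trans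
    (_root_.sum_apply Finset.univ (fun i => c i • chartForm (θ i) x y) v).symm

theorem SmoothFormNear.sum_smul {ι : Type*} [Fintype ι] {θ : ι → Form d M} {x : M}
    (h : ∀ i, SmoothFormNear (θ i) x) (c : ι → ℝ) :
    SmoothFormNear (fun z => ∑ i, c i • θ i z) x := by
  have h1 := Filter.eventually_all.2 h
  unfold SmoothFormNear
  rw [chartForm_sum_smul]
  filter_upwards [h1] with y hy
  exact ContDiffAt.sum fun i _ => (hy i).const_smul (c i)

theorem extD_sum_smul {ι : Type*} [Fintype ι] {θ : ι → Form d M} {x : M}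
    (h : ∀ i, SmoothFormNear (θ i) x) (c : ι → ℝ) (v w : TangentSpace (𝓡 d) x) :
    extD (fun z => ∑ i, c i • θ i z) x v w = ∑ i, c i * extD (θ i) x v w := by
  have h1 : HasFDerivAt (fun y => ∑ i, c i • chartForm (θ i) x y)
      (∑ i, c i • fderiv ℝ (chartForm (θ i) x) (extChartAt (𝓡 d) x x)) (extChartAt (𝓡 d) x x) :=
    HasFDerivAt.fun_sum fun i _ =>
      (((h i).self_of_nhds.differentiableAt (by simp)).hasFDerivAt.const_smul (c i))
  unfold extD
  rw [chartForm_sum_smul, h1.fderiv]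
  have h2 : ∀ a b : Eu d,
      (∑ i, c i • fderiv ℝ (chartForm (θ i) x) (extChartAt (𝓡 d) x x)) a b =
      ∑ i, c i * fderiv ℝ (chartForm (θ i) x) (extChartAt (𝓡 d) x x) a b := by
    intro a b
    rw [_root_.sum_apply, _root_.sum_apply]
    rfl
  refine (congrArg₂ (· - ·) (h2 v w) (h2 w v)).trans ?_
  rw [← Finset.sum_sub_distrib]
  exact Finset.sum_congr rfl fun i _ => (mul_sub _ _ _).symm

/-- The derived system in terms of a frame. -/
theorem IsFrameAt.mem_derived_iff {ι : Type*} [Fintype ι] {F : Family d M} {θ : ι → Form d M}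
    {x : M} (h : IsFrameAt F θ x) (α : Cot d x) :
    α ∈ derived F x ↔ ∃ c : ι → ℝ, α = ∑ i, c i • θ i x ∧
      ∀ v w, (∀ i, θ i x v = 0) → (∀ i, θ i x w = 0) → ∑ i, c i * extD (θ i) x v w = 0 := by
  constructor
  · intro hα
    induction hα using Submodule.span_induction with
    | mem α hα =>
      obtain ⟨U, ψ, hU, hxU, rfl, hψ⟩ := hα
      obtain ⟨c, hc, hc'⟩ := h.extD_section (hU.2.1.near hU.1 hxU) (by
        filter_upwards [hU.1.mem_nhds hxU] with z hz using hU.2.2 z hz)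
      refine ⟨c, ?_, fun v w hv hw => ?_⟩
      · refine ContinuousLinearMap.ext fun v => (hc v).trans ?_
        exact (_root_.sum_apply Finset.univ (fun i => c i • θ i x) v).symm
      · rw [← hc' v w hv hw]
        exact hψ v w ((h.ker_iff v).2 hv) ((h.ker_iff w).2 hw)
    | zero => exact ⟨0, by simp, by simp⟩
    | add a b _ _ ha hb =>
      obtain ⟨c, rfl, hc⟩ := ha
      obtain ⟨c', rfl, hc'⟩ := hb
      refine ⟨c + c', ?_, fun v w hv hw => ?_⟩
      · rw [← Finset.sum_add_distrib]
        exact Finset.sum_congr rfl fun i _ => (add_smul _ _ _).symm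
      · have := hc v w hv hw
        have := hc' v w hv hw
        simp only [Pi.add_apply, add_mul, Finset.sum_add_distrib]
        linarith
    | smul r a _ ha =>
      obtain ⟨c, rfl, hc⟩ := ha
      refine ⟨r • c, ?_, fun v w hv hw => ?_⟩
      · rw [Finset.smul_sum]
        exact Finset.sum_congr rfl fun i _ => (smul_smul _ _ _)
      · have := hc v w hv hw
        simp only [Pi.smul_apply, smul_eq_mul, mul_assoc, ← Finset.mul_sum, this, mul_zero]
  -- The section with constant coefficients `c` is enough, because membership in the derived system
  -- is tested at the point `x` only.
  · rintro ⟨c, rfl, hc⟩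
    obtain ⟨U, hU, hxU, hUs, hθ⟩ := exists_open_smoothFormOn
      (θ := fun _ : Unit => fun z => ∑ i, c i • θ i z) (x := x)
      (fun _ => SmoothFormNear.sum_smul h.smooth c) h.span
    refine Submodule.subset_span ⟨U, _, ⟨hU, hθ (), fun y hy => ?_⟩, hxU, rfl, ?_⟩
    · have : Submodule.span ℝ (range fun i => θ i y) = F y := hUs hy
      rw [← this]
      exact Submodule.sum_mem _ fun i _ => Submodule.smul_mem _ _ (Submodule.subset_span ⟨i, rfl⟩)
    · rw [h.congrMod_iff]
      intro v w hv hw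
      rw [extD_sum_smul h.smooth]
      exact hc v w hv hw

theorem IsFrameAt.adjoin {ι : Type*} {F : Family d M} {θ : ι → Form d M} {x : M}
    (h : IsFrameAt F θ x) {τ : Form d M} (hτ : SmoothFormNear τ x)
    (hτF : ∀ᶠ z in 𝓝 x, τ z ∉ F z) :
    IsFrameAt (adjoin F τ) (Sum.elim θ fun _ : Unit => τ) x where
  smooth := by
    rintro (i | i)
    · exact h.smooth i
    · exact hτ
  indep := by
    filter_upwards [h.indep, h.span, hτF] with z h1 h2 h3
    have h4 : LinearIndependent ℝ (Sum.elim (fun i => θ i z) fun _ : Unit => τ z) := by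
      refine LinearIndependent.sum_type h1 ?_ ?_
      · refine LinearIndependent.of_subsingleton () ?_
        rintro h0
        exact h3 (by rw [h0]; exact zero_mem _)
      · rw [h2, range_const, Submodule.disjoint_span_singleton' ?_]
        · exact h3
        · rintro h0
          exact h3 (by rw [h0]; exact zero_mem _)
    convert h4 using 1
    funext i
    rcases i with i | i <;> rfl
  span := by
    filter_upwards [h.span] with z h2
    have h3 : (range fun i => Sum.elim θ (fun _ : Unit => τ) i z) =
        (range fun i => θ i z) ∪ {τ z} := by
      ext α
      constructor
      · rintro ⟨i | i, rfl⟩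
        · exact Or.inl ⟨i, rfl⟩
        · exact Or.inr rfl
      · rintro (⟨i, rfl⟩ | rfl)
        · exact ⟨Sum.inl i, rfl⟩
        · exact ⟨Sum.inr (), rfl⟩
    rw [h3, Submodule.span_union, h2]
    rfl

end FrameAlgebra

/-! ### Pullbacks of Pfaffian systems along submersions -/

section PullFrames

variable {d e : ℕ} {N : Type v} {M : Type u}
  [TopologicalSpace N] [ChartedSpace (EuclideanSpace ℝ (Fin e)) N]
  [TopologicalSpace M] [ChartedSpace (EuclideanSpace ℝ (Fin d)) M]

theorem mem_pullback_iff {f : N → M} {F : Family d M} {x : N} {α : Cot e x} :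
    α ∈ (pullback f F : Family e N) x ↔ ∃ β ∈ F (f x), α = pullCov f x β := Iff.rfl

/-- The pullback of covectors as a linear map. -/
def pullCovₗ (f : N → M) (x : N) : Cot d (f x) →ₗ[ℝ] Cot e x where
  toFun := pullCov f x
  map_add' _ _ := ContinuousLinearMap.add_comp _ _ _
  map_smul' _ _ := ContinuousLinearMap.smul_comp _ _ _

theorem pullback_eq_map (f : N → M) (F : Family d M) (x : N) :
    (pullback f F : Family e N) x = (F (f x)).map (pullCovₗ f x) := by
  ext α
  constructor
  · rintro ⟨β, hβ, rfl⟩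
    exact ⟨β, hβ, rfl⟩
  · rintro ⟨β, hβ, rfl⟩
    exact ⟨β, hβ, rfl⟩

theorem pullCovₗ_injective {f : N → M} {x : N}
    (hf : Function.Surjective (mfderiv (𝓡 e) (𝓡 d) f x)) :
    Function.Injective (pullCovₗ (d := d) (e := e) f x) := by
  intro a b hab
  ext v
  obtain ⟨w, rfl⟩ := hf v
  exact congrArg (fun T : Eu e →L[ℝ] ℝ => T w) hab

theorem pullback_adjoin (f : N → M) (F : Family d M) (τ : Form d M) :
    (pullback f (adjoin F τ) : Family e N) = adjoin (pullback f F) (pullForm f τ) := by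
  funext x
  rw [pullback_eq_map]
  unfold adjoin
  rw [Submodule.map_sup, Submodule.map_span, image_singleton, ← pullback_eq_map]
  rfl

theorem mem_of_pullCov_mem {f : N → M} {x : N}
    (hf : Function.Surjective (mfderiv (𝓡 e) (𝓡 d) f x)) {F : Family d M} {α : Cot d (f x)}
    (h : pullCov f x α ∈ (pullback f F : Family e N) x) : α ∈ F (f x) := by
  obtain ⟨β, hβ, h1⟩ := h
  have := pullCovₗ_injective hf h1
  rwa [this]

variable [IsManifold (𝓡 e) ∞ N] [IsManifold (𝓡 d) ∞ M]

/-- `f` is a smooth submersion near `x`. -/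
structure SubmersionNear (f : N → M) (x : N) : Prop where
  smooth : SmoothMapNear (d := d) (e := e) f x
  surj : ∀ᶠ z in 𝓝 x, Function.Surjective (mfderiv (𝓡 e) (𝓡 d) f z)

theorem subm_of_open {f : N → M} {U : Set N} (hU : IsOpen U) (hf : ContMDiffOn (𝓡 e) (𝓡 d) ∞ f U)
    (hs : ∀ x ∈ U, Function.Surjective (mfderiv (𝓡 e) (𝓡 d) f x)) {x : N} (hx : x ∈ U) :
    SubmersionNear (d := d) (e := e) f x where
  smooth := by
    filter_upwards [hU.mem_nhds hx] with z hz using hf.contMDiffAt (hU.mem_nhds hz)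
  surj := by
    filter_upwards [hU.mem_nhds hx] with z hz using hs z hz

theorem IsFrameAt.pullback {ι : Type*} [Finite ι] {f : N → M} {x : N}
    (hf : SubmersionNear (d := d) (e := e) f x)
    {F : Family d M} {θ : ι → Form d M} (h : IsFrameAt F θ (f x)) :
    IsFrameAt (pullback f F : Family e N) (fun i => pullForm f (θ i)) x where
  smooth i := (h.smooth i).pullForm hf.smooth
  indep := by
    have hc : ContinuousAt f x := hf.smooth.self_of_nhds.continuousAt
    filter_upwards [hf.surj, hc.eventually h.indep] with z h1 h2
    exact h2.map' (pullCovₗ f z) (LinearMap.ker_eq_bot.2 (pullCovₗ_injective h1))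
  span := by
    have hc : ContinuousAt f x := hf.smooth.self_of_nhds.continuousAt
    filter_upwards [hc.eventually h.span] with z h2
    rw [pullback_eq_map, ← h2, Submodule.map_span, ← range_comp]
    rfl

theorem isSubbundle_pullback {r : ℕ} {f : N → M}
    (hf : ∀ x, SubmersionNear (d := d) (e := e) f x)
    {F : Family d M} (h : IsSubbundle r F) : IsSubbundle r (pullback f F : Family e N) :=
  isSubbundle_of_frames fun x => by
    obtain ⟨θ, hθ⟩ := h.exists_frame (f x)
    exact ⟨_, hθ.pullback (hf x)⟩

/-- Exterior derivatives commute with pullbacks, and every test vector downstairs lifts because the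
differential is surjective. In particular, if `F` has no Cauchy characteristics, those of the
pullback are exactly the vertical vectors. -/
theorem mem_cauchy_pullback {ι : Type*} [Finite ι] {f : N → M} {x : N}
    (hf : SubmersionNear (d := d) (e := e) f x)
    {F : Family d M} {θ : ι → Form d M} (h : IsFrameAt F θ (f x)) (v : TangentSpace (𝓡 e) x) :
    v ∈ cauchy (pullback f F : Family e N) x ↔ mfderiv (𝓡 e) (𝓡 d) f x v ∈ cauchy F (f x) := by
  rw [(h.pullback hf).mem_cauchy_iff, h.mem_cauchy_iff]
  refine and_congr Iff.rfl (forall_congr' fun i => ⟨fun h1 w hw => ?_, fun h1 w hw => ?_⟩)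
  · obtain ⟨w, rfl⟩ := hf.surj.self_of_nhds w
    rw [← extD_pullForm hf.smooth (h.smooth i)]
    exact h1 w hw
  · rw [extD_pullForm hf.smooth (h.smooth i)]
    exact h1 _ hw

theorem derived_pullback {ι : Type*} [Finite ι] {f : N → M} {x : N}
    (hf : SubmersionNear (d := d) (e := e) f x)
    {F : Family d M} {θ : ι → Form d M} (h : IsFrameAt F θ (f x)) :
    derived (pullback f F : Family e N) x = (pullback f (derived F) : Family e N) x := by
  have := Fintype.ofFinite ι
  have hsum : ∀ c : ι → ℝ, pullCovₗ f x (∑ i, c i • θ i (f x)) =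
      ∑ i, c i • pullForm (e := e) f (θ i) x := by
    intro c
    rw [map_sum]
    exact Finset.sum_congr rfl fun i _ => map_smul _ _ _
  ext α
  rw [(h.pullback hf).mem_derived_iff, mem_pullback_iff]
  constructor
  · rintro ⟨c, rfl, hc⟩
    refine ⟨∑ i, c i • θ i (f x), (h.mem_derived_iff _).2 ⟨c, rfl, fun v w hv hw => ?_⟩,
      (hsum c).symm⟩
    obtain ⟨v, rfl⟩ := hf.surj.self_of_nhds v
    obtain ⟨w, rfl⟩ := hf.surj.self_of_nhds w
    rw [← hc v w hv hw]
    exact Finset.sum_congr rfl fun i _ => by rw [extD_pullForm hf.smooth (h.smooth i)]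
  · rintro ⟨β, hβ, rfl⟩
    obtain ⟨c, rfl, hc⟩ := (h.mem_derived_iff _).1 hβ
    refine ⟨c, hsum c, fun v w hv hw => ?_⟩
    rw [← hc (mfderiv (𝓡 e) (𝓡 d) f x v) (mfderiv (𝓡 e) (𝓡 d) f x w) hv hw]
    exact Finset.sum_congr rfl fun i _ => by rw [extD_pullForm hf.smooth (h.smooth i)]

theorem isFrobenius_pullback {r : ℕ} {f : N → M}
    (hf : ∀ x, SubmersionNear (d := d) (e := e) f x)
    {F : Family d M} (h : IsSubbundle r F) (hF : IsFrobenius F) :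
    IsFrobenius (pullback f F : Family e N) := by
  choose θ hθ using h.exists_frame
  have h1 := (isFrobenius_iff_of_frames hθ).1 hF
  refine (isFrobenius_iff_of_frames (F := (pullback f F : Family e N))
    fun x => (hθ (f x)).pullback (hf x)).2 fun x i v w hv hw => ?_
  rw [extD_pullForm (hf x).smooth ((hθ (f x)).smooth i)]
  exact h1 (f x) i _ _ hv hw

/-- Constant rank of each derived system is needed to have frames at every stage, since
`derived_pullback` is proved with a frame. -/
theorem derived_iterate_pullback {f : N → M}
    (hf : ∀ x, SubmersionNear (d := d) (e := e) f x) {F : Family d M}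
    (h : ∀ k : ℕ, ∃ r, IsSubbundle r (derived^[k] F)) (k : ℕ) :
    derived^[k] (pullback f F : Family e N) = pullback f (derived^[k] F) := by
  induction k with
  | zero => rfl
  | succ k ih =>
    rw [Function.iterate_succ_apply', Function.iterate_succ_apply', ih]
    funext x
    obtain ⟨r, hr⟩ := h k
    obtain ⟨θ, hθ⟩ := hr.exists_frame (f x)
    exact derived_pullback (hf x) hθ

end PullFrames

/-! ### Exact forms and integral surfaces -/

section Exact

variable {d : ℕ} {M : Type u} [TopologicalSpace M] [ChartedSpace (EuclideanSpace ℝ (Fin d)) M]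
  [IsManifold (𝓡 d) ∞ M]

theorem chartForm_exact {τ : Form d M} {f : M → ℝ} {x : M}
    (hf : ∀ᶠ z in 𝓝 x, ContMDiffAt (𝓡 d) 𝓘(ℝ, ℝ) ∞ f z)
    (h : ∀ᶠ z in 𝓝 x, ∀ v : TangentSpace (𝓡 d) z, τ z v = mfderiv (𝓡 d) 𝓘(ℝ, ℝ) f z v) :
    ∀ᶠ y in 𝓝 (extChartAt (𝓡 d) x x), ContDiffAt ℝ ∞ (f ∘ (extChartAt (𝓡 d) x).symm) y ∧
      chartForm τ x y = fderiv ℝ (f ∘ (extChartAt (𝓡 d) x).symm) y := by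
  have : IsManifold (𝓡 d) 1 M := isManifold_one
  filter_upwards [eventually_extChartAt_symm (hf.and h),
    extChartAt_target_mem_nhds (I := 𝓡 d) x] with y hy hy2
  have h3 : ContMDiffAt 𝓘(ℝ, EuclideanSpace ℝ (Fin d)) (𝓡 d) ∞ (extChartAt (𝓡 d) x).symm y :=
    (contMDiffOn_extChartAt_symm x).contMDiffAt ((isOpen_extChartAt_target x).mem_nhds hy2)
  refine ⟨(hy.1.comp y h3).contDiffAt, ?_⟩
  have hc := mfderiv_comp y (hy.1.mdifferentiableAt (by simp)) (h3.mdifferentiableAt (by simp))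
  rw [mfderiv_eq_fderiv] at hc
  ext v
  have h6 := congrArg (fun T : Eu d →L[ℝ] ℝ => T v) hc
  exact (hy.2 _).trans h6.symm

theorem SmoothFormNear.exact {τ : Form d M} {f : M → ℝ} {x : M}
    (hf : ∀ᶠ z in 𝓝 x, ContMDiffAt (𝓡 d) 𝓘(ℝ, ℝ) ∞ f z)
    (h : ∀ᶠ z in 𝓝 x, ∀ v : TangentSpace (𝓡 d) z, τ z v = mfderiv (𝓡 d) 𝓘(ℝ, ℝ) f z v) :
    SmoothFormNear τ x := by
  filter_upwards [(chartForm_exact hf h).eventually_nhds] with y hy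
  refine ContDiffAt.congr_of_eventuallyEq ?_ (hy.mono fun z hz => hz.2)
  exact hy.self_of_nhds.1.fderiv_right (by simp)

theorem extD_exact {τ : Form d M} {f : M → ℝ} {x : M}
    (hf : ∀ᶠ z in 𝓝 x, ContMDiffAt (𝓡 d) 𝓘(ℝ, ℝ) ∞ f z)
    (h : ∀ᶠ z in 𝓝 x, ∀ v : TangentSpace (𝓡 d) z, τ z v = mfderiv (𝓡 d) 𝓘(ℝ, ℝ) f z v)
    (v w : TangentSpace (𝓡 d) x) : extD τ x v w = 0 := by
  have h1 := chartForm_exact hf h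
  have h2 : IsSymmSndFDerivAt ℝ (f ∘ (extChartAt (𝓡 d) x).symm) (extChartAt (𝓡 d) x x) :=
    h1.self_of_nhds.1.isSymmSndFDerivAt (by
      rw [minSmoothness_of_isRCLikeNormedField]; exact WithTop.coe_le_coe.2 le_top)
  unfold extD
  rw [Filter.EventuallyEq.fderiv_eq (h1.mono fun z hz => hz.2)]
  exact sub_eq_zero.2 (h2.eq v w)

end Exact

section Surfaces

/-- A control-type system without Cauchy characteristics has no integral surfaces. -/
theorem no_integral_surface {d : ℕ} {M : Type u} [TopologicalSpace M]
    [ChartedSpace (EuclideanSpace ℝ (Fin d)) M] [IsManifold (𝓡 d) ∞ M] {r : ℕ} {I : Family d M}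
    {τ : Form d M} (hI : IsSubbundle r I) (hτ : ∀ x, τ x ∉ I x) (hτs : ∀ x, SmoothFormNear τ x)
    (hF : IsFrobenius (adjoin I τ)) (hC : ∀ x, cauchy I x = ⊥) :
    ¬ ∃ (V : Set (EuclideanSpace ℝ (Fin 2))) (s : EuclideanSpace ℝ (Fin 2) → M),
    IsOpen V ∧ ContMDiffOn (𝓡 2) (𝓡 d) ∞ s V ∧
    (∀ y ∈ V, Function.Injective (mfderiv (𝓡 2) (𝓡 d) s y)) ∧
    (∀ y ∈ V, ∀ α ∈ I (s y), (pullCov s y α : Cot 2 y) = 0) ∧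
    ∃ y ∈ V, (pullCov s y (τ (s y)) : Cot 2 y) ≠ 0 := by
  rintro ⟨V, s, hV, hs, hinj, hI0, y, hy, hy0⟩
  obtain ⟨θ, hθ⟩ := hI.exists_frame (s y)
  have hθτ := hθ.adjoin (hτs (s y)) (Filter.Eventually.of_forall hτ)
  have hsy : SmoothMapNear (d := d) (e := 2) s y := by
    filter_upwards [hV.mem_nhds hy] with z hz using hs.contMDiffAt (hV.mem_nhds hz)
  have hcont : ContinuousAt s y := hsy.self_of_nhds.continuousAt
  -- the differentials of the frame vanish on the surface
  have hd : ∀ i, ∀ v w : TangentSpace (𝓡 2) y,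
      extD (θ i) (s y) (mfderiv (𝓡 2) (𝓡 d) s y v) (mfderiv (𝓡 2) (𝓡 d) s y w) = 0 := by
    intro i v w
    rw [← extD_pullForm hsy (hθ.smooth i)]
    refine extD_eq_zero_of_eventually_zero ?_ v w
    filter_upwards [hcont.eventually hθ.span, hV.mem_nhds hy] with z hz hzV
    refine hI0 z hzV _ ?_
    rw [← hz]
    exact Submodule.subset_span ⟨i, rfl⟩
  have hI0' : ∀ i, ∀ v : TangentSpace (𝓡 2) y, θ i (s y) (mfderiv (𝓡 2) (𝓡 d) s y v) = 0 :=
    fun i v => congrArg (fun T : Eu 2 →L[ℝ] ℝ => T v) (hI0 y hy _ (hθ.mem i))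
  obtain ⟨a, ha⟩ : ∃ a : TangentSpace (𝓡 2) y, τ (s y) (mfderiv (𝓡 2) (𝓡 d) s y a) ≠ 0 := by
    by_contra! h
    exact hy0 (ContinuousLinearMap.ext h)
  -- a nonzero tangent vector of the surface in the kernel of `τ`
  obtain ⟨b, hb0, hb⟩ : ∃ b : TangentSpace (𝓡 2) y, b ≠ 0 ∧
      τ (s y) (mfderiv (𝓡 2) (𝓡 d) s y b) = 0 := by
    let T : Eu 2 →ₗ[ℝ] ℝ := (pullCov s y (τ (s y)) : Cot 2 y).toLinearMap
    have h1 := T.finrank_range_add_finrank_ker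
    have h2 : Module.finrank ℝ T.range ≤ 1 := by
      simpa using Submodule.finrank_le T.range
    have h3 : Module.finrank ℝ (Eu 2) = 2 := by simp
    have h4 : 0 < Module.finrank ℝ T.ker := by omega
    have h5 := Module.finrank_pos_iff.1 h4
    obtain ⟨b, hb⟩ := exists_ne (0 : T.ker)
    exact ⟨b.1, fun h => hb (Subtype.ext h), b.2⟩
  -- A test vector `w` splits into a part killed by `τ` and a multiple of the tangent vector at `a`.
  -- On the former `dθ` vanishes since `⟦I, τ⟧` is Frobenius, on the latter since `dθ` vanishes on
  -- the surface. So `b` would give a nonzero Cauchy characteristic.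
  have hmem : mfderiv (𝓡 2) (𝓡 d) s y b ∈ cauchy I (s y) := by
    rw [hθ.mem_cauchy_iff]
    refine ⟨fun i => hI0' i b, fun i w hw => ?_⟩
    set c := τ (s y) w / τ (s y) (mfderiv (𝓡 2) (𝓡 d) s y a) with hc
    have hw' : w = (w + (-c) • mfderiv (𝓡 2) (𝓡 d) s y a) + c • mfderiv (𝓡 2) (𝓡 d) s y a := by
      rw [neg_smul]
      exact (neg_add_cancel_right _ _).symm
    have key : extD (θ i) (s y) (mfderiv (𝓡 2) (𝓡 d) s y b)
        (w + (-c) • mfderiv (𝓡 2) (𝓡 d) s y a) = 0 := by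
      obtain ⟨U, hxU, hU⟩ := hθτ.isSectionOn (Sum.inl i)
      refine hF U _ hU (s y) hxU _ _ ((hθτ.ker_iff _).2 ?_) ((hθτ.ker_iff _).2 ?_)
      · rintro (j | j)
        · exact hI0' j b
        · exact hb
      · rintro (j | j)
        · exact (map_add (θ j (s y)) w _).trans (by rw [map_smul, hw j, hI0' j a]; simp)
        · refine (map_add (τ (s y)) w _).trans ?_
          rw [map_smul, hc, smul_eq_mul]
          field_simp
          ring
    rw [hw', extD_add_right, key, extD_smul_right, hd]
    simp
  rw [hC, Submodule.mem_bot] at hmem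
  exact hb0 (hinj y hy (hmem.trans (map_zero _).symm))

end Surfaces

/-! ### Integral curves, their perturbations and their jets -/

section OdeJets

variable {Z F : Type*} [NormedAddCommGroup Z] [NormedSpace ℝ Z] [NormedAddCommGroup F]
  [NormedSpace ℝ F]

/-- Along integral curves of a smooth vector field, the derivatives of a smooth function are smooth
functions of the position. -/
theorem exists_iteratedDeriv_eq {V : Z → Z} (hV : ContDiff ℝ ∞ V) {h : Z → F}
    (hh : ContDiff ℝ ∞ h) (k : ℕ) : ∃ H : Z → F, ContDiff ℝ ∞ H ∧ ∀ (z : ℝ → Z) (U : Set ℝ),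
      IsOpen U → (∀ s ∈ U, HasDerivAt z (V (z s)) s) →
      ∀ s ∈ U, iteratedDeriv k (fun s => h (z s)) s = H (z s) := by
  induction k with
  | zero => exact ⟨h, hh, fun z U _ _ s _ => by rw [iteratedDeriv_zero]⟩
  | succ k ih =>
    obtain ⟨H, hH, hz⟩ := ih
    refine ⟨fun p => fderiv ℝ H p (V p), (hH.fderiv_right (by simp)).clm_apply hV, ?_⟩
    intro z U hU hzU s hs
    rw [iteratedDeriv_succ]
    have h1 : iteratedDeriv k (fun s => h (z s)) =ᶠ[𝓝 s] fun s => H (z s) := by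
      filter_upwards [hU.mem_nhds hs] with t ht using hz z U hU hzU t ht
    rw [h1.deriv_eq]
    exact (((hH.differentiable (by simp)) (z s)).hasFDerivAt.comp_hasDerivAt s (hzU s hs)).deriv

theorem contDiffOn_of_hasDerivAt {V : Z → Z} (hV : ContDiff ℝ ∞ V) {z : ℝ → Z} {U : Set ℝ}
    (hU : IsOpen U) (hz : ∀ s ∈ U, HasDerivAt z (V (z s)) s) : ContDiffOn ℝ ∞ z U := by
  rw [contDiffOn_infty]
  intro n
  induction n with
  | zero =>
    exact contDiffOn_zero.2 fun s hs => (hz s hs).continuousAt.continuousWithinAt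
  | succ n ih =>
    have := (contDiffOn_succ_iff_deriv_of_isOpen (𝕜 := ℝ) (f := z) (n := (n : ℕ∞ω)) hU).2
    push_cast at this ⊢
    refine this ⟨fun s hs => (hz s hs).differentiableAt.differentiableWithinAt, by simp, ?_⟩
    refine ((hV.of_le (by exact_mod_cast le_top)).comp_contDiffOn ih).congr fun s hs => ?_
    exact (hz s hs).deriv

end OdeJets

section CurvesInCharts

variable {S : PfSystem.{u}}

theorem form_velocity {γ : ℝ → S.M} {t : ℝ} {x₀ : S.M}
    (hγ : MDifferentiableAt 𝓘(ℝ, ℝ) (𝓡 S.dim) γ t)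
    (hx : γ t ∈ (chartAt (EuclideanSpace ℝ (Fin S.dim)) x₀).source) (ψ : Form S.dim S.M) :
    ψ (γ t) (velocity S γ t) = chartForm ψ x₀ (extChartAt (𝓡 S.dim) x₀ (γ t))
      (deriv (fun s => extChartAt (𝓡 S.dim) x₀ (γ s)) t) := by
  have : IsManifold (𝓡 S.dim) 1 S.M := isManifold_one
  have hx' : γ t ∈ (extChartAt (𝓡 S.dim) x₀).source := by rwa [extChartAt_source]
  have hev : (extChartAt (𝓡 S.dim) x₀).symm ∘ (fun s => extChartAt (𝓡 S.dim) x₀ (γ s))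
      =ᶠ[𝓝 t] γ := by
    filter_upwards [hγ.continuousAt.preimage_mem_nhds (extChartAt_source_mem_nhds' hx')] with s hs
    exact (extChartAt (𝓡 S.dim) x₀).left_inv hs
  have h1 : MDifferentiableAt 𝓘(ℝ, EuclideanSpace ℝ (Fin S.dim)) (𝓡 S.dim)
      (extChartAt (𝓡 S.dim) x₀).symm (extChartAt (𝓡 S.dim) x₀ (γ t)) :=
    ((contMDiffOn_extChartAt_symm (n := ∞) x₀).contMDiffAt
      ((isOpen_extChartAt_target x₀).mem_nhds
        ((extChartAt (𝓡 S.dim) x₀).map_source hx'))).mdifferentiableAt (by simp)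
  have h2 : MDifferentiableAt 𝓘(ℝ, ℝ) 𝓘(ℝ, EuclideanSpace ℝ (Fin S.dim))
      (fun s => extChartAt (𝓡 S.dim) x₀ (γ s)) t :=
    (mdifferentiableAt_extChartAt hx).comp t hγ
  have h3 := mfderiv_comp t h1 h2
  rw [mfderiv_eq_fderiv] at h3
  have h4 : mfderiv 𝓘(ℝ, ℝ) (𝓡 S.dim) ((extChartAt (𝓡 S.dim) x₀).symm ∘
      (fun s => extChartAt (𝓡 S.dim) x₀ (γ s))) t = mfderiv 𝓘(ℝ, ℝ) (𝓡 S.dim) γ t :=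
    Filter.EventuallyEq.mfderiv_eq hev
  have h5 := congrArg (fun T : ℝ →L[ℝ] Eu S.dim => ψ (γ t) (T 1)) (h4.symm.trans h3)
  exact h5.trans (form_congr ψ hev.self_of_nhds _).symm

theorem velocity_eq_deriv {γ : ℝ → S.M} {t : ℝ} {x : S.M}
    (hγ : MDifferentiableAt 𝓘(ℝ, ℝ) (𝓡 S.dim) γ t) (hx : γ t = x) :
    (velocity S γ t : Eu S.dim) = deriv (fun s => extChartAt (𝓡 S.dim) x (γ s)) t := by
  subst hx
  unfold velocity
  rw [hγ.mfderiv]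
  simp only [mfld_simps, fderivWithin_univ]
  rfl

theorem isIntegralCurve_symm {x₀ : S.M} {y : ℝ → Eu S.dim} {ε : ℝ}
    (hy : ContDiffOn ℝ ∞ y (Ioo (-ε) ε))
    (ht : ∀ t ∈ Ioo (-ε) ε, y t ∈ (extChartAt (𝓡 S.dim) x₀).target)
    (h0 : ∀ t ∈ Ioo (-ε) ε, ∀ ψ : Form S.dim S.M,
      ψ ((extChartAt (𝓡 S.dim) x₀).symm (y t)) ∈ S.I ((extChartAt (𝓡 S.dim) x₀).symm (y t)) →
      chartForm ψ x₀ (y t) (deriv y t) = 0)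
    (hτ : ∀ t ∈ Ioo (-ε) ε, chartForm S.τ x₀ (y t) (deriv y t) ≠ 0) :
    IsIntegralCurve S (fun t => (extChartAt (𝓡 S.dim) x₀).symm (y t)) ε := by
  have hs : ∀ t ∈ Ioo (-ε) ε, ContMDiffAt 𝓘(ℝ, ℝ) (𝓡 S.dim) ∞
      (fun t => (extChartAt (𝓡 S.dim) x₀).symm (y t)) t := fun t h =>
    ((contMDiffOn_extChartAt_symm (n := ∞) x₀).contMDiffAt
      ((isOpen_extChartAt_target x₀).mem_nhds (ht t h))).comp t
      (hy.contDiffAt (isOpen_Ioo.mem_nhds h)).contMDiffAt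
  have hvel : ∀ t ∈ Ioo (-ε) ε, ∀ ψ : Form S.dim S.M,
      ψ ((extChartAt (𝓡 S.dim) x₀).symm (y t))
        (velocity S (fun t => (extChartAt (𝓡 S.dim) x₀).symm (y t)) t) =
      chartForm ψ x₀ (y t) (deriv y t) := by
    intro t h ψ
    have h1 := form_velocity ((hs t h).mdifferentiableAt (by simp)) (x₀ := x₀) (by
      rw [← extChartAt_source (𝓡 S.dim)]
      exact (extChartAt (𝓡 S.dim) x₀).map_target (ht t h)) ψ
    have h2 : (fun s => extChartAt (𝓡 S.dim) x₀ ((extChartAt (𝓡 S.dim) x₀).symm (y s)))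
        =ᶠ[𝓝 t] y := by
      filter_upwards [isOpen_Ioo.mem_nhds h] with s hs
      exact (extChartAt (𝓡 S.dim) x₀).right_inv (ht s hs)
    have h3 : extChartAt (𝓡 S.dim) x₀ ((extChartAt (𝓡 S.dim) x₀).symm (y t)) = y t :=
      h2.self_of_nhds
    rw [h2.deriv_eq, h3] at h1
    exact h1
  classical
  refine ⟨fun t h => (hs t h).contMDiffWithinAt, fun t h => ⟨fun α hα => ?_, ?_⟩⟩
  -- A single covector is the value of a form, here zero at all other points; no smoothness is
  -- required of the form.
  · have h1 := hvel t h (Function.update 0 _ α)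
    rw [Function.update_self] at h1
    rw [h1]
    exact h0 t h _ (by rwa [Function.update_self])
  · rw [hvel t h]
    exact hτ t h

theorem IsIntegralCurve.mono {γ : ℝ → S.M} {ε ε' : ℝ} (h : IsIntegralCurve S γ ε) (hε : ε' ≤ ε) :
    IsIntegralCurve S γ ε' :=
  have hsub : Ioo (-ε') ε' ⊆ Ioo (-ε) ε := Ioo_subset_Ioo (by linarith) hε
  ⟨h.1.mono hsub, fun t ht => h.2 t (hsub ht)⟩

theorem IsIntegralCurve.contMDiffAt {γ : ℝ → S.M} {ε t : ℝ} (h : IsIntegralCurve S γ ε)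
    (ht : t ∈ Ioo (-ε) ε) : ContMDiffAt 𝓘(ℝ, ℝ) (𝓡 S.dim) ∞ γ t :=
  h.1.contMDiffAt (isOpen_Ioo.mem_nhds ht)

theorem zero_mem_Ioo {ε : ℝ} (hε : 0 < ε) : (0 : ℝ) ∈ Ioo (-ε) ε := ⟨by linarith, hε⟩

theorem exists_Ioo_of_eventually {p : ℝ → Prop} (h : ∀ᶠ s in 𝓝 (0 : ℝ), p s) :
    ∃ ε > 0, ∀ s ∈ Ioo (-ε) ε, p s := by
  obtain ⟨ε, hε, h1⟩ := Metric.eventually_nhds_iff_ball.1 h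
  refine ⟨ε, hε, fun s hs => h1 s ?_⟩
  rw [Real.ball_eq_Ioo]
  simpa using hs

/-- Perturbations of the initial velocity of an integral curve. -/
theorem exists_perturbed_curves (x : S.M) (g : ℝ → Eu S.dim)
    (hg : ∀ᶠ s in 𝓝 (0 : ℝ), ContDiffAt ℝ ∞ g s)
    (hg0 : ∀ α ∈ S.I x, α (g 0) = 0) (hgτ : S.τ x (g 0) ≠ 0) :
    ∃ (Q : Eu S.dim →L[ℝ] Eu S.dim) (γ : Eu S.dim → ℝ → S.M),
      (∀ v : Eu S.dim, (∀ α ∈ S.I x, α v = 0) → Q v = v) ∧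
      (∀ v : Eu S.dim, ∀ α ∈ S.I x, α (Q v) = 0) ∧
      (∀ᶠ c in 𝓝 (0 : Eu S.dim), ∃ ε > 0, IsIntegralCurve S (γ c) ε ∧ γ c 0 = x ∧
        (velocity S (γ c) 0 : Eu S.dim) = Q (g 0 + c)) ∧
      ∀ (γ₀ : ℝ → S.M) (ε₀ : ℝ), 0 < ε₀ → IsIntegralCurve S γ₀ ε₀ → γ₀ 0 = x →
        (∀ᶠ s in 𝓝 (0 : ℝ), deriv (fun s => extChartAt (𝓡 S.dim) x (γ₀ s)) s = g s) →
        ∀ (r : ℕ) (δ : ℝ), 0 < δ → ∀ᶠ c in 𝓝 (0 : Eu S.dim), JetNear S r δ γ₀ (γ c) := by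
  obtain ⟨θ, hθ⟩ := S.subbundle.exists_frame x
  set φ := extChartAt (𝓡 S.dim) x with hφ
  set y₀ := φ x with hy₀
  set Θ : Eu S.dim → Eu S.dim →L[ℝ] (Fin S.rank → ℝ) :=
    fun y => ContinuousLinearMap.pi fun i => chartForm (θ i) x y with hΘ
  have hΘs : ∀ᶠ y in 𝓝 y₀, ContDiffAt ℝ ∞ Θ y := by
    have h1 : ∀ᶠ y in 𝓝 y₀, ∀ i, ContDiffAt ℝ ∞ (chartForm (θ i) x) y :=
      Filter.eventually_all.2 fun i => hθ.smooth i
    filter_upwards [h1] with y hy using contDiffAt_clm_pi hy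
  have hsurj : Function.Surjective (Θ y₀) := by
    refine surjective_pi_of_linearIndependent ?_
    have h1 : (fun i => chartForm (θ i) x y₀) = fun i => θ i x := by
      funext i
      ext v
      exact chartForm_self (θ i) x v
    rw [h1]
    exact hθ.indep.self_of_nhds
  have hker : ∀ᶠ y in 𝓝 y₀, ∀ v, Θ y v = 0 → ∀ ψ : Form S.dim S.M,
      ψ (φ.symm y) ∈ S.I (φ.symm y) → chartForm ψ x y v = 0 := by
    filter_upwards [eventually_extChartAt_symm hθ.span] with y hy v hv ψ hψ
    have h1 := (mem_ker_span_iff (E := Eu S.dim) (fun i => θ i (φ.symm y))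
      (mfderiv 𝓘(ℝ, EuclideanSpace ℝ (Fin S.dim)) (𝓡 S.dim) φ.symm y v)).2
      (fun i => congrFun hv i)
    exact h1 _ (by
      rw [← hy] at hψ
      exact hψ)
  have hΘ0 : ∀ v : Eu S.dim, Θ y₀ v = 0 ↔ ∀ α ∈ S.I x, α v = 0 := by
    intro v
    rw [hθ.ker_iff (v : TangentSpace (𝓡 S.dim) x)]
    constructor
    · intro h i
      exact (chartForm_self (θ i) x v).symm.trans (congrFun h i)
    · intro h
      funext i
      exact (chartForm_self (θ i) x v).trans (h i)
  obtain ⟨ρ, hρ, hρΘ⟩ := exists_smooth_rightInverse hΘs hsurj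
  -- `Q y` projects to the vectors killed by the system at `y`. Hence every curve with velocity `Q y
  -- (g s + c)` annihilates the system, and `c = 0` reproduces the reference curve, whose velocity
  -- in the chart is `g`.
  set Q : Eu S.dim → Eu S.dim →L[ℝ] Eu S.dim :=
    fun y => ContinuousLinearMap.id ℝ _ - (ρ y).comp (Θ y) with hQ
  have hQv : ∀ y v, Q y v = v - ρ y (Θ y v) := fun y v => rfl
  have hQs : ∀ᶠ y in 𝓝 y₀, ContDiffAt ℝ ∞ Q y := by
    filter_upwards [hΘs, hρ] with y h1 h2 using contDiffAt_const.sub (h2.clm_comp h1)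
  have hΘQ : ∀ᶠ y in 𝓝 y₀, ∀ v, Θ y (Q y v) = 0 := by
    filter_upwards [hρΘ] with y hy v
    rw [hQv, map_sub, hy.1, sub_self]
  have hQid : ∀ y v, Θ y v = 0 → Q y v = v := fun y v h => by
    rw [hQv, h, map_zero, sub_zero]
  -- the extended vector field
  set V : ℝ × Eu S.dim × Eu S.dim → ℝ × Eu S.dim × Eu S.dim :=
    fun z => (1, 0, Q z.2.2 (g z.1 + z.2.1)) with hV
  set z₀ : Eu S.dim → ℝ × Eu S.dim × Eu S.dim := fun c => (0, c, y₀) with hz₀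
  have hz₀c : Continuous z₀ := by fun_prop
  have e1 : ∀ {p : ℝ → Prop}, (∀ᶠ s in 𝓝 (0 : ℝ), p s) → ∀ᶠ z in 𝓝 (z₀ 0), p z.1 := fun h =>
    (continuous_fst.tendsto (z₀ 0)).eventually h
  have e3 : ∀ {p : Eu S.dim → Prop}, (∀ᶠ s in 𝓝 y₀, p s) → ∀ᶠ z in 𝓝 (z₀ 0), p z.2.2 := fun h =>
    ((continuous_snd.comp continuous_snd).tendsto (z₀ 0)).eventually h
  have hVs : ∀ᶠ z in 𝓝 (z₀ 0), ContDiffAt ℝ ∞ V z := by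
    filter_upwards [e1 hg, e3 hQs] with z h1 h2
    have h3 : ContDiffAt ℝ ∞ (fun z : ℝ × Eu S.dim × Eu S.dim => Q z.2.2) z :=
      ContDiffAt.comp (g := Q) z h2 (contDiff_snd.comp contDiff_snd).contDiffAt
    have h4 : ContDiffAt ℝ ∞ (fun z : ℝ × Eu S.dim × Eu S.dim => g z.1) z :=
      ContDiffAt.comp (g := g) z h1 contDiff_fst.contDiffAt
    exact contDiffAt_const.prodMk (contDiffAt_const.prodMk
      (h3.clm_apply (h4.add (contDiff_fst.comp contDiff_snd).contDiffAt)))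
  obtain ⟨V', hV', hVV'⟩ := exists_contDiff_eventuallyEq hVs
  have hsol : ∀ Z, ∃ z : ℝ → ℝ × Eu S.dim × Eu S.dim, z 0 = Z ∧ ∃ ε > 0, ∀ t ∈ Ioo (-ε) ε,
      HasDerivAt z (V' (z t)) t := by
    intro Z
    obtain ⟨z, hz, ε, hε, h⟩ :=
      (hV'.contDiffAt (x := Z)).of_le (m := 1) (by exact_mod_cast le_top)
        |>.exists_forall_mem_closedBall_exists_eq_forall_mem_Ioo_hasDerivAt₀ 0
    exact ⟨z, hz, ε, hε, by simpa using h⟩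
  choose z hz0 ez hez hz using hsol
  -- the good region
  have hτ' : ∀ᶠ p in 𝓝 (z₀ 0), chartForm S.τ x p.2.2 (Q p.2.2 (g p.1 + p.2.1)) ≠ 0 := by
    have hτs : SmoothFormNear S.τ x := by
      obtain ⟨f, hf, hf'⟩ := S.exact
      exact SmoothFormNear.exact (Filter.Eventually.of_forall fun z => hf.contMDiffAt)
        (Filter.Eventually.of_forall hf')
    have h1 : ContinuousAt (fun p : ℝ × Eu S.dim × Eu S.dim =>
        chartForm S.τ x p.2.2 (V p).2.2) (z₀ 0) := by
      have h2 : ContinuousAt (fun p : ℝ × Eu S.dim × Eu S.dim => chartForm S.τ x p.2.2) (z₀ 0) :=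
        ContinuousAt.comp (g := chartForm S.τ x) hτs.self_of_nhds.continuousAt (by fun_prop)
      exact h2.clm_apply (hVs.self_of_nhds.continuousAt.snd.snd)
    refine h1.eventually_ne ?_
    have h3 : (V (z₀ 0)).2.2 = g 0 := by
      simp only [hV, hz₀, add_zero]
      exact hQid _ _ ((hΘ0 _).2 hg0)
    rw [h3]
    intro h
    exact hgτ ((chartForm_self S.τ x (g 0)).symm.trans h)
  have hgood : ∀ᶠ p in 𝓝 (z₀ 0), V' p = V p ∧ p.2.2 ∈ φ.target ∧
      (∀ v, Θ p.2.2 v = 0 → ∀ ψ : Form S.dim S.M,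
        ψ (φ.symm p.2.2) ∈ S.I (φ.symm p.2.2) → chartForm ψ x p.2.2 v = 0) ∧
      (∀ v, Θ p.2.2 (Q p.2.2 v) = 0) ∧
      chartForm S.τ x p.2.2 (Q p.2.2 (g p.1 + p.2.1)) ≠ 0 := by
    filter_upwards [hVV', e3 (extChartAt_target_mem_nhds (I := 𝓡 S.dim) x), e3 hker, e3 hΘQ, hτ']
      with p h1 h2 h3 h4 h5 using ⟨h1, h2, h3, h4, h5⟩
  have hd : ∀ c, ∀ t ∈ Ioo (-(ez (z₀ c))) (ez (z₀ c)),
      HasDerivAt (fun s => (z (z₀ c) s).2.2) (V' (z (z₀ c) t)).2.2 t := fun c t ht =>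
    (hz (z₀ c) t ht).snd.snd
  have hsym : φ.symm y₀ = x := extChartAt_to_inv x
  refine ⟨Q y₀, fun c s => φ.symm (z (z₀ c) s).2.2, fun v hv => hQid _ _ ((hΘ0 v).2 hv),
    fun v => (hΘ0 _).1 (hΘQ.self_of_nhds v), ?_, ?_⟩
  · filter_upwards [hz₀c.continuousAt.eventually hgood.eventually_nhds] with c hc
    have hcont : ContinuousAt (z (z₀ c)) 0 :=
      (hz (z₀ c) 0 (zero_mem_Ioo (hez _))).continuousAt
    rw [← hz0 (z₀ c)] at hc
    obtain ⟨ε₁, hε₁, h1⟩ := exists_Ioo_of_eventually (hcont.eventually hc)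
    have hsub1 : Ioo (-(min ε₁ (ez (z₀ c)))) (min ε₁ (ez (z₀ c))) ⊆ Ioo (-ε₁) ε₁ :=
      Ioo_subset_Ioo (by linarith [min_le_left ε₁ (ez (z₀ c))]) (min_le_left _ _)
    have hsub2 : Ioo (-(min ε₁ (ez (z₀ c)))) (min ε₁ (ez (z₀ c))) ⊆
        Ioo (-(ez (z₀ c))) (ez (z₀ c)) :=
      Ioo_subset_Ioo (by linarith [min_le_right ε₁ (ez (z₀ c))]) (min_le_right _ _)
    have hderiv : ∀ t ∈ Ioo (-(min ε₁ (ez (z₀ c)))) (min ε₁ (ez (z₀ c))),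
        deriv (fun s => (z (z₀ c) s).2.2) t =
          Q (z (z₀ c) t).2.2 (g (z (z₀ c) t).1 + (z (z₀ c) t).2.1) := by
      intro t ht
      rw [(hd c t (hsub2 ht)).deriv, (h1 t (hsub1 ht)).1]
    have hε : 0 < min ε₁ (ez (z₀ c)) := lt_min hε₁ (hez _)
    have hint : IsIntegralCurve S (fun s => φ.symm (z (z₀ c) s).2.2) (min ε₁ (ez (z₀ c))) := by
      refine isIntegralCurve_symm ?_ (fun t ht => (h1 t (hsub1 ht)).2.1)
        (fun t ht ψ hψ => ?_) (fun t ht => ?_)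
      · exact ((contDiffOn_of_hasDerivAt hV' isOpen_Ioo (hz (z₀ c))).mono hsub2).snd.snd
      · rw [hderiv t ht]
        have h2 := (h1 t (hsub1 ht))
        exact h2.2.2.1 _ (h2.2.2.2.1 _) ψ hψ
      · rw [hderiv t ht]
        exact (h1 t (hsub1 ht)).2.2.2.2
    have hx0 : φ.symm (z (z₀ c) 0).2.2 = x := by rw [hz0]; exact hsym
    refine ⟨_, hε, hint, hx0, ?_⟩
    rw [velocity_eq_deriv ((hint.contMDiffAt (zero_mem_Ioo hε)).mdifferentiableAt (by simp)) hx0]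
    have h2 : (fun s => φ (φ.symm (z (z₀ c) s).2.2)) =ᶠ[𝓝 0] fun s => (z (z₀ c) s).2.2 := by
      filter_upwards [isOpen_Ioo.mem_nhds (zero_mem_Ioo hε)] with s hs
      exact φ.right_inv (h1 s (hsub1 hs)).2.1
    rw [h2.deriv_eq, hderiv 0 (zero_mem_Ioo hε), hz0]
  · intro γ₀ ε₀ hε₀ hγ₀ h0 hγg r δ hδ
    -- the reference curve
    have hγc : ContinuousAt γ₀ 0 := (hγ₀.contMDiffAt (zero_mem_Ioo hε₀)).continuousAt
    have hyc : ∀ᶠ s in 𝓝 (0 : ℝ), DifferentiableAt ℝ (fun s => φ (γ₀ s)) s ∧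
        Θ (φ (γ₀ s)) (deriv (fun s => φ (γ₀ s)) s) = 0 := by
      have h1 : ∀ᶠ s in 𝓝 (0 : ℝ), Submodule.span ℝ (range fun i => θ i (γ₀ s)) = S.I (γ₀ s) :=
        hγc.eventually (by rw [h0]; exact hθ.span)
      have h2 : ∀ᶠ s in 𝓝 (0 : ℝ),
          γ₀ s ∈ (chartAt (EuclideanSpace ℝ (Fin S.dim)) x).source :=
        hγc.eventually (by rw [h0]; exact chart_source_mem_nhds _ _)
      filter_upwards [h1, h2, isOpen_Ioo.mem_nhds (zero_mem_Ioo hε₀)] with s hs1 hs2 hs3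
      have hs4 := (hγ₀.contMDiffAt hs3).mdifferentiableAt (by simp)
      refine ⟨((mdifferentiableAt_extChartAt hs2).comp s hs4).differentiableAt, ?_⟩
      funext i
      refine (form_velocity hs4 hs2 (θ i)).symm.trans ((hγ₀.2 s hs3).1 _ ?_)
      rw [← hs1]
      exact Submodule.subset_span ⟨i, rfl⟩
    have hφc : ContinuousAt (fun s => ((s, 0, φ (γ₀ s)) : ℝ × Eu S.dim × Eu S.dim)) 0 :=
      continuousAt_id.prodMk (continuousAt_const.prodMk hyc.self_of_nhds.1.continuousAt)
    have href : ∀ᶠ s in 𝓝 (0 : ℝ), HasDerivAt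
        (fun s => ((s, 0, φ (γ₀ s)) : ℝ × Eu S.dim × Eu S.dim)) (V' (s, 0, φ (γ₀ s))) s := by
      have h1 : ∀ᶠ s in 𝓝 (0 : ℝ), V' (s, 0, φ (γ₀ s)) = V (s, 0, φ (γ₀ s)) :=
        hφc.eventually (p := fun p => V' p = V p) (by simp only [h0]; exact hVV')
      filter_upwards [h1, hyc, hγg] with s hs1 hs2 hs3
      rw [hs1]
      have h2 : V (s, 0, φ (γ₀ s)) = (1, 0, deriv (fun s => φ (γ₀ s)) s) := by
        simp only [hV, add_zero]
        rw [← hs3, hQid _ _ hs2.2]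
      rw [h2]
      exact (hasDerivAt_id s).prodMk ((hasDerivAt_const s _).prodMk hs2.1.hasDerivAt)
    obtain ⟨U, hU, hUo, h0U⟩ := mem_nhds_iff.1 href
    -- The reference curve and the perturbed ones solve the same autonomous equation `V'`, where the
    -- time and the perturbation `c` are state variables. Their `k`-th derivatives at `0` are
    -- therefore values of one function `H` at the initial points `z₀ 0` and `z₀ c`, so continuity
    -- of `H` is enough, and no dependence of solutions on initial values is needed.
    have key : ∀ k : ℕ, ∀ᶠ c in 𝓝 (0 : Eu S.dim),
        ‖iteratedDeriv k (fun s => φ (φ.symm (z (z₀ c) s).2.2)) 0 -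
          iteratedDeriv k (fun s => φ (γ₀ s)) 0‖ < δ := by
      intro k
      obtain ⟨H, hH, hHk⟩ := exists_iteratedDeriv_eq hV'
        (h := fun p : ℝ × Eu S.dim × Eu S.dim => p.2.2) (by fun_prop) k
      have h1 : iteratedDeriv k (fun s => φ (γ₀ s)) 0 = H (z₀ 0) := by
        refine (hHk _ U hUo (fun s hs => hU hs) 0 h0U).trans ?_
        simp only [h0, hz₀, hy₀]
      have h2 : ContinuousAt (fun c => ‖H (z₀ c) - H (z₀ 0)‖) 0 :=
        ((hH.continuous.comp hz₀c).sub continuous_const).norm.continuousAt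
      have h3 : ∀ᶠ c in 𝓝 (0 : Eu S.dim), ‖H (z₀ c) - H (z₀ 0)‖ < δ :=
        h2.eventually (p := fun a => a < δ) (Iio_mem_nhds (by simpa using hδ))
      filter_upwards [h3, hz₀c.continuousAt.eventually hgood.eventually_nhds] with c hc hc2
      have hcont : ContinuousAt (z (z₀ c)) 0 :=
        (hz (z₀ c) 0 (zero_mem_Ioo (hez _))).continuousAt
      rw [← hz0 (z₀ c)] at hc2
      have h4 : (fun s => φ (φ.symm (z (z₀ c) s).2.2)) =ᶠ[𝓝 0] fun s => (z (z₀ c) s).2.2 := by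
        filter_upwards [hcont.eventually hc2] with s hs
        exact φ.right_inv hs.2.1
      rw [h4.iteratedDeriv_eq, hHk _ _ isOpen_Ioo (hz (z₀ c)) 0 (zero_mem_Ioo (hez _)), hz0, h1]
      exact hc
    have key' : ∀ᶠ c in 𝓝 (0 : Eu S.dim), ∀ k ∈ Finset.range (r + 1),
        ‖iteratedDeriv k (fun s => φ (φ.symm (z (z₀ c) s).2.2)) 0 -
          iteratedDeriv k (fun s => φ (γ₀ s)) 0‖ < δ :=
      (Finset.eventually_all _).2 fun k _ => key k
    filter_upwards [key'] with c hc
    unfold JetNear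
    rw [h0]
    refine ⟨?_, fun k hk => hc k (Finset.mem_range.2 (by omega))⟩
    show φ.symm (z (z₀ c) 0).2.2 ∈ _
    rw [hz0]
    show φ.symm y₀ ∈ _
    rw [hsym]
    exact mem_chart_source _ _

end CurvesInCharts

section Annihilators

variable {d : ℕ} {M : Type u} [TopologicalSpace M] [ChartedSpace (EuclideanSpace ℝ (Fin d)) M]

/-- The vectors annihilated by a family of covectors. -/
def annih (F : Family d M) (x : M) : Submodule ℝ (Eu d) where
  carrier := {v | ∀ α ∈ F x, α v = 0}
  add_mem' := fun {a b} ha hb α hα => (map_add α a b).trans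
    ((congrArg₂ (· + ·) (ha α hα) (hb α hα)).trans (add_zero 0))
  zero_mem' := fun α _ => map_zero α
  smul_mem' := fun c a ha α hα => (map_smul α c a).trans
    ((congrArg (c • ·) (ha α hα)).trans (smul_zero c))

instance finite_clm {E : Type*} [NormedAddCommGroup E] [NormedSpace ℝ E] [FiniteDimensional ℝ E] :
    Module.Finite ℝ (E →L[ℝ] ℝ) :=
  Module.Finite.equiv (LinearMap.toContinuousLinearMap : (E →ₗ[ℝ] ℝ) ≃ₗ[ℝ] E →L[ℝ] ℝ)

instance finite_cot (x : M) : Module.Finite ℝ (Cot d x) :=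
  finite_clm (E := Eu d)

variable [IsManifold (𝓡 d) ∞ M]

theorem IsFrameAt.finrank_annih_add {ι : Type*} [Fintype ι] {F : Family d M} {θ : ι → Form d M}
    {x : M} (h : IsFrameAt F θ x) :
    Module.finrank ℝ (annih F x) + Fintype.card ι = d := by
  have h1 := surjective_pi_of_linearIndependent (E := Eu d) h.indep.self_of_nhds
  set T : Eu d →ₗ[ℝ] (ι → ℝ) :=
    (ContinuousLinearMap.pi (fun i => (θ i x : Eu d →L[ℝ] ℝ)) : Eu d →L[ℝ] (ι → ℝ)).toLinearMap
  have h2 : annih F x = T.ker := by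
    ext v
    refine (h.ker_iff v).trans ?_
    rw [LinearMap.mem_ker]
    exact ⟨fun h => funext h, fun h => congrFun h⟩
  have h3 := T.finrank_range_add_finrank_ker
  rw [LinearMap.range_eq_top.2 h1, finrank_top, Module.finrank_fintype_fun_eq_card,
    finrank_euclideanSpace_fin, ← h2] at h3
  omega

theorem IsFrameAt.finrank_eq {ι : Type*} [Fintype ι] {F : Family d M} {θ : ι → Form d M}
    {x : M} (h : IsFrameAt F θ x) : Module.finrank ℝ (F x) = Fintype.card ι := by
  rw [← h.span.self_of_nhds]
  exact finrank_span_eq_card h.indep.self_of_nhds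

theorem IsSubbundle.finrank_eq {r : ℕ} {F : Family d M} (h : IsSubbundle r F) (x : M) :
    Module.finrank ℝ (F x) = r := by
  obtain ⟨θ, hθ⟩ := h.exists_frame x
  rw [hθ.finrank_eq, Fintype.card_fin]

theorem IsSubbundle.finrank_annih_add {r : ℕ} {F : Family d M} (h : IsSubbundle r F) (x : M) :
    Module.finrank ℝ (annih F x) + r = d := by
  obtain ⟨θ, hθ⟩ := h.exists_frame x
  simpa using hθ.finrank_annih_add

/-- A covector outside of a subspace of covectors is detected by a vector. -/
theorem exists_vector_of_notMem {E : Type*} [NormedAddCommGroup E] [NormedSpace ℝ E]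
    [FiniteDimensional ℝ E] {p : Submodule ℝ (E →L[ℝ] ℝ)} {α : E →L[ℝ] ℝ} (h : α ∉ p) :
    ∃ v, (∀ β ∈ p, β v = 0) ∧ α v = 1 := by
  set p' : Submodule ℝ (Module.Dual ℝ E) :=
    p.comap (LinearMap.toContinuousLinearMap : (E →ₗ[ℝ] ℝ) ≃ₗ[ℝ] E →L[ℝ] ℝ).toLinearMap with hp'
  have h1 : (α : E →ₗ[ℝ] ℝ) ∉ p'.dualCoannihilator.dualAnnihilator := by
    rw [Subspace.dualCoannihilator_dualAnnihilator_eq]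
    exact h
  rw [Submodule.mem_dualAnnihilator] at h1
  push Not at h1
  obtain ⟨v, hv, hv0⟩ := h1
  rw [Submodule.mem_dualCoannihilator] at hv
  have hv0' : α v ≠ 0 := hv0
  refine ⟨(α v)⁻¹ • v, fun β hβ => ?_, ?_⟩
  · have h2 : β v = 0 := hv (β : E →ₗ[ℝ] ℝ) hβ
    rw [map_smul, h2, smul_zero]
  · rw [map_smul, smul_eq_mul, inv_mul_cancel₀ hv0']

end Annihilators

section Jets

theorem contDiffAt_iteratedDeriv {F : Type*} [NormedAddCommGroup F] [NormedSpace ℝ F] {f : ℝ → F}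
    {t : ℝ} (hf : ContDiffAt ℝ ∞ f t) (k : ℕ) : ContDiffAt ℝ ∞ (iteratedDeriv k f) t := by
  induction k with
  | zero => rwa [iteratedDeriv_zero]
  | succ k ih =>
    rw [iteratedDeriv_succ]
    exact (ih.fderiv_right (m := ∞) (by simp)).clm_apply contDiffAt_const

variable {S : PfSystem.{u}}

theorem IsIntegralCurve.shift {γ : ℝ → S.M} {ε : ℝ} (h : IsIntegralCurve S γ ε) {t ε' : ℝ}
    (ht : |t| + ε' ≤ ε) : IsIntegralCurve S (fun s => γ (t + s)) ε' := by
  have hmem : ∀ s ∈ Ioo (-ε') ε', t + s ∈ Ioo (-ε) ε := by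
    rintro s ⟨h1, h2⟩
    constructor <;> linarith [neg_abs_le t, le_abs_self t]
  have hsm : ∀ s : ℝ, ContMDiffAt 𝓘(ℝ, ℝ) 𝓘(ℝ, ℝ) ∞ (fun s : ℝ => t + s) s := fun s =>
    (contDiffAt_const.add contDiffAt_id).contMDiffAt
  have hvel : ∀ s ∈ Ioo (-ε') ε', (velocity S (fun s => γ (t + s)) s : Eu S.dim) =
      velocity S γ (t + s) := by
    intro s hs
    have h1 := mfderiv_comp s ((h.contMDiffAt (hmem s hs)).mdifferentiableAt (by simp))
      ((hsm s).mdifferentiableAt (by simp))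
    have h2 : fderiv ℝ (fun s : ℝ => t + s) s 1 = 1 := by
      rw [fderiv_const_add]
      simp
    rw [mfderiv_eq_fderiv] at h1
    have h3 := congrArg (fun T : ℝ →L[ℝ] Eu S.dim => T 1) h1
    exact h3.trans (congrArg (fun a : ℝ => (mfderiv 𝓘(ℝ, ℝ) (𝓡 S.dim) γ (t + s) : ℝ →L[ℝ] Eu S.dim) a) h2)
  refine ⟨fun s hs => ((h.contMDiffAt (hmem s hs)).comp s (hsm s)).contMDiffWithinAt,
    fun s hs => ⟨fun α hα => ?_, ?_⟩⟩
  · exact (congrArg (fun v : Eu S.dim => α v) (hvel s hs)).trans ((h.2 _ (hmem s hs)).1 α hα)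
  · have h1 := congrArg (fun v : Eu S.dim => S.τ (γ (t + s)) v) (hvel s hs)
    exact fun h2 => (h.2 _ (hmem s hs)).2 (h1.symm.trans h2)

/-- The shifts of a curve by small times are close to the curve. -/
theorem eventually_jetNear_shift {γ : ℝ → S.M} (h : ContMDiffAt 𝓘(ℝ, ℝ) (𝓡 S.dim) ∞ γ 0) (r : ℕ)
    {δ : ℝ} (hδ : 0 < δ) : ∀ᶠ t in 𝓝 (0 : ℝ), JetNear S r δ γ (fun s => γ (t + s)) := by
  have hf : ContDiffAt ℝ ∞ (fun s => extChartAt (𝓡 S.dim) (γ 0) (γ s)) 0 :=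
    ((contMDiffAt_extChartAt (I := 𝓡 S.dim) (x := γ 0)).comp (0 : ℝ) h).contDiffAt
  have h1 : ∀ᶠ t in 𝓝 (0 : ℝ), ∀ k ∈ Finset.range (r + 1),
      ‖iteratedDeriv k (fun s => extChartAt (𝓡 S.dim) (γ 0) (γ s)) t -
        iteratedDeriv k (fun s => extChartAt (𝓡 S.dim) (γ 0) (γ s)) 0‖ < δ := by
    refine (Finset.eventually_all _).2 fun k _ => ?_
    have h2 := ((contDiffAt_iteratedDeriv hf k).continuousAt.sub
      (continuousAt_const (y := iteratedDeriv k
        (fun s => extChartAt (𝓡 S.dim) (γ 0) (γ s)) 0))).norm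
    exact h2.eventually (p := fun a => a < δ) (Iio_mem_nhds (by simpa using hδ))
  filter_upwards [h1, h.continuousAt.preimage_mem_nhds
    (chart_source_mem_nhds (EuclideanSpace ℝ (Fin S.dim)) (γ 0))] with t ht ht2
  refine ⟨by simpa using ht2, fun k hk => ?_⟩
  have h3 := congrFun (iteratedDeriv_comp_const_add k
    (fun s => extChartAt (𝓡 S.dim) (γ 0) (γ s)) t) 0
  rw [h3, add_zero]
  exact ht k (Finset.mem_range.2 (by omega))

/-- Small time shifts of an integral curve are integral curves with nearby jets, so an open
condition on the jet at time `0` persists on an interval. -/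
theorem IsJetOpen.exists_jetsIn {W : Set (ℝ → S.M)} (hW : IsJetOpen S W) {γ : ℝ → S.M} {ε : ℝ}
    (hε : 0 < ε) (h : IsIntegralCurve S γ ε) (hγ : γ ∈ W) :
    ∃ ε' > 0, ε' ≤ ε ∧ JetsIn S W γ ε' := by
  obtain ⟨r, δ, hδ, hrδ⟩ := hW γ hγ ε hε h
  obtain ⟨ε₁, hε₁, h1⟩ := exists_Ioo_of_eventually
    (eventually_jetNear_shift (h.contMDiffAt (zero_mem_Ioo hε)) r hδ)
  refine ⟨min ε₁ (ε / 2), by positivity, by linarith [min_le_right ε₁ (ε / 2)], fun t ht => ?_⟩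
  have ht1 : t ∈ Ioo (-ε₁) ε₁ :=
    ⟨by linarith [ht.1, min_le_left ε₁ (ε / 2)], by linarith [ht.2, min_le_left ε₁ (ε / 2)]⟩
  refine hrδ _ (ε / 2) (by positivity) (h.shift ?_) (h1 t ht1)
  have : |t| ≤ ε / 2 := abs_le.2 ⟨by linarith [ht.1, min_le_right ε₁ (ε / 2)],
    by linarith [ht.2, min_le_right ε₁ (ε / 2)]⟩
  linarith

theorem velocity_comp {N : PfSystem.{u}} {π : N.M → S.M} {γ : ℝ → S.M} {γ' : ℝ → N.M} {t : ℝ}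
    (hπ : MDifferentiableAt (𝓡 N.dim) (𝓡 S.dim) π (γ' t))
    (hγ : MDifferentiableAt 𝓘(ℝ, ℝ) (𝓡 N.dim) γ' t) (h : ∀ᶠ s in 𝓝 t, π (γ' s) = γ s) :
    (velocity S γ t : Eu S.dim) = mfderiv (𝓡 N.dim) (𝓡 S.dim) π (γ' t) (velocity N γ' t) := by
  have h1 := mfderiv_comp t hπ hγ
  have h2 : mfderiv 𝓘(ℝ, ℝ) (𝓡 S.dim) (π ∘ γ') t = mfderiv 𝓘(ℝ, ℝ) (𝓡 S.dim) γ t :=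
    Filter.EventuallyEq.mfderiv_eq h
  exact congrArg (fun T : ℝ →L[ℝ] Eu S.dim => T 1) (h2.symm.trans h1)

/-- Integral curves project to integral curves. -/
theorem IsIntegralCurve.proj {N : PfSystem.{u}} {π : N.M → S.M}
    (hπ : ContMDiff (𝓡 N.dim) (𝓡 S.dim) ∞ π)
    (hle : ∀ x, (pullback π S.I : Family N.dim N.M) x ≤ N.I x)
    (hτ : ∀ x, pullCov π x (S.τ (π x)) = N.τ x) {γ : ℝ → N.M} {ε : ℝ}
    (h : IsIntegralCurve N γ ε) : IsIntegralCurve S (fun t => π (γ t)) ε := by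
  have hvel : ∀ t ∈ Ioo (-ε) ε, (velocity S (fun t => π (γ t)) t : Eu S.dim) =
      mfderiv (𝓡 N.dim) (𝓡 S.dim) π (γ t) (velocity N γ t) := fun t ht =>
    velocity_comp (hπ.contMDiffAt.mdifferentiableAt (by simp))
      ((h.contMDiffAt ht).mdifferentiableAt (by simp)) (Filter.Eventually.of_forall fun _ => rfl)
  refine ⟨fun t ht => (hπ.contMDiffAt.comp t (h.contMDiffAt ht)).contMDiffWithinAt,
    fun t ht => ⟨fun α hα => ?_, fun h0 => ?_⟩⟩
  · exact (congrArg (fun v : Eu S.dim => α v) (hvel t ht)).trans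
      ((h.2 t ht).1 _ (hle _ ⟨α, hα, rfl⟩))
  · refine (h.2 t ht).2 ?_
    rw [← hτ]
    exact (congrArg (fun v : Eu S.dim => S.τ (π (γ t)) v) (hvel t ht)).symm.trans h0

theorem tau_smooth (S : PfSystem.{u}) (x : S.M) : SmoothFormNear S.τ x := by
  obtain ⟨f, hf, hf'⟩ := S.exact
  exact SmoothFormNear.exact (Filter.Eventually.of_forall fun z => hf.contMDiffAt)
    (Filter.Eventually.of_forall hf')

/-- There are integral curves through every point. -/
theorem exists_integralCurve (x : S.M) :
    ∃ (γ : ℝ → S.M) (ε : ℝ), 0 < ε ∧ IsIntegralCurve S γ ε ∧ γ 0 = x := by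
  obtain ⟨v, hv, hv1⟩ := exists_vector_of_notMem (E := Eu S.dim) (S.independent x)
  obtain ⟨Q, γ, -, -, hγ, -⟩ := exists_perturbed_curves x (fun _ => v)
    (Filter.Eventually.of_forall fun _ => contDiffAt_const) hv
    (by rw [show S.τ x v = 1 from hv1]; exact one_ne_zero)
  obtain ⟨ε, hε, h1, h2, -⟩ := hγ.self_of_nhds
  exact ⟨_, ε, hε, h1, h2⟩

end Jets

/-! ### Dimension count for Cartan prolongations -/

section EqualDim

variable {d e : ℕ} {N : Type v} {M : Type u}
  [TopologicalSpace N] [ChartedSpace (EuclideanSpace ℝ (Fin e)) N]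
  [TopologicalSpace M] [ChartedSpace (EuclideanSpace ℝ (Fin d)) M]
  [IsManifold (𝓡 e) ∞ N] [IsManifold (𝓡 d) ∞ M]

theorem exists_nhds_injOn {f : N → M} {x : N} (hf : SmoothMapNear (d := d) (e := e) f x)
    (hd : e = d) (hs : Function.Surjective (mfderiv (𝓡 e) (𝓡 d) f x)) :
    ∃ U ∈ 𝓝 x, InjOn f U := by
  set T : Eu e →L[ℝ] Eu d := mfderiv (𝓡 e) (𝓡 d) f x with hT
  have hinj : Function.Injective T :=
    (LinearMap.injective_iff_surjective_of_finrank_eq_finrank (f := T.toLinearMap)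
      (by simp [hd])).2 hs
  have hT' : ((ContinuousLinearEquiv.ofBijective T (LinearMap.ker_eq_bot.2 hinj)
      (LinearMap.range_eq_top.2 hs) : Eu e ≃L[ℝ] Eu d) : Eu e →L[ℝ] Eu d) = T := by
    ext v
    simp
  have h1 := hf.written
  have h2 : HasFDerivAt (writtenInExtChartAt (𝓡 e) (𝓡 d) x f) T (extChartAt (𝓡 e) x x) := by
    rw [hT, ← fderiv_written hf]
    exact (h1.self_of_nhds.2.differentiableAt (by simp)).hasFDerivAt
  rw [← hT'] at h2
  obtain ⟨e', ha, hes, hee, -⟩ := exists_smooth_local_inverse (h1.mono fun y hy => hy.2) h2 h1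
  refine ⟨(extChartAt (𝓡 e) x).source ∩ extChartAt (𝓡 e) x ⁻¹' e'.source,
    Filter.inter_mem (extChartAt_source_mem_nhds x)
      ((continuousAt_extChartAt x).preimage_mem_nhds (e'.open_source.mem_nhds ha)), ?_⟩
  rintro a ⟨ha1, ha2⟩ b ⟨hb1, hb2⟩ hab
  refine (extChartAt (𝓡 e) x).injOn ha1 hb1 (e'.injOn ha2 hb2 ?_)
  rw [hee]
  simp only [writtenInExtChartAt, Function.comp_apply]
  rw [(extChartAt (𝓡 e) x).left_inv ha1, (extChartAt (𝓡 e) x).left_inv hb1, hab]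

/-- In equal dimensions a submersion is locally injective, so its fibers are discrete, and a
discrete subset of a second countable space is countable. Countability makes the union of velocity
spaces in `IsCartanProlongation.rank_eq` a null set. -/
theorem countable_fiber [SecondCountableTopology N] {f : N → M}
    (hf : ∀ x, SmoothMapNear (d := d) (e := e) f x) (hd : e = d)
    (hs : ∀ x, Function.Surjective (mfderiv (𝓡 e) (𝓡 d) f x)) (y : M) :
    (f ⁻¹' {y}).Countable := by
  have : DiscreteTopology (f ⁻¹' {y}) := by
    refine discreteTopology_subtype_iff.2 fun x hx => ?_
    obtain ⟨U, hU, hinj⟩ := exists_nhds_injOn (hf x) hd (hs x)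
    rw [Filter.inf_principal_eq_bot]
    filter_upwards [mem_nhdsWithin_of_mem_nhds hU, self_mem_nhdsWithin] with z hz hne hzy
    exact hne (hinj hz (mem_of_mem_nhds hU) (hzy.trans hx.symm))
  have := countable_of_Lindelof_of_discrete (X := (f ⁻¹' {y} : Set N))
  exact countable_coe_iff.1 this

end EqualDim

/-- A Cartan prolongation between systems of the same dimension does not enlarge the rank. -/
theorem IsCartanProlongation.rank_eq {N S : PfSystem.{u}} {π : N.M → S.M}
    (h : IsCartanProlongation N S π) (x₀ : N.M) (hd : N.dim = S.dim) : N.rank = S.rank := by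
  have hsub : ∀ x, SubmersionNear (d := S.dim) (e := N.dim) π x := fun x =>
    subm_of_open isOpen_univ h.smooth.contMDiffOn (fun x _ => h.submersion x) (mem_univ x)
  refine le_antisymm (not_lt.1 fun hlt => ?_) ?_
  swap
  · rw [← N.subbundle.finrank_eq x₀,
      ← (isSubbundle_pullback hsub S.subbundle).finrank_eq x₀]
    exact Submodule.finrank_mono (h.pull_le x₀)
  obtain ⟨γ', ε', hε', hγ', hx₀⟩ := exists_integralCurve x₀
  obtain ⟨W, hW, hlift, happ⟩ := h.lifting
  obtain ⟨γ₁, ε₁, hε₁, hγ₁, -, hjets⟩ := happ γ' ε' hε' hγ' 0 1 one_pos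
  have hγ₀ := hγ₁.proj h.smooth h.pull_le h.pull_indep
  set γ₀ : ℝ → S.M := fun t => π (γ₁ t) with hγ₀def
  have h0mem := zero_mem_Ioo hε₁
  have hW0 : γ₀ ∈ W := by simpa using hjets 0 h0mem
  set x := γ₀ 0 with hx
  set g : ℝ → Eu S.dim := deriv (fun s => extChartAt (𝓡 S.dim) x (γ₀ s)) with hg
  have hgs : ∀ᶠ s in 𝓝 (0 : ℝ), ContDiffAt ℝ ∞ g s := by
    filter_upwards [isOpen_Ioo.mem_nhds h0mem, (hγ₀.contMDiffAt h0mem).continuousAt.preimage_mem_nhds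
      (chart_source_mem_nhds (EuclideanSpace ℝ (Fin S.dim)) x)] with s hs1 hs2
    have h1 : ContDiffAt ℝ ∞ (fun s => extChartAt (𝓡 S.dim) x (γ₀ s)) s :=
      ((contMDiffAt_extChartAt' (I := 𝓡 S.dim) hs2).comp s (hγ₀.contMDiffAt hs1)).contDiffAt
    have := contDiffAt_iteratedDeriv h1 1
    rwa [iteratedDeriv_one] at this
  have hg0 : (velocity S γ₀ 0 : Eu S.dim) = g 0 :=
    velocity_eq_deriv ((hγ₀.contMDiffAt h0mem).mdifferentiableAt (by simp)) rfl
  obtain ⟨Q, γ, hQid, hQ, hγ, hnear⟩ := exists_perturbed_curves x g hgs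
    (by rw [← hg0]; exact (hγ₀.2 0 h0mem).1) (by rw [← hg0]; exact (hγ₀.2 0 h0mem).2)
  obtain ⟨r, δ, hδ, hrδ⟩ := hW γ₀ hW0 ε₁ hε₁ hγ₀
  have hnear' := hnear γ₀ ε₁ hε₁ hγ₀ rfl (Filter.Eventually.of_forall fun s => rfl) r δ hδ
  -- the possible initial velocities
  set L : N.M → Submodule ℝ (Eu S.dim) := fun p => (annih N.I p).map
    (mfderiv (𝓡 N.dim) (𝓡 S.dim) π p : Eu N.dim →L[ℝ] Eu S.dim).toLinearMap with hL
  -- A small perturbation of a generic curve is still generic, hence lifts. Its initial velocity is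
  -- then the projection of an admissible velocity at some point `p` of the fiber over `x`.
  have hcover : ∀ᶠ c in 𝓝 (0 : Eu S.dim), ∃ p ∈ π ⁻¹' {x}, Q (g 0 + c) ∈ L p := by
    filter_upwards [hγ, hnear'] with c ⟨ε, hε, hc1, hc2, hc3⟩ hc4
    have hcW : γ c ∈ W := hrδ (γ c) ε hε hc1 hc4
    obtain ⟨ε₂, hε₂, hle, hj⟩ := hW.exists_jetsIn hε hc1 hcW
    obtain ⟨β, ⟨hβ1, hβ2⟩, -⟩ := hlift (γ c) ε₂ hε₂ (hc1.mono hle) hj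
    have h0' := zero_mem_Ioo hε₂
    refine ⟨β 0, (hβ2 0 h0').trans hc2, ?_⟩
    rw [← hc3]
    refine ⟨velocity N β 0, (hβ1.2 0 h0').1, ?_⟩
    refine (velocity_comp (h.smooth.contMDiffAt.mdifferentiableAt (by simp))
      ((hβ1.contMDiffAt h0').mdifferentiableAt (by simp)) ?_).symm
    filter_upwards [isOpen_Ioo.mem_nhds h0'] with s hs using hβ2 s hs
  -- If the rank upstairs were larger in the same dimension, the admissible velocities at `p` would
  -- have smaller dimension than those at `x`, all of which are values of `Q`.
  have hLtop : ∀ p ∈ π ⁻¹' {x}, (L p).comap Q.toLinearMap ≠ ⊤ := by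
    intro p hp htop
    have h1 : annih S.I x ≤ L p := by
      intro v hv
      have h2 : v ∈ (L p).comap Q.toLinearMap := by rw [htop]; trivial
      have h3 : Q v ∈ L p := h2
      rwa [hQid v hv] at h3
    have h2 := Submodule.finrank_mono h1
    have hmap : ∀ (T : Eu N.dim →ₗ[ℝ] Eu S.dim) (P : Submodule ℝ (Eu N.dim)),
        Module.finrank ℝ (P.map T) ≤ Module.finrank ℝ P := fun T P => Submodule.finrank_map_le T P
    have h3 : Module.finrank ℝ (L p) ≤ Module.finrank ℝ (annih N.I p) := hmap _ _
    have h4 := N.subbundle.finrank_annih_add p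
    have h5 := S.subbundle.finrank_annih_add x
    omega
  have hcount : (π ⁻¹' {x}).Countable :=
    countable_fiber (fun x => (hsub x).smooth) hd h.submersion x
  -- Countably many translates of proper subspaces have measure zero, so they cannot cover a
  -- neighborhood of `0`.
  have hnull : MeasureTheory.volume {c : Eu S.dim | ∃ p ∈ π ⁻¹' {x}, Q (g 0 + c) ∈ L p} = 0 := by
    have h1 : {c : Eu S.dim | ∃ p ∈ π ⁻¹' {x}, Q (g 0 + c) ∈ L p} =
        ⋃ p ∈ π ⁻¹' {x}, (fun c => g 0 + c) ⁻¹' ((L p).comap Q.toLinearMap : Set (Eu S.dim)) := by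
      ext c
      simp
    rw [h1, MeasureTheory.measure_biUnion_null_iff hcount]
    intro p hp
    rw [MeasureTheory.measure_preimage_add]
    exact MeasureTheory.Measure.addHaar_submodule _ _ (hLtop p hp)
  exact (MeasureTheory.Measure.measure_pos_of_mem_nhds MeasureTheory.volume hcover).ne' hnull

/-! ### Normal form of flags of Pfaffian systems -/

section Contraction

variable {E : Type u} [NormedAddCommGroup E] [NormedSpace ℝ E]

/-- The exterior derivative of a `1`-form on a normed space. -/
def dForm (β : E → E →L[ℝ] ℝ) (y v w : E) : ℝ := fderiv ℝ β y v w - fderiv ℝ β y w v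

theorem dForm_antisymm (β : E → E →L[ℝ] ℝ) (y v w : E) : dForm β y v w = -dForm β y w v := by
  unfold dForm
  ring

theorem dForm_add_smul (β : E → E →L[ℝ] ℝ) (y v w X : E) (a b : ℝ) :
    dForm β y (v + a • X) (w + b • X) =
      dForm β y v w + a * dForm β y X w - b * dForm β y X v := by
  unfold dForm
  simp only [map_add, map_smul, add_apply, smul_apply, smul_eq_mul]
  ring

/-- `f` is smooth near `x₀`. -/
def SmoothNear {F : Type*} [NormedAddCommGroup F] [NormedSpace ℝ F] (f : E → F) (x₀ : E) : Prop :=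
  ∀ᶠ y in 𝓝 x₀, ContDiffAt ℝ ∞ f y

/-- The contraction of the exterior derivative of `β` with the vector field `X`. -/
def contr (X : E → E) (β : E → E →L[ℝ] ℝ) (y : E) : E →L[ℝ] ℝ :=
  fderiv ℝ β y (X y) - (fderiv ℝ β y).flip (X y)

theorem contr_apply (X : E → E) (β : E → E →L[ℝ] ℝ) (y v : E) :
    contr X β y v = dForm β y (X y) v := rfl

theorem contr_self (X : E → E) (β : E → E →L[ℝ] ℝ) (y : E) : contr X β y (X y) = 0 :=
  sub_self _

theorem SmoothNear.contr {X : E → E} {β : E → E →L[ℝ] ℝ} {x₀ : E} (hX : SmoothNear X x₀)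
    (hβ : SmoothNear β x₀) : SmoothNear (contr X β) x₀ := by
  filter_upwards [hX, hβ] with y h1 h2
  have h3 : ContDiffAt ℝ ∞ (fderiv ℝ β) y := h2.fderiv_right (by simp)
  have h4 : ContDiffAt ℝ ∞ (fun y => (fderiv ℝ β y).flip) y :=
    (IsBoundedLinearMap.contDiff (𝕜 := ℝ) (f := fun T : E →L[ℝ] E →L[ℝ] ℝ => T.flip)
      ⟨⟨fun _ _ => rfl, fun _ _ => rfl⟩, 1, one_pos, fun T => by
        rw [ContinuousLinearMap.opNorm_flip, one_mul]⟩).contDiffAt.comp y h3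
  exact (h3.clm_apply h1).sub (h4.clm_apply h1)

/-- Leibniz rule; the term with `dc` and the factor `β₀(X)` drops since `X` is in the kernel of
`β₀`. Modulo forms of the system, a change of frame thus acts on the contractions with the same
coefficients. -/
theorem contr_add_smul {X : E → E} {β β₀ : E → E →L[ℝ] ℝ} {c : E → ℝ} {y : E}
    (hβ : ContDiffAt ℝ ∞ β y) (hβ₀ : ContDiffAt ℝ ∞ β₀ y) (hc : ContDiffAt ℝ ∞ c y)
    (h0 : β₀ y (X y) = 0) :
    contr X (fun y => β y + c y • β₀ y) y =
      contr X β y + c y • contr X β₀ y + (fderiv ℝ c y (X y)) • β₀ y := by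
  have h1 : HasFDerivAt (fun y => β y + c y • β₀ y) _ y :=
    (hβ.differentiableAt (by simp)).hasFDerivAt.add
    ((hc.differentiableAt (by simp)).hasFDerivAt.smul (hβ₀.differentiableAt (by simp)).hasFDerivAt)
  ext v
  simp only [contr, h1.fderiv, add_apply, sub_apply, smul_apply, ContinuousLinearMap.flip_apply,
    ContinuousLinearMap.smulRight_apply, smul_eq_mul, h0]
  ring

/-- `κ` is a smooth frame of `F` near `x₀`. -/
structure IsFrameNear {ι : Type*} (F : E → Submodule ℝ (E →L[ℝ] ℝ)) (κ : ι → E → E →L[ℝ] ℝ)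
    (x₀ : E) : Prop where
  smooth : ∀ i, SmoothNear (κ i) x₀
  indep : ∀ᶠ y in 𝓝 x₀, LinearIndependent ℝ fun i => κ i y
  span : ∀ᶠ y in 𝓝 x₀, Submodule.span ℝ (range fun i => κ i y) = F y

/-- The covectors that annihilate a subspace. -/
def perp (C : Submodule ℝ E) : Submodule ℝ (E →L[ℝ] ℝ) where
  carrier := {α | ∀ v ∈ C, α v = 0}
  add_mem' ha hb v hv := by rw [add_apply, ha v hv, hb v hv, add_zero]
  zero_mem' _ _ := rfl
  smul_mem' c a ha v hv := by rw [smul_apply, ha v hv, smul_zero]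

theorem finrank_add_finrank_perp [FiniteDimensional ℝ E] (C : Submodule ℝ E) :
    Module.finrank ℝ C + Module.finrank ℝ (perp C) = Module.finrank ℝ E := by
  rw [← Subspace.finrank_add_finrank_dualAnnihilator_eq C]
  congr 1
  have h1 : perp C = C.dualAnnihilator.map
      (LinearMap.toContinuousLinearMap : (E →ₗ[ℝ] ℝ) ≃ₗ[ℝ] E →L[ℝ] ℝ).toLinearMap := by
    ext α
    constructor
    · intro h
      exact ⟨(α : E →ₗ[ℝ] ℝ), (Submodule.mem_dualAnnihilator _).2 h, by ext; rfl⟩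
    · rintro ⟨β, hβ, rfl⟩
      exact (Submodule.mem_dualAnnihilator _).1 hβ
  rw [h1]
  exact LinearEquiv.finrank_map_eq _ _

theorem eventually_linearIndependent [FiniteDimensional ℝ E] {ι : Type*} [Finite ι]
    {κ : ι → E → E →L[ℝ] ℝ} {x₀ : E} (h : ∀ i, SmoothNear (κ i) x₀)
    (hi : LinearIndependent ℝ fun i => κ i x₀) :
    ∀ᶠ y in 𝓝 x₀, LinearIndependent ℝ fun i => κ i y := by
  have hc : ContinuousAt (fun y i => κ i y) x₀ :=
    continuousAt_pi.2 fun i => (h i).self_of_nhds.continuousAt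
  exact hc.eventually (isOpen_setOfPred_linearIndependent.mem_nhds hi)

theorem linearIndependent_sum_unit {V ι : Type*} [AddCommGroup V] [Module ℝ V]
    {κ : ι → V} (h : LinearIndependent ℝ κ) {α : V} (hα : α ∉ Submodule.span ℝ (range κ)) :
    LinearIndependent ℝ (Sum.elim κ fun _ : Unit => α) := by
  have hα0 : α ≠ 0 := by
    rintro rfl
    exact hα (zero_mem _)
  refine LinearIndependent.sum_type h (LinearIndependent.of_subsingleton () hα0) ?_
  rw [range_const, Submodule.disjoint_span_singleton' hα0]
  exact hα

theorem notMem_span_range_sum {V ι : Type*} [AddCommGroup V] [Module ℝ V] {κ : ι → V} {α β : V}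
    (h : β ∉ Submodule.span ℝ (range κ) ⊔ Submodule.span ℝ {α}) :
    β ∉ Submodule.span ℝ (range (Sum.elim κ fun _ : Unit => α)) := by
  rwa [Sum.elim_range, Submodule.span_union, range_const]

end Contraction

section Flag

variable {E : Type u} [NormedAddCommGroup E] [NormedSpace ℝ E] [FiniteDimensional ℝ E]

/-- A flag `G 0 ⊆ ⋯ ⊆ G K` of Pfaffian systems, with Cauchy characteristics `C k`, that arises
from the relative extensions of a linearizing prolongation. -/
structure IsPfaffianFlag (n K : ℕ) (G : ℕ → E → Submodule ℝ (E →L[ℝ] ℝ))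
    (C : ℕ → E → Submodule ℝ E) (σ : E → E →L[ℝ] ℝ) (x₀ : E) : Prop where
  smooth_σ : SmoothNear σ x₀
  frame : ∀ k ≤ K, ∃ κ : Fin (n + k) → E → E →L[ℝ] ℝ, IsFrameNear (G k) κ x₀
  le_top : ∀ k ≤ K, ∀ᶠ y in 𝓝 x₀, G k y ≤ G K y
  le_succ : ∀ k < K, ∀ᶠ y in 𝓝 x₀, G k y ≤ G (k + 1) y
  notMem : ∀ᶠ y in 𝓝 x₀, σ y ∉ G K y
  char : ∀ k ≤ K, ∀ᶠ y in 𝓝 x₀, σ y ∈ perp (C k y)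
  next : ∀ k < K, ∀ᶠ y in 𝓝 x₀, G (k + 1) y = perp (C k y) ⊓ G K y
  cauchy : ∀ k ≤ K, ∀ κ : Fin (n + k) → E → E →L[ℝ] ℝ, IsFrameNear (G k) κ x₀ →
    ∀ᶠ y in 𝓝 x₀, ∀ v, v ∈ C k y ↔ (∀ i, κ i y v = 0) ∧
      ∀ i w, (∀ j, κ j y w = 0) → dForm (κ i) y v w = 0
  integrable : ∀ k ≤ K, ∀ κ : Fin (n + k) → E → E →L[ℝ] ℝ, IsFrameNear (G k) κ x₀ →
    ∀ᶠ y in 𝓝 x₀, ∀ i v w, (∀ j, κ j y v = 0) → (∀ j, κ j y w = 0) → σ y v = 0 → σ y w = 0 →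
      dForm (κ i) y v w = 0
  finrank_zero : ∀ᶠ y in 𝓝 x₀, Module.finrank ℝ (C 0 y) + (n + 3) = Module.finrank ℝ E
  bot : ∀ᶠ y in 𝓝 x₀, C K y = ⊥
  finrank_ge : n + K + 3 ≤ Module.finrank ℝ E

variable {n K : ℕ} {G : ℕ → E → Submodule ℝ (E →L[ℝ] ℝ)} {C : ℕ → E → Submodule ℝ E}
  {σ : E → E →L[ℝ] ℝ} {x₀ : E}

/-- Contracting with such a field turns the structure equations into statements about one-forms. It
comes from a smooth right inverse of the independent forms given by a frame of `G K` and `σ`. -/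
theorem IsPfaffianFlag.exists_transversal (h : IsPfaffianFlag n K G C σ x₀) :
    ∃ X : E → E, SmoothNear X x₀ ∧ ∀ᶠ y in 𝓝 x₀, (∀ α ∈ G K y, α (X y) = 0) ∧ σ y (X y) = 1 := by
  obtain ⟨κ, hκ⟩ := h.frame K le_rfl
  have hsm : ∀ i, SmoothNear (Sum.elim κ (fun _ : Unit => σ) i) x₀ := by
    rintro (i | i)
    · exact hκ.smooth i
    · exact h.smooth_σ
  have hΘ : ∀ᶠ y in 𝓝 x₀, ContDiffAt ℝ ∞
      (fun y => ContinuousLinearMap.pi fun i => Sum.elim κ (fun _ : Unit => σ) i y) y := by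
    filter_upwards [Filter.eventually_all.2 hsm] with y hy using contDiffAt_clm_pi hy
  have hli : LinearIndependent ℝ fun i => Sum.elim κ (fun _ : Unit => σ) i x₀ := by
    have h1 := linearIndependent_sum_unit hκ.indep.self_of_nhds (α := σ x₀) (by
      rw [hκ.span.self_of_nhds]
      exact h.notMem.self_of_nhds)
    have h2 : (fun i => Sum.elim κ (fun _ : Unit => σ) i x₀) =
        Sum.elim (fun i => κ i x₀) fun _ : Unit => σ x₀ := by
      funext i
      rcases i with i | i <;> rfl
    rw [h2]
    exact h1
  obtain ⟨ρ, hρ, hρΘ⟩ := exists_smooth_rightInverse hΘ (surjective_pi_of_linearIndependent hli)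
  refine ⟨fun y => ρ y (Sum.elim 0 1), ?_, ?_⟩
  · filter_upwards [hρ] with y hy using hy.clm_apply contDiffAt_const
  · filter_upwards [hρΘ, hκ.span] with y hy hy2
    have h1 := hy.1 (Sum.elim 0 1)
    refine ⟨?_, congrFun h1 (Sum.inr ())⟩
    rw [← hy2, mem_ker_span_iff]
    exact fun i => congrFun h1 (Sum.inl i)

variable {X : E → E}

/-- Subtracting `σ(v) X` and `σ(w) X` moves the arguments into the kernel of `σ`, where the exterior
derivative vanishes by integrability; expanding the bilinear form leaves the wedge product of `σ`
with the contraction. -/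
theorem IsPfaffianFlag.structure_eq (h : IsPfaffianFlag n K G C σ x₀)
    (hX : ∀ᶠ y in 𝓝 x₀, (∀ α ∈ G K y, α (X y) = 0) ∧ σ y (X y) = 1) {k : ℕ} (hk : k ≤ K)
    {κ : Fin (n + k) → E → E →L[ℝ] ℝ} (hκ : IsFrameNear (G k) κ x₀) :
    ∀ᶠ y in 𝓝 x₀, ∀ i v w, (∀ j, κ j y v = 0) → (∀ j, κ j y w = 0) →
      dForm (κ i) y v w = σ y v * contr X (κ i) y w - σ y w * contr X (κ i) y v := by
  filter_upwards [h.integrable k hk κ hκ, hX, h.le_top k hk, hκ.span] with y h1 h2 h3 h4 i v w hv hw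
  have hXk : ∀ j, κ j y (X y) = 0 := fun j => h2.1 _ (h3 (by
    rw [← h4]
    exact Submodule.subset_span ⟨j, rfl⟩))
  have h5 := h1 i (v + (-(σ y v)) • X y) (w + (-(σ y w)) • X y)
    (fun j => by rw [map_add, map_smul, hv, hXk, smul_zero, add_zero])
    (fun j => by rw [map_add, map_smul, hw, hXk, smul_zero, add_zero])
    (by rw [map_add, map_smul, h2.2, smul_eq_mul]; ring)
    (by rw [map_add, map_smul, h2.2, smul_eq_mul]; ring)
  rw [dForm_add_smul] at h5
  rw [contr_apply, contr_apply]
  linarith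

theorem IsPfaffianFlag.mem_perp (h : IsPfaffianFlag n K G C σ x₀)
    (hX : ∀ᶠ y in 𝓝 x₀, (∀ α ∈ G K y, α (X y) = 0) ∧ σ y (X y) = 1) {k : ℕ} (hk : k ≤ K)
    {κ : Fin (n + k) → E → E →L[ℝ] ℝ} (hκ : IsFrameNear (G k) κ x₀) :
    ∀ᶠ y in 𝓝 x₀, G k y ≤ perp (C k y) ∧ ∀ i, contr X (κ i) y ∈ perp (C k y) := by
  filter_upwards [h.cauchy k hk κ hκ, hX, h.le_top k hk, hκ.span] with y h1 h2 h3 h4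
  constructor
  · rw [← h4, Submodule.span_le]
    rintro _ ⟨i, rfl⟩ v hv
    exact ((h1 v).1 hv).1 i
  · intro i v hv
    rw [contr_apply, dForm_antisymm, ((h1 v).1 hv).2 i _ fun j => h2.1 _ (h3 (by
      rw [← h4]
      exact Submodule.subset_span ⟨j, rfl⟩)), neg_zero]

/-- By `IsPfaffianFlag.structure_eq`, a vector killed by `G k`, `σ` and all contractions is a Cauchy
characteristic. Dually, these forms generate the Cartan system `perp (C k y)`. -/
theorem IsPfaffianFlag.perp_le (h : IsPfaffianFlag n K G C σ x₀)
    (hX : ∀ᶠ y in 𝓝 x₀, (∀ α ∈ G K y, α (X y) = 0) ∧ σ y (X y) = 1) {k : ℕ} (hk : k ≤ K)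
    {κ : Fin (n + k) → E → E →L[ℝ] ℝ} (hκ : IsFrameNear (G k) κ x₀) :
    ∀ᶠ y in 𝓝 x₀, ∀ P : Submodule ℝ (E →L[ℝ] ℝ), G k y ≤ P → σ y ∈ P →
      (∀ i, contr X (κ i) y ∈ P) → perp (C k y) ≤ P := by
  filter_upwards [h.cauchy k hk κ hκ, h.structure_eq hX hk hκ, hκ.span]
    with y h1 h2 h3 P hG hσ hP α hα
  by_contra hαP
  obtain ⟨v, hv, hv1⟩ := exists_vector_of_notMem hαP
  have hκv : ∀ i, κ i y v = 0 := fun i => hv _ (hG (by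
    rw [← h3]
    exact Submodule.subset_span ⟨i, rfl⟩))
  have hvC : v ∈ C k y := (h1 v).2 ⟨hκv, fun i w hw => by
    rw [h2 i v w hκv hw, hv _ hσ, hv _ (hP i)]
    ring⟩
  rw [hα v hvC] at hv1
  exact zero_ne_one hv1

/-- At the point `y`, the forms `b 0, …, b (n + k - 1)` are adapted to the flag up to stage `k`. -/
structure IsAdaptedAt (n K : ℕ) (G : ℕ → E → Submodule ℝ (E →L[ℝ] ℝ)) (X : E → E) (k : ℕ)
    (b : ℕ → E → E →L[ℝ] ℝ) (y : E) : Prop where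
  span : ∀ j ≤ k, Submodule.span ℝ (range fun i : Fin (n + j) => b i y) = G j y
  first : contr X (b 0) y ∉ G K y
  middle : ∀ i, 0 < i → i + 1 < n → contr X (b i) y ∈ G 0 y
  last : ∀ j < k, contr X (b (n - 1 + j)) y - b (n + j) y ∈ G j y

theorem IsAdaptedAt.mem {k : ℕ} {b : ℕ → E → E →L[ℝ] ℝ} {y : E} (h : IsAdaptedAt n K G X k b y)
    {i j : ℕ} (hj : j ≤ k) (hi : i < n + j) : b i y ∈ G j y := by
  rw [← h.span j hj]
  exact Submodule.subset_span ⟨⟨i, hi⟩, rfl⟩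

theorem IsAdaptedAt.mono {k : ℕ} {b : ℕ → E → E →L[ℝ] ℝ} {y : E} (h : IsAdaptedAt n K G X k b y)
    {i j : ℕ} (hij : i ≤ j) (hj : j ≤ k) : G i y ≤ G j y := by
  rw [← h.span i (hij.trans hj), Submodule.span_le]
  rintro _ ⟨l, rfl⟩
  exact h.mem hj (by have := l.2; omega)

/-- Independence is automatic: `n + k` forms span a space of dimension `n + k`. -/
theorem IsPfaffianFlag.isFrameNear (h : IsPfaffianFlag n K G C σ x₀) {k : ℕ} (hk : k ≤ K)
    {b : ℕ → E → E →L[ℝ] ℝ} (hb : ∀ i < n + k, SmoothNear (b i) x₀)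
    (hspan : ∀ᶠ y in 𝓝 x₀, Submodule.span ℝ (range fun i : Fin (n + k) => b i y) = G k y) :
    IsFrameNear (G k) (fun i : Fin (n + k) => b i) x₀ where
  smooth i := hb i i.2
  span := hspan
  indep := by
    obtain ⟨κ, hκ⟩ := h.frame k hk
    filter_upwards [hspan, hκ.span, hκ.indep] with y h1 h2 h3
    rw [linearIndependent_iff_card_eq_finrank_span, Set.finrank, h1, ← h2, finrank_span_eq_card h3]

/-- Among the adapted forms up to stage `k`, all contractions lie in `G k` except those of `b 0` and
of the last form `b (n - 1 + k)`. Hence the Cartan system is generated by `G k`, `σ` and these two;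
evaluating on `X`, which kills everything but `σ`, reads off the coefficient of `σ`. -/
theorem IsPfaffianFlag.exists_decomp (h : IsPfaffianFlag n K G C σ x₀)
    (hX : ∀ᶠ y in 𝓝 x₀, (∀ α ∈ G K y, α (X y) = 0) ∧ σ y (X y) = 1) (hn : 2 ≤ n) {k : ℕ}
    (hk : k ≤ K) {b : ℕ → E → E →L[ℝ] ℝ} (hb : ∀ i < n + k, SmoothNear (b i) x₀)
    (had : ∀ᶠ y in 𝓝 x₀, IsAdaptedAt n K G X k b y) :
    ∀ᶠ y in 𝓝 x₀, ∀ α ∈ perp (C k y), ∃ g ∈ G k y, ∃ r t s : ℝ,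
      α = g + r • contr X (b 0) y + t • contr X (b (n - 1 + k)) y + s • σ y ∧ s = α (X y) := by
  have hfr := h.isFrameNear hk hb (had.mono fun y hy => hy.span k le_rfl)
  filter_upwards [h.perp_le hX hk hfr, had, hX, h.le_top k hk] with y h1 h2 h3 h4 α hα
  set P := G k y ⊔ Submodule.span ℝ {contr X (b 0) y} ⊔
    Submodule.span ℝ {contr X (b (n - 1 + k)) y} ⊔ Submodule.span ℝ {σ y} with hP
  have hGP : G k y ≤ P := (le_sup_left.trans le_sup_left).trans le_sup_left
  have hωP : contr X (b 0) y ∈ P :=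
    Submodule.mem_sup_left (Submodule.mem_sup_left (Submodule.mem_sup_right
      (Submodule.mem_span_singleton_self _)))
  have hζP : contr X (b (n - 1 + k)) y ∈ P :=
    Submodule.mem_sup_left (Submodule.mem_sup_right (Submodule.mem_span_singleton_self _))
  have hσP : σ y ∈ P := Submodule.mem_sup_right (Submodule.mem_span_singleton_self _)
  have hαP := h1 P hGP hσP (fun i => ?_) hα
  · simp only [hP, Submodule.mem_sup, Submodule.mem_span_singleton] at hαP
    obtain ⟨_, ⟨_, ⟨g, hg, _, ⟨r, rfl⟩, rfl⟩, _, ⟨t, rfl⟩, rfl⟩, _, ⟨s, rfl⟩, rfl⟩ := hαP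
    refine ⟨g, hg, r, t, s, rfl, ?_⟩
    simp only [add_apply, smul_apply, contr_self, h3.1 g (h4 hg), h3.2, smul_eq_mul]
    ring
  · have hi := i.2
    rcases Nat.eq_zero_or_pos i.1 with h0 | h0
    · rw [h0]
      exact hωP
    · by_cases h5 : i.1 + 1 < n
      · exact hGP (h2.mono (Nat.zero_le k) le_rfl (h2.middle i.1 h0 h5))
      · obtain ⟨j, hj⟩ : ∃ j, i.1 = n - 1 + j := ⟨i.1 - (n - 1), by omega⟩
        rcases eq_or_ne j k with rfl | hjk
        · rw [hj]
          exact hζP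
        · have hjk' : j < k := by omega
          rw [hj, ← sub_add_cancel (contr X (b (n - 1 + j)) y) (b (n + j) y)]
          exact add_mem (hGP (h2.mono hjk'.le le_rfl (h2.last j hjk')))
            (hGP (h2.mem le_rfl (by omega)))

end Flag

section SmoothCoefficients

variable {E : Type u} [NormedAddCommGroup E] [NormedSpace ℝ E] [FiniteDimensional ℝ E]

/-- A smooth combination of independent forms has smooth coefficients. -/
theorem exists_smooth_coeffs {ι : Type*} [Fintype ι] {κ : ι → E → E →L[ℝ] ℝ} {x₀ : E}
    (hκ : ∀ i, SmoothNear (κ i) x₀) (hi : LinearIndependent ℝ fun i => κ i x₀)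
    {ψ : E → E →L[ℝ] ℝ} (hψ : SmoothNear ψ x₀)
    (hspan : ∀ᶠ y in 𝓝 x₀, ψ y ∈ Submodule.span ℝ (range fun i => κ i y)) :
    ∃ a : ι → E → ℝ, (∀ i, SmoothNear (a i) x₀) ∧ ∀ᶠ y in 𝓝 x₀, ψ y = ∑ i, a i y • κ i y := by
  classical
  have hΘ : ∀ᶠ y in 𝓝 x₀, ContDiffAt ℝ ∞ (fun y => ContinuousLinearMap.pi fun i => κ i y) y := by
    filter_upwards [Filter.eventually_all.2 hκ] with y hy using contDiffAt_clm_pi hy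
  obtain ⟨c, hc, hc'⟩ := exists_smooth_coeff hΘ (surjective_pi_of_linearIndependent hi) hψ (by
    filter_upwards [hspan] with y hy v hv
    exact (mem_ker_span_iff (fun i => κ i y) v).2 (fun i => congrFun hv i) _ hy)
  refine ⟨fun i y => c y (Pi.single i 1), fun i => ?_, ?_⟩
  · filter_upwards [hc] with y hy using hy.clm_apply contDiffAt_const
  · filter_upwards [hc'] with y hy
    rw [hy]
    ext v
    rw [ContinuousLinearMap.comp_apply, _root_.sum_apply]
    conv_lhs => rw [← Finset.univ_sum_single (ContinuousLinearMap.pi (fun i => κ i y) v)]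
    rw [map_sum]
    refine Finset.sum_congr rfl fun i _ => ?_
    have : Pi.single i (ContinuousLinearMap.pi (fun i => κ i y) v i) =
        (κ i y v) • (Pi.single i (1 : ℝ) : ι → ℝ) := by
      rw [← Pi.single_smul, smul_eq_mul, mul_one]
      rfl
    rw [this, map_smul, smul_apply, smul_eq_mul, smul_eq_mul, mul_comm]

theorem finrank_sup_span_singleton_le {V : Type*} [AddCommGroup V] [Module ℝ V]
    [FiniteDimensional ℝ V] (P : Submodule ℝ V) (a : V) :
    Module.finrank ℝ ↥(P ⊔ Submodule.span ℝ {a}) ≤ Module.finrank ℝ P + 1 :=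
  (Submodule.finrank_add_le_finrank_add_finrank _ _).trans
    (Nat.add_le_add_left ((finrank_span_le_card _).trans (by simp)) _)

theorem exists_perm_apply {n : ℕ} (hn : 2 ≤ n) {i j : Fin n} (hij : i ≠ j) :
    ∃ e : Equiv.Perm (Fin n), e ⟨0, by omega⟩ = i ∧ e ⟨n - 1, by omega⟩ = j := by
  set z : Fin n := ⟨0, by omega⟩
  set l : Fin n := ⟨n - 1, by omega⟩
  have hzl : z ≠ l := by
    intro h
    have : (0 : ℕ) = n - 1 := congrArg Fin.val h
    omega
  have hz : Equiv.swap z i j ≠ z := by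
    intro h
    exact hij ((Equiv.swap z i).injective (by rw [h, Equiv.swap_apply_right]))
  refine ⟨(Equiv.swap l (Equiv.swap z i j)).trans (Equiv.swap z i), ?_, ?_⟩
  · rw [Equiv.trans_apply, Equiv.swap_apply_of_ne_of_ne hzl hz.symm, Equiv.swap_apply_left]
  · rw [Equiv.trans_apply, Equiv.swap_apply_left, Equiv.swap_apply_self]

end SmoothCoefficients

section Flag

variable {E : Type u} [NormedAddCommGroup E] [NormedSpace ℝ E] [FiniteDimensional ℝ E]
variable {n K : ℕ} {G : ℕ → E → Submodule ℝ (E →L[ℝ] ℝ)} {C : ℕ → E → Submodule ℝ E}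
  {σ : E → E →L[ℝ] ℝ} {x₀ : E} {X : E → E}

theorem IsPfaffianFlag.finrank_eq (h : IsPfaffianFlag n K G C σ x₀) {k : ℕ} (hk : k ≤ K) :
    ∀ᶠ y in 𝓝 x₀, Module.finrank ℝ (G k y) = n + k := by
  obtain ⟨κ, hκ⟩ := h.frame k hk
  filter_upwards [hκ.span, hκ.indep] with y h1 h2
  rw [← h1, finrank_span_eq_card h2, Fintype.card_fin]

/-- Dimension counts in `perp (C 0 x₀)`, which has dimension `n + 3`. If all contractions were in `G
K`, it would be contained in its intersection with `G K` (of dimension at most `n + 1`, the rank of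
`G 1`) plus the line of `σ`. If all contractions were dependent on the frame, `σ` and one of them,
its dimension would be at most `n + 2`. The two exceptional members of the frame are moved to the
first and the last place. -/
theorem IsPfaffianFlag.exists_frame_contr (h : IsPfaffianFlag n K G C σ x₀)
    (hX : ∀ᶠ y in 𝓝 x₀, (∀ α ∈ G K y, α (X y) = 0) ∧ σ y (X y) = 1) (hn : 2 ≤ n) :
    ∃ κ : Fin (n + 0) → E → E →L[ℝ] ℝ, IsFrameNear (G 0) κ x₀ ∧
      contr X (κ ⟨0, by omega⟩) x₀ ∉ G K x₀ ∧
      LinearIndependent ℝ (Sum.elim (Sum.elim (Sum.elim (fun i => κ i x₀) fun _ : Unit => σ x₀)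
        fun _ : Unit => contr X (κ ⟨0, by omega⟩) x₀)
        fun _ : Unit => contr X (κ ⟨n - 1, by omega⟩) x₀) := by
  obtain ⟨κ, hκ⟩ := h.frame 0 (Nat.zero_le _)
  have h0 := (h.perp_le hX (Nat.zero_le K) hκ).self_of_nhds
  have h1 := (h.mem_perp hX (Nat.zero_le K) hκ).self_of_nhds
  have h2 := (h.le_top 0 (Nat.zero_le _)).self_of_nhds
  have hX0 := hX.self_of_nhds
  have hspan := hκ.span.self_of_nhds
  have hfin := finrank_add_finrank_perp (C 0 x₀)
  have hfin0 := h.finrank_zero.self_of_nhds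
  have hG0 := (h.finrank_eq (Nat.zero_le K)).self_of_nhds
  obtain ⟨i, hi⟩ : ∃ i, contr X (κ i) x₀ ∉ G K x₀ := by
    by_contra! hall
    have h3 := Submodule.finrank_mono (h0 ((perp (C 0 x₀) ⊓ G K x₀) ⊔ Submodule.span ℝ {σ x₀})
      ((le_inf h1.1 h2).trans le_sup_left)
      (Submodule.mem_sup_right (Submodule.mem_span_singleton_self _))
      fun i => Submodule.mem_sup_left ⟨h1.2 i, hall i⟩)
    have h4 := finrank_sup_span_singleton_le (perp (C 0 x₀) ⊓ G K x₀) (σ x₀)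
    have h5 : Module.finrank ℝ ↥(perp (C 0 x₀) ⊓ G K x₀) ≤ n + 1 := by
      rcases Nat.eq_zero_or_pos K with rfl | hK
      · exact (Submodule.finrank_mono inf_le_right).trans (by omega)
      · rw [← (h.next 0 hK).self_of_nhds, (h.finrank_eq (k := 0 + 1) hK).self_of_nhds]
    omega
  have hσ : σ x₀ ∉ Submodule.span ℝ (range fun i => κ i x₀) := by
    rw [hspan]
    exact fun h3 => h.notMem.self_of_nhds (h2 h3)
  have hli1 := linearIndependent_sum_unit hκ.indep.self_of_nhds hσ
  -- Contractions vanish on `X`, so a relation could not involve `σ` and would put the contraction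
  -- into `G K`.
  have hi' : contr X (κ i) x₀ ∉
      Submodule.span ℝ (range (Sum.elim (fun i => κ i x₀) fun _ : Unit => σ x₀)) := by
    refine notMem_span_range_sum fun h3 => ?_
    rw [hspan, Submodule.mem_sup] at h3
    obtain ⟨g, hg, a, ha, hga⟩ := h3
    obtain ⟨s, rfl⟩ := Submodule.mem_span_singleton.1 ha
    have h4 := congrArg (fun α => α (X x₀)) hga
    simp only [add_apply, smul_apply, contr_self, hX0.1 g (h2 hg), hX0.2, smul_eq_mul] at h4
    have h5 : s = 0 := by linarith
    rw [h5, zero_smul, add_zero] at hga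
    exact hi (hga ▸ h2 hg)
  have hli2 := linearIndependent_sum_unit hli1 hi'
  obtain ⟨j, hj⟩ : ∃ j, contr X (κ j) x₀ ∉ Submodule.span ℝ (range (Sum.elim
      (Sum.elim (fun i => κ i x₀) fun _ : Unit => σ x₀) fun _ : Unit => contr X (κ i) x₀)) := by
    by_contra! hall
    have h3 := Submodule.finrank_mono (h0 (Submodule.span ℝ (range (Sum.elim
      (Sum.elim (fun i => κ i x₀) fun _ : Unit => σ x₀) fun _ : Unit => contr X (κ i) x₀))) (by
      rw [← hspan, Submodule.span_le]
      rintro _ ⟨l, rfl⟩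
      exact Submodule.subset_span ⟨Sum.inl (Sum.inl l), rfl⟩)
      (Submodule.subset_span ⟨Sum.inl (Sum.inr ()), rfl⟩) hall)
    rw [finrank_span_eq_card hli2] at h3
    simp only [Fintype.card_sum, Fintype.card_fin, Fintype.card_unit] at h3
    omega
  have hij : i ≠ j := by
    rintro rfl
    exact hj (Submodule.subset_span ⟨Sum.inr (), rfl⟩)
  have hli3 := linearIndependent_sum_unit hli2 hj
  obtain ⟨e, he0, he1⟩ := exists_perm_apply (n := n + 0) hn hij
  refine ⟨fun l => κ (e l), ⟨fun l => hκ.smooth _, ?_, ?_⟩, ?_, ?_⟩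
  · filter_upwards [hκ.indep] with y hy using hy.comp e e.injective
  · filter_upwards [hκ.span] with y hy
    rw [← hy]
    congr 1
    exact e.surjective.range_comp (fun l => κ l y)
  · simp only [he0]
    exact hi
  · simp only [he0]
    have he1' : e ⟨n - 1, by omega⟩ = j := he1
    rw [he1']
    have h5 := hli3.comp (Sum.map (Sum.map (Sum.map e id) id) id)
      (((e.injective.sumMap Function.injective_id).sumMap Function.injective_id).sumMap
        Function.injective_id)
    have h6 : (Sum.elim (Sum.elim (Sum.elim (fun i => κ i x₀) fun _ : Unit => σ x₀)
        fun _ : Unit => contr X (κ i) x₀) fun _ : Unit => contr X (κ j) x₀) ∘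
        (Sum.map (Sum.map (Sum.map e id) id) id) =
        Sum.elim (Sum.elim (Sum.elim (fun i => κ (e i) x₀) fun _ : Unit => σ x₀)
        fun _ : Unit => contr X (κ i) x₀) fun _ : Unit => contr X (κ j) x₀ := by
      funext l
      rcases l with ((l | l) | l) | l <;> rfl
    rwa [h6] at h5

/-- The contractions of the first and the last form span, with `G 0` and `σ`, the whole Cartan
system. Subtracting suitable multiples of these two forms from a middle form therefore removes its
contraction modulo `G 0`. -/
theorem IsPfaffianFlag.exists_adapted_zero (h : IsPfaffianFlag n K G C σ x₀)
    (hXs : SmoothNear X x₀)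
    (hX : ∀ᶠ y in 𝓝 x₀, (∀ α ∈ G K y, α (X y) = 0) ∧ σ y (X y) = 1) (hn : 2 ≤ n) :
    ∃ b : ℕ → E → E →L[ℝ] ℝ, (∀ i < n + 0, SmoothNear (b i) x₀) ∧
      ∀ᶠ y in 𝓝 x₀, IsAdaptedAt n K G X 0 b y := by
  obtain ⟨κ, hκ, hfirst, hli⟩ := h.exists_frame_contr hX hn
  set z : Fin (n + 0) := ⟨0, by omega⟩ with hz
  set l : Fin (n + 0) := ⟨n - 1, by omega⟩ with hl
  set Λ : ((Fin (n + 0) ⊕ Unit) ⊕ Unit) ⊕ Unit → E → E →L[ℝ] ℝ :=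
    Sum.elim (Sum.elim (Sum.elim κ fun _ => σ) fun _ => contr X (κ z)) fun _ => contr X (κ l)
    with hΛ
  have hΛs : ∀ i, SmoothNear (Λ i) x₀ := by
    rintro (((i | i) | i) | i)
    · exact hκ.smooth i
    · exact h.smooth_σ
    · exact hXs.contr (hκ.smooth z)
    · exact hXs.contr (hκ.smooth l)
  have hΛi : LinearIndependent ℝ fun i => Λ i x₀ := by
    have h1 : (fun i => Λ i x₀) = Sum.elim (Sum.elim (Sum.elim (fun i => κ i x₀)
        fun _ : Unit => σ x₀) fun _ : Unit => contr X (κ z) x₀)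
        fun _ : Unit => contr X (κ l) x₀ := by
      funext i
      rcases i with ((i | i) | i) | i <;> rfl
    rw [h1]
    exact hli
  have hspan : ∀ᶠ y in 𝓝 x₀, ∀ i, contr X (κ i) y ∈ Submodule.span ℝ (range fun i => Λ i y) := by
    filter_upwards [eventually_linearIndependent hΛs hΛi, h.mem_perp hX (Nat.zero_le K) hκ,
      h.finrank_zero, h.char 0 (Nat.zero_le K), hκ.span] with y h1 h2 h3 h4 h5 i
    -- The `n + 3` independent forms `Λ` fill the Cartan system at every nearby point, so the
    -- contractions have smooth coefficients in them.
    have h6 : Submodule.span ℝ (range fun i => Λ i y) = perp (C 0 y) := by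
      refine Submodule.eq_of_le_of_finrank_le ?_ ?_
      · rw [Submodule.span_le]
        rintro _ ⟨((i | i) | i) | i, rfl⟩
        · exact h2.1 (by
            rw [← h5]
            exact Submodule.subset_span ⟨i, rfl⟩)
        · exact h4
        · exact h2.2 z
        · exact h2.2 l
      · have h7 := finrank_add_finrank_perp (C 0 y)
        rw [finrank_span_eq_card h1]
        simp only [Fintype.card_sum, Fintype.card_fin, Fintype.card_unit]
        omega
    rw [h6]
    exact h2.2 i
  have hcoef : ∀ i, ∃ a : ((Fin (n + 0) ⊕ Unit) ⊕ Unit) ⊕ Unit → E → ℝ,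
      (∀ i, SmoothNear (a i) x₀) ∧ ∀ᶠ y in 𝓝 x₀, contr X (κ i) y = ∑ j, a j y • Λ j y := fun i =>
    exists_smooth_coeffs hΛs hΛi (hXs.contr (hκ.smooth i)) (hspan.mono fun y hy => hy i)
  choose a ha ha' using hcoef
  set s : Fin (n + 0) → E → ℝ := fun i y => -(a i (Sum.inl (Sum.inr ())) y) with hs
  set t : Fin (n + 0) → E → ℝ := fun i y => -(a i (Sum.inr ()) y) with ht
  set m : Fin (n + 0) → E → E →L[ℝ] ℝ := fun i y => κ i y + s i y • κ z y with hm
  set m' : Fin (n + 0) → E → E →L[ℝ] ℝ := fun i y => m i y + t i y • κ l y with hm'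
  set b : ℕ → E → E →L[ℝ] ℝ := fun i => if hi : i < n + 0 then
    (if i = 0 ∨ i = n - 1 then κ ⟨i, hi⟩ else m' ⟨i, hi⟩) else 0 with hb
  have hss : ∀ i, SmoothNear (s i) x₀ := fun i => (ha i _).mono fun y hy => hy.neg
  have hts : ∀ i, SmoothNear (t i) x₀ := fun i => (ha i _).mono fun y hy => hy.neg
  have hms : ∀ i, SmoothNear (m i) x₀ := fun i => by
    filter_upwards [hκ.smooth i, hss i, hκ.smooth z] with y h1 h2 h3 using h1.add (h2.smul h3)
  have hms' : ∀ i, SmoothNear (m' i) x₀ := fun i => by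
    filter_upwards [hms i, hts i, hκ.smooth l] with y h1 h2 h3 using h1.add (h2.smul h3)
  have hbz : b 0 = κ z := by
    simp only [hb]
    rw [dif_pos (by omega), if_pos (Or.inl trivial)]
  have hbl : b (n - 1) = κ l := by
    simp only [hb]
    rw [dif_pos (by omega), if_pos (Or.inr trivial)]
  have hbm : ∀ i (hi : i < n + 0), 0 < i → i ≠ n - 1 → b i = m' ⟨i, hi⟩ := by
    intro i hi h0 h1
    simp only [hb]
    rw [dif_pos hi, if_neg (by omega)]
  refine ⟨b, fun i hi => ?_, ?_⟩
  · by_cases h1 : i = 0 ∨ i = n - 1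
    · rcases h1 with rfl | rfl
      · rw [hbz]
        exact hκ.smooth z
      · rw [hbl]
        exact hκ.smooth l
    · rw [hbm i hi (by omega) (by omega)]
      exact hms' _
  have hfirst' : ∀ᶠ y in 𝓝 x₀, contr X (κ z) y ∉ G K y := by
    obtain ⟨μ, hμ⟩ := h.frame K le_rfl
    have hμi := linearIndependent_sum_unit hμ.indep.self_of_nhds (α := contr X (κ z) x₀) (by
      rw [hμ.span.self_of_nhds]
      exact hfirst)
    have hμs : ∀ i, SmoothNear (Sum.elim μ (fun _ : Unit => contr X (κ z)) i) x₀ := by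
      rintro (i | i)
      · exact hμ.smooth i
      · exact hXs.contr (hκ.smooth z)
    have hμi' : LinearIndependent ℝ fun i => Sum.elim μ (fun _ : Unit => contr X (κ z)) i x₀ := by
      have h1 : (fun i => Sum.elim μ (fun _ : Unit => contr X (κ z)) i x₀) =
          Sum.elim (fun i => μ i x₀) fun _ : Unit => contr X (κ z) x₀ := by
        funext i
        rcases i with i | i <;> rfl
      rw [h1]
      exact hμi
    filter_upwards [eventually_linearIndependent hμs hμi', hμ.span] with y h1 h2 h3
    have h4 := h1.notMem_span_image (s := range Sum.inl) (x := Sum.inr ()) (by simp)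
    rw [← range_comp] at h4
    refine h4 ?_
    have h5 : ((fun i => Sum.elim μ (fun _ : Unit => contr X (κ z)) i y) ∘ Sum.inl) =
      fun i => μ i y := rfl
    rw [h5, h2]
    exact h3
  filter_upwards [hfirst', hκ.span, Filter.eventually_all.2 ha', Filter.eventually_all.2 hms,
    Filter.eventually_all.2 hss, Filter.eventually_all.2 hts, Filter.eventually_all.2 hκ.smooth,
    hX, h.le_top 0 (Nat.zero_le K)] with y h1 h2 h3 h4 h5 h6 h7 h8 h9
  have hκG : ∀ i, κ i y ∈ G 0 y := fun i => by
    rw [← h2]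
    exact Submodule.subset_span ⟨i, rfl⟩
  have hκX : ∀ i, κ i y (X y) = 0 := fun i => h8.1 _ (h9 (hκG i))
  have hmG : ∀ i, m' i y ∈ G 0 y := fun i =>
    add_mem (add_mem (hκG i) (Submodule.smul_mem _ _ (hκG z))) (Submodule.smul_mem _ _ (hκG l))
  refine ⟨fun j hj => ?_, ?_, fun i hi0 hi1 => ?_, fun j hj => absurd hj (Nat.not_lt_zero j)⟩
  · obtain rfl : j = 0 := by omega
    refine le_antisymm ?_ ?_
    · rw [Submodule.span_le]
      rintro _ ⟨i, rfl⟩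
      by_cases h10 : i.1 = 0 ∨ i.1 = n - 1
      · rcases h10 with h10 | h10
        · simp only [h10, hbz]
          exact hκG z
        · simp only [h10, hbl]
          exact hκG l
      · simp only [hbm i.1 i.2 (by omega) (by omega)]
        exact hmG _
    · rw [← h2, Submodule.span_le]
      rintro _ ⟨i, rfl⟩
      set P := Submodule.span ℝ (range fun i : Fin (n + 0) => b i y) with hP
      have hPz : κ z y ∈ P := Submodule.subset_span ⟨z, by
        show b 0 y = κ z y
        rw [hbz]⟩
      have hPl : κ l y ∈ P := Submodule.subset_span ⟨l, by
        show b (n - 1) y = κ l y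
        rw [hbl]⟩
      by_cases h10 : i.1 = 0 ∨ i.1 = n - 1
      · rcases h10 with h10 | h10
        · obtain rfl : i = z := Fin.ext h10
          exact hPz
        · obtain rfl : i = l := Fin.ext h10
          exact hPl
      · have hPi : m' i y ∈ P := Submodule.subset_span ⟨i, by
          show b i.1 y = m' i y
          rw [hbm i.1 i.2 (by omega) (by omega)]⟩
        have h11 : κ i y = m' i y - s i y • κ z y - t i y • κ l y := by
          simp only [hm', hm]
          abel
        show κ i y ∈ P
        rw [h11]
        exact sub_mem (sub_mem hPi (Submodule.smul_mem _ _ hPz)) (Submodule.smul_mem _ _ hPl)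
  · rw [hbz]
    exact h1
  · have hi : i < n + 0 := by omega
    rw [hbm i hi hi0 (by omega)]
    set i' : Fin (n + 0) := ⟨i, hi⟩ with hi'
    have hc1 : contr X (m' i') y = contr X (m i') y + t i' y • contr X (κ l) y +
        (fderiv ℝ (t i') y (X y)) • κ l y := contr_add_smul (h4 i') (h7 l) (h6 i') (hκX l)
    have hc2 : contr X (m i') y = contr X (κ i') y + s i' y • contr X (κ z) y +
        (fderiv ℝ (s i') y (X y)) • κ z y := contr_add_smul (h7 i') (h7 z) (h5 i') (hκX z)
    have h10 : contr X (κ i') y = ∑ j, a i' (Sum.inl (Sum.inl (Sum.inl j))) y • κ j y +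
        a i' (Sum.inl (Sum.inl (Sum.inr ()))) y • σ y +
        a i' (Sum.inl (Sum.inr ())) y • contr X (κ z) y +
        a i' (Sum.inr ()) y • contr X (κ l) y := by
      rw [h3 i']
      simp only [Fintype.sum_sum_type, Fintype.sum_unique]
      rfl
    have h11 : contr X (m' i') y = (∑ j, a i' (Sum.inl (Sum.inl (Sum.inl j))) y • κ j y +
        (fderiv ℝ (s i') y (X y)) • κ z y + (fderiv ℝ (t i') y (X y)) • κ l y) +
        a i' (Sum.inl (Sum.inl (Sum.inr ()))) y • σ y := by
      rw [hc1, hc2, h10]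
      simp only [hs, ht]
      module
    have h12 : (∑ j, a i' (Sum.inl (Sum.inl (Sum.inl j))) y • κ j y +
        (fderiv ℝ (s i') y (X y)) • κ z y + (fderiv ℝ (t i') y (X y)) • κ l y) ∈ G 0 y :=
      add_mem (add_mem (Submodule.sum_mem _ fun j _ => Submodule.smul_mem _ _ (hκG j))
        (Submodule.smul_mem _ _ (hκG z))) (Submodule.smul_mem _ _ (hκG l))
    -- Evaluation on `X` kills the contraction and all of `G 0`, so the coefficient of `σ` must
    -- vanish.
    have h13 := congrArg (fun α => α (X y)) h11
    simp only [contr_self] at h13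
    rw [add_apply, h8.1 _ (h9 h12), smul_apply, h8.2, zero_add, smul_eq_mul, mul_one] at h13
    rw [h11, ← h13, zero_smul, add_zero]
    exact h12

end Flag

section Flag

variable {E : Type u} [NormedAddCommGroup E] [NormedSpace ℝ E] [FiniteDimensional ℝ E]
variable {n K : ℕ} {G : ℕ → E → Submodule ℝ (E →L[ℝ] ℝ)} {C : ℕ → E → Submodule ℝ E}
  {σ : E → E →L[ℝ] ℝ} {x₀ : E} {X : E → E}

/-- A form of `G (k + 1)` outside `G k` lies in the Cartan system and in `G K`, hence kills `X` and
has no `σ`-part. It must involve the contraction of the last form, since a multiple of the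
contraction of `b 0` alone would have to lie in `G K`. -/
theorem IsPfaffianFlag.exists_next_form (h : IsPfaffianFlag n K G C σ x₀)
    (hX : ∀ᶠ y in 𝓝 x₀, (∀ α ∈ G K y, α (X y) = 0) ∧ σ y (X y) = 1) (hn : 2 ≤ n) {k : ℕ}
    (hk : k < K) {b : ℕ → E → E →L[ℝ] ℝ} (hb : ∀ i < n + k, SmoothNear (b i) x₀)
    (had : ∀ᶠ y in 𝓝 x₀, IsAdaptedAt n K G X k b y) :
    ∀ᶠ y in 𝓝 x₀, ∃ β ∈ G (k + 1) y, β ∉ G k y ∧ ∃ g ∈ G k y, ∃ r t : ℝ, t ≠ 0 ∧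
      β = g + r • contr X (b 0) y + t • contr X (b (n - 1 + k)) y := by
  filter_upwards [h.exists_decomp hX hn hk.le hb had, h.finrank_eq hk.le, h.finrank_eq (k := k + 1) hk,
    h.next k hk, hX, h.le_top k hk.le, had] with y h1 h2 h3 h4 h5 h6 h7
  obtain ⟨β, hβ, hβk⟩ : ∃ β ∈ G (k + 1) y, β ∉ G k y := by
    by_contra! hall
    have := Submodule.finrank_mono (show G (k + 1) y ≤ G k y from hall)
    omega
  have hβ' := hβ
  rw [h4] at hβ'
  obtain ⟨g, hg, r, t, s, hs, hs'⟩ := h1 β hβ'.1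
  rw [h5.1 β hβ'.2] at hs'
  rw [hs', zero_smul, add_zero] at hs
  refine ⟨β, hβ, hβk, g, hg, r, t, ?_, hs⟩
  rintro rfl
  rw [zero_smul, add_zero] at hs
  rcases eq_or_ne r 0 with rfl | hr
  · rw [zero_smul, add_zero] at hs
    exact hβk (hs ▸ hg)
  · refine h7.first ((Submodule.smul_mem_iff _ hr).1 ?_)
    have := sub_mem hβ'.2 (h6 hg)
    rwa [hs, add_sub_cancel_left] at this

/-- The contraction of the last form lies in `G (k + 1)` plus the line spanned by the contraction of
`b 0`. Adding a multiple of `b 0` to the last form removes the second part, and the corrected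
contraction is itself the next member of the frame. -/
theorem IsPfaffianFlag.exists_adapted_succ (h : IsPfaffianFlag n K G C σ x₀)
    (hXs : SmoothNear X x₀)
    (hX : ∀ᶠ y in 𝓝 x₀, (∀ α ∈ G K y, α (X y) = 0) ∧ σ y (X y) = 1) (hn : 2 ≤ n) {k : ℕ}
    (hk : k < K) {b : ℕ → E → E →L[ℝ] ℝ} (hb : ∀ i < n + k, SmoothNear (b i) x₀)
    (had : ∀ᶠ y in 𝓝 x₀, IsAdaptedAt n K G X k b y) :
    ∃ b' : ℕ → E → E →L[ℝ] ℝ, (∀ i < n + (k + 1), SmoothNear (b' i) x₀) ∧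
      ∀ᶠ y in 𝓝 x₀, IsAdaptedAt n K G X (k + 1) b' y := by
  have hnext := h.exists_next_form hX hn hk hb had
  obtain ⟨κ, hκ⟩ := h.frame (k + 1) hk
  set Λ : Fin (n + (k + 1)) ⊕ Unit → E → E →L[ℝ] ℝ := Sum.elim κ fun _ => contr X (b 0) with hΛ
  have hΛs : ∀ i, SmoothNear (Λ i) x₀ := by
    rintro (i | i)
    · exact hκ.smooth i
    · exact hXs.contr (hb 0 (by omega))
  have hΛi : LinearIndependent ℝ fun i => Λ i x₀ := by
    have h1 : (fun i => Λ i x₀) = Sum.elim (fun i => κ i x₀) fun _ : Unit => contr X (b 0) x₀ := by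
      funext i
      rcases i with i | i <;> rfl
    rw [h1]
    refine linearIndependent_sum_unit hκ.indep.self_of_nhds ?_
    rw [hκ.span.self_of_nhds]
    exact fun h2 => had.self_of_nhds.first ((h.le_top (k + 1) hk).self_of_nhds h2)
  have hspan : ∀ᶠ y in 𝓝 x₀,
      contr X (b (n - 1 + k)) y ∈ Submodule.span ℝ (range fun i => Λ i y) := by
    filter_upwards [hnext, hκ.span, h.le_succ k hk] with y ⟨β, hβ, _, g, hg, r, t, ht, hs⟩ h2 h3
    have h4 : G (k + 1) y ≤ Submodule.span ℝ (range fun i => Λ i y) := by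
      rw [← h2]
      refine Submodule.span_mono ?_
      rintro _ ⟨i, rfl⟩
      exact ⟨Sum.inl i, rfl⟩
    have h5 : contr X (b 0) y ∈ Submodule.span ℝ (range fun i => Λ i y) :=
      Submodule.subset_span ⟨Sum.inr (), rfl⟩
    refine (Submodule.smul_mem_iff _ ht).1 ?_
    have h6 : t • contr X (b (n - 1 + k)) y = β - g - r • contr X (b 0) y := by
      rw [hs]
      module
    rw [h6]
    exact sub_mem (sub_mem (h4 hβ) (h4 (h3 hg))) (Submodule.smul_mem _ _ h5)
  obtain ⟨a, ha, ha'⟩ := exists_smooth_coeffs hΛs hΛi (hXs.contr (hb (n - 1 + k) (by omega))) hspan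
  -- Minus the coefficient of `contr X (b 0)`, so that it cancels in `contr X e`.
  set c : E → ℝ := fun y => -(a (Sum.inr ()) y) with hc
  have hcs : SmoothNear c x₀ := (ha _).mono fun y hy => hy.neg
  set e : E → E →L[ℝ] ℝ := fun y => b (n - 1 + k) y + c y • b 0 y with he
  have hes : SmoothNear e x₀ := by
    filter_upwards [hb (n - 1 + k) (by omega), hcs, hb 0 (by omega)] with y h1 h2 h3
      using h1.add (h2.smul h3)
  set b' : ℕ → E → E →L[ℝ] ℝ := fun i => if i = n - 1 + k then e else
    if i = n + k then contr X e else b i with hb'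
  have hbe : b' (n - 1 + k) = e := if_pos rfl
  have hbc : b' (n + k) = contr X e := by
    simp only [hb']
    rw [if_neg (by omega), if_pos trivial]
  have hbb : ∀ i, i ≠ n - 1 + k → i ≠ n + k → b' i = b i := fun i h1 h2 => by
    simp only [hb']
    rw [if_neg h1, if_neg h2]
  refine ⟨b', fun i hi => ?_, ?_⟩
  · rcases eq_or_ne i (n - 1 + k) with rfl | h1
    · rw [hbe]
      exact hes
    · rcases eq_or_ne i (n + k) with rfl | h2
      · rw [hbc]
        exact hXs.contr hes
      · rw [hbb i h1 h2]
        exact hb i (by omega)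
  filter_upwards [had, hnext, ha', hκ.span, hX, h.le_top k hk.le, h.le_succ k hk,
    hb (n - 1 + k) (by omega), hb 0 (by omega), hcs, h.finrank_eq hk.le,
    h.finrank_eq (k := k + 1) hk, h.le_top (k + 1) hk] with y h1 ⟨β, hβ, hβk, g, hg, r, t, ht, hs⟩ h3 h4 h5 h6 h7 h8 h9
      h10 h11 h12 h13K
  have hb0 : b 0 y ∈ G 0 y := h1.mem (Nat.zero_le _) (by omega)
  have hb0j : ∀ j ≤ k, b 0 y ∈ G j y := fun j hj => h1.mem hj (by omega)
  have hce : contr X e y = contr X (b (n - 1 + k)) y + c y • contr X (b 0) y +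
      (fderiv ℝ c y (X y)) • b 0 y :=
    contr_add_smul h8 h9 h10 (h5.1 _ (h6 (hb0j k le_rfl)))
  have hce1 : contr X e y ∈ G (k + 1) y := by
    have h13 : contr X (b (n - 1 + k)) y = ∑ j, a (Sum.inl j) y • κ j y +
        a (Sum.inr ()) y • contr X (b 0) y := by
      rw [h3]
      simp only [Fintype.sum_sum_type, Fintype.sum_unique]
      rfl
    have h14 : contr X e y = ∑ j, a (Sum.inl j) y • κ j y + (fderiv ℝ c y (X y)) • b 0 y := by
      rw [hce, h13]
      simp only [hc]
      module
    rw [h14]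
    refine add_mem (Submodule.sum_mem _ fun j _ => Submodule.smul_mem _ _ ?_)
      (Submodule.smul_mem _ _ (h7 (hb0j k le_rfl)))
    rw [← h4]
    exact Submodule.subset_span ⟨j, rfl⟩
  -- Otherwise the new form `β` would be an element of `G k` plus a multiple of `contr X (b 0) y`,
  -- and the latter is not in `G K`.
  have hce2 : contr X e y ∉ G k y := by
    intro h13
    have h14 : β = (g + t • contr X e y - (t * fderiv ℝ c y (X y)) • b 0 y) +
        (r - t * c y) • contr X (b 0) y := by
      rw [hs, hce]
      module
    have h15 : g + t • contr X e y - (t * fderiv ℝ c y (X y)) • b 0 y ∈ G k y :=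
      sub_mem (add_mem hg (Submodule.smul_mem _ _ h13)) (Submodule.smul_mem _ _ (hb0j k le_rfl))
    rcases eq_or_ne (r - t * c y) 0 with h16 | h16
    · rw [h16, zero_smul, add_zero] at h14
      exact hβk (h14 ▸ h15)
    · refine h1.first ((Submodule.smul_mem_iff _ h16).1 ?_)
      have hβK : β ∈ G K y := h13K hβ
      have := sub_mem hβK (h6 h15)
      rwa [h14, add_sub_cancel_left] at this
  have hbk : ∀ i < n + k, b' i y ∈ G k y := fun i hi => by
    rcases eq_or_ne i (n - 1 + k) with rfl | h13
    · rw [hbe]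
      exact add_mem (h1.mem le_rfl (by omega)) (Submodule.smul_mem _ _ (hb0j k le_rfl))
    · rw [hbb i h13 (by omega)]
      exact h1.mem le_rfl hi
  have hspank : Submodule.span ℝ (range fun i : Fin (n + k) => b' i y) = G k y := by
    refine le_antisymm ?_ ?_
    · rw [Submodule.span_le]
      rintro _ ⟨i, rfl⟩
      exact hbk i i.2
    · rw [← h1.span k le_rfl, Submodule.span_le]
      rintro _ ⟨i, rfl⟩
      have h0 : b 0 y ∈ Submodule.span ℝ (range fun i : Fin (n + k) => b' i y) :=
        Submodule.subset_span ⟨⟨0, by omega⟩, by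
          show b' 0 y = b 0 y
          rw [hbb 0 (by omega) (by omega)]⟩
      rcases eq_or_ne i.1 (n - 1 + k) with h13 | h13
      · have h14 : e y ∈ Submodule.span ℝ (range fun i : Fin (n + k) => b' i y) :=
          Submodule.subset_span ⟨i, by
            show b' i.1 y = e y
            rw [h13, hbe]⟩
        have h15 := sub_mem h14 (Submodule.smul_mem _ (c y) h0)
        show b i.1 y ∈ _
        rw [h13]
        rwa [he, add_sub_cancel_right] at h15
      · exact Submodule.subset_span ⟨i, by
          show b' i.1 y = b i.1 y
          rw [hbb i.1 h13 (by have := i.2; omega)]⟩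
  refine ⟨fun j hj => ?_, ?_, fun i hi0 hi1 => ?_, fun j hj => ?_⟩
  · rcases Nat.lt_or_ge j k with hjk | hjk
    · rw [← h1.span j hjk.le]
      congr 2
      funext i
      rw [hbb i.1 (by have := i.2; omega) (by have := i.2; omega)]
    · rcases hjk.eq_or_lt with rfl | hjk
      · exact hspank
      · obtain rfl : j = k + 1 := by omega
        have h13 : G k y ≤ Submodule.span ℝ (range fun i : Fin (n + (k + 1)) => b' i y) := by
          rw [← hspank]
          refine Submodule.span_mono ?_
          rintro _ ⟨i, rfl⟩
          exact ⟨⟨i.1, by have := i.2; omega⟩, rfl⟩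
        have h14 : contr X e y ∈ Submodule.span ℝ (range fun i : Fin (n + (k + 1)) => b' i y) :=
          Submodule.subset_span ⟨⟨n + k, by omega⟩, by
            show b' (n + k) y = _
            rw [hbc]⟩
        -- The span strictly contains `G k`, of dimension `n + k`, and lies in `G (k + 1)`, of
        -- dimension `n + k + 1`.
        have h15 := Submodule.finrank_lt_finrank_of_lt
          (lt_of_le_of_ne h13 fun h16 => hce2 (h16 ▸ h14))
        refine Submodule.eq_of_le_of_finrank_le ?_ (by omega)
        rw [Submodule.span_le]
        rintro _ ⟨i, rfl⟩
        rcases Nat.lt_or_ge i.1 (n + k) with h16 | h16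
        · exact h7 (hbk i h16)
        · have h17 : i.1 = n + k := by have := i.2; omega
          show b' i.1 y ∈ _
          rw [h17, hbc]
          exact hce1
  · rw [hbb 0 (by omega) (by omega)]
    exact h1.first
  · rw [hbb i (by omega) (by omega)]
    exact h1.middle i hi0 hi1
  · rcases Nat.lt_or_ge j k with hjk | hjk
    · rw [hbb (n - 1 + j) (by omega) (by omega)]
      -- For `j = k - 1` the form `b (n + j)` is the one that was corrected; the correction is a
      -- multiple of `b 0` and lies in `G j`, so the earlier equation survives.
      rcases eq_or_ne (n + j) (n - 1 + k) with h13 | h13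
      · have h14 := sub_mem (h1.last j hjk) (Submodule.smul_mem _ (c y) (hb0j j hjk.le))
        rw [h13, hbe]
        rw [h13, sub_sub] at h14
        exact h14
      · rw [hbb (n + j) h13 (by omega)]
        exact h1.last j hjk
    · obtain rfl : j = k := by omega
      rw [hbe, hbc, sub_self]
      exact zero_mem _

theorem IsPfaffianFlag.exists_adapted (h : IsPfaffianFlag n K G C σ x₀)
    (hXs : SmoothNear X x₀)
    (hX : ∀ᶠ y in 𝓝 x₀, (∀ α ∈ G K y, α (X y) = 0) ∧ σ y (X y) = 1) (hn : 2 ≤ n) :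
    ∃ b : ℕ → E → E →L[ℝ] ℝ, (∀ i < n + K, SmoothNear (b i) x₀) ∧
      ∀ᶠ y in 𝓝 x₀, IsAdaptedAt n K G X K b y := by
  have key : ∀ k ≤ K, ∃ b : ℕ → E → E →L[ℝ] ℝ, (∀ i < n + k, SmoothNear (b i) x₀) ∧
      ∀ᶠ y in 𝓝 x₀, IsAdaptedAt n K G X k b y := by
    intro k
    induction k with
    | zero => exact fun _ => h.exists_adapted_zero hXs hX hn
    | succ k ih =>
      intro hk
      obtain ⟨b, hb, hb'⟩ := ih (by omega)
      exact h.exists_adapted_succ hXs hX hn hk hb hb'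
  exact key K le_rfl

/-- A flag that arises from a linearizing prolongation has an adapted coframing. -/
theorem IsPfaffianFlag.exists_coframing (h : IsPfaffianFlag n K G C σ x₀) (hn : 2 ≤ n) :
    ∃ (b : ℕ → E → E →L[ℝ] ℝ) (ω₁ ω₂ : E → E →L[ℝ] ℝ), (∀ i < n + K, SmoothNear (b i) x₀) ∧
      SmoothNear ω₁ x₀ ∧ SmoothNear ω₂ x₀ ∧ Module.finrank ℝ E = n + K + 3 ∧ ∀ᶠ y in 𝓝 x₀,
      (∀ j ≤ K, Submodule.span ℝ (range fun i : Fin (n + j) => b i y) = G j y) ∧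
      LinearIndependent ℝ (Sum.elim (fun i : Fin n => b i y)
        (Sum.elim (fun j : Fin K => b (n + j) y) ![ω₁ y, ω₂ y, σ y])) ∧
      (∀ v w, (∀ α ∈ G 0 y, α v = 0) → (∀ α ∈ G 0 y, α w = 0) →
        dForm (b 0) y v w = σ y v * ω₁ y w - σ y w * ω₁ y v) ∧
      (∀ i, 0 < i → i + 1 < n → ∀ v w, (∀ α ∈ G 0 y, α v = 0) → (∀ α ∈ G 0 y, α w = 0) →
        dForm (b i) y v w = 0) ∧
      ∀ j ≤ K, ∀ v w, (∀ α ∈ G j y, α v = 0) → (∀ α ∈ G j y, α w = 0) →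
        dForm (b (n - 1 + j)) y v w = σ y v * (if j < K then b (n + j) y else ω₂ y) w -
          σ y w * (if j < K then b (n + j) y else ω₂ y) v := by
  obtain ⟨X, hXs, hX⟩ := h.exists_transversal
  obtain ⟨b, hb, had⟩ := h.exists_adapted hXs hX hn
  have hfr : ∀ j ≤ K, IsFrameNear (G j) (fun i : Fin (n + j) => b i) x₀ := fun j hj =>
    h.isFrameNear hj (fun i hi => hb i (by omega)) (had.mono fun y hy => hy.span j hj)
  have hseq : ∀ᶠ y in 𝓝 x₀, ∀ j ≤ K, ∀ i < n + j, ∀ v w, (∀ α ∈ G j y, α v = 0) →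
      (∀ α ∈ G j y, α w = 0) →
      dForm (b i) y v w = σ y v * contr X (b i) y w - σ y w * contr X (b i) y v := by
    have h1 : ∀ j : Fin (K + 1), _ := fun j =>
      h.structure_eq hX (Nat.lt_succ_iff.1 j.2) (hfr j (Nat.lt_succ_iff.1 j.2))
    filter_upwards [Filter.eventually_all.2 h1, had] with y h2 h3 j hj i hi v w hv hw
    exact h2 ⟨j, Nat.lt_succ_iff.2 hj⟩ ⟨i, hi⟩ v w (fun l => hv _ (h3.mem hj l.2))
      (fun l => hw _ (h3.mem hj l.2))
  have hspan : ∀ᶠ y in 𝓝 x₀, ⊤ ≤ Submodule.span ℝ (range (Sum.elim (fun i : Fin n => b i y)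
        (Sum.elim (fun j : Fin K => b (n + j) y)
          ![contr X (b 0) y, contr X (b (n - 1 + K)) y, σ y]))) := by
    filter_upwards [h.perp_le hX le_rfl (hfr K le_rfl), h.bot, had] with y h1 h2 h3
    set P := Submodule.span ℝ (range (Sum.elim (fun i : Fin n => b i y)
        (Sum.elim (fun j : Fin K => b (n + j) y)
          ![contr X (b 0) y, contr X (b (n - 1 + K)) y, σ y]))) with hP
    have hbP : ∀ i < n + K, b i y ∈ P := fun i hi => by
      rcases Nat.lt_or_ge i n with h4 | h4
      · exact Submodule.subset_span ⟨Sum.inl ⟨i, h4⟩, rfl⟩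
      · obtain ⟨j, rfl⟩ := Nat.exists_eq_add_of_le h4
        exact Submodule.subset_span ⟨Sum.inr (Sum.inl ⟨j, by omega⟩), rfl⟩
    have hGP : G K y ≤ P := by
      rw [← h3.span K le_rfl, Submodule.span_le]
      rintro _ ⟨i, rfl⟩
      exact hbP i i.2
    -- At the top there are no Cauchy characteristics, so the Cartan system is everything and
    -- `IsPfaffianFlag.perp_le` shows that the adapted forms span.
    have h4 : (⊤ : Submodule ℝ (E →L[ℝ] ℝ)) ≤ perp (C K y) := by
      intro α _ v hv
      rw [h2, Submodule.mem_bot] at hv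
      rw [hv, map_zero]
    refine h4.trans (h1 P hGP (Submodule.subset_span ⟨Sum.inr (Sum.inr 2), rfl⟩) fun i => ?_)
    have hi := i.2
    rcases Nat.eq_zero_or_pos i.1 with h0 | h0
    · rw [h0]
      exact Submodule.subset_span ⟨Sum.inr (Sum.inr 0), rfl⟩
    · by_cases h5 : i.1 + 1 < n
      · exact hGP (h3.mono (Nat.zero_le K) le_rfl (h3.middle i.1 h0 h5))
      · obtain ⟨j, hj⟩ : ∃ j, i.1 = n - 1 + j := ⟨i.1 - (n - 1), by omega⟩
        rw [hj]
        rcases Nat.lt_or_ge j K with hjK | hjK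
        · rw [← sub_add_cancel (contr X (b (n - 1 + j)) y) (b (n + j) y)]
          exact add_mem (hGP (h3.mono hjK.le le_rfl (h3.last j hjK))) (hbP _ (by omega))
        · obtain rfl : j = K := by omega
          exact Submodule.subset_span ⟨Sum.inr (Sum.inr 1), rfl⟩
  have hdual : Module.finrank ℝ (E →L[ℝ] ℝ) = Module.finrank ℝ E := by
    have h1 := finrank_add_finrank_perp (⊥ : Submodule ℝ E)
    have h2 : perp (⊥ : Submodule ℝ E) = ⊤ := by
      refine top_unique fun α _ v hv => ?_
      rw [(Submodule.mem_bot ℝ).1 hv, map_zero]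
    rwa [h2, finrank_top, finrank_bot, zero_add] at h1
  have hcard : Fintype.card (Fin n ⊕ (Fin K ⊕ Fin 3)) = n + K + 3 := by
    simp only [Fintype.card_sum, Fintype.card_fin]
    omega
  -- The spanning family bounds the dimension from above; the bound from below is the dimension
  -- count recorded in the flag.
  have hdim : Module.finrank ℝ E = n + K + 3 := by
    refine le_antisymm ?_ h.finrank_ge
    have h1 := hspan.self_of_nhds
    rw [← hcard, ← hdual, ← finrank_top ℝ (E →L[ℝ] ℝ), ← top_unique h1]
    exact finrank_range_le_card _
  refine ⟨b, contr X (b 0), contr X (b (n - 1 + K)), hb, hXs.contr (hb 0 (by omega)),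
    hXs.contr (hb (n - 1 + K) (by omega)), hdim, ?_⟩
  filter_upwards [had, hseq, hspan] with y h1 h2 h3
  refine ⟨h1.span, linearIndependent_of_top_le_span_of_card_eq_finrank h3 ?_, ?_, ?_, ?_⟩
  · rw [hcard, hdual, hdim]
  · exact fun v w hv hw => h2 0 (Nat.zero_le K) 0 (by omega) v w hv hw
  · intro i hi0 hi1 v w hv hw
    rw [h2 0 (Nat.zero_le K) i (by omega) v w hv hw, hv _ (h1.middle i hi0 hi1),
      hw _ (h1.middle i hi0 hi1)]
    ring
  · intro j hj v w hv hw
    rw [h2 j hj (n - 1 + j) (by omega) v w hv hw]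
    rcases Nat.lt_or_ge j K with hjK | hjK
    · rw [if_pos hjK]
      have h4 := hv _ (h1.last j hjK)
      have h5 := hw _ (h1.last j hjK)
      rw [sub_apply, sub_eq_zero] at h4 h5
      rw [h4, h5]
    · obtain rfl : j = K := by omega
      rw [if_neg (lt_irrefl _)]

end Flag

/-! ### Transport by local diffeomorphisms -/

section LocalInverse

variable {d e : ℕ} {N : Type v} {M : Type u}
  [TopologicalSpace N] [ChartedSpace (EuclideanSpace ℝ (Fin e)) N]
  [TopologicalSpace M] [ChartedSpace (EuclideanSpace ℝ (Fin d)) M]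

theorem mfderiv_leftInverse {f : N → M} {g : M → N} {x : N}
    (hf : MDifferentiableAt (𝓡 e) (𝓡 d) f x) (hg : MDifferentiableAt (𝓡 d) (𝓡 e) g (f x))
    (h : ∀ᶠ z in 𝓝 x, g (f z) = z) (v : Eu e) :
    (mfderiv (𝓡 d) (𝓡 e) g (f x) (mfderiv (𝓡 e) (𝓡 d) f x v) : Eu e) = v := by
  have h1 := mfderiv_comp x hg hf
  have h2 : mfderiv (𝓡 e) (𝓡 e) (g ∘ f) x = mfderiv (𝓡 e) (𝓡 e) id x :=
    Filter.EventuallyEq.mfderiv_eq h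
  rw [mfderiv_id] at h2
  exact (congrArg (fun T : Eu e →L[ℝ] Eu e => T v) (h1.symm.trans h2))

theorem surjective_mfderiv_of_leftInverse {f : N → M} {g : M → N} {x : N}
    (hf : MDifferentiableAt (𝓡 e) (𝓡 d) f x) (hg : MDifferentiableAt (𝓡 d) (𝓡 e) g (f x))
    (h : ∀ᶠ z in 𝓝 x, g (f z) = z) :
    Function.Surjective (mfderiv (𝓡 d) (𝓡 e) g (f x)) := fun v =>
  ⟨_, mfderiv_leftInverse hf hg h v⟩

theorem pullForm_leftInverse {f : N → M} {g : M → N} {x : N}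
    (hf : MDifferentiableAt (𝓡 e) (𝓡 d) f x) (hg : MDifferentiableAt (𝓡 d) (𝓡 e) g (f x))
    (h : ∀ᶠ z in 𝓝 x, g (f z) = z) (ψ : Form e N) :
    pullForm f (pullForm (e := d) g ψ) x = ψ x := by
  ext v
  exact (form_congr ψ h.self_of_nhds _).trans
    (congrArg (ψ x : Eu e →L[ℝ] ℝ) (mfderiv_leftInverse hf hg h v))

theorem family_congr (F : Family e N) {x x' : N} (h : x' = x) {α : Eu e →L[ℝ] ℝ} :
    (α : Cot e x') ∈ F x' ↔ (α : Cot e x) ∈ F x := by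
  subst h
  rfl

theorem pullback_leftInverse {f : N → M} {g : M → N} {x : N}
    (hf : MDifferentiableAt (𝓡 e) (𝓡 d) f x) (hg : MDifferentiableAt (𝓡 d) (𝓡 e) g (f x))
    (h : ∀ᶠ z in 𝓝 x, g (f z) = z) (F : Family e N) :
    (pullback f (pullback g F : Family d M) : Family e N) x = F x := by
  have hpull : ∀ β : Cot e (g (f x)),
      (pullCov f x (pullCov g (f x) β : Cot d (f x)) : Eu e →L[ℝ] ℝ) = β := by
    intro β
    ext v
    exact congrArg (β : Eu e →L[ℝ] ℝ) (mfderiv_leftInverse hf hg h v)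
  ext α
  constructor
  · rintro ⟨_, ⟨β, hβ, rfl⟩, rfl⟩
    have h1 := (family_congr F h.self_of_nhds (α := β)).1 hβ
    exact (congrArg (fun T : Eu e →L[ℝ] ℝ => T ∈ (F x : Submodule ℝ (Eu e →L[ℝ] ℝ)))
      (hpull β)).mpr h1
  · intro hα
    have h1 := (family_congr F h.self_of_nhds (α := α)).2 hα
    exact ⟨_, ⟨_, h1, rfl⟩, (hpull _).symm⟩

theorem finrank_ker_of_surjective {T : Eu e →L[ℝ] Eu d} (hT : Function.Surjective T) :
    Module.finrank ℝ T.toLinearMap.ker + d = e := by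
  have h1 := T.toLinearMap.finrank_range_add_finrank_ker
  rw [LinearMap.range_eq_top.2 hT, finrank_top, finrank_euclideanSpace_fin,
    finrank_euclideanSpace_fin] at h1
  omega

theorem dim_le_of_submersion {f : N → M} {x : N}
    (hf : Function.Surjective (mfderiv (𝓡 e) (𝓡 d) f x)) : d ≤ e := by
  have := finrank_ker_of_surjective (T := (mfderiv (𝓡 e) (𝓡 d) f x : Eu e →L[ℝ] Eu d)) hf
  omega

variable [IsManifold (𝓡 e) ∞ N]

theorem chart_smooth (q : N) {z : N} (hz : z ∈ (extChartAt (𝓡 e) q).source) :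
    ContMDiffAt (𝓡 e) (𝓡 e) ∞ (extChartAt (𝓡 e) q : N → Eu e) z := by
  refine contMDiffAt_extChartAt' ?_
  rwa [extChartAt_source] at hz

theorem chart_symm_smooth (q : N) {y : Eu e} (hy : y ∈ (extChartAt (𝓡 e) q).target) :
    ContMDiffAt (𝓡 e) (𝓡 e) ∞ ((extChartAt (𝓡 e) q).symm : Eu e → N) y :=
  (contMDiffOn_extChartAt_symm q).contMDiffAt ((isOpen_extChartAt_target q).mem_nhds hy)

theorem chart_submersion (q : N) :
    SubmersionNear (d := e) (e := e) (extChartAt (𝓡 e) q : N → Eu e) q where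
  smooth := by
    filter_upwards [extChartAt_source_mem_nhds (I := 𝓡 e) q] with z hz using chart_smooth q hz
  surj := by
    filter_upwards [extChartAt_source_mem_nhds (I := 𝓡 e) q] with z hz
    have h1 := surjective_mfderiv_of_leftInverse (d := e) (e := e) (N := Eu e) (M := N)
      (f := (extChartAt (𝓡 e) q).symm) (g := extChartAt (𝓡 e) q) (x := extChartAt (𝓡 e) q z)
      ((chart_symm_smooth q ((extChartAt (𝓡 e) q).map_source hz)).mdifferentiableAt (by simp))
      (by
        rw [(extChartAt (𝓡 e) q).left_inv hz]
        exact (chart_smooth q hz).mdifferentiableAt (by simp))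
      (by
        filter_upwards [(isOpen_extChartAt_target q).mem_nhds ((extChartAt (𝓡 e) q).map_source hz)]
          with y hy using (extChartAt (𝓡 e) q).right_inv hy)
    rwa [(extChartAt (𝓡 e) q).left_inv hz] at h1

theorem chart_symm_submersion (q : N) {y : Eu e} (hy : y ∈ (extChartAt (𝓡 e) q).target) :
    SubmersionNear (d := e) (e := e) ((extChartAt (𝓡 e) q).symm : Eu e → N) y :=
  subm_of_open (isOpen_extChartAt_target q) (contMDiffOn_extChartAt_symm q) (fun y hy => by
    have hs := (extChartAt (𝓡 e) q).map_target hy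
    have h1 := surjective_mfderiv_of_leftInverse (d := e) (e := e) (N := N) (M := Eu e)
      (f := extChartAt (𝓡 e) q) (g := (extChartAt (𝓡 e) q).symm)
      (x := (extChartAt (𝓡 e) q).symm y)
      ((chart_smooth q hs).mdifferentiableAt (by simp))
      (by
        rw [(extChartAt (𝓡 e) q).right_inv hy]
        exact (chart_symm_smooth q hy).mdifferentiableAt (by simp))
      (by
        filter_upwards [(isOpen_extChartAt_source (I := 𝓡 e) q).mem_nhds hs]
          with z hz using (extChartAt (𝓡 e) q).left_inv hz)
    rwa [(extChartAt (𝓡 e) q).right_inv hy] at h1) hy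

theorem chart_left_inverse (q : N) {z : N} (hz : z ∈ (extChartAt (𝓡 e) q).source) :
    MDifferentiableAt (𝓡 e) (𝓡 e) (extChartAt (𝓡 e) q : N → Eu e) z ∧
    MDifferentiableAt (𝓡 e) (𝓡 e) ((extChartAt (𝓡 e) q).symm : Eu e → N)
      (extChartAt (𝓡 e) q z) ∧
    ∀ᶠ z' in 𝓝 z, (extChartAt (𝓡 e) q).symm (extChartAt (𝓡 e) q z') = z' := by
  refine ⟨(chart_smooth q hz).mdifferentiableAt (by simp),
    (chart_symm_smooth q ((extChartAt (𝓡 e) q).map_source hz)).mdifferentiableAt (by simp), ?_⟩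
  filter_upwards [(isOpen_extChartAt_source (I := 𝓡 e) q).mem_nhds hz]
    with z hz using (extChartAt (𝓡 e) q).left_inv hz

theorem isFrameAt_euclidean {ι : Type*} {F : Family e (Eu e)} {κ : ι → Form e (Eu e)} {x : Eu e} :
    IsFrameAt F κ x ↔ IsFrameNear (E := Eu e) F κ x :=
  ⟨fun h => ⟨fun i => (smoothFormNear_euclidean _ _).1 (h.smooth i), h.indep, h.span⟩,
    fun h => ⟨fun i => (smoothFormNear_euclidean _ _).2 (h.smooth i), h.indep, h.span⟩⟩

theorem SmoothNear.eventually {E F : Type*} [NormedAddCommGroup E] [NormedSpace ℝ E]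
    [NormedAddCommGroup F] [NormedSpace ℝ F] {f : E → F} {x : E} (h : SmoothNear f x) :
    ∀ᶠ y in 𝓝 x, SmoothNear f y := eventually_eventually_nhds.2 h

theorem IsFrameNear.eventually {E ι : Type*} [NormedAddCommGroup E] [NormedSpace ℝ E] [Finite ι]
    {F : E → Submodule ℝ (E →L[ℝ] ℝ)} {κ : ι → E → E →L[ℝ] ℝ} {x : E} (h : IsFrameNear F κ x) :
    ∀ᶠ y in 𝓝 x, IsFrameNear F κ y := by
  filter_upwards [Filter.eventually_all.2 fun i => (h.smooth i).eventually,
    eventually_eventually_nhds.2 h.indep, eventually_eventually_nhds.2 h.span] with y h1 h2 h3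
    using ⟨h1, h2, h3⟩

end LocalInverse

/-! ### Adapted coframings of linearizing prolongations -/

section Coframings

variable {S N : PfSystem.{u}} {π : N.M → S.M} {n K : ℕ}

theorem IsCartanProlongation.submersionNear (h : IsCartanProlongation N S π) (x : N.M) :
    SubmersionNear (d := S.dim) (e := N.dim) π x :=
  subm_of_open isOpen_univ h.smooth.contMDiffOn (fun x _ => h.submersion x) (mem_univ x)

theorem IsReduction.submersionNear {d : ℕ} {N : Type u} [TopologicalSpace N]
    [ChartedSpace (EuclideanSpace ℝ (Fin d)) N] [IsManifold (𝓡 d) ∞ N]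
    {F : Family d N} {σ : Form d N} {U : Set N} {p : N → S.M} (h : IsReduction F σ U S p) {x : N}
    (hx : x ∈ U) : SubmersionNear (d := S.dim) (e := d) p x :=
  subm_of_open h.isOpen h.smooth h.submersion hx

theorem relExt_le (h : ∀ x, (pullback π S.I : Family N.dim N.M) x ≤ N.I x) (k : ℕ) (x : N.M) :
    relExt N S π k x ≤ N.I x := by
  cases k with
  | zero => exact h x
  | succ k => exact inf_le_right

/-- Each stage is the pullback of the bundle of its reduction, hence a subbundle; its rank is found
by counting at the single point `q`. -/
theorem IsLinearizing.isSubbundle_relExt (h : IsLinearizing N S π K) (hS : S.rank = n) (q : N.M)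
    {k : ℕ} (hk : k ≤ K) : IsSubbundle (n + k) (relExt N S π k) := by
  obtain ⟨T, p, hred, -⟩ := h.cRegular.chain
  have hsub : IsSubbundle (T k).rank (relExt N S π k) := by
    have h1 : (pullback (p k) (T k).I : Family N.dim N.M) = relExt N S π k :=
      funext fun x => (hred k hk).pull x (mem_univ x)
    rw [← h1]
    exact isSubbundle_pullback (fun x => (hred k hk).submersionNear (mem_univ x)) (T k).subbundle
  have hrank : ∀ j ≤ K, Module.finrank ℝ (relExt N S π j q) = n + j := by
    intro j
    induction j with
    | zero =>
      intro _
      rw [← hS]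
      exact (isSubbundle_pullback h.cRegular.prolongation.submersionNear S.subbundle).finrank_eq q
    | succ j ih =>
      intro hj
      rw [h.rank_one j (by omega) q, ih (by omega)]
      rfl
  rw [← hrank k hk, hsub.finrank_eq q]
  exact hsub

/-- The leaves of the Cartan system of `π^* I` have the tangent spaces of the fibers of `π`, so the
lowest reduction has the dimension `n + 3` of `S`. Each further reduction has larger rank, and by
`IsCartanProlongation.rank_eq` it must also have larger dimension. -/
theorem IsLinearizing.le_dim (h : IsLinearizing N S π K) (hS : S.HasType n 2) (q : N.M) :
    n + K + 3 ≤ N.dim := by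
  obtain ⟨T, p, hred, hq⟩ := h.cRegular.chain
  have hrank : ∀ k ≤ K, (T k).rank = n + k := by
    intro k hk
    rw [← (h.isSubbundle_relExt hS.2 q hk).finrank_eq q, ← (hred k hk).pull q (mem_univ q)]
    exact ((isSubbundle_pullback (fun x => (hred k hk).submersionNear (mem_univ x))
      (T k).subbundle).finrank_eq q).symm
  have hdim : ∀ k ≤ K, n + 3 + k ≤ (T k).dim := by
    intro k
    induction k with
    | zero =>
      intro hk
      have hr := hred 0 hk
      obtain ⟨θ, hθ⟩ := S.subbundle.exists_frame (π q)
      obtain ⟨A, hA⟩ : ∃ A : Eu N.dim →L[ℝ] Eu (T 0).dim,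
        A = mfderiv (𝓡 N.dim) (𝓡 (T 0).dim) (p 0) q := ⟨_, rfl⟩
      obtain ⟨B, hB⟩ : ∃ B : Eu N.dim →L[ℝ] Eu S.dim,
        B = mfderiv (𝓡 N.dim) (𝓡 S.dim) π q := ⟨_, rfl⟩
      have h1 : A.toLinearMap.ker = B.toLinearMap.ker := by
        ext v
        rw [LinearMap.mem_ker, LinearMap.mem_ker]
        show A v = 0 ↔ B v = 0
        rw [hA, hB]
        refine (hr.ker q (mem_univ q) v).trans ((mem_cauchy_pullback
          (h.cRegular.prolongation.submersionNear q) hθ v).trans ?_)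
        rw [S.noCauchy]
        rfl
      have h2 := finrank_ker_of_surjective (T := A) (by
        rw [hA]
        exact hr.submersion q (mem_univ q))
      have h3 := finrank_ker_of_surjective (T := B) (by
        rw [hB]
        exact h.cRegular.prolongation.submersion q)
      rw [h1] at h2
      have h4 := hS.1
      omega
    | succ k ih =>
      intro hk
      obtain ⟨r, -, hr⟩ := hq k hk
      have h1 := ih (by omega)
      have h2 := dim_le_of_submersion (hr.submersion (p (k + 1) q))
      have h3 : (T (k + 1)).dim ≠ (T k).dim := by
        intro h4
        have h5 := hr.rank_eq (p (k + 1) q) h4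
        rw [hrank (k + 1) hk, hrank k (by omega)] at h5
        omega
      omega
  have h1 := hdim K le_rfl
  have h2 := dim_le_of_submersion ((hred K le_rfl).submersion q (mem_univ q))
  omega

/-- The inverse chart is a local diffeomorphism, so all properties of the relative extensions carry
over to the model space. -/
theorem IsLinearizing.isPfaffianFlag (h : IsLinearizing N S π K) (hS : S.HasType n 2) (q : N.M) :
    IsPfaffianFlag (E := Eu N.dim) n K
      (fun k => (pullback ((extChartAt (𝓡 N.dim) q).symm : Eu N.dim → N.M) (relExt N S π k) :
        Family N.dim (Eu N.dim)))
      (fun k => cauchy (pullback ((extChartAt (𝓡 N.dim) q).symm : Eu N.dim → N.M)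
        (relExt N S π k) : Family N.dim (Eu N.dim)))
      (pullForm ((extChartAt (𝓡 N.dim) q).symm : Eu N.dim → N.M) N.τ)
      (extChartAt (𝓡 N.dim) q q) := by
  have hle := relExt_le h.cRegular.prolongation.pull_le
  set g : Eu N.dim → N.M := ⇑(extChartAt (𝓡 N.dim) q).symm with hg
  have htar : ∀ᶠ y in 𝓝 (extChartAt (𝓡 N.dim) q q), y ∈ (extChartAt (𝓡 N.dim) q).target :=
    extChartAt_target_mem_nhds q
  have hgs : ∀ᶠ y in 𝓝 (extChartAt (𝓡 N.dim) q q),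
      SubmersionNear (d := N.dim) (e := N.dim) g y :=
    htar.mono fun y hy => chart_symm_submersion q hy
  have hframe : ∀ k ≤ K, ∀ x, ∃ θ : Fin (n + k) → Form N.dim N.M,
      IsFrameAt (relExt N S π k) θ x := fun k hk x =>
    (h.isSubbundle_relExt hS.2 q hk).exists_frame x
  have hmemC : ∀ k ≤ K, ∀ᶠ y in 𝓝 (extChartAt (𝓡 N.dim) q q), ∀ v : Eu N.dim,
      v ∈ cauchy (pullback g (relExt N S π k) : Family N.dim (Eu N.dim)) y ↔
        mfderiv (𝓡 N.dim) (𝓡 N.dim) g y v ∈ cauchy (relExt N S π k) (g y) := by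
    intro k hk
    filter_upwards [hgs] with y hy v
    obtain ⟨θ, hθ⟩ := hframe k hk (g y)
    exact mem_cauchy_pullback hy hθ v
  have hσg : ∀ x, N.τ x ∉ N.I x := N.independent
  refine ⟨?_, ?_, ?_, ?_, ?_, ?_, ?_, ?_, ?_, ?_, ?_, ?_⟩
  · exact (smoothFormNear_euclidean _ _).1
      ((tau_smooth N _).pullForm (hgs.self_of_nhds).smooth)
  · intro k hk
    obtain ⟨θ, hθ⟩ := hframe k hk (g (extChartAt (𝓡 N.dim) q q))
    exact ⟨_, isFrameAt_euclidean.1 (hθ.pullback hgs.self_of_nhds)⟩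
  · rintro k -
    refine Filter.Eventually.of_forall fun y => ?_
    rintro _ ⟨β, hβ, rfl⟩
    refine ⟨β, ?_, rfl⟩
    rw [h.cRegular.top]
    exact hle k _ hβ
  · rintro k hk
    refine Filter.Eventually.of_forall fun y => ?_
    rintro _ ⟨β, hβ, rfl⟩
    exact ⟨β, (h.cRegular.strict k hk).le _ hβ, rfl⟩
  · filter_upwards [hgs] with y hy h1
    have h2 := mem_of_pullCov_mem hy.surj.self_of_nhds h1
    rw [h.cRegular.top] at h2
    exact hσg _ h2
  · intro k hk
    filter_upwards [hmemC k hk] with y hy v hv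
    exact h.cRegular.indep_mem k hk (g y) _ ((hy v).1 hv)
  · intro k hk
    filter_upwards [hmemC k hk.le, hgs] with y hy hys
    ext α
    constructor
    · rintro ⟨β, hβ, rfl⟩
      refine ⟨fun v hv => hβ.1 _ ((hy v).1 hv), β, ?_, rfl⟩
      rw [h.cRegular.top]
      exact hβ.2
    · rintro ⟨h1, β, hβ, rfl⟩
      rw [h.cRegular.top] at hβ
      refine ⟨β, ⟨fun v hv => ?_, hβ⟩, rfl⟩
      obtain ⟨w, rfl⟩ := hys.surj.self_of_nhds v
      exact h1 w ((hy w).2 hv)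
  · intro k hk κ hκ
    filter_upwards [hκ.eventually] with y hy v
    refine ((isFrameAt_euclidean.2 hy).mem_cauchy_iff v).trans (and_congr Iff.rfl
      (forall_congr' fun i => forall_congr' fun w => imp_congr Iff.rfl ?_))
    exact Eq.congr_left (extD_euclidean (κ i) y v w)
  · intro k hk κ hκ
    filter_upwards [hκ.eventually, hgs] with y hy hys i v w hv hw hσv hσw
    obtain ⟨θ, hθ⟩ := hframe k hk (g y)
    have hpb := hθ.pullback hys
    have hyE := isFrameAt_euclidean.2 hy
    obtain ⟨c, hc, hc'⟩ := hpb.extD_section (hyE.smooth i) (by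
      filter_upwards [hyE.span] with z hz
      rw [← hz]
      exact Submodule.subset_span ⟨i, rfl⟩)
    have hv' := (hpb.ker_iff v).1 ((hyE.ker_iff v).2 hv)
    have hw' := (hpb.ker_iff w).1 ((hyE.ker_iff w).2 hw)
    have h1 := hc' v w hv' hw'
    have hadj := hθ.adjoin (tau_smooth N (g y))
      (Filter.Eventually.of_forall fun z hz => hσg z (hle k z hz))
    refine (extD_euclidean (κ i) y v w).symm.trans (h1.trans (Finset.sum_eq_zero fun j _ => ?_))
    obtain ⟨U, hU, hsec⟩ := hadj.isSectionOn (Sum.inl j)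
    have h2 := (hadj.congrMod_iff _ _).1 (h.cts k hk U _ hsec (g y) hU)
      (mfderiv (𝓡 N.dim) (𝓡 N.dim) g y v) (mfderiv (𝓡 N.dim) (𝓡 N.dim) g y w)
      (by rintro (l | l); exacts [hv' l, hσv]) (by rintro (l | l); exacts [hw' l, hσw])
    exact (congrArg (c j * ·) ((extD_pullForm hys.smooth (hθ.smooth j) v w).trans h2)).trans
      (mul_zero _)
  -- Since `S` has no Cauchy characteristics, those of the pulled back system form the kernel of the
  -- differential to `S`, whose codimension is `dim S = n + 3`.
  · filter_upwards [hmemC 0 (Nat.zero_le K), hgs] with y hy hys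
    obtain ⟨θ, hθ⟩ := S.subbundle.exists_frame (π (g y))
    have hπ := h.cRegular.prolongation
    obtain ⟨A, hA⟩ : ∃ A : Eu N.dim →L[ℝ] Eu S.dim,
        A = mfderiv (𝓡 N.dim) (𝓡 S.dim) π (g y) := ⟨_, rfl⟩
    obtain ⟨B, hB⟩ : ∃ B : Eu N.dim →L[ℝ] Eu N.dim,
        B = mfderiv (𝓡 N.dim) (𝓡 N.dim) g y := ⟨_, rfl⟩
    have h1 : cauchy (pullback g (relExt N S π 0) : Family N.dim (Eu N.dim)) y =
        (A.comp B).toLinearMap.ker := by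
      ext v
      refine (hy v).trans ((mem_cauchy_pullback (hπ.submersionNear (g y)) hθ _).trans ?_)
      rw [S.noCauchy, hA, hB]
      rfl
    have h2 := finrank_ker_of_surjective (T := A.comp B) (by
      rw [hA, hB]
      exact (hπ.submersion (g y)).comp hys.surj.self_of_nhds)
    have h3 : Module.finrank ℝ (cauchy (pullback g (relExt N S π 0) :
        Family N.dim (Eu N.dim)) y) + S.dim = N.dim :=
      (congrArg (fun P : Submodule ℝ (Eu N.dim) => Module.finrank ℝ P + S.dim) h1).trans h2
    rw [hS.1] at h3
    exact h3.trans finrank_euclideanSpace_fin.symm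
  · filter_upwards [hmemC K le_rfl, hgs] with y hy hys
    refine (Submodule.eq_bot_iff _).2 fun v hv => ?_
    have h1 := (hy v).1 hv
    rw [h.cRegular.top, N.noCauchy, Submodule.mem_bot] at h1
    obtain ⟨B, hB⟩ : ∃ B : Eu N.dim →L[ℝ] Eu N.dim,
        B = mfderiv (𝓡 N.dim) (𝓡 N.dim) g y := ⟨_, rfl⟩
    have h2 : Function.Injective B := LinearMap.injective_iff_surjective.2 (by
      rw [hB]
      exact hys.surj.self_of_nhds)
    refine h2 (Eq.trans ?_ (map_zero B).symm)
    rw [hB]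
    exact h1
  · rw [finrank_euclideanSpace_fin]
    exact h.le_dim hS q

/-- Linearizing prolongations have adapted coframings. -/
theorem IsLinearizing.exists_adaptedCoframing (h : IsLinearizing N S π K) (hS : S.HasType n 2)
    (hn : 2 ≤ n) (q : N.M) : ∃ U : Set N.M, IsOpen U ∧ q ∈ U ∧
      ∃ (θ : Fin n → Form N.dim N.M) (η : Fin K → Form N.dim N.M) (ω₁ ω₂ : Form N.dim N.M),
        IsAdaptedCoframing U θ η ω₁ ω₂ N.τ ∧
          ∀ k ≤ K, ∀ x ∈ U, relExt N S π k x = spanUpTo θ η k x := by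
  obtain ⟨b, ω₁, ω₂, hb, hω₁, hω₂, hdim, hev⟩ := (h.isPfaffianFlag hS q).exists_coframing hn
  set φ : N.M → Eu N.dim := ⇑(extChartAt (𝓡 N.dim) q) with hφ
  have hφs : ∀ᶠ x in 𝓝 q, SubmersionNear (d := N.dim) (e := N.dim) φ x := by
    filter_upwards [eventually_eventually_nhds.2 (chart_submersion (e := N.dim) q).smooth,
      eventually_eventually_nhds.2 (chart_submersion (e := N.dim) q).surj] with x h1 h2 using ⟨h1, h2⟩
  have hφc : Filter.Tendsto φ (𝓝 q) (𝓝 (φ q)) := continuousAt_extChartAt q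
  set θ : Fin n → Form N.dim N.M := fun i => pullForm φ (b i) with hθ
  set η : Fin K → Form N.dim N.M := fun j => pullForm φ (b (n + j)) with hη
  have hnear : ∀ {β : Eu N.dim → Eu N.dim →L[ℝ] ℝ}, SmoothNear β (φ q) →
      SmoothFormNear (pullForm (e := N.dim) φ β) q := fun hβ =>
    SmoothFormNear.pullForm (chart_submersion (e := N.dim) q).smooth
      ((smoothFormNear_euclidean (d := N.dim) _ _).2 hβ)
  have hsm : ∀ i, SmoothFormNear (Sum.elim θ (Sum.elim η
      ![pullForm φ ω₁, pullForm φ ω₂, N.τ]) i) q := by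
    rintro (i | j | l)
    · exact hnear (hb i (by have := i.2; omega))
    · exact hnear (hb (n + j) (by have := j.2; omega))
    · fin_cases l
      · exact hnear hω₁
      · exact hnear hω₂
      · exact tau_smooth N q
  have hbs : ∀ᶠ y in 𝓝 (φ q), ∀ i : Fin (n + K), SmoothNear (b i) y :=
    Filter.eventually_all.2 fun i => (hb i i.2).eventually
  obtain ⟨U, hUo, hqU, hUs, hUsm⟩ := exists_open_smoothFormOn hsm
    (Filter.inter_mem (Filter.inter_mem (extChartAt_source_mem_nhds (I := 𝓡 N.dim) q) hφs)
      (Filter.inter_mem (hφc.eventually hev) (hφc.eventually hbs)))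
  have hF : ∀ k, ∀ x ∈ U, relExt N S π k x = (pullback φ (pullback
      ((extChartAt (𝓡 N.dim) q).symm : Eu N.dim → N.M) (relExt N S π k) :
        Family N.dim (Eu N.dim)) : Family N.dim N.M) x := fun k x hx => by
    obtain ⟨h1, h2, h3⟩ := chart_left_inverse q (hUs hx).1.1
    exact (pullback_leftInverse h1 h2 h3 _).symm
  have hτ : ∀ x ∈ U, N.τ x = pullForm φ (pullForm
      ((extChartAt (𝓡 N.dim) q).symm : Eu N.dim → N.M) N.τ) x := fun x hx => by
    obtain ⟨h1, h2, h3⟩ := chart_left_inverse q (hUs hx).1.1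
    exact (pullForm_leftInverse h1 h2 h3 _).symm
  have hspan : ∀ k ≤ K, ∀ x ∈ U, relExt N S π k x = spanUpTo θ η k x := by
    intro k hk x hx
    have h1 := (hUs hx).2.1.1 k hk
    rw [hF k x hx, pullback_eq_map]
    refine (congrArg (fun P : Submodule ℝ (Eu N.dim →L[ℝ] ℝ) => P.map (pullCovₗ φ x)) h1.symm).trans
      ((Submodule.map_span _ _).trans (congrArg _ ?_))
    ext α
    constructor
    · rintro ⟨_, ⟨i, rfl⟩, rfl⟩
      rcases Nat.lt_or_ge i.1 n with h2 | h2
      · exact Or.inl ⟨⟨i.1, h2⟩, rfl⟩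
      · obtain ⟨j, hj⟩ := Nat.exists_eq_add_of_le h2
        have hi := i.2
        refine Or.inr ⟨⟨j, by omega⟩, by show j < k; omega, ?_⟩
        show pullCov φ x (b i.1 (φ x)) = pullCov φ x (b (n + j) (φ x))
        rw [hj]
    · rintro (⟨i, rfl⟩ | ⟨j, hj, rfl⟩)
      · exact ⟨_, ⟨⟨i.1, by have := i.2; omega⟩, rfl⟩, rfl⟩
      · exact ⟨_, ⟨⟨n + j, by omega⟩, rfl⟩, rfl⟩
  have hker : ∀ k ≤ K, ∀ x ∈ U, ∀ v : TangentSpace (𝓡 N.dim) x,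
      (∀ α ∈ spanUpTo θ η k x, α v = 0) →
      ∀ α ∈ (pullback ((extChartAt (𝓡 N.dim) q).symm : Eu N.dim → N.M) (relExt N S π k) :
        Family N.dim (Eu N.dim)) (φ x), α (mfderiv (𝓡 N.dim) (𝓡 N.dim) φ x v) = 0 := by
    intro k hk x hx v hv α hα
    refine hv (pullCov φ x α) ?_
    rw [← hspan k hk x hx, hF k x hx]
    exact ⟨α, hα, rfl⟩
  have hextD : ∀ i < n + K, ∀ x ∈ U, ∀ v w : TangentSpace (𝓡 N.dim) x,
      extD (pullForm φ (b i)) x v w = dForm (E := Eu N.dim) (b i) (φ x)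
        (mfderiv (𝓡 N.dim) (𝓡 N.dim) φ x v) (mfderiv (𝓡 N.dim) (𝓡 N.dim) φ x w) := by
    intro i hi x hx v w
    exact (extD_pullForm (hUs hx).1.2.smooth
      ((smoothFormNear_euclidean _ _).2 ((hUs hx).2.2 ⟨i, hi⟩)) v w).trans
      (extD_euclidean (b i) (φ x) _ _)
  have hlast : ∀ j (hj : j ≤ K) x (hx : x ∈ U), CongrMod (spanUpTo θ η j x)
      (extD (pullForm φ (b (n - 1 + j))) x)
      (wedge (N.τ x) (etaNext η (pullForm φ ω₂) j x)) := by
    intro j hj x hx v w hv hw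
    rw [hextD _ (by omega) x hx, hτ x hx]
    have h1 := (hUs hx).2.1.2.2.2.2 j hj _ _ (hker j hj x hx v hv) (hker j hj x hx w hw)
    refine h1.trans ?_
    rcases Nat.lt_or_ge j K with hjK | hjK
    · rw [if_pos hjK, etaNext, dif_pos hjK]
      rfl
    · rw [if_neg (by omega), etaNext, dif_neg (by omega)]
      rfl
  refine ⟨U, hUo, hqU, θ, η, pullForm φ ω₁, pullForm φ ω₂, ⟨fun i => hUsm (Sum.inl i),
    fun j => hUsm (Sum.inr (Sum.inl j)), hUsm (Sum.inr (Sum.inr 0)), hUsm (Sum.inr (Sum.inr 1)),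
    hUsm (Sum.inr (Sum.inr 2)), fun x hx => ?_, ?_, ?_, ?_, ?_, ?_⟩, hspan⟩
  · have h1 := (hUs hx).2.1.2.1
    have h2 := h1.map' (pullCovₗ (d := N.dim) (e := N.dim) φ x)
      (LinearMap.ker_eq_bot.2 (pullCovₗ_injective (hUs hx).1.2.surj.self_of_nhds))
    rw [hτ x hx]
    have h3 : (Sum.elim (fun i => θ i x) (Sum.elim (fun j => η j x)
        ![pullForm (d := N.dim) φ ω₁ x, pullForm (d := N.dim) φ ω₂ x,
          pullForm (d := N.dim) φ (pullForm
          ((extChartAt (𝓡 N.dim) q).symm : Eu N.dim → N.M) N.τ) x])) =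
        ⇑(pullCovₗ (d := N.dim) (e := N.dim) φ x) ∘ (Sum.elim (fun i : Fin n => b i (φ x))
          (Sum.elim (fun j : Fin K => b (n + j) (φ x)) ![ω₁ (φ x), ω₂ (φ x), pullForm
          ((extChartAt (𝓡 N.dim) q).symm : Eu N.dim → N.M) N.τ (φ x)])) := by
      funext i
      rcases i with i | j | l
      · rfl
      · rfl
      · fin_cases l <;> rfl
    rw [h3]
    exact h2
  · rw [← hdim, finrank_euclideanSpace_fin]
  · intro i hi x hx v w hv hw
    rw [hτ x hx]
    refine (hextD i (by omega) x hx v w).trans ?_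
    rw [hi]
    exact (hUs hx).2.1.2.2.1 _ _ (hker 0 (Nat.zero_le K) x hx v hv)
      (hker 0 (Nat.zero_le K) x hx w hw)
  · intro i hi0 hi1 x hx v w hv hw
    exact (hextD i (by omega) x hx v w).trans ((hUs hx).2.1.2.2.2.1 i hi0 hi1 _ _
      (hker 0 (Nat.zero_le K) x hx v hv) (hker 0 (Nat.zero_le K) x hx w hw))
  · intro i hi x hx
    have h1 := hlast 0 (Nat.zero_le K) x hx
    have h2 : n - 1 + 0 = i.1 := by omega
    rw [h2] at h1
    exact h1
  · intro k x hx
    have h1 := hlast (k + 1) k.2 x hx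
    have h2 : n - 1 + (k.1 + 1) = n + k.1 := by omega
    rw [h2] at h1
    exact h1

end Coframings

/-! ### Coordinates adapted to a coframing -/

section LinearAlgebra

variable {E : Type u} [NormedAddCommGroup E] [NormedSpace ℝ E] [FiniteDimensional ℝ E]

theorem exists_factor_of_ker_le {G : Type*} [NormedAddCommGroup G] [NormedSpace ℝ G]
    [FiniteDimensional ℝ G] {Θ Θ' : E →L[ℝ] G} (hΘ : Function.Surjective Θ)
    (hΘ' : Function.Surjective Θ') (h : ∀ v, Θ v = 0 → Θ' v = 0) :
    ∃ M : G ≃L[ℝ] G, ∀ v, M (Θ' v) = Θ v := by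
  obtain ⟨R', hR'⟩ := (Θ : E →ₗ[ℝ] G).exists_rightInverse_of_surjective
    (LinearMap.range_eq_top.2 hΘ)
  have hR : ∀ g, Θ (R' g) = g := fun g => congrArg (fun T : G →ₗ[ℝ] G => T g) hR'
  set L : G →ₗ[ℝ] G := (Θ' : E →ₗ[ℝ] G) ∘ₗ R' with hL
  have hLΘ : ∀ v, L (Θ v) = Θ' v := fun v => by
    have h1 := h (R' (Θ v) - v) (by rw [map_sub, hR, sub_self])
    rw [map_sub, sub_eq_zero] at h1
    exact h1
  have hLs : Function.Surjective L := fun g => by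
    obtain ⟨v, rfl⟩ := hΘ' g
    exact ⟨Θ v, hLΘ v⟩
  have hLi : Function.Injective L := LinearMap.injective_iff_surjective.2 hLs
  refine ⟨(LinearEquiv.ofBijective L ⟨hLi, hLs⟩).symm.toContinuousLinearEquiv, fun v => ?_⟩
  show (LinearEquiv.ofBijective L ⟨hLi, hLs⟩).symm (Θ' v) = Θ v
  rw [LinearEquiv.symm_apply_eq]
  exact (hLΘ v).symm

/-- Equally many independent forms have kernels of the same dimension, so an inclusion of kernels is
an equality. -/
theorem ker_iff_of_ker_le {ι : Type*} [Fintype ι] {κ κ' : ι → E →L[ℝ] ℝ}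
    (hκ : LinearIndependent ℝ κ) (hκ' : LinearIndependent ℝ κ')
    (h : ∀ v, (∀ i, κ i v = 0) → ∀ i, κ' i v = 0) (v : E) :
    (∀ i, κ i v = 0) ↔ ∀ i, κ' i v = 0 := by
  refine ⟨h v, fun hv => ?_⟩
  obtain ⟨M, hM⟩ := exists_factor_of_ker_le (surjective_pi_of_linearIndependent hκ)
    (surjective_pi_of_linearIndependent hκ') fun v hv => funext (h v (congrFun hv))
  have h1 := hM v
  rw [show ContinuousLinearMap.pi κ' v = 0 from funext hv, map_zero] at h1
  exact fun i => (congrFun h1 i).symm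

theorem linearIndependent_of_ker_eq_zero {ι : Type*} [Fintype ι] {κ : ι → E →L[ℝ] ℝ}
    (hc : Fintype.card ι = Module.finrank ℝ E) (h : ∀ v, (∀ i, κ i v = 0) → v = 0) :
    LinearIndependent ℝ κ := by
  have hdual : Module.finrank ℝ (E →L[ℝ] ℝ) = Module.finrank ℝ E := by
    have h1 := finrank_add_finrank_perp (⊥ : Submodule ℝ E)
    have h2 : perp (⊥ : Submodule ℝ E) = ⊤ := by
      refine top_unique fun α _ v hv => ?_
      rw [(Submodule.mem_bot ℝ).1 hv, map_zero]
    rwa [h2, finrank_top, finrank_bot, zero_add] at h1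
  refine linearIndependent_of_top_le_span_of_card_eq_finrank (fun α _ => ?_) (hc.trans hdual.symm)
  by_contra hα
  obtain ⟨v, hv, hv1⟩ := exists_vector_of_notMem hα
  rw [h v fun i => hv _ (Submodule.subset_span ⟨i, rfl⟩), map_zero] at hv1
  exact zero_ne_one hv1

theorem eq_zero_of_linearIndependent {ι : Type*} [Fintype ι] {κ : ι → E →L[ℝ] ℝ}
    (hc : Fintype.card ι = Module.finrank ℝ E) (h : LinearIndependent ℝ κ) {v : E}
    (hv : ∀ i, κ i v = 0) : v = 0 := by
  have h1 := surjective_pi_of_linearIndependent h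
  have h2 : Function.Injective (ContinuousLinearMap.pi κ).toLinearMap :=
    (LinearMap.injective_iff_surjective_of_finrank_eq_finrank
      (by rw [Module.finrank_fintype_fun_eq_card, hc])).2 h1
  exact h2 ((funext hv : ContinuousLinearMap.pi κ v = 0).trans (map_zero _).symm)

end LinearAlgebra

section FirstIntegrals

variable {E : Type u} [NormedAddCommGroup E] [NormedSpace ℝ E] [FiniteDimensional ℝ E]

/-- An integrable Pfaffian system has first integrals with prescribed differential at a point. -/
theorem exists_first_integral {ι : Type*} [Fintype ι] {κ : ι → E → E →L[ℝ] ℝ} {x₀ : E}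
    (hκ : ∀ i, SmoothNear (κ i) x₀) (hi : LinearIndependent ℝ fun i => κ i x₀)
    (hF : ∀ᶠ y in 𝓝 x₀, ∀ i v w, (∀ j, κ j y v = 0) → (∀ j, κ j y w = 0) →
      dForm (κ i) y v w = 0) (i₀ : ι) :
    ∃ h : E → ℝ, SmoothNear h x₀ ∧ fderiv ℝ h x₀ = κ i₀ x₀ ∧
      ∀ᶠ y in 𝓝 x₀, ∀ v, (∀ j, κ j y v = 0) → fderiv ℝ h y v = 0 := by
  have hall := Filter.eventually_all.2 hκ
  have hΘ : ∀ᶠ y in 𝓝 x₀, ContDiffAt ℝ ∞ (fun y => ContinuousLinearMap.pi fun i => κ i y) y := by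
    filter_upwards [hall] with y hy using contDiffAt_clm_pi hy
  obtain ⟨f, hf, hfs, hfk⟩ := exists_first_integrals hΘ (surjective_pi_of_linearIndependent hi) (by
    filter_upwards [hF, hall, hΘ] with y h1 h2 h3 v w hv hw
    funext i
    have h4 : ∀ a b, fderiv ℝ (fun y => ContinuousLinearMap.pi fun i => κ i y) y a b i =
        fderiv ℝ (κ i) y a b := by
      intro a b
      have h5 : (κ i) = fun y => (ContinuousLinearMap.compL ℝ E (ι → ℝ) ℝ
          (ContinuousLinearMap.proj i)) (ContinuousLinearMap.pi fun i => κ i y) := by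
        funext y
        ext v
        rfl
      have h6 := ((ContinuousLinearMap.compL ℝ E (ι → ℝ) ℝ
          (ContinuousLinearMap.proj i)).hasFDerivAt.comp y
          (h3.differentiableAt (by simp)).hasFDerivAt).fderiv
      have h7 : fderiv ℝ (κ i) y = _ := (congrArg (fun g => fderiv ℝ g y) h5).trans h6
      rw [h7]
      rfl
    rw [h4, h4]
    exact sub_eq_zero.1 (h1 i v w (congrFun hv) (congrFun hw)))
  obtain ⟨M, hM⟩ := exists_factor_of_ker_le (surjective_pi_of_linearIndependent hi) hfs
    hfk.self_of_nhds
  -- The linear change `M` of the values normalizes the differential at `x₀` to the given forms, and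
  -- a linear image of first integrals is again a first integral.
  set L : (ι → ℝ) →L[ℝ] ℝ := (ContinuousLinearMap.proj i₀).comp (M : (ι → ℝ) →L[ℝ] ι → ℝ) with hL
  have hd : ∀ᶠ y in 𝓝 x₀, fderiv ℝ (fun y => L (f y)) y = L.comp (fderiv ℝ f y) := by
    filter_upwards [hf] with y hy
    exact (L.hasFDerivAt.comp y (hy.differentiableAt (by simp)).hasFDerivAt).fderiv
  refine ⟨fun y => L (f y), ?_, ?_, ?_⟩
  · filter_upwards [hf] with y hy using L.contDiff.contDiffAt.comp y hy
  · rw [hd.self_of_nhds]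
    ext v
    exact congrFun (hM v) i₀
  · filter_upwards [hd, hfk] with y h1 h2 v hv
    rw [h1, ContinuousLinearMap.comp_apply, h2 v (funext hv), map_zero]

theorem dForm_fderiv {h : E → ℝ} {y : E} (hh : ContDiffAt ℝ ∞ h y) (v w : E) :
    dForm (fderiv ℝ h) y v w = 0 :=
  sub_eq_zero.2 (hh.isSymmSndFDerivAt (by
    rw [minSmoothness_of_isRCLikeNormedField]
    exact WithTop.coe_le_coe.2 le_top) v w)

/-- The exterior derivative of a combination on the common kernel. -/
theorem dForm_sum_smul {ι : Type*} [Fintype ι] {κ : ι → E → E →L[ℝ] ℝ} {a : ι → E → ℝ} {y : E}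
    (hκ : ∀ i, ContDiffAt ℝ ∞ (κ i) y) (ha : ∀ i, ContDiffAt ℝ ∞ (a i) y) {v w : E}
    (hv : ∀ i, κ i y v = 0) (hw : ∀ i, κ i y w = 0) :
    dForm (fun y => ∑ i, a i y • κ i y) y v w = ∑ i, a i y * dForm (κ i) y v w := by
  have h1 : HasFDerivAt (fun y => ∑ i, a i y • κ i y) _ y := HasFDerivAt.fun_sum fun i _ =>
    ((ha i).differentiableAt (by simp)).hasFDerivAt.smul
      ((hκ i).differentiableAt (by simp)).hasFDerivAt
  unfold dForm
  rw [h1.fderiv]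
  simp only [_root_.sum_apply, add_apply, smul_apply, ContinuousLinearMap.smulRight_apply, hv, hw,
    smul_eq_mul, mul_zero, add_zero, mul_sub, Finset.sum_sub_distrib]

theorem dForm_sub_smul {β β₀ : E → E →L[ℝ] ℝ} {c : E → ℝ} {y : E} (hβ : ContDiffAt ℝ ∞ β y)
    (hβ₀ : ContDiffAt ℝ ∞ β₀ y) (hc : ContDiffAt ℝ ∞ c y) (v w : E) :
    dForm (fun y => β y - c y • β₀ y) y v w = dForm β y v w - c y * dForm β₀ y v w -
      (fderiv ℝ c y v * β₀ y w - fderiv ℝ c y w * β₀ y v) := by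
  have h1 : HasFDerivAt (fun y => β y - c y • β₀ y) _ y :=
    (hβ.differentiableAt (by simp)).hasFDerivAt.sub
    ((hc.differentiableAt (by simp)).hasFDerivAt.smul (hβ₀.differentiableAt (by simp)).hasFDerivAt)
  unfold dForm
  simp only [h1.fderiv, add_apply, sub_apply, smul_apply, ContinuousLinearMap.smulRight_apply,
    smul_eq_mul]
  ring

end FirstIntegrals

section Coordinates

variable {E : Type u} [NormedAddCommGroup E] [NormedSpace ℝ E] [FiniteDimensional ℝ E]

/-- The structure equations of an adapted coframing `b 0, …, b (n + K), ω₁, dT`. -/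
structure IsStructureCoframing (n K : ℕ) (b : ℕ → E → E →L[ℝ] ℝ) (ω₁ : E → E →L[ℝ] ℝ) (T : E → ℝ)
    (x₀ : E) : Prop where
  two_le : 2 ≤ n
  smooth_b : ∀ i ≤ n + K, SmoothNear (b i) x₀
  smooth_ω₁ : SmoothNear ω₁ x₀
  smooth_T : SmoothNear T x₀
  indep : LinearIndependent ℝ (Sum.elim (fun i : Fin (n + K + 1) => b i x₀)
    ![ω₁ x₀, fderiv ℝ T x₀])
  finrank : Module.finrank ℝ E = n + K + 3
  d_first : ∀ᶠ y in 𝓝 x₀, ∀ v w, (∀ i < n, b i y v = 0) → (∀ i < n, b i y w = 0) →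
    dForm (b 0) y v w = fderiv ℝ T y v * ω₁ y w - fderiv ℝ T y w * ω₁ y v
  d_middle : ∀ᶠ y in 𝓝 x₀, ∀ i, 0 < i → i + 1 < n → ∀ v w, (∀ i < n, b i y v = 0) →
    (∀ i < n, b i y w = 0) → dForm (b i) y v w = 0
  d_last : ∀ᶠ y in 𝓝 x₀, ∀ i, n ≤ i + 1 → i < n + K → ∀ v w, (∀ l ≤ i, b l y v = 0) →
    (∀ l ≤ i, b l y w = 0) →
    dForm (b i) y v w = fderiv ℝ T y v * b (i + 1) y w - fderiv ℝ T y w * b (i + 1) y v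

variable {n K : ℕ} {b : ℕ → E → E →L[ℝ] ℝ} {ω₁ : E → E →L[ℝ] ℝ} {T : E → ℝ} {x₀ : E}

theorem SmoothNear.fderiv {F : Type*} [NormedAddCommGroup F] [NormedSpace ℝ F] {f : E → F}
    (h : SmoothNear f x₀) : SmoothNear (fderiv ℝ f) x₀ :=
  h.mono fun _ hy => hy.fderiv_right (by simp)

/-- The three kinds of structure equations have the common shape `dT ∧ β`, modulo any initial
segment of length at least `n` that contains the form. So every such segment becomes integrable once
`dT` is adjoined. -/
theorem IsStructureCoframing.d_eq (h : IsStructureCoframing n K b ω₁ T x₀) :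
    ∀ᶠ y in 𝓝 x₀, ∀ m, n ≤ m → ∀ i < m, i < n + K → ∀ v w, (∀ i < m, b i y v = 0) →
      (∀ i < m, b i y w = 0) → dForm (b i) y v w =
        fderiv ℝ T y v * (if i = 0 then ω₁ else if i + 1 < n then 0 else b (i + 1)) y w -
        fderiv ℝ T y w * (if i = 0 then ω₁ else if i + 1 < n then 0 else b (i + 1)) y v := by
  have hn := h.two_le
  filter_upwards [h.d_first, h.d_middle, h.d_last] with y h1 h2 h3 m hm i hi hiK v w hv hw
  by_cases h0 : i = 0
  · subst h0
    simp only [if_true]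
    exact h1 v w (fun l hl => hv l (by omega)) fun l hl => hw l (by omega)
  · by_cases h4 : i + 1 < n
    · rw [if_neg h0, if_pos h4, h2 i (by omega) h4 v w (fun l hl => hv l (by omega))
        fun l hl => hw l (by omega)]
      simp
    · rw [if_neg h0, if_neg h4]
      exact h3 i (by omega) hiK v w (fun l hl => hv l (by omega)) fun l hl => hw l (by omega)

theorem IsStructureCoframing.smoothNear_full (h : IsStructureCoframing n K b ω₁ T x₀)
    (i : Fin (n + K + 1) ⊕ Fin 2) :
    SmoothNear (Sum.elim (fun i : Fin (n + K + 1) => b i) ![ω₁, fderiv ℝ T] i) x₀ := by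
  rcases i with i | i
  · exact h.smooth_b i (by have := i.2; omega)
  · fin_cases i
    · exact h.smooth_ω₁
    · exact h.smooth_T.fderiv

theorem IsStructureCoframing.eventually_indep (h : IsStructureCoframing n K b ω₁ T x₀) :
    ∀ᶠ y in 𝓝 x₀, LinearIndependent ℝ (Sum.elim (fun i : Fin (n + K + 1) => b i y)
      ![ω₁ y, fderiv ℝ T y]) := by
  have h1 : ∀ y, (Sum.elim (fun i : Fin (n + K + 1) => b i y) ![ω₁ y, fderiv ℝ T y]) =
      fun i => Sum.elim (fun i : Fin (n + K + 1) => b i) ![ω₁, fderiv ℝ T] i y := by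
    intro y
    funext i
    rcases i with i | i
    · rfl
    · fin_cases i <;> rfl
  simp only [h1]
  exact eventually_linearIndependent h.smoothNear_full (by rw [← h1]; exact h.indep)

theorem linearIndependent_sum_unit_of_full {V : Type*} [AddCommGroup V] [Module ℝ V]
    {β : ℕ → V} {α σ : V} {m l : ℕ}
    (h : LinearIndependent ℝ (Sum.elim (fun i : Fin m => β i) ![α, σ])) (hl : l ≤ m) :
    LinearIndependent ℝ (Sum.elim (fun i : Fin l => β i) fun _ : Unit => σ) := by
  have h1 := h.comp (Sum.map (Fin.castLE hl) fun _ : Unit => (1 : Fin 2))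
    ((Fin.castLE_injective hl).sumMap fun _ _ _ => rfl)
  convert h1 using 1
  funext i
  rcases i with i | i <;> rfl

theorem linearIndependent_sum_of_full {V : Type*} [AddCommGroup V] [Module ℝ V]
    {β : ℕ → V} {α σ : V} {m l : ℕ}
    (h : LinearIndependent ℝ (Sum.elim (fun i : Fin m => β i) ![α, σ])) (hl : l ≤ m) :
    LinearIndependent ℝ (Sum.elim (fun i : Fin l => β i) ![α, σ]) := by
  have h1 := h.comp (Sum.map (Fin.castLE hl) id)
    ((Fin.castLE_injective hl).sumMap Function.injective_id)
  convert h1 using 1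
  funext i
  rcases i with i | i <;> rfl

/-- First integrals of the integrable systems of an adapted coframing. -/
theorem IsStructureCoframing.exists_integral (h : IsStructureCoframing n K b ω₁ T x₀) {i m : ℕ}
    (hm : n ≤ m) (hmK : m ≤ n + K) (hi : i < m) : ∃ f : E → ℝ, SmoothNear f x₀ ∧
      fderiv ℝ f x₀ = b i x₀ ∧ ∀ᶠ y in 𝓝 x₀, ∀ v, (∀ l < m, b l y v = 0) →
        fderiv ℝ T y v = 0 → fderiv ℝ f y v = 0 := by
  set κ : Fin m ⊕ Unit → E → E →L[ℝ] ℝ := Sum.elim (fun i => b i) fun _ => fderiv ℝ T with hκ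
  obtain ⟨f, hf, hf0, hfk⟩ := exists_first_integral (κ := κ) (x₀ := x₀) (by
      rintro (l | l)
      · exact h.smooth_b l (by have := l.2; omega)
      · exact h.smooth_T.fderiv) (by
      have h1 := linearIndependent_sum_unit_of_full (β := fun i => b i x₀) h.indep (l := m) (by omega)
      have h2 : (fun i => κ i x₀) =
          Sum.elim (fun i : Fin m => b i x₀) fun _ : Unit => fderiv ℝ T x₀ := by
        funext l
        rcases l with l | l <;> rfl
      rw [h2]
      exact h1) (by
      filter_upwards [h.d_eq, h.smooth_T] with y h1 h2 l v w hv hw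
      have hTv : fderiv ℝ T y v = 0 := hv (Sum.inr ())
      have hTw : fderiv ℝ T y w = 0 := hw (Sum.inr ())
      rcases l with l | l
      · refine (h1 m hm l l.2 (by have := l.2; omega) v w
          (fun i hi => hv (Sum.inl ⟨i, hi⟩)) fun i hi => hw (Sum.inl ⟨i, hi⟩)).trans ?_
        rw [hTv, hTw]
        ring
      · exact dForm_fderiv h2 v w) (Sum.inl ⟨i, hi⟩)
  refine ⟨f, hf, hf0, hfk.mono fun y hy v hv hT => hy v ?_⟩
  rintro (l | l)
  · exact hv l l.2
  · exact hT

/-- A first integral of the Cartan system that is independent of the integrals of the first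
derived stage. -/
theorem IsStructureCoframing.exists_cartan_integral (h : IsStructureCoframing n K b ω₁ T x₀)
    {g : E → ℝ} (hg : SmoothNear g x₀) (hg0 : fderiv ℝ g x₀ = b 0 x₀)
    (hgk : ∀ᶠ y in 𝓝 x₀, ∀ v, (∀ l < n, b l y v = 0) → fderiv ℝ T y v = 0 → fderiv ℝ g y v = 0) :
    ∃ f : E → ℝ, SmoothNear f x₀ ∧
      (∀ v, (∀ l < n, b l x₀ v = 0) → fderiv ℝ T x₀ v = 0 → fderiv ℝ f x₀ v = ω₁ x₀ v) ∧
      ∀ᶠ y in 𝓝 x₀, ∀ v, (∀ l ≤ n, b l y v = 0) → ω₁ y v = 0 → fderiv ℝ T y v = 0 →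
        fderiv ℝ f y v = 0 := by
  have hn := h.two_le
  set Λ : Fin n ⊕ Unit → E → E →L[ℝ] ℝ := Sum.elim (fun i => b i) fun _ => fderiv ℝ T with hΛ
  have hΛs : ∀ i, SmoothNear (Λ i) x₀ := by
    rintro (l | l)
    · exact h.smooth_b l (by have := l.2; omega)
    · exact h.smooth_T.fderiv
  have hΛi : LinearIndependent ℝ fun i => Λ i x₀ := by
    have h1 := linearIndependent_sum_unit_of_full (β := fun i => b i x₀) h.indep (l := n) (by omega)
    have h2 : (fun i => Λ i x₀) =
        Sum.elim (fun i : Fin n => b i x₀) fun _ : Unit => fderiv ℝ T x₀ := by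
      funext l
      rcases l with l | l <;> rfl
    rw [h2]
    exact h1
  have hΛi' := eventually_linearIndependent hΛs hΛi
  obtain ⟨a, ha, ha'⟩ := exists_smooth_coeffs hΛs hΛi hg.fderiv (by
    filter_upwards [hgk] with y hy
    by_contra hnot
    obtain ⟨v, hv, hv1⟩ := exists_vector_of_notMem hnot
    rw [hy v (fun l hl => hv _ (Submodule.subset_span ⟨Sum.inl ⟨l, hl⟩, rfl⟩))
      (hv _ (Submodule.subset_span ⟨Sum.inr (), rfl⟩))] at hv1
    exact zero_ne_one hv1)
  have hform : ∀ᶠ y in 𝓝 x₀, fderiv ℝ g y - a (Sum.inr ()) y • fderiv ℝ T y =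
      ∑ i : Fin n, a (Sum.inl i) y • b i y := by
    filter_upwards [ha'] with y hy
    rw [hy, Fintype.sum_sum_type]
    simp only [Finset.univ_unique, Finset.sum_singleton]
    exact add_sub_cancel_right _ _
  -- The coefficient of `dT` in `dg`, in effect the time derivative of `g`, is the function sought.
  -- Applying `d` to the identity `dg - a dT = ∑ aᵢ bᵢ` and pairing with a vector on which `dT` is
  -- `1` and the forms `bᵢ` vanish expresses `da` through the structure equations.
  have key : ∀ᶠ y in 𝓝 x₀, ∀ v, (∀ l < n, b l y v = 0) → fderiv ℝ T y v = 0 →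
      fderiv ℝ (a (Sum.inr ())) y v = ∑ i : Fin n, a (Sum.inl i) y *
        (if i.1 = 0 then ω₁ else if i.1 + 1 < n then 0 else b (i.1 + 1)) y v := by
    filter_upwards [eventually_eventually_nhds.2 hform, h.d_eq, Filter.eventually_all.2 hΛs,
      Filter.eventually_all.2 ha, hΛi', hg, h.smooth_T] with y h1 h2 h3 h4 h5 h6 h7 v hv hTv
    obtain ⟨X, hX⟩ := surjective_pi_of_linearIndependent h5 (Sum.elim 0 1)
    have hXb : ∀ l < n, b l y X = 0 := fun l hl => congrFun hX (Sum.inl ⟨l, hl⟩)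
    have hXT : fderiv ℝ T y X = 1 := congrFun hX (Sum.inr ())
    have h8 : dForm (fun y => fderiv ℝ g y - a (Sum.inr ()) y • fderiv ℝ T y) y v X =
        dForm (fun y => ∑ i : Fin n, a (Sum.inl i) y • b i y) y v X := by
      have h9 := Filter.EventuallyEq.fderiv_eq (𝕜 := ℝ) h1
      unfold dForm
      rw [h9]
    rw [dForm_sub_smul (h6.fderiv_right (by simp)) (h7.fderiv_right (by simp)) (h4 (Sum.inr ())),
      dForm_fderiv h6, dForm_fderiv h7, dForm_sum_smul (κ := fun i : Fin n => b i)
        (a := fun i => a (Sum.inl i)) (fun i => h3 (Sum.inl i))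
        (fun i => h4 (Sum.inl i)) (fun i => hv i i.2) (fun i => hXb i i.2), hXT, hTv] at h8
    have h9 : ∑ i : Fin n, a (Sum.inl i) y * dForm (b i) y v X = -∑ i : Fin n,
        a (Sum.inl i) y * (if i.1 = 0 then ω₁ else if i.1 + 1 < n then 0 else b (i.1 + 1)) y v := by
      rw [← Finset.sum_neg_distrib]
      refine Finset.sum_congr rfl fun i _ => ?_
      rw [h2 n le_rfl i i.2 (by have := i.2; omega) v X hv hXb, hTv, hXT]
      ring
    rw [h9] at h8
    linarith
  refine ⟨a (Sum.inr ()), ha _, fun v hv hTv => ?_, ?_⟩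
  · rw [key.self_of_nhds v hv hTv]
    -- At `x₀` the differential of `g` is `b 0`, so only the term of `b 0` survives and `da` reduces
    -- to `ω₁`.
    have h1 : ∀ i, a i x₀ = Pi.single (M := fun _ => ℝ) (Sum.inl ⟨0, by omega⟩) 1 i := by
      have h2 := ha'.self_of_nhds
      rw [hg0] at h2
      have h3 : b 0 x₀ = ∑ i, Pi.single (M := fun _ => ℝ) (Sum.inl ⟨0, by omega⟩) (1 : ℝ) i •
          Λ i x₀ := by
        rw [Finset.sum_eq_single (Sum.inl (⟨0, by omega⟩ : Fin n))]
        · rw [Pi.single_eq_same, one_smul]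
          rfl
        · intro i _ hi
          rw [Pi.single_eq_of_ne hi, zero_smul]
        · intro hi
          exact absurd (Finset.mem_univ _) hi
      rw [h3] at h2
      intro i
      have h4 := Fintype.linearIndependent_iff.1 hΛi
        (fun i => a i x₀ - Pi.single (M := fun _ => ℝ) (Sum.inl ⟨0, by omega⟩) (1 : ℝ) i) (by
          simp only [sub_smul, Finset.sum_sub_distrib]
          rw [← h2, sub_self]) i
      exact sub_eq_zero.1 h4
    rw [Finset.sum_eq_single (⟨0, by omega⟩ : Fin n)]
    · rw [h1, Pi.single_eq_same, one_mul, if_pos rfl]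
    · intro i _ hi
      rw [h1, Pi.single_eq_of_ne (fun h2 => hi (Sum.inl_injective h2)), zero_mul]
    · intro hi
      exact absurd (Finset.mem_univ _) hi
  · filter_upwards [key] with y hy v hv hω hTv
    rw [hy v (fun l hl => hv l hl.le) hTv]
    refine Finset.sum_eq_zero fun i _ => ?_
    by_cases h0 : i.1 = 0
    · rw [if_pos h0, hω, mul_zero]
    · by_cases h4 : i.1 + 1 < n
      · rw [if_neg h0, if_pos h4]
        exact mul_zero _
      · rw [if_neg h0, if_neg h4, hv _ (by have := i.2; omega), mul_zero]

/-- Coordinates adapted to a coframing: `c 0 = T`, and the systems `⟦b 0, …, b (n + k - 1), dT⟧`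
and `⟦b 0, …, b (n + k), ω₁, dT⟧` are spanned by coordinate differentials. -/
theorem IsStructureCoframing.exists_coordinates (h : IsStructureCoframing n K b ω₁ T x₀) :
    ∃ c : ℕ → E → ℝ, (∀ i < n + K + 3, SmoothNear (c i) x₀) ∧ c 0 = T ∧
      LinearIndependent ℝ (fun i : Fin (n + K + 3) => fderiv ℝ (c i) x₀) ∧
      (∀ᶠ y in 𝓝 x₀, ∀ k ≤ K, ∀ v, ((∀ l < n + k, b l y v = 0) ∧ fderiv ℝ T y v = 0) ↔
        (∀ l < n + k, fderiv ℝ (c (l + 2)) y v = 0) ∧ fderiv ℝ (c 0) y v = 0) ∧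
      ∀ᶠ y in 𝓝 x₀, ∀ k ≤ K, ∀ v, ((∀ l < n + k + 1, b l y v = 0) ∧ ω₁ y v = 0 ∧
        fderiv ℝ T y v = 0) ↔ ∀ l < n + k + 3, fderiv ℝ (c l) y v = 0 := by
  have hn := h.two_le
  -- `max n (i + 1)` is the length of the shortest integrable segment that contains `b i`: the first
  -- `n` forms enter together and the others one at a time.
  have hex : ∀ i : ℕ, ∃ f : E → ℝ, SmoothNear f x₀ ∧ (i ≤ n + K → fderiv ℝ f x₀ = b i x₀) ∧
      (i < n + K → ∀ᶠ y in 𝓝 x₀, ∀ v, (∀ l < max n (i + 1), b l y v = 0) →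
        fderiv ℝ T y v = 0 → fderiv ℝ f y v = 0) := by
    intro i
    rcases Nat.lt_or_ge i (n + K) with hi | hi
    · obtain ⟨f, hf, hf0, hfk⟩ := h.exists_integral (i := i) (m := max n (i + 1)) (by omega)
        (by omega) (by omega)
      exact ⟨f, hf, fun _ => hf0, fun _ => hfk⟩
    -- Beyond the integrable segments any function with the right differential at `x₀` will do, for
    -- instance a linear one.
    · exact ⟨b i x₀, Filter.Eventually.of_forall fun y => (b i x₀).contDiff.contDiffAt,
        fun _ => (b i x₀).fderiv, fun hi' => absurd hi' (by omega)⟩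
  choose g hg hg0 hgk using hex
  obtain ⟨w, hw, hw0, hwk⟩ := h.exists_cartan_integral (hg 0) (hg0 0 (by omega)) (by
    have h1 := hgk 0 (by omega)
    rwa [max_eq_left (by omega)] at h1)
  -- Index `0` is time and index `1` is the integral of the Cartan systems, the control paired with
  -- the first form; the shift by `2` leaves the integrals of the `b i` in order.
  set c : ℕ → E → ℝ := fun i => if i = 0 then T else if i = 1 then w else g (i - 2) with hc
  have hc0 : c 0 = T := rfl
  have hc1 : c 1 = w := rfl
  have hc2 : ∀ i, c (i + 2) = g i := fun i => rfl
  have hcs : ∀ i, SmoothNear (c i) x₀ := by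
    rintro (_ | _ | i)
    · exact h.smooth_T
    · exact hw
    · exact hg i
  have hker : ∀ v, (∀ i < n + K + 3, fderiv ℝ (c i) x₀ v = 0) → v = 0 := by
    intro v hv
    have h0 : fderiv ℝ T x₀ v = 0 := hv 0 (by omega)
    have hb : ∀ i ≤ n + K, b i x₀ v = 0 := fun i hi => by
      rw [← hg0 i hi]
      exact hv (i + 2) (by omega)
    have h1 : ω₁ x₀ v = 0 := by
      rw [← hw0 v (fun l hl => hb l (by omega)) h0]
      exact hv 1 (by omega)
    refine eq_zero_of_linearIndependent ?_ h.indep ?_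
    · simp only [Fintype.card_sum, Fintype.card_fin, h.finrank]
    · rintro (i | i)
      · exact hb i (by have := i.2; omega)
      · fin_cases i
        · exact h1
        · exact h0
  have hind : LinearIndependent ℝ (fun i : Fin (n + K + 3) => fderiv ℝ (c i) x₀) :=
    linearIndependent_of_ker_eq_zero (by rw [Fintype.card_fin, h.finrank])
      fun v hv => hker v fun i hi => hv ⟨i, hi⟩
  have hind' := eventually_linearIndependent
    (κ := fun (i : Fin (n + K + 3)) => fderiv ℝ (c i)) (fun i => (hcs i).fderiv) hind
  have hgk' : ∀ᶠ y in 𝓝 x₀, ∀ i : Fin (n + K), ∀ v, (∀ l < max n (i.1 + 1), b l y v = 0) →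
      fderiv ℝ T y v = 0 → fderiv ℝ (g i) y v = 0 :=
    Filter.eventually_all.2 fun i => hgk i i.2
  refine ⟨c, fun i _ => hcs i, rfl, hind, ?_, ?_⟩
  · filter_upwards [hind', h.eventually_indep, hgk'] with y h1 h2 h3 k hk v
    have h4 := linearIndependent_sum_unit_of_full (β := fun i => b i y) h2 (l := n + k) (by omega)
    have h5 := h1.comp (Sum.elim (fun i : Fin (n + k) => (⟨i.1 + 2, by have := i.2; omega⟩ :
        Fin (n + K + 3))) fun _ : Unit => ⟨0, by omega⟩) (by
      rintro (i | i) (j | j) hij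
      · have h6 : i.1 + 2 = j.1 + 2 := congrArg Fin.val hij
        exact congrArg Sum.inl (Fin.ext (by omega))
      · exact absurd (congrArg Fin.val hij) (Nat.succ_ne_zero _)
      · exact absurd (congrArg Fin.val hij).symm (Nat.succ_ne_zero _)
      · rfl)
    have h6 := ker_iff_of_ker_le h4 h5 (fun v hv => by
      rintro (i | i)
      · exact h3 ⟨i.1, by have := i.2; omega⟩ v (fun l hl => hv (Sum.inl ⟨l, by
          have := i.2
          have : l < max n (i.1 + 1) := hl
          omega⟩)) (hv (Sum.inr ()))
      · exact hv (Sum.inr ())) v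
    simp only [Sum.forall] at h6
    refine Iff.trans ?_ (h6.trans ?_)
    · exact ⟨fun h7 => ⟨fun i => h7.1 i i.2, fun _ => h7.2⟩,
        fun h7 => ⟨fun l hl => h7.1 ⟨l, hl⟩, h7.2 ()⟩⟩
    · exact ⟨fun h7 => ⟨fun l hl => h7.1 ⟨l, hl⟩, h7.2 ()⟩,
        fun h7 => ⟨fun i => h7.1 i i.2, fun _ => h7.2⟩⟩
  · filter_upwards [hind', h.eventually_indep, hgk', hwk] with y h1 h2 h3 hw3 k hk v
    have h4 := linearIndependent_sum_of_full (β := fun i => b i y) h2 (l := n + k + 1) (by omega)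
    have h5 := h1.comp (Sum.elim (fun i : Fin (n + k + 1) => (⟨i.1 + 2, by have := i.2; omega⟩ :
        Fin (n + K + 3))) ![⟨1, by omega⟩, ⟨0, by omega⟩]) (by
      rintro (i | i) (j | j) hij
      · have h6 : i.1 + 2 = j.1 + 2 := congrArg Fin.val hij
        exact congrArg Sum.inl (Fin.ext (by omega))
      · have h6 := congrArg Fin.val hij
        fin_cases j <;> simp at h6
      · have h6 := congrArg Fin.val hij
        fin_cases i <;> simp at h6
      · have h6 := congrArg Fin.val hij
        fin_cases i <;> fin_cases j <;> simp at h6 ⊢)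
    have h6 := ker_iff_of_ker_le h4 h5 (fun v hv => by
      have hb : ∀ l < n + k + 1, b l y v = 0 := fun l hl => hv (Sum.inl ⟨l, hl⟩)
      have hω : ω₁ y v = 0 := hv (Sum.inr 0)
      have hT : fderiv ℝ T y v = 0 := hv (Sum.inr 1)
      -- At the top level the forms make up a full coframing, so the last coordinate, which need not
      -- be an integral of anything, causes no problem.
      have hv0 : k = K → v = 0 := by
        rintro rfl
        refine eq_zero_of_linearIndependent ?_ h2 hv
        simp only [Fintype.card_sum, Fintype.card_fin, h.finrank]
      rintro (i | i)
      · rcases eq_or_ne k K with hkK | hkK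
        · rw [hv0 hkK, map_zero]
        · exact h3 ⟨i.1, by have := i.2; omega⟩ v (fun l hl => hb l (by
            have := i.2
            have : l < max n (i.1 + 1) := hl
            omega)) hT
      · fin_cases i
        · exact hw3 v (fun l hl => hb l (by omega)) hω hT
        · exact hT) v
    refine Iff.trans ?_ (h6.trans ?_)
    · constructor
      · rintro ⟨h7, h8, h9⟩ (i | i)
        · exact h7 i i.2
        · fin_cases i
          · exact h8
          · exact h9
      · exact fun h7 => ⟨fun l hl => h7 (Sum.inl ⟨l, hl⟩), h7 (Sum.inr 0), h7 (Sum.inr 1)⟩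
    · constructor
      · rintro h7 (_ | _ | l) hl
        · exact h7 (Sum.inr 1)
        · exact h7 (Sum.inr 0)
        · exact h7 (Sum.inl ⟨l, by omega⟩)
      · rintro h7 (i | i)
        · exact h7 (i.1 + 2) (by have := i.2; omega)
        · fin_cases i
          · exact h7 1 (by omega)
          · exact h7 0 (by omega)

end Coordinates

/-! ### Cauchy characteristics of an adapted coframing -/

section AdaptedCoframings

variable {d : ℕ} {N : Type u} [TopologicalSpace N] [ChartedSpace (EuclideanSpace ℝ (Fin d)) N]
  [IsManifold (𝓡 d) ∞ N] {n K : ℕ} {θ : Fin n → Form d N} {η : Fin K → Form d N}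
  {ω₁ ω₂ σ : Form d N}

/-- The sequence `θ¹, …, θⁿ, η¹, …, η^K, ω², ω², …`, numbered from `0`. -/
def coframe (θ : Fin n → Form d N) (η : Fin K → Form d N) (ω₂ : Form d N) (i : ℕ) : Form d N :=
  if h : i < n then θ ⟨i, h⟩ else etaNext η ω₂ (i - n)

theorem coframe_of_lt {i : ℕ} (h : i < n) : coframe θ η ω₂ i = θ ⟨i, h⟩ := dif_pos h

theorem coframe_add (j : ℕ) : coframe θ η ω₂ (n + j) = etaNext η ω₂ j := by
  rw [coframe, dif_neg (by omega), Nat.add_sub_cancel_left]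

theorem coframe_η (j : Fin K) : coframe θ η ω₂ (n + j) = η j := by
  rw [coframe_add, etaNext, dif_pos j.2]

theorem coframe_last : coframe θ η ω₂ (n + K) = ω₂ := by
  rw [coframe_add, etaNext, dif_neg (lt_irrefl _)]

theorem spanUpTo_eq {k : ℕ} (hk : k ≤ K) (x : N) :
    Submodule.span ℝ (range fun l : Fin (n + k) => coframe θ η ω₂ l x) = spanUpTo θ η k x := by
  refine congrArg (Submodule.span ℝ) ?_
  ext α
  constructor
  · rintro ⟨l, rfl⟩
    rcases Nat.lt_or_ge l.1 n with h | h
    · exact Or.inl ⟨⟨l.1, h⟩, congrFun (coframe_of_lt h) x⟩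
    · obtain ⟨j, hj⟩ := Nat.exists_eq_add_of_le h
      have hl := l.2
      refine Or.inr ⟨⟨j, by omega⟩, by show j < k; omega, ?_⟩
      show coframe θ η ω₂ l.1 x = _
      rw [hj]
      exact congrFun (coframe_η (⟨j, by omega⟩ : Fin K)) x
  · rintro (⟨i, rfl⟩ | ⟨j, hj, rfl⟩)
    · exact ⟨⟨i.1, by have := i.2; omega⟩, congrFun (coframe_of_lt i.2) x⟩
    · exact ⟨⟨n + j.1, by omega⟩, congrFun (coframe_η j) x⟩

theorem ker_spanUpTo (ω₂ : Form d N) {k : ℕ} (hk : k ≤ K) (x : N) (v : TangentSpace (𝓡 d) x) :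
    (∀ α ∈ spanUpTo θ η k x, α v = 0) ↔ ∀ l < n + k, coframe θ η ω₂ l x v = 0 := by
  rw [← spanUpTo_eq (ω₂ := ω₂) hk]
  refine (mem_ker_span_iff _ v).trans ?_
  exact ⟨fun h l hl => h ⟨l, hl⟩, fun h l => h l l.2⟩

theorem IsAdaptedCoframing.coframe_smooth (h : IsAdaptedCoframing univ θ η ω₁ ω₂ σ) (i : ℕ) (x : N) :
    SmoothFormNear (coframe θ η ω₂ i) x := by
  rcases Nat.lt_or_ge i n with hi | hi
  · rw [coframe_of_lt hi]
    exact (h.smooth_θ _).near isOpen_univ (mem_univ x)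
  · obtain ⟨j, rfl⟩ := Nat.exists_eq_add_of_le hi
    rw [coframe_add, etaNext]
    split_ifs with hj
    · exact (h.smooth_η _).near isOpen_univ (mem_univ x)
    · exact h.smooth_ω₂.near isOpen_univ (mem_univ x)

theorem IsAdaptedCoframing.coframe_indep (h : IsAdaptedCoframing univ θ η ω₁ ω₂ σ) (x : N) :
    LinearIndependent ℝ (Sum.elim (fun i : Fin (n + K + 1) => coframe θ η ω₂ i x)
      ![ω₁ x, σ x] : Fin (n + K + 1) ⊕ Fin 2 → Eu d →L[ℝ] ℝ) := by
  refine linearIndependent_of_ker_eq_zero ?_ fun v hv => ?_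
  · rw [finrank_euclideanSpace_fin, h.dim_eq]
    simp only [Fintype.card_sum, Fintype.card_fin]
  · refine eq_zero_of_linearIndependent (E := Eu d) ?_ (h.independent x (mem_univ x)) ?_
    · rw [finrank_euclideanSpace_fin, h.dim_eq]
      simp only [Fintype.card_sum, Fintype.card_fin]
      omega
    · have hv' : ∀ l < n + K + 1, coframe θ η ω₂ l x v = 0 := fun l hl => hv (Sum.inl ⟨l, hl⟩)
      rintro (i | j | l)
      · have h1 := hv' i (by have := i.2; omega)
        rw [coframe_of_lt i.2] at h1
        exact h1
      · have h1 := hv' (n + j) (by have := j.2; omega)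
        rw [coframe_η] at h1
        exact h1
      · fin_cases l
        · exact hv (Sum.inr 0)
        · have h1 := hv' (n + K) (by omega)
          rw [coframe_last] at h1
          exact h1
        · exact hv (Sum.inr 1)

theorem IsAdaptedCoframing.isFrameAt (h : IsAdaptedCoframing univ θ η ω₁ ω₂ σ) {k : ℕ} (hk : k ≤ K) (x : N) :
    IsFrameAt (spanUpTo θ η k) (fun l : Fin (n + k) => coframe θ η ω₂ l) x where
  smooth l := h.coframe_smooth l x
  indep := Filter.Eventually.of_forall fun z =>
    ((h.coframe_indep z).comp (fun i : Fin (n + k) => Sum.inl (⟨i.1, by have := i.2; omega⟩ :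
      Fin (n + K + 1))) fun i j hij => by
        have h1 := Sum.inl_injective hij
        exact Fin.ext (congrArg Fin.val h1 :))
  span := Filter.Eventually.of_forall fun z => spanUpTo_eq hk z

theorem IsAdaptedCoframing.d_coframe_first (h : IsAdaptedCoframing univ θ η ω₁ ω₂ σ) (hn : 2 ≤ n) (x : N) (v w : TangentSpace (𝓡 d) x)
    (hv : ∀ l < n, coframe θ η ω₂ l x v = 0) (hw : ∀ l < n, coframe θ η ω₂ l x w = 0) :
    extD (coframe θ η ω₂ 0) x v w = σ x v * ω₁ x w - σ x w * ω₁ x v := by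
  rw [coframe_of_lt (by omega)]
  exact h.d_θ_first _ rfl x (mem_univ x) v w ((ker_spanUpTo ω₂ (Nat.zero_le K) x v).2 hv)
    ((ker_spanUpTo ω₂ (Nat.zero_le K) x w).2 hw)

theorem IsAdaptedCoframing.d_coframe_middle (h : IsAdaptedCoframing univ θ η ω₁ ω₂ σ) (x : N) {i : ℕ} (h0 : 0 < i) (hi : i + 1 < n)
    (v w : TangentSpace (𝓡 d) x) (hv : ∀ l < n, coframe θ η ω₂ l x v = 0)
    (hw : ∀ l < n, coframe θ η ω₂ l x w = 0) : extD (coframe θ η ω₂ i) x v w = 0 := by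
  rw [coframe_of_lt (by omega)]
  exact h.d_θ_middle _ h0 hi x (mem_univ x) v w ((ker_spanUpTo ω₂ (Nat.zero_le K) x v).2 hv)
    ((ker_spanUpTo ω₂ (Nat.zero_le K) x w).2 hw)

theorem IsAdaptedCoframing.d_coframe_last (h : IsAdaptedCoframing univ θ η ω₁ ω₂ σ) (x : N) {i : ℕ} (hi : n ≤ i + 1)
    (hiK : i < n + K) (v w : TangentSpace (𝓡 d) x) (hv : ∀ l ≤ i, coframe θ η ω₂ l x v = 0)
    (hw : ∀ l ≤ i, coframe θ η ω₂ l x w = 0) : extD (coframe θ η ω₂ i) x v w =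
      σ x v * coframe θ η ω₂ (i + 1) x w - σ x w * coframe θ η ω₂ (i + 1) x v := by
  rcases hi.eq_or_lt with hi' | hi'
  · have h1 : coframe θ η ω₂ (i + 1) = etaNext η ω₂ 0 := by rw [← hi', ← coframe_add, add_zero]
    rw [coframe_of_lt (by omega), h1]
    exact h.d_θ_last _ hi'.symm x (mem_univ x) v w
      ((ker_spanUpTo ω₂ (Nat.zero_le K) x v).2 fun l hl => hv l (by omega))
      ((ker_spanUpTo ω₂ (Nat.zero_le K) x w).2 fun l hl => hw l (by omega))
  · obtain ⟨j, rfl⟩ := Nat.exists_eq_add_of_le (show n ≤ i by omega)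
    rw [add_assoc, coframe_add (j + 1), coframe_η ⟨j, by omega⟩]
    exact h.d_η ⟨j, by omega⟩ x (mem_univ x) v w
      ((ker_spanUpTo ω₂ (show j + 1 ≤ K by omega) x v).2 fun l hl => hv l (by omega))
      ((ker_spanUpTo ω₂ (show j + 1 ≤ K by omega) x w).2 fun l hl => hw l (by omega))

/-- The Cauchy characteristics of the systems of an adapted coframing. -/
theorem IsAdaptedCoframing.mem_cauchy_iff (h : IsAdaptedCoframing univ θ η ω₁ ω₂ σ) (hn : 2 ≤ n) {k : ℕ} (hk : k ≤ K) (x : N)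
    (v : TangentSpace (𝓡 d) x) : v ∈ cauchy (spanUpTo θ η k) x ↔
      (∀ l < n + k + 1, coframe θ η ω₂ l x v = 0) ∧ ω₁ x v = 0 ∧ σ x v = 0 := by
  rw [(h.isFrameAt hk x).mem_cauchy_iff]
  constructor
  · rintro ⟨h1, h2⟩
    have h1' : ∀ l < n + k, coframe θ η ω₂ l x v = 0 := fun l hl => h1 ⟨l, hl⟩
    have hsurj := surjective_pi_of_linearIndependent (E := Eu d) (h.coframe_indep x)
    have hfirst : ∀ w : TangentSpace (𝓡 d) x, (∀ l < n + k, coframe θ η ω₂ l x w = 0) →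
        σ x v * ω₁ x w - σ x w * ω₁ x v = 0 := fun w hw => by
      rw [← h.d_coframe_first hn x v w (fun l hl => h1' l (by omega))
        fun l hl => hw l (by omega)]
      exact h2 ⟨0, by omega⟩ w fun j => hw j j.2
    -- `a` is dual to `ω₁` and `c` is dual to `σ`. Pairing the structure equation of the first form
    -- with `a` detects `σ v`, and with `c` it detects `ω₁ v`; pairing that of the last form with
    -- `c` detects the next form on `v`.
    obtain ⟨a, ha⟩ := hsurj (Sum.elim 0 ![1, 0])
    obtain ⟨c, hc⟩ := hsurj (Sum.elim 0 ![0, 1])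
    have ha1 : ∀ l < n + k, coframe θ η ω₂ l x a = 0 := fun l hl =>
      congrFun ha (Sum.inl ⟨l, by omega⟩)
    have hc1 : ∀ l < n + k + 1, coframe θ η ω₂ l x c = 0 := fun l hl =>
      congrFun hc (Sum.inl ⟨l, by omega⟩)
    have ha2 : ω₁ x a = 1 := congrFun ha (Sum.inr 0)
    have ha3 : σ x a = 0 := congrFun ha (Sum.inr 1)
    have hc2 : ω₁ x c = 0 := congrFun hc (Sum.inr 0)
    have hc3 : σ x c = 1 := congrFun hc (Sum.inr 1)
    have h3 := hfirst a ha1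
    have h4 := hfirst c fun l hl => hc1 l (by omega)
    rw [ha2, ha3] at h3
    rw [hc2, hc3] at h4
    have h5 : coframe θ η ω₂ (n + k) x v = 0 := by
      have h6 := h.d_coframe_last x (i := n + k - 1) (by omega) (by omega) v c
        (fun l hl => h1' l (by omega)) fun l hl => hc1 l (by omega)
      have h7 : n + k - 1 + 1 = n + k := by omega
      have h8 := h2 ⟨n + k - 1, by omega⟩ c fun j => hc1 j (by have := j.2; omega)
      rw [h7, hc1 _ (by omega), hc3] at h6
      have h9 := h8.symm.trans h6
      linarith
    refine ⟨fun l hl => ?_, by linarith, by linarith⟩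
    rcases Nat.lt_or_ge l (n + k) with hl' | hl'
    · exact h1' l hl'
    · obtain rfl : l = n + k := by omega
      exact h5
  · rintro ⟨h1, h2, h3⟩
    refine ⟨fun i => h1 i (by have := i.2; omega), fun i w hw => ?_⟩
    have hw' : ∀ l < n + k, coframe θ η ω₂ l x w = 0 := fun l hl => hw ⟨l, hl⟩
    have hi := i.2
    rcases Nat.eq_zero_or_pos i.1 with h0 | h0
    · rw [h0, h.d_coframe_first hn x v w (fun l hl => h1 l (by omega))
        fun l hl => hw' l (by omega), h2, h3]
      ring
    · by_cases h4 : i.1 + 1 < n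
      · exact h.d_coframe_middle x h0 h4 v w (fun l hl => h1 l (by omega))
          fun l hl => hw' l (by omega)
      · rw [h.d_coframe_last x (by omega) (by omega) v w (fun l hl => h1 l (by omega))
          fun l hl => hw' l (by omega), h3, h1 _ (by omega)]
        ring

end AdaptedCoframings

/-! ### Coordinate functionals, and charts onto all of Euclidean space -/

section Coordinates

/-- The coordinate functionals of `ℝ^d`, numbered by the natural numbers and zero from `d` on. -/
def co (d j : ℕ) : Eu d →L[ℝ] ℝ := if h : j < d then EuclideanSpace.proj ⟨j, h⟩ else 0

theorem co_apply {d : ℕ} (y : Eu d) (i : Fin d) : co d i y = y i := by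
  rw [co, dif_pos i.2]
  rfl

theorem eu_ext {d : ℕ} {y z : Eu d} (h : ∀ j < d, co d j y = co d j z) : y = z := by
  ext i
  rw [← co_apply, ← co_apply, h i i.2]

theorem eu_eq_zero {d : ℕ} {y : Eu d} (h : ∀ j < d, co d j y = 0) : y = 0 :=
  eu_ext fun j hj => by rw [h j hj, map_zero]

/-- The vector with the coordinates `f 0, f 1, …`. -/
def vec (d : ℕ) (f : ℕ → ℝ) : Eu d := WithLp.toLp 2 fun i => f i

theorem co_vec {d : ℕ} (f : ℕ → ℝ) {j : ℕ} (h : j < d) : co d j (vec d f) = f j := by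
  rw [co, dif_pos h]
  rfl

/-- The linear map `ℝ^a → ℝ^b` that truncates vectors or extends them by zero. -/
def res (a b : ℕ) : Eu a →L[ℝ] Eu b :=
  (EuclideanSpace.equiv (Fin b) ℝ).symm.toContinuousLinearMap.comp
    (ContinuousLinearMap.pi fun i : Fin b => co a i)

theorem co_res {a b j : ℕ} (h : j < b) (v : Eu a) : co b j (res a b v) = co a j v := by
  rw [co, dif_pos h]
  rfl

theorem res_res {a b c : ℕ} (h : c ≤ b) (v : Eu a) : res b c (res a b v) = res a c v :=
  eu_ext fun j hj => by rw [co_res hj, co_res (by omega), co_res hj]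

theorem res_self (a : ℕ) (v : Eu a) : res a a v = v := eu_ext fun _ hj => co_res hj v

theorem res_res_self {a b : ℕ} (h : a ≤ b) (v : Eu a) : res b a (res a b v) = v := by
  rw [res_res h, res_self]

theorem res_surjective {a b : ℕ} (h : b ≤ a) : Function.Surjective (res a b) :=
  fun v => ⟨res b a v, res_res_self h v⟩

theorem res_eq_zero_iff {a b : ℕ} {v : Eu a} : res a b v = 0 ↔ ∀ j < b, co a j v = 0 := by
  constructor
  · intro h j hj
    rw [← co_res hj, h, map_zero]
  · exact fun h => eu_eq_zero fun j hj => by rw [co_res hj, h j hj]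

end Coordinates

section Box

variable {E : Type*} [NormedAddCommGroup E] [NormedSpace ℝ E] [FiniteDimensional ℝ E]

/-- Functions with independent differentials are, up to changes of the single coordinates,
the coordinates of a chart onto the full space. -/
theorem exists_box_coordinates {m : ℕ} {c : ℕ → E → ℝ} {x₀ : E}
    (hc : ∀ i < m, SmoothNear (c i) x₀)
    (hi : LinearIndependent ℝ fun i : Fin m => fderiv ℝ (c i) x₀) (hm : Module.finrank ℝ E = m)
    {s : Set E} (hs : s ∈ 𝓝 x₀) :
    ∃ (e : OpenPartialHomeomorph E (Eu m)) (ρ : ℕ → ℝ → ℝ), x₀ ∈ e.source ∧ e.source ⊆ s ∧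
      e.target = univ ∧ (∀ x ∈ e.source, ContDiffAt ℝ ∞ e x) ∧ ContDiff ℝ ∞ e.symm ∧
      (∀ i, ContDiff ℝ ∞ (ρ i)) ∧ (∀ i t, deriv (ρ i) t ≠ 0) ∧
      ∀ y, ∀ i < m, c i (e.symm y) = ρ i (co m i y) := by
  have : CompleteSpace E := FiniteDimensional.complete ℝ E
  set Y : E → Fin m → ℝ := fun x i => c i x with hY
  have hYs : ∀ᶠ x in 𝓝 x₀, ContDiffAt ℝ ∞ Y x := by
    filter_upwards [Filter.eventually_all.2 fun i : Fin m => hc i i.2] with x hx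
    exact contDiffAt_pi.2 hx
  set T : E →L[ℝ] Fin m → ℝ := ContinuousLinearMap.pi fun i : Fin m => fderiv ℝ (c i) x₀ with hT
  have hTs : Function.Surjective T := surjective_pi_of_linearIndependent hi
  have hTi : Function.Injective T.toLinearMap :=
    (LinearMap.injective_iff_surjective_of_finrank_eq_finrank (by
      rw [Module.finrank_fintype_fun_eq_card, Fintype.card_fin, hm])).2 hTs
  have hYd : HasFDerivAt Y ((ContinuousLinearEquiv.ofBijective T (LinearMap.ker_eq_bot.2 hTi)
      (LinearMap.range_eq_top.2 hTs) : E ≃L[ℝ] Fin m → ℝ) : E →L[ℝ] Fin m → ℝ) x₀ := by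
    rw [ContinuousLinearEquiv.coe_ofBijective]
    exact hasFDerivAt_pi.2 fun i =>
      ((hc i i.2).self_of_nhds.differentiableAt (by simp)).hasFDerivAt
  obtain ⟨e₀, hx₀, hes, hcoe, hsm, -, hsymm⟩ := exists_smooth_local_inverse hYs hYd hs
  have htar : e₀.target ∈ 𝓝 (Y x₀) := by
    rw [← hcoe]
    exact e₀.open_target.mem_nhds (e₀.map_source hx₀)
  obtain ⟨r, hr, hball⟩ := Metric.mem_nhds_iff.1 htar
  -- Each coordinate separately is reparametrized from an interval of radius `r` to the whole line.
  -- The product turns a sup-norm ball into the full space and keeps the coordinate differentials up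
  -- to nonzero factors; on the full space the fibers of coordinate projections are connected.
  set R : ℕ → OpenPartialHomeomorph ℝ ℝ := fun i => OpenPartialHomeomorph.univBall (c i x₀) r
  have hRt : ∀ i, (R i).target = Metric.ball (c i x₀) r := fun i =>
    OpenPartialHomeomorph.univBall_target _ hr
  have hRsrc : ∀ i, (R i).source = univ := fun i => OpenPartialHomeomorph.univBall_source _ _
  have hR : ∀ i, ContDiff ℝ ∞ (R i) := fun i => OpenPartialHomeomorph.contDiff_univBall
  have hRs : ∀ i, ∀ t ∈ Metric.ball (c i x₀) r, ContDiffAt ℝ ∞ (R i).symm t := fun i t ht =>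
    OpenPartialHomeomorph.contDiffOn_univBall_symm.contDiffAt (Metric.isOpen_ball.mem_nhds ht)
  set P : OpenPartialHomeomorph (Fin m → ℝ) (Fin m → ℝ) :=
    OpenPartialHomeomorph.pi fun i : Fin m => R i with hP
  have hPt : P.target = Metric.ball (Y x₀) r := by
    rw [ball_pi _ hr]
    show univ.pi (fun i : Fin m => (R i).target) = _
    simp only [hRt]
    rfl
  have hPs : P.source = univ := by
    show univ.pi (fun i : Fin m => (R i).source) = _
    simp only [hRsrc]
    exact pi_univ _
  set Q : OpenPartialHomeomorph (Fin m → ℝ) (Eu m) :=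
    (EuclideanSpace.equiv (Fin m) ℝ).symm.toHomeomorph.toOpenPartialHomeomorph
  have hmem : ∀ z, P z ∈ Metric.ball (Y x₀) r := fun z => by
    rw [← hPt]
    exact P.map_source (by rw [hPs]; trivial)
  have hsymm_eq : ∀ y, ((e₀.trans P.symm).trans Q).symm y =
      e₀.symm (P (EuclideanSpace.equiv (Fin m) ℝ y)) := fun y => rfl
  refine ⟨(e₀.trans P.symm).trans Q, fun i => R i, ?_, ?_, ?_, ?_, ?_, hR, ?_, ?_⟩
  · rw [OpenPartialHomeomorph.trans_source, OpenPartialHomeomorph.trans_source]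
    refine ⟨⟨hx₀, ?_⟩, trivial⟩
    show e₀ x₀ ∈ P.target
    rw [hPt, hcoe]
    exact Metric.mem_ball_self hr
  · rw [OpenPartialHomeomorph.trans_source, OpenPartialHomeomorph.trans_source]
    exact fun x hx => hes hx.1.1
  · rw [OpenPartialHomeomorph.trans_target, OpenPartialHomeomorph.trans_target]
    refine eq_univ_of_forall fun y => ⟨trivial, ?_, ?_⟩
    · show _ ∈ P.source
      rw [hPs]
      trivial
    · exact hball (hmem _)
  · intro x hx
    rw [OpenPartialHomeomorph.trans_source, OpenPartialHomeomorph.trans_source] at hx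
    have h1 : Y x ∈ Metric.ball (Y x₀) r := by
      rw [← hPt, ← hcoe]
      exact hx.1.2
    have h2 : ContDiffAt ℝ ∞ P.symm (Y x) := by
      refine contDiffAt_pi.2 fun i => ?_
      rw [ball_pi _ hr] at h1
      exact (hRs i _ (h1 i trivial)).comp (Y x) (contDiffAt_apply ℝ ℝ i (Y x))
    have h3 := h2.comp x (hsm x hx.1.1)
    have h4 : ContDiffAt ℝ ∞ (fun z => (EuclideanSpace.equiv (Fin m) ℝ).symm (P.symm (Y z))) x :=
      ((EuclideanSpace.equiv (Fin m) ℝ).symm.contDiff.contDiffAt).comp x h3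
    refine h4.congr_of_eventuallyEq (Filter.Eventually.of_forall fun z => ?_)
    show (EuclideanSpace.equiv (Fin m) ℝ).symm (P.symm (e₀ z)) = _
    rw [hcoe]
  · refine contDiff_iff_contDiffAt.2 fun y => ?_
    have h1 : ContDiff ℝ ∞ fun y : Eu m => P (EuclideanSpace.equiv (Fin m) ℝ y) :=
      contDiff_pi.2 fun i => (hR i).comp
        ((contDiff_apply ℝ ℝ i).comp (EuclideanSpace.equiv (Fin m) ℝ).contDiff)
    exact ContDiffAt.comp (g := e₀.symm) y (hsymm _ (hball (hmem _))) h1.contDiffAt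
  · intro i t h0
    have h1 : HasDerivAt (R i) (deriv (R i) t) t :=
      ((hR i).differentiable (by simp) t).hasDerivAt
    have hmt : (R i) t ∈ Metric.ball (c i x₀) r := by
      rw [← hRt]
      exact (R i).map_source (by rw [hRsrc]; trivial)
    have h2 : HasDerivAt (R i).symm (deriv (R i).symm (R i t)) (R i t) :=
      ((hRs i _ hmt).differentiableAt (by simp)).hasDerivAt
    have h3 := h2.comp t h1
    have h4 : (R i).symm ∘ (R i) = id := by
      funext t
      exact (R i).left_inv (by rw [hRsrc]; trivial)
    rw [h4, h0, mul_zero] at h3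
    exact zero_ne_one (h3.unique (hasDerivAt_id t))
  · intro y i hi'
    rw [hsymm_eq]
    have h1 := e₀.right_inv (hball (hmem (EuclideanSpace.equiv (Fin m) ℝ y)))
    rw [hcoe] at h1
    refine (congrFun h1 ⟨i, hi'⟩).trans ?_
    exact congrArg (R i) (co_apply y ⟨i, hi'⟩).symm

end Box

/-! ### Parametrizations adapted to a coframing -/

section Parametrization

variable {d : ℕ} {N : Type u} [TopologicalSpace N] [ChartedSpace (EuclideanSpace ℝ (Fin d)) N]
  [IsManifold (𝓡 d) ∞ N] {n K : ℕ} {θ : Fin n → Form d N} {η : Fin K → Form d N}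
  {ω₁ ω₂ σ : Form d N}

theorem fderiv_comp_chart_symm {f : N → ℝ} (hf : ContMDiff (𝓡 d) 𝓘(ℝ, ℝ) ∞ f)
    (hσ : ∀ x, ∀ v : TangentSpace (𝓡 d) x, σ x v = mfderiv (𝓡 d) 𝓘(ℝ, ℝ) f x v) (q : N) {y : Eu d}
    (hy : y ∈ (extChartAt (𝓡 d) q).target) :
    ContDiffAt ℝ ∞ (f ∘ ⇑(extChartAt (𝓡 d) q).symm) y ∧
      fderiv ℝ (f ∘ ⇑(extChartAt (𝓡 d) q).symm) y =
        pullForm (e := d) (d := d) (N := Eu d) (⇑(extChartAt (𝓡 d) q).symm) σ y := by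
  have h1 := chart_symm_smooth q hy
  refine ⟨(hf.contMDiffAt.comp y h1).contDiffAt, ?_⟩
  have h2 := mfderiv_comp y (hf.contMDiffAt.mdifferentiableAt (by simp))
    (h1.mdifferentiableAt (by simp))
  ext v
  have h3 : mfderiv (𝓡 d) 𝓘(ℝ, ℝ) (f ∘ ⇑(extChartAt (𝓡 d) q).symm) y =
      fderiv ℝ (f ∘ ⇑(extChartAt (𝓡 d) q).symm) y := mfderiv_eq_fderiv
  exact (congrArg (fun T : Eu d →L[ℝ] ℝ => T v) (h3.symm.trans h2)).trans (hσ _ _).symm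

/-- An adapted coframing written in a chart. -/
theorem IsAdaptedCoframing.isStructureCoframing (h : IsAdaptedCoframing univ θ η ω₁ ω₂ σ)
    (hn : 2 ≤ n) {f : N → ℝ} (hf : ContMDiff (𝓡 d) 𝓘(ℝ, ℝ) ∞ f)
    (hσ : ∀ x, ∀ v : TangentSpace (𝓡 d) x, σ x v = mfderiv (𝓡 d) 𝓘(ℝ, ℝ) f x v) (q : N) :
    IsStructureCoframing (E := Eu d) n K
      (fun i => pullForm (⇑(extChartAt (𝓡 d) q).symm) (coframe θ η ω₂ i))
      (pullForm (⇑(extChartAt (𝓡 d) q).symm) ω₁) (f ∘ ⇑(extChartAt (𝓡 d) q).symm)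
      (extChartAt (𝓡 d) q q) := by
  set g : Eu d → N := ⇑(extChartAt (𝓡 d) q).symm with hg
  set y₀ : Eu d := extChartAt (𝓡 d) q q with hy₀
  have hmem : ∀ᶠ y in 𝓝 y₀, y ∈ (extChartAt (𝓡 d) q).target :=
    extChartAt_target_mem_nhds (I := 𝓡 d) q
  have hT : ∀ᶠ y in 𝓝 y₀, fderiv ℝ (f ∘ g) y = pullForm (e := d) g σ y := by
    filter_upwards [hmem] with y hy using (fderiv_comp_chart_symm hf hσ q hy).2
  have hsm : ∀ i y, y ∈ (extChartAt (𝓡 d) q).target →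
      SmoothFormNear (pullForm (e := d) g (coframe θ η ω₂ i)) y := fun i y hy =>
    (h.coframe_smooth i _).pullForm (chart_symm_submersion q hy).smooth
  have hd : ∀ i y, y ∈ (extChartAt (𝓡 d) q).target → ∀ v w : Eu d,
      dForm (pullForm (e := d) g (coframe θ η ω₂ i)) y v w = extD (coframe θ η ω₂ i) (g y)
        (mfderiv (𝓡 d) (𝓡 d) g y v) (mfderiv (𝓡 d) (𝓡 d) g y w) := fun i y hy v w =>
    (extD_euclidean (pullForm (e := d) g (coframe θ η ω₂ i)) y v w).symm.trans
      (extD_pullForm (chart_symm_submersion q hy).smooth (h.coframe_smooth i _) v w)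
  have hT' : ∀ y v, fderiv ℝ (f ∘ g) y = pullForm (e := d) g σ y →
      fderiv ℝ (f ∘ g) y v = σ (g y) (mfderiv (𝓡 d) (𝓡 d) g y v) := fun y v hy =>
    congrArg (fun T : Eu d →L[ℝ] ℝ => T v) hy
  refine ⟨hn, fun i _ => (smoothFormNear_euclidean _ _).1
    (hsm i y₀ hmem.self_of_nhds), ?_, ?_, ?_, ?_, ?_, ?_, ?_⟩
  · exact (smoothFormNear_euclidean _ _).1 ((h.smooth_ω₁.near isOpen_univ (mem_univ _)).pullForm
      (chart_symm_submersion q hmem.self_of_nhds).smooth)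
  · filter_upwards [hmem] with y hy using (fderiv_comp_chart_symm hf hσ q hy).1
  · have h1 := (h.coframe_indep (g y₀)).map' (pullCovₗ (e := d) (d := d) g y₀)
      (LinearMap.ker_eq_bot.2 (pullCovₗ_injective
        (chart_symm_submersion q hmem.self_of_nhds).surj.self_of_nhds))
    have h2 : (pullCovₗ (e := d) (d := d) g y₀ ∘
        Sum.elim (fun i : Fin (n + K + 1) => coframe θ η ω₂ i (g y₀)) ![ω₁ (g y₀), σ (g y₀)]) =
        (Sum.elim (fun i : Fin (n + K + 1) => pullForm (e := d) g (coframe θ η ω₂ i) y₀)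
          ![pullForm (e := d) g ω₁ y₀, fderiv ℝ (f ∘ g) y₀] :
            Fin (n + K + 1) ⊕ Fin 2 → Eu d →L[ℝ] ℝ) := by
      funext i
      rcases i with i | i
      · rfl
      · fin_cases i
        · rfl
        · exact hT.self_of_nhds.symm
    exact (congrArg (fun κ : Fin (n + K + 1) ⊕ Fin 2 → Eu d →L[ℝ] ℝ => LinearIndependent ℝ κ)
      h2).mp h1
  · rw [finrank_euclideanSpace_fin, h.dim_eq]
  · filter_upwards [hmem, hT] with y hy hTy v w hv hw
    rw [hd 0 y hy, hT' y v hTy, hT' y w hTy]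
    exact h.d_coframe_first hn (g y) _ _ hv hw
  · filter_upwards [hmem] with y hy i h0 hi v w hv hw
    rw [hd i y hy]
    exact h.d_coframe_middle (g y) h0 hi _ _ hv hw
  · filter_upwards [hmem, hT] with y hy hTy i hi hiK v w hv hw
    rw [hd i y hy, hT' y v hTy, hT' y w hTy]
    exact h.d_coframe_last (g y) hi hiK _ _ hv hw

/-- Near every point, a manifold with an adapted coframing has a chart onto `ℝ^(n+K+3)` whose
coordinates are adapted to the flag of Pfaffian systems. -/
theorem IsAdaptedCoframing.exists_parametrization (h : IsAdaptedCoframing univ θ η ω₁ ω₂ σ)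
    (hn : 2 ≤ n) {f : N → ℝ} (hf : ContMDiff (𝓡 d) 𝓘(ℝ, ℝ) ∞ f)
    (hσ : ∀ x, ∀ v : TangentSpace (𝓡 d) x, σ x v = mfderiv (𝓡 d) 𝓘(ℝ, ℝ) f x v) (q : N) :
    ∃ (e : OpenPartialHomeomorph N (Eu (n + K + 3))) (ρ : ℝ → ℝ), q ∈ e.source ∧ e.target = univ ∧
      ContMDiffOn (𝓡 d) (𝓡 (n + K + 3)) ∞ e e.source ∧
      ContMDiff (𝓡 (n + K + 3)) (𝓡 d) ∞ e.symm ∧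
      (∀ y, SubmersionNear (d := d) (e := n + K + 3) e.symm y) ∧ ContDiff ℝ ∞ ρ ∧
      (∀ t, deriv ρ t ≠ 0) ∧
      (∀ y v : Eu (n + K + 3), pullForm (e := n + K + 3) e.symm σ y v =
        deriv ρ (co _ 0 y) * co _ 0 v) ∧
      (∀ k ≤ K, ∀ y v : Eu (n + K + 3),
        (∀ α ∈ (pullback e.symm (spanUpTo θ η k) : Family (n + K + 3) (Eu (n + K + 3))) y,
          α v = 0) ∧ co _ 0 v = 0 ↔ (∀ l < n + k, co _ (l + 2) v = 0) ∧ co _ 0 v = 0) ∧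
      ∀ k ≤ K, ∀ y v : Eu (n + K + 3),
        v ∈ cauchy (pullback e.symm (spanUpTo θ η k) : Family (n + K + 3) (Eu (n + K + 3))) y ↔
          ∀ l < n + k + 3, co _ l v = 0 := by
  set g : Eu d → N := ⇑(extChartAt (𝓡 d) q).symm with hg
  set y₀ : Eu d := extChartAt (𝓡 d) q q with hy₀
  obtain ⟨c, hc, hc0, hci, hck, hcc⟩ := (h.isStructureCoframing hn hf hσ q).exists_coordinates
  have hmem : ∀ᶠ y in 𝓝 y₀, y ∈ (extChartAt (𝓡 d) q).target :=
    extChartAt_target_mem_nhds (I := 𝓡 d) q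
  have hcs := Filter.eventually_all.2 fun i : Fin (n + K + 3) => hc i i.2
  obtain ⟨e₀, ρ, hye, hes, het, hesm, hesymm, hρ, hρ', hcρ⟩ := exists_box_coordinates hc hci
    (by rw [finrank_euclideanSpace_fin, h.dim_eq]) (((hmem.and hcs).and hck).and hcc)
  set e : OpenPartialHomeomorph N (Eu (n + K + 3)) :=
    (chartAt (EuclideanSpace ℝ (Fin d)) q).trans e₀ with he
  have hesymm_eq : (e.symm : Eu (n + K + 3) → N) = g ∘ e₀.symm := rfl
  have hz : ∀ y, e₀.symm y ∈ e₀.source := fun y => e₀.map_target (by rw [het]; trivial)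
  have hzt : ∀ y, e₀.symm y ∈ (extChartAt (𝓡 d) q).target := fun y => (hes (hz y)).1.1.1
  have hgs : ∀ y, ContMDiffAt (𝓡 d) (𝓡 d) ∞ g (e₀.symm y) := fun y => chart_symm_smooth q (hzt y)
  have hes' : ∀ y, ContMDiffAt (𝓡 (n + K + 3)) (𝓡 d) ∞ (e₀.symm : Eu (n + K + 3) → Eu d) y :=
    fun y => hesymm.contDiffAt.contMDiffAt
  have hder : ∀ y v : Eu (n + K + 3), (mfderiv (𝓡 (n + K + 3)) (𝓡 d) e.symm y v : Eu d) =
      mfderiv (𝓡 d) (𝓡 d) g (e₀.symm y) (fderiv ℝ e₀.symm y v) := fun y v => by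
    have h1 := mfderiv_comp y ((hgs y).mdifferentiableAt (by simp))
      ((hes' y).mdifferentiableAt (by simp))
    have h2 : mfderiv (𝓡 (n + K + 3)) (𝓡 d) (e₀.symm : Eu (n + K + 3) → Eu d) y =
      fderiv ℝ e₀.symm y := mfderiv_eq_fderiv
    rw [h2] at h1
    exact congrArg (fun T : Eu (n + K + 3) →L[ℝ] Eu d => T v) h1
  have hcd : ∀ y v : Eu (n + K + 3), ∀ i < n + K + 3,
      fderiv ℝ (c i) (e₀.symm y) (fderiv ℝ e₀.symm y v) = deriv (ρ i) (co _ i y) * co _ i v := by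
    intro y v i hi
    have h1 : HasFDerivAt (c i) _ (e₀.symm y) :=
      (((hes (hz y)).1.1.2 ⟨i, hi⟩).differentiableAt (by simp)).hasFDerivAt
    have h2 : HasFDerivAt (e₀.symm : Eu (n + K + 3) → Eu d) _ y :=
      (hesymm.contDiffAt.differentiableAt (by simp)).hasFDerivAt
    have h3 := h1.comp y h2
    have h4 : c i ∘ (e₀.symm : Eu (n + K + 3) → Eu d) = fun y => ρ i (co _ i y) :=
      funext fun y => hcρ y i hi
    rw [h4] at h3
    have h5 : HasFDerivAt (fun y : Eu (n + K + 3) => ρ i (co _ i y))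
        (deriv (ρ i) (co _ i y) • co _ i) y :=
      ((hρ i).differentiable (by simp) _).hasDerivAt.comp_hasFDerivAt y (co _ i).hasFDerivAt
    exact congrArg (fun T : Eu (n + K + 3) →L[ℝ] ℝ => T v) (h3.unique h5)
  -- `c i` is a reparametrization of the `i`-th coordinate with nonvanishing derivative, so the two
  -- differentials have the same kernel.
  have hcz : ∀ y v : Eu (n + K + 3), ∀ i < n + K + 3,
      fderiv ℝ (c i) (e₀.symm y) (fderiv ℝ e₀.symm y v) = 0 ↔ co _ i v = 0 := by
    intro y v i hi
    rw [hcd y v i hi, mul_eq_zero, or_iff_right (hρ' i _)]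
  have hσ0 : ∀ y v : Eu (n + K + 3), σ (e.symm y) (mfderiv (𝓡 (n + K + 3)) (𝓡 d) e.symm y v) =
      fderiv ℝ (c 0) (e₀.symm y) (fderiv ℝ e₀.symm y v) := fun y v => by
    rw [hc0]
    exact (congrArg (σ (e.symm y) : Eu d →L[ℝ] ℝ) (hder y v)).trans
      (congrArg (fun T : Eu d →L[ℝ] ℝ => T (fderiv ℝ e₀.symm y v))
        (fderiv_comp_chart_symm hf hσ q (hzt y)).2).symm
  have hco : ∀ (ψ : Form d N) (y v : Eu (n + K + 3)),
      ψ (e.symm y) (mfderiv (𝓡 (n + K + 3)) (𝓡 d) e.symm y v) =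
        pullForm (e := d) (N := Eu d) g ψ (e₀.symm y) (fderiv ℝ e₀.symm y v) := fun ψ y v =>
    congrArg (ψ (e.symm y) : Eu d →L[ℝ] ℝ) (hder y v)
  have hsmooth : ContMDiff (𝓡 (n + K + 3)) (𝓡 d) ∞ e.symm := fun y => (hgs y).comp y (hes' y)
  have hsource : ∀ x ∈ e.source, x ∈ (extChartAt (𝓡 d) q).source ∧ extChartAt (𝓡 d) q x ∈ e₀.source := by
    intro x hx
    rw [he, OpenPartialHomeomorph.trans_source] at hx
    exact ⟨by rw [extChartAt_source]; exact hx.1, hx.2⟩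
  have hesmooth : ContMDiffOn (𝓡 d) (𝓡 (n + K + 3)) ∞ e e.source := fun x hx =>
    ((hesm _ (hsource x hx).2).contMDiffAt.comp x (chart_smooth q (hsource x hx).1)).contMDiffWithinAt
  have htarget : e.target = univ := by
    rw [he, OpenPartialHomeomorph.trans_target, het]
    refine eq_univ_of_forall fun y => ⟨trivial, ?_⟩
    have := hzt y
    rw [extChartAt_target] at this
    exact this.1
  have hsubm : ∀ y, SubmersionNear (d := d) (e := n + K + 3) e.symm y := by
    intro y
    refine subm_of_open isOpen_univ hsmooth.contMDiffOn (fun y _ => ?_) (mem_univ y)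
    have hsrc : e.symm y ∈ e.source := e.map_target (by rw [htarget]; trivial)
    have h1 := surjective_mfderiv_of_leftInverse (d := n + K + 3) (e := d) (f := e) (g := e.symm)
      (x := e.symm y) ((hesmooth.contMDiffAt (e.open_source.mem_nhds hsrc)).mdifferentiableAt
        (by simp)) (hsmooth.contMDiffAt.mdifferentiableAt (by simp)) (by
        filter_upwards [e.open_source.mem_nhds hsrc] with x hx using e.left_inv hx)
    rwa [e.right_inv (by rw [htarget]; trivial)] at h1
  refine ⟨e, ρ 0, ?_, htarget, hesmooth, hsmooth, hsubm, hρ 0, hρ' 0, fun y v => ?_, fun k hk y v => ?_,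
    fun k hk y v => ?_⟩
  · rw [he, OpenPartialHomeomorph.trans_source]
    exact ⟨mem_chart_source _ q, hye⟩
  · exact (hσ0 y v).trans (hcd y v 0 (by omega))
  · have h1 := (hes (hz y)).1.2 k hk (fderiv ℝ e₀.symm y v)
    have h2 : (∀ α ∈ (pullback e.symm (spanUpTo θ η k) : Family (n + K + 3) (Eu (n + K + 3))) y,
        α v = 0) ↔ ∀ l < n + k, pullForm (e := d) (N := Eu d) g (coframe θ η ω₂ l) (e₀.symm y)
          (fderiv ℝ e₀.symm y v) = 0 := by
      refine (((h.isFrameAt hk (e.symm y)).pullback (hsubm y)).ker_iff v).trans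
        ⟨fun h3 l hl => ?_, fun h3 l => ?_⟩
      · exact (hco _ y v).symm.trans (h3 ⟨l, hl⟩)
      · exact (hco _ y v).trans (h3 l l.2)
    have h3 : fderiv ℝ (c 0) (e₀.symm y) (fderiv ℝ e₀.symm y v) = 0 ↔ co _ 0 v = 0 :=
      hcz y v 0 (by omega)
    rw [h2, ← h3]
    refine Iff.trans ?_ (h1.trans (and_congr (forall₂_congr fun l hl => hcz y v (l + 2) (by omega))
      Iff.rfl))
    rw [hc0]
    exact Iff.rfl
  · refine (mem_cauchy_pullback (hsubm y) (h.isFrameAt hk (e.symm y)) v).trans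
      ((h.mem_cauchy_iff hn hk (e.symm y) _).trans ?_)
    have h1 := (hes (hz y)).2 k hk (fderiv ℝ e₀.symm y v)
    refine Iff.trans (and_congr (forall₂_congr fun l _ => ?_) (and_congr ?_ ?_))
      (h1.trans (forall₂_congr fun l hl => hcz y v l (by omega)))
    · exact Eq.congr_left (hco _ y v)
    · exact Eq.congr_left (hco _ y v)
    · rw [hσ0 y v, hc0]

end Parametrization

/-! ### Control systems and their flags in coordinates -/

section ControlForms

variable {d : ℕ} {X : ℕ → Eu d → ℝ}

/-- The forms `dy_{l+2} - X_l dy_0` of the control system `dy_{l+2}/dy_0 = X_l`. -/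
def controlForm (X : ℕ → Eu d → ℝ) (l : ℕ) (y : Eu d) : Eu d →L[ℝ] ℝ :=
  co d (l + 2) - X l y • co d 0

theorem controlForm_apply (l : ℕ) (y v : Eu d) :
    controlForm X l y v = co d (l + 2) v - X l y * co d 0 v := rfl

theorem controlForm_eq_zero_iff {l : ℕ} {y v : Eu d} :
    controlForm X l y v = 0 ↔ co d (l + 2) v = X l y * co d 0 v := by
  rw [controlForm_apply, sub_eq_zero]

theorem contDiffAt_controlForm {l : ℕ} {y : Eu d} (h : ContDiffAt ℝ ∞ (X l) y) :
    ContDiffAt ℝ ∞ (controlForm X l) y :=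
  contDiffAt_const.sub (h.smul contDiffAt_const)

theorem extD_controlForm {l : ℕ} {y : Eu d} (h : ContDiffAt ℝ ∞ (X l) y) (v w : Eu d) :
    extD (M := Eu d) (controlForm X l) y v w =
      fderiv ℝ (X l) y w * co d 0 v - fderiv ℝ (X l) y v * co d 0 w := by
  have h1 : HasFDerivAt (controlForm X l) _ y :=
    ((h.differentiableAt (by simp)).hasFDerivAt.smul_const (co d 0)).const_sub (co d (l + 2))
  refine (extD_euclidean _ y v w).trans ?_
  rw [h1.fderiv]
  simp only [neg_apply, ContinuousLinearMap.smulRight_apply, smul_apply, smul_eq_mul]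
  ring

theorem controlForm_indep {r : ℕ} (hr : r + 2 ≤ d) (y : Eu d) :
    LinearIndependent ℝ (fun l : Fin r => controlForm X l y) := by
  rw [Fintype.linearIndependent_iff]
  intro a ha i
  have h1 := congrArg (fun T : Eu d →L[ℝ] ℝ => T (vec d (Pi.single (i.1 + 2) 1))) ha
  simp only [_root_.sum_apply, smul_apply, smul_eq_mul, controlForm_apply, zero_apply] at h1
  rw [co_vec _ (by omega), Finset.sum_eq_single i] at h1
  · rw [co_vec _ (by have := i.2; omega)] at h1
    simpa using h1
  · intro j _ hj
    rw [co_vec _ (by have := j.2; omega), Pi.single_eq_of_ne (by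
      intro h; exact hj (Fin.ext (by omega)))]
    simp
  · exact fun h => (h (Finset.mem_univ i)).elim

/-- The Pfaffian system of a control system with `r` states. -/
def controlFamily (r : ℕ) (X : ℕ → Eu d → ℝ) (y : Eu d) : Submodule ℝ (Eu d →L[ℝ] ℝ) :=
  Submodule.span ℝ (range fun l : Fin r => controlForm X l y)

theorem controlFamily_isFrameAt {r : ℕ} (hr : r + 2 ≤ d) (hX : ∀ l, ContDiff ℝ ∞ (X l)) (y : Eu d) :
    IsFrameAt (M := Eu d) (controlFamily r X) (fun l : Fin r => controlForm X l) y where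
  smooth l := (smoothFormNear_euclidean _ _).2
    (Filter.Eventually.of_forall fun _ => contDiffAt_controlForm (hX l).contDiffAt)
  indep := Filter.Eventually.of_forall fun z => controlForm_indep hr z
  span := Filter.Eventually.of_forall fun _ => rfl

/-- The vector field with `dy_0 = 1` and `dy_1 = 0` annihilated by all the forms. -/
def controlVec (X : ℕ → Eu d → ℝ) (y : Eu d) : Eu d :=
  vec d fun j => if j = 0 then 1 else if j = 1 then 0 else X (j - 2) y

theorem co_controlVec_zero (hd : 0 < d) (y : Eu d) : co d 0 (controlVec X y) = 1 := by
  rw [controlVec, co_vec _ hd, if_pos rfl]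

theorem controlForm_controlVec {l : ℕ} (hl : l + 2 < d) (y : Eu d) :
    controlForm X l y (controlVec X y) = 0 := by
  rw [controlForm_eq_zero_iff, co_controlVec_zero (by omega), mul_one, controlVec, co_vec _ hl,
    if_neg (by omega), if_neg (by omega), Nat.add_sub_cancel]

theorem ker_controlFamily {r : ℕ} {y v : Eu d} :
    (∀ α ∈ controlFamily r X y, α v = 0) ↔ ∀ l < r, co d (l + 2) v = X l y * co d 0 v := by
  refine (mem_ker_span_iff (fun l : Fin r => controlForm X l y) v).trans
    ⟨fun h l hl => controlForm_eq_zero_iff.1 (h ⟨l, hl⟩),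
      fun h l => controlForm_eq_zero_iff.2 (h l l.2)⟩

/-- The vectors with `dy_0 = 0` among the Cauchy characteristics of a control system. -/
theorem mem_cauchy_controlFamily {r : ℕ} (hr : r + 2 ≤ d) (hX : ∀ l, ContDiff ℝ ∞ (X l))
    {y v : Eu d} (hv : co d 0 v = 0) : v ∈ cauchy (M := Eu d) (controlFamily r X) y ↔
      ∀ l < r, co d (l + 2) v = 0 ∧ fderiv ℝ (X l) y v = 0 := by
  refine ((controlFamily_isFrameAt hr hX y).mem_cauchy_iff v).trans ?_
  constructor
  · rintro ⟨h1, h2⟩ l hl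
    refine ⟨?_, ?_⟩
    · have h3 := controlForm_eq_zero_iff.1 (h1 ⟨l, hl⟩)
      rwa [hv, mul_zero] at h3
    · have h3 := (extD_controlForm (hX l).contDiffAt v (controlVec X y)).symm.trans
        (h2 ⟨l, hl⟩ (controlVec X y) fun j => controlForm_controlVec (by have := j.2; omega) y)
      rw [hv, co_controlVec_zero (by omega)] at h3
      linarith
  · intro h
    refine ⟨fun l => controlForm_eq_zero_iff.2 ?_, fun l w hw => ?_⟩
    · rw [(h l l.2).1, hv, mul_zero]
    · refine (extD_controlForm (hX l).contDiffAt v w).trans ?_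
      rw [(h l l.2).2, hv]
      ring

end ControlForms

section ControlFlag

/-- A flag of control systems on `ℝ^(n+K+3)`: the right hand sides `X_l`, `l < n + k`, only depend
on the coordinates `y_j` with `j < n + k + 3`, and there are no Cauchy characteristics on the space
of these coordinates. -/
structure IsControlFlag (n K : ℕ) (X : ℕ → Eu (n + K + 3) → ℝ) : Prop where
  smooth : ∀ l, ContDiff ℝ ∞ (X l)
  congr : ∀ k ≤ K, ∀ l < n + k, ∀ y z, (∀ j < n + k + 3, co _ j y = co _ j z) → X l y = X l z
  nondegenerate : ∀ k ≤ K, ∀ y v, co _ 0 v = 0 → (∀ l < n + k, co _ (l + 2) v = 0) →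
    (∀ l < n + k, fderiv ℝ (X l) y v = 0) → co _ 1 v = 0 ∧ co _ (n + k + 2) v = 0

theorem eq_of_fderiv_eq_zero {E : Type*} [NormedAddCommGroup E] [NormedSpace ℝ E] {f : E → ℝ}
    (hf : ContDiff ℝ ∞ f) {y z : E} (h : ∀ x, fderiv ℝ f x (y - z) = 0) : f y = f z := by
  have h1 : ∀ t : ℝ, HasDerivAt (fun t : ℝ => f (z + t • (y - z))) 0 t := fun t => by
    have h2 : HasDerivAt (fun t : ℝ => z + t • (y - z)) (y - z) t := by
      simpa using ((hasDerivAt_id t).smul_const (y - z)).const_add z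
    have h3 := (hf.differentiable (by simp) (z + t • (y - z))).hasFDerivAt.comp_hasDerivAt t h2
    rwa [h] at h3
  have h2 := is_const_of_deriv_eq_zero (fun t => (h1 t).differentiableAt) (fun t => (h1 t).deriv) 1 0
  simpa using h2

/-- Flags of Pfaffian systems in adapted coordinates are flags of control systems. -/
theorem exists_controlFlag {n K : ℕ} 
    {G : ℕ → Eu (n + K + 3) → Submodule ℝ (Eu (n + K + 3) →L[ℝ] ℝ)}
    (hframe : ∀ k ≤ K, ∀ y, ∃ κ : Fin (n + k) → Eu (n + K + 3) → Eu (n + K + 3) →L[ℝ] ℝ,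
      IsFrameNear (G k) κ y)
    (hmono : ∀ k ≤ K, ∀ y, G k y ≤ G K y) (h0 : ∀ y, co (n + K + 3) 0 ∉ G K y)
    (hker : ∀ k ≤ K, ∀ y v : Eu (n + K + 3), (∀ α ∈ G k y, α v = 0) ∧ co _ 0 v = 0 →
      ∀ l < n + k, co _ (l + 2) v = 0)
    (hcauchy : ∀ k ≤ K, ∀ y v : Eu (n + K + 3), v ∈ cauchy (M := Eu (n + K + 3)) (G k) y ↔
      ∀ l < n + k + 3, co _ l v = 0) :
    ∃ X, IsControlFlag n K X ∧ ∀ k ≤ K, ∀ y, G k y = controlFamily (n + k) X y := by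
  classical
  -- On the common kernel of `G k` and `dy_0` also `dy_{l+2}` vanishes, so it is an element of `G k`
  -- plus a multiple of `dy_0`.
  have hex : ∀ k ≤ K, ∀ y, ∀ l < n + k, ∃ a : ℝ,
      (co (n + K + 3) (l + 2) - a • co (n + K + 3) 0) ∈ G k y := by
    intro k hk y l hl
    have h1 : (co (n + K + 3) (l + 2)) ∈
        G k y ⊔ Submodule.span ℝ {(co (n + K + 3) 0)} := by
      by_contra hc
      obtain ⟨v, hv, hv1⟩ := exists_vector_of_notMem (E := Eu (n + K + 3)) hc
      have h2 := hker k hk y v ⟨fun α hα => hv α (Submodule.mem_sup_left hα),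
        hv _ (Submodule.mem_sup_right (Submodule.mem_span_singleton_self _))⟩ l hl
      exact zero_ne_one (h2.symm.trans hv1)
    obtain ⟨α, hα, β, hβ, h2⟩ := Submodule.mem_sup.1 h1
    obtain ⟨a, rfl⟩ := Submodule.mem_span_singleton.1 hβ
    refine ⟨a, ?_⟩
    rwa [← h2, add_sub_cancel_right]
  -- Two such multiples would put `dy_0` into `G K`. Hence the right-hand side `X l` is the same at
  -- all levels `k`.
  have huniq : ∀ (y : Eu (n + K + 3)) (l : ℕ) (a b : ℝ),
      (co (n + K + 3) (l + 2) - a • co (n + K + 3) 0) ∈ G K y →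
      (co (n + K + 3) (l + 2) - b • co (n + K + 3) 0) ∈ G K y → a = b := by
    intro y l a b ha hb
    by_contra hab
    refine h0 y ?_
    have h1 := (G K y).smul_mem (b - a)⁻¹ (sub_mem ha hb)
    have h2 : (b - a)⁻¹ • ((co (n + K + 3) (l + 2) - a • co (n + K + 3) 0) -
        (co (n + K + 3) (l + 2) - b • co (n + K + 3) 0)) = co (n + K + 3) 0 := by
      have h3 : b - a ≠ 0 := sub_ne_zero.2 (Ne.symm hab)
      ext v
      simp only [smul_apply, sub_apply, smul_eq_mul]
      field_simp
      ring
    rwa [h2] at h1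
  choose a ha using hex K le_rfl
  set X : ℕ → Eu (n + K + 3) → ℝ := fun l y => if h : l < n + K then a y l h else 0 with hX
  have hXmem : ∀ k ≤ K, ∀ y, ∀ l < n + k, controlForm X l y ∈ G k y := by
    intro k hk y l hl
    obtain ⟨b, hb⟩ := hex k hk y l hl
    have hl' : l < n + K := by omega
    have h1 : X l y = b := by
      rw [hX]
      simp only [dif_pos hl']
      exact huniq y l _ _ (ha y l hl') (hmono k hk y hb)
    unfold controlForm
    rw [h1]
    exact hb
  have hspan : ∀ k ≤ K, ∀ y, G k y = controlFamily (n + k) X y := by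
    intro k hk y
    refine (Submodule.eq_of_le_of_finrank_eq ?_ ?_).symm
    · refine Submodule.span_le.2 ?_
      rintro _ ⟨l, rfl⟩
      exact hXmem k hk y l l.2
    · obtain ⟨κ, hκ⟩ := hframe k hk y
      exact (finrank_span_eq_card (controlForm_indep (by omega) y)).trans
        ((finrank_span_eq_card hκ.indep.self_of_nhds).symm.trans (by rw [hκ.span.self_of_nhds]))
  have hsmooth : ∀ l, ContDiff ℝ ∞ (X l) := by
    intro l
    by_cases hl : l < n + K
    swap
    · have : X l = fun _ => 0 := funext fun y => dif_neg hl
      rw [this]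
      exact contDiff_const
    refine contDiff_iff_contDiffAt.2 fun y => ?_
    obtain ⟨κ, hκ'⟩ := hframe K le_rfl y
    -- Smoothness of `X l`: it is the coefficient of `dy_0` when the constant form `dy_{l+2}` is
    -- expanded in a smooth frame.
    obtain ⟨c, hc, hc'⟩ := exists_smooth_coeffs (E := Eu (n + K + 3))
      (κ := Sum.elim κ fun _ : Unit => fun _ => co (n + K + 3) 0) (x₀ := y)
      (ψ := fun _ => co (n + K + 3) (l + 2)) (by
        rintro (i | i)
        · exact hκ'.smooth i
        · exact Filter.Eventually.of_forall fun _ => contDiffAt_const) (by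
        have h1 := linearIndependent_sum_unit (V := Eu (n + K + 3) →L[ℝ] ℝ)
          hκ'.indep.self_of_nhds (α := co (n + K + 3) 0) (by
            rw [hκ'.span.self_of_nhds]
            exact h0 y)
        have h2 : (fun i => Sum.elim κ (fun _ : Unit => fun _ => co (n + K + 3) 0) i y :
            Fin (n + K) ⊕ Unit → Eu (n + K + 3) →L[ℝ] ℝ) =
            Sum.elim (fun i => κ i y) fun _ : Unit => co (n + K + 3) 0 := by
          funext i
          rcases i with i | i <;> rfl
        rw [h2]
        exact h1) (Filter.Eventually.of_forall fun _ => contDiffAt_const) (by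
        filter_upwards [hκ'.span] with z hz
        have h1 : (co (n + K + 3) (l + 2) : Eu (n + K + 3) →L[ℝ] ℝ) =
            controlForm X l z + X l z • co (n + K + 3) 0 := (sub_add_cancel _ _).symm
        rw [h1]
        refine add_mem ?_ (Submodule.smul_mem _ _ (Submodule.subset_span ⟨Sum.inr (), rfl⟩))
        have h2 : controlForm X l z ∈ Submodule.span ℝ (range fun i => κ i z) := by
          rw [hz]
          exact hXmem K le_rfl z l hl
        refine Submodule.span_mono ?_ h2
        rintro _ ⟨i, rfl⟩
        exact ⟨Sum.inl i, rfl⟩)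
    refine (hc (Sum.inr ())).self_of_nhds.congr_of_eventuallyEq ?_
    filter_upwards [hc', hκ'.span] with z hz hz'
    refine huniq z l _ _ (hXmem K le_rfl z l hl) ?_
    rw [Fintype.sum_sum_type] at hz
    simp only [Finset.univ_unique, Finset.sum_singleton, Sum.elim_inl, Sum.elim_inr] at hz
    have h1 : (co (n + K + 3) (l + 2) - c (Sum.inr ()) z • co (n + K + 3) 0 :
        Eu (n + K + 3) →L[ℝ] ℝ) = ∑ i, c (Sum.inl i) z • κ i z := sub_eq_of_eq_add hz
    rw [h1, ← hz']
    exact Submodule.sum_mem _ fun i _ => Submodule.smul_mem _ _ (Submodule.subset_span ⟨i, rfl⟩)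
  have hG : ∀ k ≤ K, G k = controlFamily (n + k) X := fun k hk => funext (hspan k hk)
  -- For vectors with `dy_0 = 0` there are two descriptions of the Cauchy characteristics. One
  -- direction says that `X l` is constant along the coordinates from `n + k + 3` on, the other is
  -- the nondegeneracy.
  have hc2 : ∀ k ≤ K, ∀ y v : Eu (n + K + 3), co _ 0 v = 0 →
      ((∀ l < n + k, co _ (l + 2) v = 0 ∧ fderiv ℝ (X l) y v = 0) ↔
        ∀ l < n + k + 3, co _ l v = 0) := fun k hk y v hv => by
    rw [← hcauchy k hk y v, hG k hk]
    exact (mem_cauchy_controlFamily (by omega) hsmooth hv).symm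
  refine ⟨X, ⟨hsmooth, fun k hk l hl y z hyz => eq_of_fderiv_eq_zero (hsmooth l) fun x => ?_,
    fun k hk y v hv h1 h2 => ?_⟩, hspan⟩
  · have h1 : ∀ j < n + k + 3, co (n + K + 3) j (y - z) = 0 := fun j hj => by
      rw [map_sub, hyz j hj, sub_self]
    exact ((hc2 k hk x (y - z) (h1 0 (by omega))).2 h1 l hl).2
  · have h3 := (hc2 k hk y v hv).1 fun l hl => ⟨h1 l hl, h2 l hl⟩
    exact ⟨h3 1 (by omega), h3 _ (by omega)⟩

end ControlFlag

/-! ### Euclidean spaces as manifolds in an arbitrary universe -/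

section LiftedSpace

/-- The space `ℝ^d` as a manifold in any universe. -/
def UEu (d : ℕ) : Type u := ULift.{u} (Eu d)

instance (d : ℕ) : TopologicalSpace (UEu.{u} d) := inferInstanceAs (TopologicalSpace (ULift.{u} (Eu d)))

/-- The identification of `UEu d` with `ℝ^d`. -/
def unlift (d : ℕ) : UEu.{u} d ≃ₜ Eu d := Homeomorph.ulift

instance (d : ℕ) : T2Space (UEu.{u} d) := (unlift d).symm.t2Space

instance (d : ℕ) : SecondCountableTopology (UEu.{u} d) := (unlift d).secondCountableTopology

instance (d : ℕ) : ChartedSpace (EuclideanSpace ℝ (Fin d)) (UEu.{u} d) :=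
  (unlift d).toOpenPartialHomeomorph.singletonChartedSpace rfl

instance (d : ℕ) : IsManifold (𝓡 d) ∞ (UEu.{u} d) :=
  (unlift d).toOpenPartialHomeomorph.isManifold_singleton rfl

variable {d : ℕ}

theorem contMDiff_unlift : ContMDiff (𝓡 d) (𝓡 d) ∞ (unlift d : UEu.{u} d → Eu d) := fun x =>
  chart_smooth x (mem_extChartAt_source x)

theorem contMDiff_unlift_symm : ContMDiff (𝓡 d) (𝓡 d) ∞ ((unlift d).symm : Eu d → UEu.{u} d) :=
  fun y => chart_symm_smooth ((unlift d).symm y) (y := y) (by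
    rw [extChartAt_target]
    exact ⟨trivial, y, rfl⟩)

theorem mfderiv_unlift (x : UEu.{u} d) (v : Eu d) :
    (mfderiv (𝓡 d) (𝓡 d) (unlift d) x v : Eu d) = v := by
  have h1 : mfderiv (𝓡 d) (𝓡 d) (unlift d : UEu.{u} d → Eu d) x = fderivWithin ℝ
      (writtenInExtChartAt (𝓡 d) (𝓡 d) x (unlift d)) (range (𝓡 d)) (extChartAt (𝓡 d) x x) :=
    (contMDiff_unlift.contMDiffAt.mdifferentiableAt (by simp)).mfderiv
  have h2 : writtenInExtChartAt (𝓡 d) (𝓡 d) x (unlift d) = id := rfl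
  rw [h2, ModelWithCorners.range_eq_univ, fderivWithin_univ, fderiv_id] at h1
  exact congrArg (fun T : Eu d →L[ℝ] Eu d => T v) h1

theorem mfderiv_unlift_symm (y : Eu d) (v : Eu d) :
    (mfderiv (𝓡 d) (𝓡 d) ((unlift d).symm : Eu d → UEu.{u} d) y v : Eu d) = v := by
  have h1 := mfderiv_leftInverse (f := ((unlift d).symm : Eu d → UEu.{u} d)) (g := unlift d) (x := y)
    (contMDiff_unlift_symm.contMDiffAt.mdifferentiableAt (by simp))
    (contMDiff_unlift.contMDiffAt.mdifferentiableAt (by simp))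
    (Filter.Eventually.of_forall fun z => (unlift.{u} d).apply_symm_apply z) v
  exact (mfderiv_unlift _ _).symm.trans h1

theorem submersionNear_unlift (x : UEu.{u} d) :
    SubmersionNear (d := d) (e := d) (unlift d : UEu.{u} d → Eu d) x :=
  subm_of_open isOpen_univ contMDiff_unlift.contMDiffOn (fun x _ v => ⟨v, mfderiv_unlift x v⟩)
    (mem_univ x)

/-- A map between Euclidean spaces as a map between their copies. -/
def liftMap {a b : ℕ} (f : Eu a → Eu b) : UEu.{u} a → UEu.{v} b := (unlift b).symm ∘ f ∘ unlift a

theorem contMDiff_liftMap {a b : ℕ} {f : Eu a → Eu b} (hf : ContDiff ℝ ∞ f) :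
    ContMDiff (𝓡 a) (𝓡 b) ∞ (liftMap f : UEu.{u} a → UEu.{v} b) :=
  contMDiff_unlift_symm.comp (hf.contMDiff.comp contMDiff_unlift)

theorem mfderiv_liftMap {a b : ℕ} {f : Eu a → Eu b} (hf : ContDiff ℝ ∞ f) (x : UEu.{u} a)
    (v : Eu a) : (mfderiv (𝓡 a) (𝓡 b) (liftMap f : UEu.{u} a → UEu.{v} b) x v : Eu b) =
      fderiv ℝ f (unlift a x) v := by
  have h1 := mfderiv_comp x (f := f ∘ unlift a) (g := ((unlift b).symm : Eu b → UEu.{v} b))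
    (contMDiff_unlift_symm.contMDiffAt.mdifferentiableAt (by simp))
    ((hf.contMDiff.comp contMDiff_unlift).contMDiffAt.mdifferentiableAt (by simp))
  have h2 := mfderiv_comp x (f := (unlift a : UEu.{u} a → Eu a)) (g := f)
    (hf.contMDiff.contMDiffAt.mdifferentiableAt (by simp))
    (contMDiff_unlift.contMDiffAt.mdifferentiableAt (by simp))
  have h3 : mfderiv (𝓡 a) (𝓡 b) f (unlift a x) = fderiv ℝ f (unlift a x) := mfderiv_eq_fderiv
  refine (congrArg (fun T : Eu a →L[ℝ] Eu b => T v) h1).trans ((mfderiv_unlift_symm _ _).trans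
    ((congrArg (fun T : Eu a →L[ℝ] Eu b => T v) h2).trans ?_))
  rw [h3]
  exact congrArg (fderiv ℝ f (unlift a x)) (mfderiv_unlift x v)

end LiftedSpace

/-! ### Control systems as Pfaffian systems without Cauchy characteristics -/

section ControlSystems

/-- A control system with `r` states, two controls, and the independence condition `dρ(y_0)`,
without Cauchy characteristics. -/
structure IsControlSystem (r : ℕ) (X : ℕ → Eu (r + 3) → ℝ) (ρ : ℝ → ℝ) : Prop where
  smooth : ∀ l, ContDiff ℝ ∞ (X l)
  nondegenerate : ∀ y v, co _ 0 v = 0 → (∀ l < r, co _ (l + 2) v = 0) →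
    (∀ l < r, fderiv ℝ (X l) y v = 0) → co _ 1 v = 0 ∧ co _ (r + 2) v = 0
  smooth_ρ : ContDiff ℝ ∞ ρ
  deriv_ρ : ∀ t, deriv ρ t ≠ 0

variable {r : ℕ} {X : ℕ → Eu (r + 3) → ℝ} {ρ : ℝ → ℝ}

/-- The independence condition of a control system. -/
def timeForm (d : ℕ) (ρ : ℝ → ℝ) (y : Eu d) : Eu d →L[ℝ] ℝ := deriv ρ (co d 0 y) • co d 0

theorem hasFDerivAt_time {d : ℕ} {ρ : ℝ → ℝ} (hρ : ContDiff ℝ ∞ ρ) (y : Eu d) :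
    HasFDerivAt (fun y => ρ (co d 0 y)) (timeForm d ρ y) y :=
  (hρ.differentiable (by simp) _).hasDerivAt.comp_hasFDerivAt y (co d 0).hasFDerivAt

/-- Nondegeneracy concerns vectors with `dy_0 = 0` only. A characteristic with `dy_0 ≠ 0`, paired
with the direction `w` of the control `y_1`, would make all `X l` stationary along `w`, which
nondegeneracy forbids. -/
theorem IsControlSystem.cauchy_eq (h : IsControlSystem r X ρ) (y : Eu (r + 3)) :
    cauchy (M := Eu (r + 3)) (controlFamily r X) y = ⊥ := by
  refine (Submodule.eq_bot_iff _).2 fun v hv => ?_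
  have h1 := ((controlFamily_isFrameAt (by omega) h.smooth y).mem_cauchy_iff v).1 hv
  have h0 : co (r + 3) 0 v = 0 := by
    by_contra hne
    set w : Eu (r + 3) := vec _ (Pi.single 1 1) with hw
    have hw' : ∀ j < r + 3, j ≠ 1 → co (r + 3) j w = 0 := fun j hj hj1 => by
      rw [hw, co_vec _ hj, Pi.single_eq_of_ne hj1]
    have h2 : ∀ l < r, fderiv ℝ (X l) y w = 0 := fun l hl => by
      have h3 := (extD_controlForm (h.smooth l).contDiffAt v w).symm.trans (h1.2 ⟨l, hl⟩ w fun j => by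
        have := j.2
        refine controlForm_eq_zero_iff.2 ?_
        rw [hw' _ (by omega) (by omega), hw' _ (by omega) (by omega), mul_zero])
      rw [hw' 0 (by omega) (by omega), mul_zero, sub_zero] at h3
      exact (mul_eq_zero.1 h3).resolve_right hne
    have h4 := (h.nondegenerate y w (hw' 0 (by omega) (by omega))
      (fun l hl => hw' _ (by omega) (by omega)) h2).1
    rw [hw, co_vec _ (by omega), Pi.single_eq_same] at h4
    exact one_ne_zero h4
  have h2 := (mem_cauchy_controlFamily (by omega) h.smooth h0).1 hv
  have h3 := h.nondegenerate y v h0 (fun l hl => (h2 l hl).1) fun l hl => (h2 l hl).2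
  refine eu_eq_zero fun j hj => ?_
  rcases Nat.lt_or_ge j 2 with hj2 | hj2
  · interval_cases j
    · exact h0
    · exact h3.1
  · obtain ⟨i, rfl⟩ := Nat.exists_eq_add_of_le' hj2
    rcases Nat.lt_or_ge i r with hi | hi
    · exact (h2 i hi).1
    · obtain rfl : i = r := by omega
      exact h3.2

variable (r X ρ) in
/-- The Pfaffian system of a control system, on the copy of the Euclidean space. -/
def liftFamily : Family (r + 3) (UEu.{u} (r + 3)) :=
  pullback (unlift (r + 3)) (controlFamily r X : Family (r + 3) (Eu (r + 3)))

theorem IsControlSystem.isFrameAt (h : IsControlSystem r X ρ) (x : UEu.{u} (r + 3)) :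
    IsFrameAt (liftFamily r X) (fun l : Fin r =>
      pullForm (unlift (r + 3)) (controlForm X l : Form (r + 3) (Eu (r + 3)))) x :=
  (controlFamily_isFrameAt (by omega) h.smooth _).pullback (submersionNear_unlift x)

theorem ker_liftFamily {x : UEu.{u} (r + 3)} {v : Eu (r + 3)} :
    (∀ α ∈ liftFamily r X x, α v = 0) ↔
      ∀ l < r, co _ (l + 2) v = X l (unlift _ x) * co _ 0 v := by
  rw [← ker_controlFamily]
  constructor
  · intro h α hα
    exact (congrArg α (mfderiv_unlift x v)).symm.trans (h _ ⟨α, hα, rfl⟩)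
  · rintro h _ ⟨α, hα, rfl⟩
    exact (congrArg (α : Eu (r + 3) →L[ℝ] ℝ) (mfderiv_unlift x v)).trans (h α hα)

variable (r ρ) in
/-- The independence condition on the copy of the Euclidean space. -/
def liftTime : Form (r + 3) (UEu.{u} (r + 3)) :=
  pullForm (unlift (r + 3)) (timeForm (r + 3) ρ : Form (r + 3) (Eu (r + 3)))

theorem liftTime_apply (x : UEu.{u} (r + 3)) (v : Eu (r + 3)) :
    liftTime r ρ x v = deriv ρ (co _ 0 (unlift _ x)) * co _ 0 v :=
  congrArg (timeForm (r + 3) ρ (unlift _ x)) (mfderiv_unlift x v)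

theorem IsControlSystem.exact_liftTime (h : IsControlSystem r X ρ) :
    ContMDiff (𝓡 (r + 3)) 𝓘(ℝ, ℝ) ∞ (fun x : UEu.{u} (r + 3) => ρ (co _ 0 (unlift _ x))) ∧
      ∀ x : UEu.{u} (r + 3), ∀ v : TangentSpace (𝓡 (r + 3)) x, liftTime r ρ x v =
        mfderiv (𝓡 (r + 3)) 𝓘(ℝ, ℝ) (fun x : UEu.{u} (r + 3) => ρ (co _ 0 (unlift _ x))) x v := by
  have h1 : ContDiff ℝ ∞ fun y : Eu (r + 3) => ρ (co _ 0 y) := h.smooth_ρ.comp (co _ 0).contDiff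
  refine ⟨h1.contMDiff.comp contMDiff_unlift, fun x v => ?_⟩
  have h2 := mfderiv_comp x (f := (unlift (r + 3) : UEu.{u} (r + 3) → Eu (r + 3)))
    (g := fun y : Eu (r + 3) => ρ (co _ 0 y)) (I' := 𝓡 (r + 3))
    (h1.contMDiff.contMDiffAt.mdifferentiableAt (by simp))
    (contMDiff_unlift.contMDiffAt.mdifferentiableAt (by simp))
  have h3 : mfderiv (𝓡 (r + 3)) 𝓘(ℝ, ℝ) (fun y : Eu (r + 3) => ρ (co _ 0 y)) (unlift _ x) =
      timeForm (r + 3) ρ (unlift _ x) :=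
    mfderiv_eq_fderiv.trans (hasFDerivAt_time h.smooth_ρ _).fderiv
  rw [h3] at h2
  exact (congrArg (fun T : Eu (r + 3) →L[ℝ] ℝ => T v) h2).symm

theorem IsControlSystem.liftTime_notMem (h : IsControlSystem r X ρ) (x : UEu.{u} (r + 3)) :
    liftTime r ρ x ∉ liftFamily r X x := by
  intro h1
  have h2 := (ker_liftFamily (X := X) (x := x) (v := controlVec X (unlift _ x))).2 (fun l hl =>
    controlForm_eq_zero_iff.1 (controlForm_controlVec (by omega) _)) _ h1
  have h3 := (liftTime_apply x _).symm.trans h2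
  rw [co_controlVec_zero (by omega), mul_one] at h3
  exact h.deriv_ρ _ h3

theorem IsControlSystem.smooth_liftTime (h : IsControlSystem r X ρ) (x : UEu.{u} (r + 3)) :
    SmoothFormNear (liftTime r ρ) x :=
  SmoothFormNear.exact (Filter.Eventually.of_forall fun _ => h.exact_liftTime.1.contMDiffAt)
    (Filter.Eventually.of_forall h.exact_liftTime.2)

theorem IsControlSystem.isFrobenius (h : IsControlSystem r X ρ) :
    IsFrobenius (adjoin (liftFamily.{u} r X) (liftTime r ρ)) := by
  refine (isFrobenius_iff_of_frames fun x => (h.isFrameAt x).adjoin (h.smooth_liftTime x)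
    (Filter.Eventually.of_forall h.liftTime_notMem)).2 ?_
  rintro x (l | l) v w hv hw
  · have h0 : ∀ v : Eu (r + 3), liftTime r ρ x v = 0 → co _ 0 v = 0 := fun v hv =>
      (mul_eq_zero.1 ((liftTime_apply x v).symm.trans hv)).resolve_left (h.deriv_ρ _)
    refine (extD_pullForm (submersionNear_unlift x).smooth
      ((controlFamily_isFrameAt (by omega) h.smooth _).smooth l) v w).trans
      ((extD_controlForm (h.smooth l).contDiffAt _ _).trans ?_)
    have h1 : co (r + 3) 0 (mfderiv (𝓡 (r + 3)) (𝓡 (r + 3)) (unlift (r + 3)) x v) = 0 :=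
      (congrArg (co (r + 3) 0) (mfderiv_unlift x v)).trans (h0 v (hv (Sum.inr ())))
    have h2 : co (r + 3) 0 (mfderiv (𝓡 (r + 3)) (𝓡 (r + 3)) (unlift (r + 3)) x w) = 0 :=
      (congrArg (co (r + 3) 0) (mfderiv_unlift x w)).trans (h0 w (hw (Sum.inr ())))
    rw [h1, h2]
    ring
  · exact extD_exact (Filter.Eventually.of_forall fun _ => h.exact_liftTime.1.contMDiffAt)
      (Filter.Eventually.of_forall h.exact_liftTime.2) v w

theorem IsControlSystem.cauchy_lift (h : IsControlSystem r X ρ) (x : UEu.{u} (r + 3)) :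
    cauchy (liftFamily r X) x = ⊥ := by
  refine (Submodule.eq_bot_iff _).2 fun v hv => ?_
  have h1 := (mem_cauchy_pullback (submersionNear_unlift x)
    (controlFamily_isFrameAt (by omega) h.smooth _) v).1 hv
  have h2 := (Submodule.eq_bot_iff _).1 (h.cauchy_eq (unlift _ x)) _ h1
  exact (mfderiv_unlift x v).symm.trans h2

theorem IsControlSystem.isSubbundle (h : IsControlSystem r X ρ) :
    IsSubbundle r (liftFamily.{u} r X) :=
  isSubbundle_of_frames fun x => ⟨_, h.isFrameAt x⟩

/-- A control system as a Pfaffian system with independence condition. -/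
def IsControlSystem.system (h : IsControlSystem r X ρ) : PfSystem.{u} where
  M := UEu.{u} (r + 3)
  dim := r + 3
  I := liftFamily r X
  rank := r
  τ := liftTime r ρ
  subbundle := h.isSubbundle
  exact := ⟨_, h.exact_liftTime⟩
  independent := h.liftTime_notMem
  noCauchy := h.cauchy_lift
  noIntegralSurface := no_integral_surface h.isSubbundle h.liftTime_notMem h.smooth_liftTime
    h.isFrobenius h.cauchy_lift

theorem IsControlSystem.isCTS (h : IsControlSystem r X ρ) : (h.system : PfSystem.{u}).IsCTS :=
  h.isFrobenius

end ControlSystems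

/-! ### Local liftings of integral curves -/

section Lifting

variable {S N P : PfSystem.{u}}

theorem isIntegralCurve_of_local {γ : ℝ → S.M} {ε : ℝ}
    (h : ∀ t ∈ Ioo (-ε) ε, ∃ γ' : ℝ → S.M, ∃ ε' > 0, IsIntegralCurve S γ' ε' ∧
      ∀ s ∈ Ioo (-ε') ε', γ (t + s) = γ' s) : IsIntegralCurve S γ ε := by
  have key : ∀ t ∈ Ioo (-ε) ε, ContMDiffAt 𝓘(ℝ, ℝ) (𝓡 S.dim) ∞ γ t ∧
      ∀ (Q : S.M → Eu S.dim → Prop), (∀ γ' : ℝ → S.M, ∀ ε' > 0, IsIntegralCurve S γ' ε' →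
        Q (γ' 0) (velocity S γ' 0)) → Q (γ t) (velocity S γ t) := by
    intro t ht
    obtain ⟨γ', ε', hε', h1, h2⟩ := h t ht
    have hsm : ContMDiffAt 𝓘(ℝ, ℝ) 𝓘(ℝ, ℝ) ∞ (fun s : ℝ => s - t) t :=
      (contDiffAt_id.sub contDiffAt_const).contMDiffAt
    have heq : γ =ᶠ[𝓝 t] γ' ∘ fun s => s - t := by
      have h3 : ∀ᶠ s in 𝓝 t, s - t ∈ Ioo (-ε') ε' := by
        refine (continuous_id.sub continuous_const).continuousAt.preimage_mem_nhds ?_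
        simpa using Ioo_mem_nhds (by linarith : -ε' < (0 : ℝ)) hε'
      filter_upwards [h3] with s hs
      have h4 := h2 _ hs
      rwa [add_sub_cancel] at h4
    have h0 : (fun s : ℝ => s - t) t = 0 := sub_self t
    have hγ' : ContMDiffAt 𝓘(ℝ, ℝ) (𝓡 S.dim) ∞ γ' ((fun s : ℝ => s - t) t) := by
      rw [h0]
      exact h1.contMDiffAt (zero_mem_Ioo hε')
    refine ⟨(ContMDiffAt.comp (f := fun s : ℝ => s - t) t hγ' hsm).congr_of_eventuallyEq heq, fun Q hQ => ?_⟩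
    have h3 := mfderiv_comp (f := fun s : ℝ => s - t) t (hγ'.mdifferentiableAt (by simp)) (hsm.mdifferentiableAt (by simp))
    have h4 : fderiv ℝ (fun s : ℝ => s - t) t 1 = 1 := by
      rw [fderiv_sub_const]
      simp
    rw [mfderiv_eq_fderiv] at h3
    have h5 : (velocity S γ t : Eu S.dim) = velocity S γ' ((fun s : ℝ => s - t) t) :=
      (congrArg (fun T : ℝ →L[ℝ] Eu S.dim => T 1) (heq.mfderiv_eq.trans h3)).trans
        (congrArg (fun a : ℝ => (mfderiv 𝓘(ℝ, ℝ) (𝓡 S.dim) γ' _ : ℝ →L[ℝ] Eu S.dim) a) h4)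
    rw [h0] at h5
    have h6 : γ t = γ' 0 := by
      have := heq.self_of_nhds
      rwa [Function.comp_apply, sub_self] at this
    have h7 : Q (γ t) (velocity S γ t : Eu S.dim) = Q (γ' 0) (velocity S γ' 0 : Eu S.dim) :=
      congrArg₂ Q h6 h5
    exact h7.mpr (hQ γ' ε' hε' h1)
  refine ⟨fun t ht => (key t ht).1.contMDiffWithinAt, fun t ht => (key t ht).2
    (fun x v => (∀ α ∈ S.I x, α v = 0) ∧ S.τ x v ≠ 0) fun γ' ε' hε' h1 => h1.2 0 (zero_mem_Ioo hε')⟩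

theorem JetNear.congr_left {r : ℕ} {δ : ℝ} {γ₀ γ₁ γ : ℝ → S.M} (h : JetNear S r δ γ₀ γ)
    (heq : γ₀ =ᶠ[𝓝 0] γ₁) : JetNear S r δ γ₁ γ := by
  have h0 := heq.self_of_nhds
  unfold JetNear at h ⊢
  rw [← h0]
  refine ⟨h.1, fun k hk => ?_⟩
  have h1 : (fun t => extChartAt (𝓡 S.dim) (γ₀ 0) (γ₁ t)) =ᶠ[𝓝 0]
      fun t => extChartAt (𝓡 S.dim) (γ₀ 0) (γ₀ t) := by
    filter_upwards [heq] with t ht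
    rw [ht]
  rw [h1.iteratedDeriv_eq]
  exact h.2 k hk

/-- A submersion between systems such that liftings of integral curves are determined pointwise,
and integral curves near a curve that has a lifting have local liftings near that lifting. -/
structure HasLocalLiftings (N S : PfSystem.{u}) (π : N.M → S.M) : Prop where
  smooth : ContMDiff (𝓡 N.dim) (𝓡 S.dim) ∞ π
  pull_le : ∀ x, (pullback π S.I : Family N.dim N.M) x ≤ N.I x
  pull_indep : ∀ x, pullCov π x (S.τ (π x)) = N.τ x
  unique : ∀ (γ₁ γ₂ : ℝ → N.M), ∀ ε > 0, IsIntegralCurve N γ₁ ε → IsIntegralCurve N γ₂ ε →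
    (∀ t ∈ Ioo (-ε) ε, π (γ₁ t) = π (γ₂ t)) → γ₁ 0 = γ₂ 0
  lift : ∀ (γ' : ℝ → N.M), ∀ ε' > 0, IsIntegralCurve N γ' ε' → ∀ (r : ℕ), ∀ δ > 0,
    ∃ (r₁ : ℕ), ∃ δ₁ > 0, ∀ (γ : ℝ → S.M), ∀ ε > 0, IsIntegralCurve S γ ε →
      JetNear S r₁ δ₁ (fun t => π (γ' t)) γ → ∃ γ'' : ℝ → N.M, ∃ ε'' > 0,
        IsIntegralCurve N γ'' ε'' ∧ (∀ t ∈ Ioo (-ε'') ε'', π (γ'' t) = γ t) ∧ JetNear N r δ γ' γ''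

theorem HasLocalLiftings.proj {π : N.M → S.M} (h : HasLocalLiftings N S π) {γ : ℝ → N.M} {ε : ℝ}
    (hγ : IsIntegralCurve N γ ε) : IsIntegralCurve S (fun t => π (γ t)) ε :=
  hγ.proj h.smooth h.pull_le h.pull_indep

theorem HasLocalLiftings.eqOn {π : N.M → S.M} (h : HasLocalLiftings N S π) {γ₁ γ₂ : ℝ → N.M}
    {ε : ℝ} (h₁ : IsIntegralCurve N γ₁ ε) (h₂ : IsIntegralCurve N γ₂ ε)
    (heq : ∀ t ∈ Ioo (-ε) ε, π (γ₁ t) = π (γ₂ t)) : EqOn γ₁ γ₂ (Ioo (-ε) ε) := by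
  intro t ht
  have h3 := h.unique (fun s => γ₁ (t + s)) (fun s => γ₂ (t + s)) (ε - |t|)
    (by linarith [abs_lt.2 ht]) (h₁.shift (by linarith)) (h₂.shift (by linarith)) fun s hs =>
      heq _ (by constructor <;> linarith [neg_abs_le t, le_abs_self t, hs.1, hs.2])
  simpa using h3

theorem HasLocalLiftings.refl (S : PfSystem.{u}) : HasLocalLiftings S S id where
  smooth := contMDiff_id
  pull_le x := by
    rintro _ ⟨β, hβ, rfl⟩
    have h1 : pullCov (id : S.M → S.M) x β = β := by
      unfold pullCov
      rw [mfderiv_id]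
      rfl
    rw [h1]
    exact hβ
  pull_indep x := by
    unfold pullCov
    rw [mfderiv_id]
    rfl
  unique γ₁ γ₂ ε hε _ _ h := h 0 (zero_mem_Ioo hε)
  lift γ' ε' _ _ r δ hδ := ⟨r, δ, hδ, fun γ ε hε hγ hn => ⟨γ, ε, hε, hγ, fun _ _ => rfl, hn⟩⟩

theorem pullCov_comp {π : N.M → S.M} {ϖ : P.M → N.M} (hπ : ContMDiff (𝓡 N.dim) (𝓡 S.dim) ∞ π)
    (hϖ : ContMDiff (𝓡 P.dim) (𝓡 N.dim) ∞ ϖ) (x : P.M) (α : Cot S.dim (π (ϖ x))) :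
    (pullCov (π ∘ ϖ) x α : Cot P.dim x) = pullCov ϖ x (pullCov π (ϖ x) α : Cot N.dim (ϖ x)) := by
  have h1 := mfderiv_comp x (hπ.contMDiffAt.mdifferentiableAt (by simp))
    (hϖ.contMDiffAt.mdifferentiableAt (by simp))
  ext v
  exact congrArg (fun T : Eu P.dim →L[ℝ] Eu S.dim => α (T v)) h1

/-- Closure under composition reduces a tower to its single steps. It works because the lifted curve
is controlled in its jets, so it is again an admissible input for the next lifting. -/
theorem HasLocalLiftings.comp {π : N.M → S.M} {ϖ : P.M → N.M} (h : HasLocalLiftings N S π)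
    (h' : HasLocalLiftings P N ϖ) : HasLocalLiftings P S (π ∘ ϖ) where
  smooth := h.smooth.comp h'.smooth
  pull_le x := by
    rintro _ ⟨β, hβ, rfl⟩
    exact h'.pull_le x ⟨_, h.pull_le (ϖ x) ⟨β, hβ, rfl⟩, pullCov_comp h.smooth h'.smooth x β⟩
  pull_indep x := by
    rw [← h'.pull_indep, ← h.pull_indep]
    exact pullCov_comp h.smooth h'.smooth x _
  unique γ₁ γ₂ ε hε h₁ h₂ heq := h'.unique γ₁ γ₂ ε hε h₁ h₂
    (h.eqOn (h'.proj h₁) (h'.proj h₂) heq)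
  lift γ' ε' hε' hγ' r δ hδ := by
    obtain ⟨r₁, δ₁, hδ₁, h1⟩ := h'.lift γ' ε' hε' hγ' r δ hδ
    obtain ⟨r₂, δ₂, hδ₂, h2⟩ := h.lift _ ε' hε' (h'.proj hγ') r₁ δ₁ hδ₁
    refine ⟨r₂, δ₂, hδ₂, fun γ ε hε hγ hn => ?_⟩
    obtain ⟨γ₁, ε₁, hε₁, h3, h4, h5⟩ := h2 γ ε hε hγ hn
    obtain ⟨γ₂, ε₂, hε₂, h6, h7, h8⟩ := h1 γ₁ ε₁ hε₁ h3 h5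
    refine ⟨γ₂, min ε₁ ε₂, lt_min hε₁ hε₂, h6.mono (min_le_right _ _), fun t ht => ?_, h8⟩
    have ht1 : t ∈ Ioo (-ε₁) ε₁ := ⟨by linarith [ht.1, min_le_left ε₁ ε₂],
      by linarith [ht.2, min_le_left ε₁ ε₂]⟩
    have ht2 : t ∈ Ioo (-ε₂) ε₂ := ⟨by linarith [ht.1, min_le_right ε₁ ε₂],
      by linarith [ht.2, min_le_right ε₁ ε₂]⟩
    exact (congrArg π (h7 t ht2)).trans (h4 t ht1)

/-- The curves with local liftings are an open and dense class of curves with unique liftings. -/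
theorem HasLocalLiftings.genericUniqueLifting {π : N.M → S.M} (h : HasLocalLiftings N S π) :
    GenericUniqueLifting N S π := by
  refine ⟨{γ | ∃ γ' : ℝ → N.M, ∃ ε > 0, IsIntegralCurve N γ' ε ∧
    ∀ t ∈ Ioo (-ε) ε, π (γ' t) = γ t}, ?_, ?_, ?_⟩
  · rintro γ₀ ⟨γ', ε', hε', h1, h2⟩ ε₀ - -
    obtain ⟨r, δ, hδ, h3⟩ := h.lift γ' ε' hε' h1 0 1 one_pos
    refine ⟨r, δ, hδ, fun γ ε hε hγ hn => ?_⟩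
    obtain ⟨γ'', ε'', hε'', h4, h5, -⟩ := h3 γ ε hε hγ (hn.congr_left (by
      filter_upwards [isOpen_Ioo.mem_nhds (zero_mem_Ioo hε')] with t ht using (h2 t ht).symm))
    exact ⟨γ'', ε'', hε'', h4, h5⟩
  · intro γ ε hε hγ hW
    have hW' : ∀ t : ℝ, ∃ (γ' : ℝ → N.M) (ε' : ℝ), t ∈ Ioo (-ε) ε → 0 < ε' ∧
        IsIntegralCurve N γ' ε' ∧ ∀ s ∈ Ioo (-ε') ε', π (γ' s) = γ (t + s) := by
      intro t
      by_cases ht : t ∈ Ioo (-ε) ε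
      · obtain ⟨γ', ε', h1, h2, h3⟩ := hW t ht
        exact ⟨γ', ε', fun _ => ⟨h1, h2, h3⟩⟩
      · have : Nonempty N.M := by
          obtain ⟨γ', -⟩ := hW 0 (zero_mem_Ioo hε)
          exact ⟨γ' 0⟩
        exact ⟨fun _ => Classical.arbitrary _, 0, fun h => (ht h).elim⟩
    choose L e hL using hW'
    -- The chosen local liftings agree where they overlap, by pointwise uniqueness; so their values
    -- at their own centers fit together to one lifting on the whole interval.
    have hloc : ∀ t ∈ Ioo (-ε) ε, ∃ ε' > 0, ε' ≤ e t ∧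
        ∀ s ∈ Ioo (-ε') ε', L (t + s) 0 = L t s := by
      intro t ht
      obtain ⟨h1, h2, h3⟩ := hL t ht
      refine ⟨min (e t) (ε - |t|), lt_min h1 (by linarith [abs_lt.2 ht]), min_le_left _ _,
        fun s hs => ?_⟩
      have hs1 : |s| < e t := lt_of_lt_of_le (abs_lt.2 hs) (min_le_left _ _)
      have hs2 : |s| < ε - |t| := lt_of_lt_of_le (abs_lt.2 hs) (min_le_right _ _)
      have hts : t + s ∈ Ioo (-ε) ε := abs_lt.1 (lt_of_le_of_lt (abs_add_le t s) (by linarith))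
      obtain ⟨h4, h5, h6⟩ := hL (t + s) hts
      have h7 := h.unique (L (t + s)) (fun a => L t (s + a)) (min (e (t + s)) (e t - |s|))
        (lt_min h4 (by linarith)) (h5.mono (min_le_left _ _))
        (h2.shift (by linarith [min_le_right (e (t + s)) (e t - |s|)])) fun a ha => by
          have ha1 : |a| < e (t + s) := lt_of_lt_of_le (abs_lt.2 ha) (min_le_left _ _)
          have ha2 : |a| < e t - |s| := lt_of_lt_of_le (abs_lt.2 ha) (min_le_right _ _)
          rw [h6 a (abs_lt.1 ha1), h3 (s + a)
            (abs_lt.1 (lt_of_le_of_lt (abs_add_le s a) (by linarith))), add_assoc]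
      simpa using h7
    refine ⟨fun t => L t 0, ⟨isIntegralCurve_of_local fun t ht => ?_, fun t ht => ?_⟩,
      fun γ'' hγ'' => ?_⟩
    · obtain ⟨ε', hε', hle, h1⟩ := hloc t ht
      exact ⟨L t, ε', hε', (hL t ht).2.1.mono hle, h1⟩
    · obtain ⟨h1, -, h3⟩ := hL t ht
      have h4 := h3 0 (zero_mem_Ioo h1)
      rwa [add_zero] at h4
    · refine h.eqOn hγ''.1 (isIntegralCurve_of_local fun t ht => ?_) fun t ht => ?_
      · obtain ⟨ε', hε', hle, h1⟩ := hloc t ht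
        exact ⟨L t, ε', hε', (hL t ht).2.1.mono hle, h1⟩
      · obtain ⟨h1, -, h3⟩ := hL t ht
        have h4 := h3 0 (zero_mem_Ioo h1)
        rw [add_zero] at h4
        rw [hγ''.2 t ht, h4]
  -- An integral curve upstairs is its own approximation: at every time its shift is a local lifting
  -- of its projection.
  · intro γ ε hε hγ r δ hδ
    refine ⟨γ, ε, hε, hγ, ⟨mem_chart_source _ _, fun k _ => by rwa [sub_self, norm_zero]⟩,
      fun t ht => ⟨fun s => γ (t + s), ε - |t|, by linarith [abs_lt.2 ht],
        hγ.shift (by linarith), fun _ _ => rfl⟩⟩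

end Lifting

/-! ### Jets under smooth maps, and curves of control systems -/

section Jets

theorem _root_.ContDiffAt.deriv_top {E : Type*} [NormedAddCommGroup E] [NormedSpace ℝ E] {f : ℝ → E}
    {t : ℝ} (hf : ContDiffAt ℝ ∞ f t) : ContDiffAt ℝ ∞ (deriv f) t := by
  have := contDiffAt_iteratedDeriv hf 1
  rwa [iteratedDeriv_one] at this

theorem iteratedDeriv_prodMk {E F : Type*} [NormedAddCommGroup E] [NormedSpace ℝ E]
    [NormedAddCommGroup F] [NormedSpace ℝ F] (k : ℕ) : ∀ {f : ℝ → E} {g : ℝ → F} {t : ℝ},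
      ContDiffAt ℝ ∞ f t → ContDiffAt ℝ ∞ g t →
      iteratedDeriv k (fun s => (f s, g s)) t = (iteratedDeriv k f t, iteratedDeriv k g t) := by
  induction k with
  | zero => intro f g t _ _; simp
  | succ k ih =>
    intro f g t hf hg
    rw [iteratedDeriv_succ', iteratedDeriv_succ', iteratedDeriv_succ']
    rw [← ih hf.deriv_top hg.deriv_top]
    refine Filter.EventuallyEq.iteratedDeriv_eq _ ?_
    filter_upwards [(hf.of_le (m := 1) (by simp)).eventually (by simp),
      (hg.of_le (m := 1) (by simp)).eventually (by simp)] with s h2 h3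
    exact ((h2.differentiableAt (by simp)).hasDerivAt.prodMk
      (h3.differentiableAt (by simp)).hasDerivAt).deriv

/-- The jets of `F ∘ c` depend continuously on the jets of `c`. -/
theorem exists_jet_near_comp (r : ℕ) : ∀ {E F : Type} [NormedAddCommGroup E] [NormedSpace ℝ E]
    [NormedAddCommGroup F] [NormedSpace ℝ F] {f : E → F} {c₀ : ℝ → E}, SmoothNear f (c₀ 0) →
    ContDiffAt ℝ ∞ c₀ 0 → ∀ δ > 0, ∃ δ' > 0, ∀ c : ℝ → E, ContDiffAt ℝ ∞ c 0 →
      (∀ k ≤ r, ‖iteratedDeriv k c 0 - iteratedDeriv k c₀ 0‖ < δ') →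
      ∀ k ≤ r, ‖iteratedDeriv k (fun t => f (c t)) 0 - iteratedDeriv k (fun t => f (c₀ t)) 0‖ < δ := by
  have hzero : ∀ {E F : Type} [NormedAddCommGroup E] [NormedSpace ℝ E]
      [NormedAddCommGroup F] [NormedSpace ℝ F] {f : E → F} {c₀ : ℝ → E}, SmoothNear f (c₀ 0) →
      ∀ δ > 0, ∃ δ' > 0, ∀ c : ℝ → E, ‖iteratedDeriv 0 c 0 - iteratedDeriv 0 c₀ 0‖ < δ' →
        ‖iteratedDeriv 0 (fun t => f (c t)) 0 - iteratedDeriv 0 (fun t => f (c₀ t)) 0‖ < δ ∧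
        SmoothNear f (c 0) := by
    intro E F _ _ _ _ f c₀ hf δ hδ
    obtain ⟨δ₁, hδ₁, h1⟩ := Metric.eventually_nhds_iff.1
      ((hf.self_of_nhds.continuousAt.eventually (Metric.ball_mem_nhds _ hδ)).and hf.eventually)
    refine ⟨δ₁, hδ₁, fun c hc => ?_⟩
    simp only [iteratedDeriv_zero] at hc ⊢
    have h2 := h1 (y := c 0) (by rwa [dist_eq_norm])
    refine ⟨?_, h2.2⟩
    rw [← dist_eq_norm]
    exact h2.1
  induction r with
  | zero =>
    intro E F _ _ _ _ f c₀ hf _ δ hδ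
    obtain ⟨δ', hδ', h1⟩ := hzero hf δ hδ
    refine ⟨δ', hδ', fun c _ hc k hk => ?_⟩
    obtain rfl : k = 0 := by omega
    exact (h1 c (hc 0 le_rfl)).1
  | succ r ih =>
    intro E F _ _ _ _ f c₀ hf hc₀ δ hδ
    -- The derivative of `f ∘ c` is the tangent map of `f` along `(c, c')`. The induction lowers the
    -- order by passing to this map, hence it runs over all spaces.
    have hTf : SmoothNear (fun p : E × E => fderiv ℝ f p.1 p.2) (c₀ 0, deriv c₀ 0) := by
      have h1 : ∀ᶠ p : E × E in 𝓝 (c₀ 0, deriv c₀ 0), ContDiffAt ℝ ∞ f p.1 :=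
        continuous_fst.continuousAt.eventually (p := fun y => ContDiffAt ℝ ∞ f y) hf
      filter_upwards [h1] with p hp
      have h2 : ContDiffAt ℝ ∞ (fderiv ℝ f) p.1 := hp.fderiv_right (by simp)
      exact (h2.comp p contDiffAt_fst).clm_apply contDiffAt_snd
    obtain ⟨δ₀, hδ₀, h0⟩ := hzero hf δ hδ
    obtain ⟨δ₁, hδ₁, h1⟩ := ih (c₀ := fun t => (c₀ t, deriv c₀ t)) hTf
      (hc₀.prodMk hc₀.deriv_top) δ hδ
    have hder : ∀ {c : ℝ → E}, ContDiffAt ℝ ∞ c 0 → SmoothNear f (c 0) →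
        deriv (fun t => f (c t)) =ᶠ[𝓝 0] fun t => fderiv ℝ f (c t) (deriv c t) := by
      intro c hc hfc
      filter_upwards [(hc.of_le (m := 1) (by simp)).eventually (by simp),
        hc.continuousAt.eventually (p := fun y => ContDiffAt ℝ ∞ f y) hfc] with t h2 h3
      exact ((h3.differentiableAt (by simp)).hasFDerivAt.comp_hasDerivAt t
        (h2.differentiableAt (by simp)).hasDerivAt).deriv
    refine ⟨min δ₀ δ₁, lt_min hδ₀ hδ₁, fun c hc hcn k hk => ?_⟩
    have h2 := h0 c ((hcn 0 (Nat.zero_le _)).trans_le (min_le_left _ _))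
    rcases k with _ | k
    · exact h2.1
    · rw [iteratedDeriv_succ', iteratedDeriv_succ', (hder hc h2.2).iteratedDeriv_eq,
        (hder hc₀ hf).iteratedDeriv_eq]
      refine h1 (fun t => (c t, deriv c t)) (hc.prodMk hc.deriv_top) (fun j hj => ?_) k
        (by omega)
      rw [iteratedDeriv_prodMk j hc hc.deriv_top,
        iteratedDeriv_prodMk j hc₀ hc₀.deriv_top, ← iteratedDeriv_succ',
        ← iteratedDeriv_succ', Prod.mk_sub_mk, Prod.norm_mk]
      exact max_lt ((hcn j (by omega)).trans_le (min_le_right _ _))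
        ((hcn (j + 1) (by omega)).trans_le (min_le_right _ _))

end Jets

section ControlCurves

variable {r : ℕ} {X : ℕ → Eu (r + 3) → ℝ} {ρ : ℝ → ℝ}

/-- The integral curves of a control system are the solutions of the differential equations. -/
theorem IsControlSystem.isIntegralCurve_iff (h : IsControlSystem r X ρ) {γ : ℝ → UEu.{u} (r + 3)}
    {ε : ℝ} : IsIntegralCurve h.system γ ε ↔
      ContDiffOn ℝ ∞ (fun t => unlift _ (γ t)) (Ioo (-ε) ε) ∧ ∀ t ∈ Ioo (-ε) ε,
        (∀ l < r, co _ (l + 2) (deriv (fun t => unlift _ (γ t)) t) =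
          X l (unlift _ (γ t)) * co _ 0 (deriv (fun t => unlift _ (γ t)) t)) ∧
        co _ 0 (deriv (fun t => unlift _ (γ t)) t) ≠ 0 := by
  have hvel : ∀ t, MDifferentiableAt 𝓘(ℝ, ℝ) (𝓡 (r + 3)) γ t →
      (velocity h.system γ t : Eu (r + 3)) = deriv (fun t => unlift _ (γ t)) t := fun t ht =>
    velocity_eq_deriv (S := h.system) ht rfl
  have hpt : ∀ t, MDifferentiableAt 𝓘(ℝ, ℝ) (𝓡 (r + 3)) γ t →
      (((∀ α ∈ h.system.I (γ t), α (velocity h.system γ t) = 0) ∧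
        h.system.τ (γ t) (velocity h.system γ t) ≠ 0) ↔
      (∀ l < r, co _ (l + 2) (deriv (fun t => unlift _ (γ t)) t) =
          X l (unlift _ (γ t)) * co _ 0 (deriv (fun t => unlift _ (γ t)) t)) ∧
        co _ 0 (deriv (fun t => unlift _ (γ t)) t) ≠ 0) := by
    intro t ht
    rw [← hvel t ht]
    refine and_congr ker_liftFamily (not_congr ?_)
    refine (Eq.congr_left (liftTime_apply (γ t) _)).trans ?_
    rw [mul_eq_zero, or_iff_right (h.deriv_ρ _)]
  constructor
  · rintro ⟨h1, h2⟩
    refine ⟨(contMDiff_unlift.comp_contMDiffOn h1).contDiffOn, fun t ht => (hpt t ?_).1 (h2 t ht)⟩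
    exact (h1.contMDiffAt (isOpen_Ioo.mem_nhds ht)).mdifferentiableAt (by simp)
  · rintro ⟨h1, h2⟩
    have h3 : ContMDiffOn 𝓘(ℝ, ℝ) (𝓡 (r + 3)) ∞ γ (Ioo (-ε) ε) :=
      (contMDiff_unlift_symm.{u}.comp_contMDiffOn h1.contMDiffOn).congr fun t _ =>
        ((unlift _).symm_apply_apply (γ t)).symm
    refine ⟨h3, fun t ht => (hpt t ?_).2 (h2 t ht)⟩
    exact (h3.contMDiffAt (isOpen_Ioo.mem_nhds ht)).mdifferentiableAt (by simp)

theorem IsControlSystem.jetNear_iff (h : IsControlSystem r X ρ) {γ₀ γ : ℝ → UEu.{u} (r + 3)}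
    {m : ℕ} {δ : ℝ} : JetNear h.system m δ γ₀ γ ↔ ∀ k ≤ m,
      ‖iteratedDeriv k (fun t => unlift _ (γ t)) 0 - iteratedDeriv k (fun t => unlift _ (γ₀ t)) 0‖ < δ :=
  ⟨fun h => h.2, fun h => ⟨trivial, h⟩⟩

end ControlCurves

/-! ### Projections between control systems, and lifting by one state -/

section Projections

variable {r r' : ℕ} {X : ℕ → Eu (r + 3) → ℝ} {X' : ℕ → Eu (r' + 3) → ℝ} {ρ : ℝ → ℝ}

/-- The projection between the spaces of two control systems. -/
def controlProj (r' r : ℕ) : UEu.{u} (r' + 3) → UEu.{u} (r + 3) := liftMap (res (r' + 3) (r + 3))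

theorem unlift_controlProj (x : UEu.{u} (r' + 3)) :
    unlift _ (controlProj r' r x) = res (r' + 3) (r + 3) (unlift _ x) := rfl

theorem contMDiff_controlProj (r' r : ℕ) :
    ContMDiff (𝓡 (r' + 3)) (𝓡 (r + 3)) ∞ (controlProj.{u} r' r) :=
  contMDiff_liftMap (res _ _).contDiff

theorem mfderiv_controlProj (x : UEu.{u} (r' + 3)) (v : Eu (r' + 3)) :
    (mfderiv (𝓡 (r' + 3)) (𝓡 (r + 3)) (controlProj r' r) x v : Eu (r + 3)) =
      res (r' + 3) (r + 3) v :=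
  (mfderiv_liftMap (res _ _).contDiff x v).trans
    (congrArg (fun T : Eu (r' + 3) →L[ℝ] Eu (r + 3) => T v) (ContinuousLinearMap.fderiv _))

theorem controlProj_surjective (hr : r ≤ r') : Function.Surjective (controlProj.{u} r' r) := fun z => by
  obtain ⟨y, hy⟩ := res_surjective (show r + 3 ≤ r' + 3 by omega) (unlift _ z)
  exact ⟨(unlift _).symm y, (unlift _).injective hy⟩

theorem surjective_mfderiv_controlProj (hr : r ≤ r') (x : UEu.{u} (r' + 3)) :
    Function.Surjective (mfderiv (𝓡 (r' + 3)) (𝓡 (r + 3)) (controlProj r' r) x) := fun w => by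
  obtain ⟨v, hv⟩ := res_surjective (show r + 3 ≤ r' + 3 by omega) w
  exact ⟨v, (mfderiv_controlProj x v).trans hv⟩

theorem submersionNear_controlProj (hr : r ≤ r') (x : UEu.{u} (r' + 3)) :
    SubmersionNear (d := r + 3) (e := r' + 3) (controlProj.{u} r' r) x :=
  subm_of_open isOpen_univ (contMDiff_controlProj r' r).contMDiffOn
    (fun x _ => surjective_mfderiv_controlProj hr x) (mem_univ x)

theorem pullCov_liftTime (x : UEu.{u} (r' + 3)) :
    (pullCov (controlProj.{u} r' r) x (liftTime r ρ (controlProj r' r x)) : Cot (r' + 3) x) =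
      liftTime r' ρ x := by
  ext v
  refine ((liftTime_apply _ _).trans ?_).trans (liftTime_apply x v).symm
  rw [unlift_controlProj, co_res (by omega)]
  exact congrArg (_ * ·) ((congrArg (co (r + 3) 0) (mfderiv_controlProj x v)).trans
    (co_res (by omega) v))

theorem ker_pullback_liftFamily
    (hXX : ∀ l < r, ∀ y, X' l y = X l (res (r' + 3) (r + 3) y)) {x : UEu.{u} (r' + 3)}
    {v : Eu (r' + 3)} :
    (∀ α ∈ (pullback (controlProj r' r) (liftFamily r X) : Family (r' + 3) (UEu.{u} (r' + 3))) x,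
      α v = 0) ↔ ∀ l < r, co _ (l + 2) v = X' l (unlift _ x) * co _ 0 v := by
  have h1 := ker_liftFamily (X := X) (x := controlProj r' r x) (v := res (r' + 3) (r + 3) v)
  have h2 : (∀ l < r, co (r + 3) (l + 2) (res (r' + 3) (r + 3) v) =
      X l (unlift _ (controlProj r' r x)) * co (r + 3) 0 (res (r' + 3) (r + 3) v)) ↔
      ∀ l < r, co _ (l + 2) v = X' l (unlift _ x) * co _ 0 v :=
    forall₂_congr fun l hl => by
      rw [co_res (by omega), co_res (by omega), unlift_controlProj, hXX l hl]
  rw [← h2, ← h1]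
  constructor
  · intro h α hα
    exact (congrArg (α : Eu (r + 3) →L[ℝ] ℝ) (mfderiv_controlProj x v)).symm.trans (h _ ⟨α, hα, rfl⟩)
  · rintro h _ ⟨α, hα, rfl⟩
    exact (congrArg (α : Eu (r + 3) →L[ℝ] ℝ) (mfderiv_controlProj x v)).trans (h α hα)

/-- A subspace of covectors is determined by its common kernel. -/
theorem le_of_ker_le {E : Type*} [NormedAddCommGroup E] [NormedSpace ℝ E] [FiniteDimensional ℝ E]
    {A B : Submodule ℝ (E →L[ℝ] ℝ)} (h : ∀ v, (∀ β ∈ B, β v = 0) → ∀ α ∈ A, α v = 0) : A ≤ B := by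
  intro α hα
  by_contra hc
  obtain ⟨v, hv, hv1⟩ := exists_vector_of_notMem hc
  rw [h v hv α hα] at hv1
  exact zero_ne_one hv1

theorem pullback_liftFamily_le (hr : r ≤ r')
    (hXX : ∀ l < r, ∀ y, X' l y = X l (res (r' + 3) (r + 3) y)) (x : UEu.{u} (r' + 3)) :
    (pullback (controlProj r' r) (liftFamily r X) : Family (r' + 3) (UEu.{u} (r' + 3))) x ≤
      liftFamily r' X' x :=
  le_of_ker_le (E := Eu (r' + 3)) fun v hv => (ker_pullback_liftFamily hXX).2 fun l hl =>
    ker_liftFamily.1 hv l (by omega)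

end Projections

section Step

variable {r r' : ℕ} {X : ℕ → Eu (r + 3) → ℝ} {X' : ℕ → Eu (r' + 3) → ℝ} {ρ : ℝ → ℝ}

/-- The right hand side of the last equation depends on the last control. -/
theorem IsControlSystem.fderiv_last_ne_zero (h' : IsControlSystem r' X' ρ) (hr : r' = r + 1)
    (hX : ∀ l, ContDiff ℝ ∞ (X l))
    (hXX : ∀ l < r, ∀ y, X' l y = X l (res (r' + 3) (r + 3) y)) (y v : Eu (r' + 3))
    (hv : res (r' + 3) (r + 3) v = 0) (h0 : fderiv ℝ (X' r) y v = 0) : v = 0 := by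
  have h1 := res_eq_zero_iff.1 hv
  have h2 := h'.nondegenerate y v (h1 0 (by omega)) (fun l hl => h1 _ (by omega)) fun l hl => by
    rcases Nat.lt_or_ge l r with hl' | hl'
    · have h3 : X' l = X l ∘ res (r' + 3) (r + 3) := funext fun y => hXX l hl' y
      have h4 := ((hX l).differentiable (by simp) (res (r' + 3) (r + 3) y)).hasFDerivAt.comp y
        (res (r' + 3) (r + 3)).hasFDerivAt
      rw [← h3] at h4
      rw [h4.fderiv, ContinuousLinearMap.comp_apply, hv, map_zero]
    · obtain rfl : l = r := by omega
      exact h0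
  refine eu_eq_zero fun j hj => ?_
  rcases Nat.lt_or_ge j (r + 3) with hj' | hj'
  · exact h1 j hj'
  · obtain rfl : j = r' + 2 := by omega
    exact h2.2

/-- Rolle's theorem on the segment from `z` to `y`: equal values at the ends force a zero of the
derivative in the direction `y - z`, hence `y = z`. -/
theorem eq_of_fderiv_ne_zero {E : Type*} [NormedAddCommGroup E] [NormedSpace ℝ E] {f : E → ℝ}
    (hf : ContDiff ℝ ∞ f) {y z : E} (h : ∀ x, fderiv ℝ f x (y - z) = 0 → y - z = 0)
    (hyz : f y = f z) : y = z := by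
  have h1 : ∀ t : ℝ, HasDerivAt (fun t : ℝ => f (z + t • (y - z)))
      (fderiv ℝ f (z + t • (y - z)) (y - z)) t := fun t => by
    have h2 : HasDerivAt (fun t : ℝ => z + t • (y - z)) (y - z) t := by
      simpa using ((hasDerivAt_id t).smul_const (y - z)).const_add z
    exact (hf.differentiable (by simp) (z + t • (y - z))).hasFDerivAt.comp_hasDerivAt t h2
  obtain ⟨t, -, ht⟩ := exists_deriv_eq_zero (f := fun t : ℝ => f (z + t • (y - z))) zero_lt_one
    (fun t _ => (h1 t).continuousAt.continuousWithinAt) (by simpa using hyz.symm)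
  rw [(h1 t).deriv] at ht
  exact sub_eq_zero.1 (h _ ht)

theorem co_deriv_res {a b j : ℕ} (hj : j < b) {c : ℝ → Eu a} {t : ℝ} (hc : DifferentiableAt ℝ c t) :
    co b j (deriv (fun s => res a b (c s)) t) = co a j (deriv c t) := by
  have h1 : HasDerivAt (fun s => res a b (c s)) _ t :=
    (res a b).hasFDerivAt.comp_hasDerivAt t hc.hasDerivAt
  rw [h1.deriv, co_res hj]

/-- A control system and the system with one more state solve each other's equations. -/
theorem IsControlSystem.hasLocalLiftings (h : IsControlSystem r X ρ) (h' : IsControlSystem r' X' ρ)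
    (hr : r' = r + 1) (hXX : ∀ l < r, ∀ y, X' l y = X l (res (r' + 3) (r + 3) y)) :
    HasLocalLiftings (h'.system : PfSystem.{u}) h.system (controlProj r' r) where
  smooth := contMDiff_controlProj r' r
  pull_le x := pullback_liftFamily_le (by omega) hXX x
  pull_indep x := pullCov_liftTime x
  unique γ₁ γ₂ ε hε h₁ h₂ heq := by
    obtain ⟨hs₁, hd₁⟩ := h'.isIntegralCurve_iff.1 h₁
    obtain ⟨hs₂, hd₂⟩ := h'.isIntegralCurve_iff.1 h₂
    have hI : Ioo (-ε) ε ∈ 𝓝 (0 : ℝ) := isOpen_Ioo.mem_nhds (zero_mem_Ioo hε)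
    have hres : ∀ t ∈ Ioo (-ε) ε, res (r' + 3) (r + 3) (unlift _ (γ₁ t)) =
        res (r' + 3) (r + 3) (unlift _ (γ₂ t)) := fun t ht => congrArg (unlift _) (heq t ht)
    have hder : deriv (fun t => res (r' + 3) (r + 3) (unlift _ (γ₁ t))) 0 =
        deriv (fun t => res (r' + 3) (r + 3) (unlift _ (γ₂ t))) 0 :=
      Filter.EventuallyEq.deriv_eq (by filter_upwards [hI] with t ht using hres t ht)
    have hco : ∀ j < r + 3, co (r' + 3) j (deriv (fun t => unlift _ (γ₁ t)) 0) =
        co (r' + 3) j (deriv (fun t => unlift _ (γ₂ t)) 0) := fun j hj => by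
      rw [← co_deriv_res hj ((hs₁.contDiffAt hI).differentiableAt (by simp)), hder,
        co_deriv_res hj ((hs₂.contDiffAt hI).differentiableAt (by simp))]
    -- Both liftings share the coordinates below `r + 3` and their velocities. The last equation
    -- then equates the values of `X' r`, and these determine the one remaining coordinate.
    have h3 := (hd₁ 0 (zero_mem_Ioo hε)).1 r (by omega)
    have h4 := (hd₂ 0 (zero_mem_Ioo hε)).1 r (by omega)
    have h5 := (hd₂ 0 (zero_mem_Ioo hε)).2
    rw [hco _ (by omega), hco _ (by omega), h4] at h3
    have h6 := mul_right_cancel₀ h5 h3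
    refine (unlift _).injective (eq_of_fderiv_ne_zero (h'.smooth r) (fun x hx =>
      h'.fderiv_last_ne_zero hr h.smooth hXX x _ ?_ hx) h6.symm)
    rw [map_sub, hres 0 (zero_mem_Ioo hε), sub_self]
  lift γ' ε' hε' hγ' m δ hδ := by
    obtain ⟨hs', hd'⟩ := h'.isIntegralCurve_iff.1 hγ'
    set c' : ℝ → Eu (r' + 3) := fun t => unlift _ (γ' t) with hc'
    set R := res (r' + 3) (r + 3) with hR
    have hI : Ioo (-ε') ε' ∈ 𝓝 (0 : ℝ) := isOpen_Ioo.mem_nhds (zero_mem_Ioo hε')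
    have hc's : ContDiffAt ℝ ∞ c' 0 := hs'.contDiffAt hI
    -- `Y` replaces the new control by the value of `X' r` and is a local diffeomorphism. Along an
    -- integral curve `X' r` is the quotient of the velocities of `y_{r+2}` and `y_0`, computable
    -- downstairs as `rat`, so inverting `Y` recovers the lifting.
    set Y : Eu (r' + 3) → Eu (r + 3) × ℝ := fun y => (R y, X' r y) with hY
    set T : Eu (r' + 3) →L[ℝ] Eu (r + 3) × ℝ := R.prod (fderiv ℝ (X' r) (c' 0)) with hT
    have hTi : Function.Injective T.toLinearMap := by
      rw [← LinearMap.ker_eq_bot, LinearMap.ker_eq_bot']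
      intro v hv
      exact h'.fderiv_last_ne_zero hr h.smooth hXX _ v (congrArg Prod.fst hv) (congrArg Prod.snd hv)
    have hTs : Function.Surjective T.toLinearMap :=
      (LinearMap.injective_iff_surjective_of_finrank_eq_finrank (by
        rw [Module.finrank_prod, finrank_euclideanSpace_fin, finrank_euclideanSpace_fin,
          Module.finrank_self]
        omega)).1 hTi
    have hYd : HasFDerivAt Y ((ContinuousLinearEquiv.ofBijective T (LinearMap.ker_eq_bot.2 hTi)
        (LinearMap.range_eq_top.2 hTs) : Eu (r' + 3) ≃L[ℝ] Eu (r + 3) × ℝ) :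
        Eu (r' + 3) →L[ℝ] Eu (r + 3) × ℝ) (c' 0) := by
      rw [ContinuousLinearEquiv.coe_ofBijective]
      exact R.hasFDerivAt.prodMk ((h'.smooth r).differentiable (by simp) _).hasFDerivAt
    obtain ⟨e, he0, -, hcoe, -, -, hesymm⟩ := exists_smooth_local_inverse
      (Filter.Eventually.of_forall fun x => (R.contDiff.prodMk (h'.smooth r)).contDiffAt)
      hYd Filter.univ_mem
    replace hcoe : ∀ y, e y = Y y := congrFun hcoe
    set rat : Eu (r + 3) × Eu (r + 3) → Eu (r + 3) × ℝ :=
      fun p => (p.1, co _ (r + 2) p.2 / co _ 0 p.2) with hrat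
    have hrats : ∀ p : Eu (r + 3) × Eu (r + 3), co _ 0 p.2 ≠ 0 → ContDiffAt ℝ ∞ rat p := fun p hp =>
      contDiffAt_fst.prodMk ((((co _ (r + 2)).contDiff.comp contDiff_snd).contDiffAt).div
        (((co _ 0).contDiff.comp contDiff_snd).contDiffAt) hp)
    set C₀ : ℝ → Eu (r + 3) × Eu (r + 3) := fun t => (R (c' t), deriv (fun s => R (c' s)) t) with hC₀
    have hRc's : ContDiffAt ℝ ∞ (fun s => R (c' s)) 0 := R.contDiff.contDiffAt.comp 0 hc's
    have hC₀s : ContDiffAt ℝ ∞ C₀ 0 := hRc's.prodMk hRc's.deriv_top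
    have hrat0 : ∀ t ∈ Ioo (-ε') ε', co (r + 3) 0 (C₀ t).2 ≠ 0 ∧ rat (C₀ t) = Y (c' t) := by
      intro t ht
      have h1 : DifferentiableAt ℝ c' t :=
        (hs'.contDiffAt (isOpen_Ioo.mem_nhds ht)).differentiableAt (by simp)
      have h2 := (hd' t ht).1 r (by omega)
      have h3 := (hd' t ht).2
      have h4 : co (r + 3) 0 (C₀ t).2 = co (r' + 3) 0 (deriv c' t) := co_deriv_res (by omega) h1
      have h5 : co (r + 3) (r + 2) (C₀ t).2 = co (r' + 3) (r + 2) (deriv c' t) :=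
        co_deriv_res (by omega) h1
      refine ⟨by rwa [h4], Prod.ext rfl ?_⟩
      show co (r + 3) (r + 2) (C₀ t).2 / co (r + 3) 0 (C₀ t).2 = X' r (c' t)
      rw [h4, h5, h2, mul_div_assoc, div_self h3, mul_one]
    obtain ⟨h00, h0r⟩ := hrat0 0 (zero_mem_Ioo hε')
    have hgood : ∀ᶠ p in 𝓝 (C₀ 0), co (r + 3) 0 p.2 ≠ 0 ∧ rat p ∈ e.target := by
      refine Filter.Eventually.and ?_ ?_
      · exact (((co (r + 3) 0).continuous.comp continuous_snd).continuousAt).eventually_ne h00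
      · refine (hrats _ h00).continuousAt.preimage_mem_nhds (e.open_target.mem_nhds ?_)
        rw [h0r, ← hcoe]
        exact e.map_source he0
    have hF : ∀ p : Eu (r + 3) × Eu (r + 3), co (r + 3) 0 p.2 ≠ 0 ∧ rat p ∈ e.target →
        ContDiffAt ℝ ∞ (fun p => e.symm (rat p)) p := fun p hp =>
      (hesymm _ hp.2).comp p (hrats p hp.1)
    obtain ⟨δ₁, hδ₁, hjet⟩ := exists_jet_near_comp m (f := fun p => e.symm (rat p)) (c₀ := C₀)
      (hgood.mono hF) hC₀s δ hδ
    obtain ⟨δ₂, hδ₂, hball⟩ := Metric.eventually_nhds_iff.1 hgood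
    -- The lifting involves first derivatives of the curve below, so its `m`-jet is controlled by
    -- the `(m + 1)`-jet.
    refine ⟨m + 1, min δ₁ δ₂, lt_min hδ₁ hδ₂, fun γ ε hε hγ hn => ?_⟩
    obtain ⟨hs, hd⟩ := h.isIntegralCurve_iff.1 hγ
    replace hn := h.jetNear_iff.1 hn
    set c : ℝ → Eu (r + 3) := fun t => unlift _ (γ t) with hc
    set C : ℝ → Eu (r + 3) × Eu (r + 3) := fun t => (c t, deriv c t) with hC
    have hcs : ∀ t ∈ Ioo (-ε) ε, ContDiffAt ℝ ∞ c t := fun t ht =>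
      hs.contDiffAt (isOpen_Ioo.mem_nhds ht)
    have hCs : ∀ t ∈ Ioo (-ε) ε, ContDiffAt ℝ ∞ C t := fun t ht =>
      (hcs t ht).prodMk (hcs t ht).deriv_top
    have hc0 := hcs 0 (zero_mem_Ioo hε)
    have hCn : ∀ k ≤ m, ‖iteratedDeriv k C 0 - iteratedDeriv k C₀ 0‖ < min δ₁ δ₂ := by
      intro k hk
      rw [hC, hC₀, iteratedDeriv_prodMk k hc0 hc0.deriv_top,
        iteratedDeriv_prodMk k hRc's hRc's.deriv_top, ← iteratedDeriv_succ', ← iteratedDeriv_succ',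
        Prod.mk_sub_mk, Prod.norm_mk]
      exact max_lt (hn k (by omega)) (hn (k + 1) (by omega))
    have hC0 : co (r + 3) 0 (C 0).2 ≠ 0 ∧ rat (C 0) ∈ e.target := by
      refine hball ?_
      have h1 := hCn 0 (Nat.zero_le _)
      rw [iteratedDeriv_zero, iteratedDeriv_zero, ← dist_eq_norm] at h1
      exact h1.trans_le (min_le_right _ _)
    have hopen : ∀ᶠ t in 𝓝 (0 : ℝ), t ∈ Ioo (-ε) ε ∧ rat (C t) ∈ e.target := by
      refine Filter.inter_mem (isOpen_Ioo.mem_nhds (zero_mem_Ioo hε)) ?_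
      exact ((hrats _ hC0.1).continuousAt.comp (f := C)
        (hCs 0 (zero_mem_Ioo hε)).continuousAt).preimage_mem_nhds (e.open_target.mem_nhds hC0.2)
    obtain ⟨ε'', hε'', hU⟩ := exists_Ioo_of_eventually hopen
    have hCt : ∀ t ∈ Ioo (-ε'') ε'', co (r + 3) 0 (C t).2 ≠ 0 ∧ rat (C t) ∈ e.target := fun t ht =>
      ⟨(hd t (hU t ht).1).2, (hU t ht).2⟩
    set D : ℝ → Eu (r' + 3) := fun t => e.symm (rat (C t)) with hD
    have hYD : ∀ t ∈ Ioo (-ε'') ε'', Y (D t) = rat (C t) := fun t ht => by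
      rw [← hcoe]
      exact e.right_inv (hCt t ht).2
    have hRD : ∀ t ∈ Ioo (-ε'') ε'', R (D t) = c t := fun t ht => congrArg Prod.fst (hYD t ht)
    have hDs : ∀ t ∈ Ioo (-ε'') ε'', ContDiffAt ℝ ∞ D t := fun t ht =>
      (hF _ (hCt t ht)).comp (f := C) t (hCs t (hU t ht).1)
    refine ⟨fun t => (unlift _).symm (D t), ε'', hε'', h'.isIntegralCurve_iff.2
      ⟨fun t ht => (hDs t ht).contDiffWithinAt, fun t ht => ?_⟩,
      fun t ht => (unlift _).injective (hRD t ht), h'.jetNear_iff.2 fun k hk => ?_⟩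
    · show (∀ l < r', co _ (l + 2) (deriv D t) = X' l (D t) * co _ 0 (deriv D t)) ∧
        co _ 0 (deriv D t) ≠ 0
      have h1 : deriv (fun s => R (D s)) t = deriv c t := Filter.EventuallyEq.deriv_eq (by
        filter_upwards [isOpen_Ioo.mem_nhds ht] with s hs using hRD s hs)
      have h2 : ∀ j < r + 3, co (r' + 3) j (deriv D t) = co (r + 3) j (deriv c t) := fun j hj => by
        rw [← h1, co_deriv_res hj ((hDs t ht).differentiableAt (by simp))]
      have h3 := hd t (hU t ht).1
      refine ⟨fun l hl => ?_, by rw [h2 0 (by omega)]; exact h3.2⟩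
      rw [h2 _ (by omega), h2 0 (by omega)]
      rcases Nat.lt_or_ge l r with hl' | hl'
      · rw [hXX l hl', hRD t ht]
        exact h3.1 l hl'
      · obtain rfl : l = r := by omega
        have h4 : X' l (D t) = co _ (l + 2) (deriv c t) / co _ 0 (deriv c t) :=
          congrArg Prod.snd (hYD t ht)
        rw [h4, div_mul_cancel₀ _ h3.2]
    · have h1 := hjet C (hCs 0 (zero_mem_Ioo hε)) (fun k hk => (hCn k hk).trans_le (min_le_left _ _))
        k hk
      have h2 : (fun t => e.symm (rat (C₀ t))) =ᶠ[𝓝 0] c' := by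
        have h3 : ∀ᶠ t in 𝓝 (0 : ℝ), c' t ∈ e.source :=
          hc's.continuousAt.preimage_mem_nhds (e.open_source.mem_nhds he0)
        filter_upwards [hI, h3] with t ht ht'
        rw [(hrat0 t ht).2, ← hcoe, e.left_inv ht']
      rw [h2.iteratedDeriv_eq] at h1
      exact h1

end Step

/-! ### Reductions, strong linearity and fibers of projections -/

section Reductions

variable {d : ℕ} {N : Type u} [TopologicalSpace N] [ChartedSpace (EuclideanSpace ℝ (Fin d)) N]
  [IsManifold (𝓡 d) ∞ N] {S : PfSystem.{u}}

/-- The condition on the kernel need not be assumed: `S` has no Cauchy characteristics, so those of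
the pullback are the vertical vectors. -/
theorem isReduction_of_submersion {F : Family d N} {σ : Form d N} {U : Set N} {p : N → S.M}
    (hU : IsOpen U) (hp : ContMDiffOn (𝓡 d) (𝓡 S.dim) ∞ p U)
    (hs : ∀ x ∈ U, Function.Surjective (mfderiv (𝓡 d) (𝓡 S.dim) p x))
    (hc : ∀ y : S.M, IsConnected (U ∩ p ⁻¹' {y}))
    (hF : ∀ x ∈ U, (pullback p S.I : Family d N) x = F x)
    (hσ : ∀ x ∈ U, pullCov p x (S.τ (p x)) = σ x) : IsReduction F σ U S p where
  isOpen := hU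
  smooth := hp
  submersion := hs
  ker x hx v := by
    have hsub := subm_of_open hU hp hs hx
    obtain ⟨θ, hθ⟩ := S.subbundle.exists_frame (p x)
    have h1 := hθ.pullback hsub
    have h2 : IsFrameAt F (fun i => pullForm p (θ i)) x :=
      ⟨h1.smooth, h1.indep, by
        filter_upwards [h1.span, hU.mem_nhds hx] with z hz hzU using hz.trans (hF z hzU)⟩
    rw [h2.mem_cauchy_iff, ← h1.mem_cauchy_iff, mem_cauchy_pullback hsub hθ, S.noCauchy,
      Submodule.mem_bot]
  fibers := hc
  pull := hF
  pull_indep := hσ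

end Reductions

section StronglyLinear

variable {d : ℕ} {M : Type u} [TopologicalSpace M] [ChartedSpace (EuclideanSpace ℝ (Fin d)) M]
  [IsManifold (𝓡 d) ∞ M]

theorem isSubbundle_adjoin {r : ℕ} {F : Family d M} {τ : Form d M} (hF : IsSubbundle r F)
    (hτ : ∀ x, SmoothFormNear τ x) (hτF : ∀ x, τ x ∉ F x) : IsSubbundle (r + 1) (adjoin F τ) := by
  refine isSubbundle_of_frames fun x => ?_
  obtain ⟨θ, hθ⟩ := hF.exists_frame x
  have h1 := hθ.adjoin (hτ x) (Filter.Eventually.of_forall hτF)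
  let e : Fin (r + 1) ≃ Fin r ⊕ Unit :=
    (finSumFinEquiv.symm.trans (Equiv.sumCongr (Equiv.refl _) finOneEquiv))
  refine ⟨fun i => Sum.elim θ (fun _ => τ) (e i), fun i => h1.smooth _, ?_, ?_⟩
  · filter_upwards [h1.indep] with z hz using hz.comp e e.injective
  · filter_upwards [h1.span] with z hz
    rw [← hz]
    exact congrArg (Submodule.span ℝ) (e.surjective.range_comp fun i => Sum.elim θ (fun _ => τ) i z)

theorem derived_le (F : Family d M) (x : M) : derived F x ≤ F x := by
  refine Submodule.span_le.2 ?_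
  rintro α ⟨U, ψ, hψ, hx, rfl, -⟩
  exact hψ.2.2 x hx

theorem derived_iterate_le (F : Family d M) (k : ℕ) (x : M) : (derived^[k] F) x ≤ F x := by
  induction k with
  | zero => exact le_rfl
  | succ k ih =>
    rw [Function.iterate_succ_apply']
    exact (derived_le _ x).trans ih

/-- Strong linearity is inherited by pullbacks along submersions. -/
theorem PfSystem.IsStronglyLinear.of_pullback {N P : PfSystem.{u}} {f : P.M → N.M}
    (h : N.IsStronglyLinear)
    (hf : ∀ x, SubmersionNear (d := N.dim) (e := P.dim) f x) (hI : P.I = pullback f N.I)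
    (hτ : P.τ = pullForm f N.τ) : P.IsStronglyLinear := by
  obtain ⟨-, hsub, ⟨m, hm⟩, hfrob⟩ := h
  have hder : ∀ k, derived^[k] P.I = pullback f (derived^[k] N.I) := fun k => by
    rw [hI, derived_iterate_pullback hf hsub]
  have hF : ∀ k, IsFrobenius (adjoin (derived^[k] P.I) P.τ) := fun k => by
    obtain ⟨r, hr⟩ := hsub k
    rw [hder, hτ, ← pullback_adjoin]
    exact isFrobenius_pullback hf (isSubbundle_adjoin hr (tau_smooth N) fun x hx =>
      N.independent x (derived_iterate_le _ _ _ hx)) (hfrob k)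
  refine ⟨hF 0, fun k => ?_, ⟨m, fun x => ?_⟩, hF⟩
  · obtain ⟨r, hr⟩ := hsub k
    exact ⟨r, by rw [hder]; exact isSubbundle_pullback hf hr⟩
  · rw [hder]
    refine (Submodule.eq_bot_iff _).2 ?_
    rintro _ ⟨β, hβ, rfl⟩
    rw [hm] at hβ
    rw [(Submodule.mem_bot ℝ).1 hβ]
    exact ContinuousLinearMap.zero_comp _

end StronglyLinear

section Fibers

variable {r r' : ℕ}

theorem isConnected_fiber_controlProj (hr : r ≤ r') (y : UEu.{u} (r + 3)) :
    IsConnected (controlProj.{u} r' r ⁻¹' {y}) := by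
  have h1 : controlProj.{u} r' r ⁻¹' {y} =
      (unlift.{u} (r' + 3)).symm '' (res (r' + 3) (r + 3) ⁻¹' {unlift _ y}) := by
    ext x
    constructor
    · rintro rfl
      exact ⟨unlift _ x, rfl, rfl⟩
    · rintro ⟨z, hz, rfl⟩
      exact (unlift _).injective hz
  rw [h1]
  refine IsConnected.image ⟨?_, ?_⟩ _ (unlift _).symm.continuous.continuousOn
  · obtain ⟨z, hz⟩ := res_surjective (show r + 3 ≤ r' + 3 by omega) (unlift _ y)
    exact ⟨z, hz⟩
  · exact ((convex_singleton (unlift _ y)).linear_preimage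
      (res (r' + 3) (r + 3)).toLinearMap).isPreconnected

end Fibers

/-! ### The tower of control systems of a flag -/

section Tower

variable {n K : ℕ} {X : ℕ → Eu (n + K + 3) → ℝ} {ρ : ℝ → ℝ}

/-- The right hand sides of the first `n + k` equations, as functions of the first `n + k + 3`
coordinates. -/
def flagRhs (X : ℕ → Eu (n + K + 3) → ℝ) (k l : ℕ) (y : Eu (n + k + 3)) : ℝ :=
  X l (res (n + k + 3) (n + K + 3) y)

theorem IsControlFlag.isControlSystem (h : IsControlFlag n K X) (hρ : ContDiff ℝ ∞ ρ)
    (hρ' : ∀ t, deriv ρ t ≠ 0) {k : ℕ} (hk : k ≤ K) :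
    IsControlSystem (n + k) (flagRhs X k) ρ where
  smooth l := (h.smooth l).comp (res _ _).contDiff
  nondegenerate y v h0 h1 h2 := by
    have hco : ∀ j < n + K + 3, co (n + K + 3) j (res (n + k + 3) (n + K + 3) v) =
        co (n + k + 3) j v := fun j hj => co_res hj v
    have h3 := h.nondegenerate k hk (res _ _ y) (res (n + k + 3) (n + K + 3) v)
      (by rw [hco 0 (by omega), h0]) (fun l hl => by rw [hco _ (by omega), h1 l hl]) fun l hl => by
        have h4 := ((h.smooth l).differentiable (by simp)
          (res (n + k + 3) (n + K + 3) y)).hasFDerivAt.comp y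
          (res (n + k + 3) (n + K + 3)).hasFDerivAt
        rw [← h2 l hl, show flagRhs X k l = X l ∘ res (n + k + 3) (n + K + 3) from rfl, h4.fderiv,
          ContinuousLinearMap.comp_apply]
    rwa [hco 1 (by omega), hco _ (by omega)] at h3
  smooth_ρ := hρ
  deriv_ρ := hρ'

theorem IsControlFlag.flagRhs_res (h : IsControlFlag n K X) {j k : ℕ} (hjk : j ≤ k) (hk : k ≤ K) :
    ∀ l < n + j, ∀ y, flagRhs X k l y = flagRhs X j l (res (n + k + 3) (n + j + 3) y) :=
  fun l hl y => h.congr j (hjk.trans hk) l hl _ _ fun i hi => by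
    rw [co_res (by omega), co_res (by omega), co_res hi]

/-- The control systems defined by a flag. -/
abbrev IsControlFlag.system (h : IsControlFlag n K X) (hρ : ContDiff ℝ ∞ ρ)
    (hρ' : ∀ t, deriv ρ t ≠ 0) {k : ℕ} (hk : k ≤ K) : PfSystem.{u} :=
  (h.isControlSystem hρ hρ' hk).system

theorem controlProj_comp {a b c : ℕ} (hc : c ≤ b) :
    controlProj.{u} b c ∘ controlProj a b = controlProj a c := funext fun x =>
  (unlift _).injective (res_res (by omega) (unlift _ x))

theorem controlProj_self (a : ℕ) : controlProj.{u} a a = id := funext fun x =>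
  (unlift _).injective (res_self _ (unlift _ x))

theorem IsControlFlag.hasLocalLiftings (h : IsControlFlag n K X) (hρ : ContDiff ℝ ∞ ρ)
    (hρ' : ∀ t, deriv ρ t ≠ 0) {j k : ℕ} (hjk : j ≤ k) (hk : k ≤ K) :
    HasLocalLiftings (h.system hρ hρ' hk : PfSystem.{u}) (h.system hρ hρ' (hjk.trans hk))
      (controlProj (n + k) (n + j)) := by
  induction k, hjk using Nat.le_induction with
  | base =>
    rw [controlProj_self]
    exact HasLocalLiftings.refl _
  | succ k hjk ih =>
    rw [← controlProj_comp (show n + j ≤ n + k by omega)]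
    exact (ih (by omega)).comp ((h.isControlSystem hρ hρ' (by omega : k ≤ K)).hasLocalLiftings
      (h.isControlSystem hρ hρ' hk) rfl (h.flagRhs_res (by omega) hk))

theorem IsControlFlag.isCartanProlongation (h : IsControlFlag n K X) (hρ : ContDiff ℝ ∞ ρ)
    (hρ' : ∀ t, deriv ρ t ≠ 0) {j k : ℕ} (hjk : j ≤ k) (hk : k ≤ K) :
    IsCartanProlongation (h.system hρ hρ' hk : PfSystem.{u}) (h.system hρ hρ' (hjk.trans hk))
      (controlProj (n + k) (n + j)) where
  smooth := contMDiff_controlProj _ _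
  submersion := surjective_mfderiv_controlProj (by omega)
  dense := (controlProj_surjective (by omega)).denseRange
  pull_le := (h.hasLocalLiftings hρ hρ' hjk hk).pull_le
  pull_indep := (h.hasLocalLiftings hρ hρ' hjk hk).pull_indep
  lifting := (h.hasLocalLiftings hρ hρ' hjk hk).genericUniqueLifting

theorem HasLocalLiftings.isCartanProlongation_refl (S : PfSystem.{u}) :
    IsCartanProlongation S S id where
  smooth := contMDiff_id
  submersion x v := ⟨v, by rw [mfderiv_id]; rfl⟩
  dense := Function.surjective_id.denseRange
  pull_le := (HasLocalLiftings.refl S).pull_le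
  pull_indep := (HasLocalLiftings.refl S).pull_indep
  lifting := (HasLocalLiftings.refl S).genericUniqueLifting

/-- The pullback of the system at level `k` to the top level. -/
def flagFamily (X : ℕ → Eu (n + K + 3) → ℝ) (k : ℕ) : Family (n + K + 3) (UEu.{u} (n + K + 3)) :=
  pullback (controlProj (n + K) (n + k)) (liftFamily (n + k) (flagRhs X k))

theorem IsControlFlag.ker_flagFamily (h : IsControlFlag n K X) {k : ℕ} (hk : k ≤ K)
    {x : UEu.{u} (n + K + 3)} {v : Eu (n + K + 3)} :
    (∀ α ∈ flagFamily X k x, α v = 0) ↔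
      ∀ l < n + k, co _ (l + 2) v = X l (unlift _ x) * co _ 0 v := by
  refine (ker_pullback_liftFamily (h.flagRhs_res hk le_rfl)).trans (forall₂_congr fun l _ => ?_)
  rw [flagRhs, res_self]

theorem IsControlFlag.isFrameAt (h : IsControlFlag n K X) (hρ : ContDiff ℝ ∞ ρ)
    (hρ' : ∀ t, deriv ρ t ≠ 0) {k : ℕ} (hk : k ≤ K) (x : UEu.{u} (n + K + 3)) :
    ∃ κ : Fin (n + k) → Form (n + K + 3) (UEu.{u} (n + K + 3)), IsFrameAt (flagFamily X k) κ x :=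
  ⟨_, ((h.isControlSystem hρ hρ' hk).isFrameAt _).pullback
    (submersionNear_controlProj (by omega) x)⟩

theorem IsControlFlag.mem_cauchy_flagFamily (h : IsControlFlag n K X) (hρ : ContDiff ℝ ∞ ρ)
    (hρ' : ∀ t, deriv ρ t ≠ 0) {k : ℕ} (hk : k ≤ K) {x : UEu.{u} (n + K + 3)}
    {v : Eu (n + K + 3)} :
    v ∈ cauchy (flagFamily X k) x ↔ ∀ j < n + k + 3, co _ j v = 0 := by
  have h1 := mem_cauchy_pullback (submersionNear_controlProj (show n + k ≤ n + K by omega) x)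
    ((h.isControlSystem hρ hρ' hk).isFrameAt _) v
  refine h1.trans (Iff.trans ?_ res_eq_zero_iff)
  rw [(h.isControlSystem hρ hρ' hk).cauchy_lift, Submodule.mem_bot]
  exact (congrArg (fun w : Eu (n + k + 3) => w = 0) (mfderiv_controlProj x v)).to_iff

theorem IsControlFlag.flagFamily_mono (h : IsControlFlag n K X) {j k : ℕ} (hjk : j ≤ k)
    (hk : k ≤ K) (x : UEu.{u} (n + K + 3)) : flagFamily X j x ≤ flagFamily X k x :=
  le_of_ker_le (E := Eu (n + K + 3)) fun v hv => (h.ker_flagFamily (hjk.trans hk)).2 fun l hl =>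
    (h.ker_flagFamily hk).1 hv l (by omega)

theorem flagFamily_top (X : ℕ → Eu (n + K + 3) → ℝ) (x : UEu.{u} (n + K + 3)) :
    flagFamily X K x = liftFamily (n + K) (flagRhs X K) x := by
  refine le_antisymm (le_of_ker_le (E := Eu (n + K + 3)) fun v hv => ?_)
    (le_of_ker_le (E := Eu (n + K + 3)) fun v hv => ?_)
  · refine (ker_pullback_liftFamily (X' := flagRhs X K) fun l _ y => ?_).2 (ker_liftFamily.1 hv)
    rw [res_self]
  · refine ker_liftFamily.2 ((ker_pullback_liftFamily (X' := flagRhs X K) fun l _ y => ?_).1 hv)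
    rw [res_self]

/-- The Cauchy characteristics of level `k` are the directions of the coordinates from `n + k + 3`
on. The forms of the top system that do not involve these differentials are exactly those of level
`k + 1`. -/
theorem IsControlFlag.cartan_inf_flagFamily (h : IsControlFlag n K X) (hρ : ContDiff ℝ ∞ ρ)
    (hρ' : ∀ t, deriv ρ t ≠ 0) {k : ℕ} (hk : k + 1 ≤ K) (x : UEu.{u} (n + K + 3)) :
    cartan (flagFamily X k) x ⊓ liftFamily (n + K) (flagRhs X K) x = flagFamily X (k + 1) x := by
  rw [← flagFamily_top]
  refine le_antisymm (le_of_ker_le (E := Eu (n + K + 3)) fun v hv α hα => ?_)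
    (le_inf (fun α hα v hv => ?_) (h.flagFamily_mono hk le_rfl x))
  · have h1 := (h.ker_flagFamily hk).1 hv
    -- `w` satisfies all `n + K` equations and agrees with `v` in the coordinates below `n + k + 3`.
    -- So `α w = 0`, and `v - w` is a Cauchy characteristic of level `k`.
    set w : Eu (n + K + 3) := vec _ fun j =>
      if j = 0 then co (n + K + 3) 0 v else if j = 1 then co (n + K + 3) 1 v else
        X (j - 2) (unlift _ x) * co (n + K + 3) 0 v with hw
    have hw0 : co (n + K + 3) 0 w = co (n + K + 3) 0 v := by
      rw [hw, co_vec _ (by omega), if_pos rfl]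
    have hw1 : co (n + K + 3) 1 w = co (n + K + 3) 1 v := by
      rw [hw, co_vec _ (by omega), if_neg one_ne_zero, if_pos rfl]
    have hw2 : ∀ l < n + K, co (n + K + 3) (l + 2) w = X l (unlift _ x) * co (n + K + 3) 0 v :=
      fun l hl => by
        rw [hw, co_vec _ (by omega), if_neg (by omega), if_neg (by omega), Nat.add_sub_cancel]
    have hαw : (α : Eu (n + K + 3) →L[ℝ] ℝ) w = 0 := (h.ker_flagFamily le_rfl).2
      (fun l hl => by rw [hw2 l hl, hw0]) α hα.2
    have hαv : (α : Eu (n + K + 3) →L[ℝ] ℝ) (v - w) = 0 := hα.1 (v - w)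
      ((h.mem_cauchy_flagFamily hρ hρ' (by omega)).2 fun j hj => by
        rw [map_sub]
        rcases Nat.lt_or_ge j 2 with hj2 | hj2
        · interval_cases j
          · rw [hw0, sub_self]
          · rw [hw1, sub_self]
        · obtain ⟨l, rfl⟩ := Nat.exists_eq_add_of_le' hj2
          rw [hw2 l (by omega), h1 l (by omega), sub_self])
    rw [map_sub, hαw, sub_zero] at hαv
    exact hαv
  · have h1 := (h.mem_cauchy_flagFamily hρ hρ' (by omega)).1 hv
    exact (h.ker_flagFamily hk).2 (fun l hl => by rw [h1 _ (by omega), h1 0 (by omega), mul_zero])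
      α hα

theorem IsControlFlag.relExt_eq (h : IsControlFlag n K X) (hρ : ContDiff ℝ ∞ ρ)
    (hρ' : ∀ t, deriv ρ t ≠ 0) {k : ℕ} (hk : k ≤ K) :
    relExt (h.system hρ hρ' le_rfl : PfSystem.{u}) (h.system hρ hρ' (Nat.zero_le K))
      (controlProj (n + K) (n + 0)) k = flagFamily X k := by
  induction k with
  | zero => rfl
  | succ k ih =>
    funext x
    have h1 := h.cartan_inf_flagFamily hρ hρ' hk x
    rw [← ih (by omega)] at h1
    exact h1

theorem IsControlFlag.isCRegular (h : IsControlFlag n K X) (hρ : ContDiff ℝ ∞ ρ)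
    (hρ' : ∀ t, deriv ρ t ≠ 0) :
    IsCRegular (h.system hρ hρ' le_rfl : PfSystem.{u}) (h.system hρ hρ' (Nat.zero_le K))
      (controlProj (n + K) (n + 0)) K where
  prolongation := h.isCartanProlongation hρ hρ' (Nat.zero_le K) le_rfl
  strict k hk := by
    rw [h.relExt_eq hρ hρ' hk.le, h.relExt_eq hρ hρ' hk]
    refine lt_of_le_of_ne (fun x => h.flagFamily_mono (Nat.le_succ k) hk x) fun heq => ?_
    obtain ⟨κ, hκ⟩ := h.isFrameAt.{u} hρ hρ' hk.le ((unlift _).symm 0)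
    obtain ⟨κ', hκ'⟩ := h.isFrameAt.{u} hρ hρ' hk ((unlift _).symm 0)
    have h1 := hκ.finrank_eq
    rw [heq, hκ'.finrank_eq, Fintype.card_fin, Fintype.card_fin] at h1
    omega
  top := by
    rw [h.relExt_eq hρ hρ' le_rfl]
    exact funext fun x => flagFamily_top X x
  indep_mem k hk x := by
    rw [h.relExt_eq hρ hρ' hk]
    intro v hv
    refine (liftTime_apply x v).trans ?_
    rw [(h.mem_cauchy_flagFamily hρ hρ' hk).1 hv 0 (by omega), mul_zero]
  chain := by
    -- The chain is indexed by all natural numbers; beyond `K` it is continued by its top level.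
    refine ⟨fun k => h.system hρ hρ' (min_le_right k K),
      fun k => controlProj (n + K) (n + min k K), fun k hk => ?_, fun k _ =>
      ⟨controlProj (n + min (k + 1) K) (n + min k K), fun x => ?_,
        h.isCartanProlongation hρ hρ' (min_le_min_right K (Nat.le_succ k)) (min_le_right _ K)⟩⟩
    · rw [h.relExt_eq hρ hρ' hk]
      refine isReduction_of_submersion isOpen_univ (contMDiff_controlProj _ _).contMDiffOn
        (fun x _ => surjective_mfderiv_controlProj (by omega) x) (fun y => ?_) (fun x _ => ?_)
        fun x _ => pullCov_liftTime x
      · rw [univ_inter]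
        exact isConnected_fiber_controlProj (by omega) y
      · exact congrArg (fun j => flagFamily X j x) (min_eq_left hk)
    · exact congrFun (controlProj_comp (by omega)) x

theorem IsControlFlag.isLinearizing (h : IsControlFlag n K X) (hρ : ContDiff ℝ ∞ ρ)
    (hρ' : ∀ t, deriv ρ t ≠ 0)
    (hlin : (h.system hρ hρ' le_rfl : PfSystem.{u}).IsStronglyLinear) :
    IsLinearizing (h.system hρ hρ' le_rfl : PfSystem.{u}) (h.system hρ hρ' (Nat.zero_le K))
      (controlProj (n + K) (n + 0)) K where
  cRegular := h.isCRegular hρ hρ'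
  stronglyLinear := hlin
  cts k hk := by
    have hs := h.isControlSystem hρ hρ' hk
    have h1 := isFrobenius_pullback
      (fun x => submersionNear_controlProj.{u} (show n + k ≤ n + K by omega) x)
      (isSubbundle_adjoin hs.isSubbundle hs.smooth_liftTime hs.liftTime_notMem) hs.isFrobenius
    rw [pullback_adjoin] at h1
    rw [h.relExt_eq hρ hρ' hk]
    have h2 : pullForm (controlProj.{u} (n + K) (n + k)) (liftTime (n + k) ρ) =
        liftTime (n + K) ρ := funext fun x => pullCov_liftTime x
    rw [h2] at h1
    exact h1
  rank_one k hk x := by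
    obtain ⟨κ, hκ⟩ := h.isFrameAt.{u} hρ hρ' hk.le x
    obtain ⟨κ', hκ'⟩ := h.isFrameAt.{u} hρ hρ' hk x
    rw [h.relExt_eq hρ hρ' hk.le, h.relExt_eq hρ hρ' hk]
    exact hκ'.finrank_eq.trans ((Fintype.card_fin _).trans
      (congrArg (· + 1) (hκ.finrank_eq.trans (Fintype.card_fin _)).symm))

/-- The strongly linear top system is a prolongation of the bottom one and, by the identity, of
itself; this is the absolute equivalence. The projection from top to bottom is the linearizing
prolongation. -/
theorem IsControlFlag.cls_le (h : IsControlFlag n K X) (hρ : ContDiff ℝ ∞ ρ)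
    (hρ' : ∀ t, deriv ρ t ≠ 0)
    (hlin : (h.system hρ hρ' le_rfl : PfSystem.{u}).IsStronglyLinear) :
    (h.system hρ hρ' (Nat.zero_le K) : PfSystem.{u}).cls ≤ (K : ℕ∞) :=
  sInf_le ⟨⟨h.system hρ hρ' le_rfl, hlin, h.system hρ hρ' le_rfl, controlProj (n + K) (n + 0), id,
    h.isCartanProlongation hρ hρ' (Nat.zero_le K) le_rfl,
    HasLocalLiftings.isCartanProlongation_refl _⟩,
    K, _, _, h.isLinearizing hρ hρ' hlin, rfl⟩

end Tower

/-! ### From an adapted coframing to a control system on the leaf space -/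

section Composition

variable {a b c : ℕ} {A : Type u} {B : Type v} {C : Type*}
  [TopologicalSpace A] [ChartedSpace (EuclideanSpace ℝ (Fin a)) A]
  [TopologicalSpace B] [ChartedSpace (EuclideanSpace ℝ (Fin b)) B]
  [TopologicalSpace C] [ChartedSpace (EuclideanSpace ℝ (Fin c)) C]

theorem pullCov_comp_apply {f : A → B} {g : B → C} {x : A}
    (hg : MDifferentiableAt (𝓡 b) (𝓡 c) g (f x)) (hf : MDifferentiableAt (𝓡 a) (𝓡 b) f x)
    (β : Eu c →L[ℝ] ℝ) :
    (pullCov (d := c) (e := a) (g ∘ f) x β : Eu a →L[ℝ] ℝ) =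
      pullCov (d := b) (e := a) f x (pullCov (d := c) (e := b) g (f x) β) :=
  congrArg (fun T : Eu a →L[ℝ] Eu c => β.comp T) (mfderiv_comp x hg hf)

theorem pullback_comp_apply {f : A → B} {g : B → C} {x : A}
    (hg : MDifferentiableAt (𝓡 b) (𝓡 c) g (f x)) (hf : MDifferentiableAt (𝓡 a) (𝓡 b) f x)
    (F : Family c C) :
    (pullback (g ∘ f) F : Family a A) x = (pullback f (pullback g F : Family b B) : Family a A) x := by
  ext α
  constructor
  · rintro ⟨β, hβ, rfl⟩
    exact ⟨_, ⟨β, hβ, rfl⟩, pullCov_comp_apply hg hf β⟩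
  · rintro ⟨_, ⟨β, hβ, rfl⟩, rfl⟩
    exact ⟨β, hβ, (pullCov_comp_apply hg hf β).symm⟩

end Composition

theorem spanUpTo_mono {d : ℕ} {N : Type u} [TopologicalSpace N]
    [ChartedSpace (EuclideanSpace ℝ (Fin d)) N] {n K : ℕ} (θ : Fin n → Form d N)
    (η : Fin K → Form d N) {j k : ℕ} (h : j ≤ k) (x : N) : spanUpTo θ η j x ≤ spanUpTo θ η k x :=
  Submodule.span_mono (union_subset_union_right _ fun _ ⟨i, hi, hα⟩ => ⟨i, hi.trans_le h, hα⟩)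

/-- The reduction is a chart onto Euclidean space followed by truncation to the first `n + 3`
coordinates, and the chart identifies a neighborhood in `N` with the top of the tower of control
systems. -/
theorem IsAdaptedCoframing.exists_reduction {N : PfSystem.{u}} {n K : ℕ}
    {θ : Fin n → Form N.dim N.M} {η : Fin K → Form N.dim N.M} {ω₁ ω₂ : Form N.dim N.M}
    (h : IsAdaptedCoframing univ θ η ω₁ ω₂ N.τ) (hn : 2 ≤ n) (hlin : N.IsStronglyLinear)
    (hI : ∀ x, N.I x = spanUpTo θ η K x) (q : N.M) :
    ∃ (U : Set N.M) (S : PfSystem.{u}) (p : N.M → S.M),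
      q ∈ U ∧ IsReduction (spanUpTo θ η 0) N.τ U S p ∧
      S.HasType n 2 ∧ S.IsCTS ∧ S.cls ≤ (K : ℕ∞) := by
  obtain ⟨g, hg, hgτ⟩ := N.exact
  obtain ⟨e, ρ, hq, htar, hes, hess, hsub, hρ, hρ', hτ, hker, hcau⟩ :=
    h.exists_parametrization hn hg hgτ q
  obtain ⟨X, hX, hGX⟩ := exists_controlFlag (n := n) (K := K)
    (G := fun k => (pullback e.symm (spanUpTo θ η k) : Family (n + K + 3) (Eu (n + K + 3))))
    (fun k hk y => ⟨_, isFrameAt_euclidean.1 ((h.isFrameAt hk (e.symm y)).pullback (hsub y))⟩)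
    (fun k hk y => by
      rintro _ ⟨β, hβ, rfl⟩
      exact ⟨β, spanUpTo_mono θ η hk _ hβ, rfl⟩)
    (fun y hy => by
      have h1 : pullForm (e := n + K + 3) e.symm N.τ y =
          (deriv ρ (co (n + K + 3) 0 y) • co (n + K + 3) 0 : Eu (n + K + 3) →L[ℝ] ℝ) := by
        ext v
        exact hτ y v
      have h2 := Submodule.smul_mem _ (deriv ρ (co (n + K + 3) 0 y)) hy
      have h3 := mem_of_pullCov_mem (hsub y).surj.self_of_nhds (F := spanUpTo θ η K)
        (α := N.τ (e.symm y)) ((congrArg (fun α : Eu (n + K + 3) →L[ℝ] ℝ => α ∈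
          (pullback e.symm (spanUpTo θ η K) : Family (n + K + 3) (Eu (n + K + 3))) y) h1).mpr h2)
      rw [← hI] at h3
      exact N.independent _ h3)
    (fun k hk y v hv => ((hker k hk y v).1 hv).1) hcau
  let f : UEu.{u} (n + K + 3) → N.M := e.symm ∘ unlift (n + K + 3)
  let E : N.M → UEu.{u} (n + K + 3) := (unlift (n + K + 3)).symm ∘ e
  have hfE : ∀ x ∈ e.source, f (E x) = x := fun x hx => e.left_inv hx
  have hEf : ∀ z, E (f z) = z := fun z => (congrArg (unlift _).symm
    (e.right_inv (htar ▸ mem_univ _))).trans ((unlift _).symm_apply_apply z)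
  have hfU : ∀ z, f z ∈ e.source := fun z => e.map_target (htar ▸ mem_univ _)
  have hf : ContMDiff (𝓡 (n + K + 3)) (𝓡 N.dim) ∞ f := hess.comp contMDiff_unlift
  have hE : ContMDiffOn (𝓡 N.dim) (𝓡 (n + K + 3)) ∞ E e.source :=
    contMDiff_unlift_symm.comp_contMDiffOn hes
  have hf' : ∀ z, MDifferentiableAt (𝓡 (n + K + 3)) (𝓡 N.dim) f z := fun z =>
    hf.contMDiffAt.mdifferentiableAt (by simp)
  have hE' : ∀ x ∈ e.source, MDifferentiableAt (𝓡 N.dim) (𝓡 (n + K + 3)) E x := fun x hx =>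
    (hE.contMDiffAt (e.open_source.mem_nhds hx)).mdifferentiableAt (by simp)
  have hpull : ∀ (z : UEu.{u} (n + K + 3)) (β : Eu N.dim →L[ℝ] ℝ),
      (pullCov (d := N.dim) (e := n + K + 3) f z β : Eu (n + K + 3) →L[ℝ] ℝ) =
        pullCov (d := N.dim) (e := n + K + 3) e.symm (unlift _ z) β := fun z β => by
    refine (pullCov_comp_apply (f := unlift (n + K + 3)) (g := e.symm)
      (hess.contMDiffAt.mdifferentiableAt (by simp))
      (contMDiff_unlift.contMDiffAt.mdifferentiableAt (by simp)) β).trans ?_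
    ext v
    exact congrArg (pullCov (d := N.dim) (e := n + K + 3) e.symm (unlift _ z) β :
      Eu (n + K + 3) →L[ℝ] ℝ) (mfderiv_unlift z v)
  have hflag : ∀ k ≤ K, (pullback f (spanUpTo θ η k) : Family (n + K + 3) (UEu.{u} (n + K + 3))) =
      flagFamily X k := fun k hk => by
    funext z
    have h1 : (pullback f (spanUpTo θ η k) : Family (n + K + 3) (UEu.{u} (n + K + 3))) z =
        (controlFamily (n + k) X (unlift _ z) : Submodule ℝ (Eu (n + K + 3) →L[ℝ] ℝ)) := by
      rw [← hGX k hk]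
      ext α
      constructor
      · rintro ⟨β, hβ, rfl⟩
        exact ⟨β, hβ, hpull z β⟩
      · rintro ⟨β, hβ, rfl⟩
        exact ⟨β, hβ, (hpull z β).symm⟩
    rw [h1]
    exact le_antisymm
      (le_of_ker_le (E := Eu (n + K + 3)) fun v hv =>
        ker_controlFamily.2 ((hX.ker_flagFamily hk).1 hv))
      (le_of_ker_le (E := Eu (n + K + 3)) fun v hv =>
        (hX.ker_flagFamily hk).2 (ker_controlFamily.1 hv))
  have htime : pullForm (e := n + K + 3) f N.τ = liftTime (n + K) ρ := by
    funext z
    ext v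
    exact (congrArg (fun T : Eu (n + K + 3) →L[ℝ] ℝ => T v) (hpull z (N.τ (f z)))).trans
      ((hτ _ v).trans (liftTime_apply z v).symm)
  have hfsub : ∀ z, SubmersionNear (d := N.dim) (e := n + K + 3) f z := fun z =>
    subm_of_open isOpen_univ hf.contMDiffOn (fun z _ v => by
      obtain ⟨w, hw⟩ := (hsub (unlift _ z)).surj.self_of_nhds v
      refine ⟨w, ?_⟩
      have h1 := mfderiv_comp z (f := unlift (n + K + 3)) (g := e.symm)
        (hess.contMDiffAt.mdifferentiableAt (by simp))
        (contMDiff_unlift.contMDiffAt.mdifferentiableAt (by simp))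
      exact (congrArg (fun T : Eu (n + K + 3) →L[ℝ] Eu N.dim => T w) h1).trans
        ((congrArg (mfderiv (𝓡 (n + K + 3)) (𝓡 N.dim) e.symm (unlift _ z)) (mfderiv_unlift z w)).trans
          hw)) (mem_univ z)
  -- The top control system is the pullback of `N` along the parametrization `f`, so it inherits
  -- strong linearity.
  have hlin' : (hX.system hρ hρ' le_rfl : PfSystem.{u}).IsStronglyLinear := by
    refine hlin.of_pullback (f := f) hfsub ?_ htime.symm
    refine (funext fun z => (flagFamily_top X z).symm).trans ((hflag K le_rfl).symm.trans ?_)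
    exact congrArg (fun F : Family N.dim N.M =>
      (pullback f F : Family (n + K + 3) (UEu.{u} (n + K + 3)))) (funext hI).symm
  have hEs : ∀ x ∈ e.source, Function.Surjective (mfderiv (𝓡 N.dim) (𝓡 (n + K + 3)) E x) :=
    fun x hx => by
      have h1 := surjective_mfderiv_of_leftInverse (f := f) (g := E) (x := E x) (hf' _)
        (by rw [hfE x hx]; exact hE' x hx) (Filter.Eventually.of_forall hEf)
      rwa [hfE x hx] at h1
  have hP : ContMDiff (𝓡 (n + K + 3)) (𝓡 (n + 0 + 3)) ∞ (controlProj.{u} (n + K) (n + 0)) :=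
    contMDiff_controlProj _ _
  have hP' : ∀ z, MDifferentiableAt (𝓡 (n + K + 3)) (𝓡 (n + 0 + 3))
      (controlProj.{u} (n + K) (n + 0)) z := fun z => hP.contMDiffAt.mdifferentiableAt (by simp)
  have hinv : ∀ x ∈ e.source, ∀ᶠ z in 𝓝 x, f (E z) = z := fun x hx => by
    filter_upwards [e.open_source.mem_nhds hx] with z hz using hfE z hz
  refine ⟨e.source, hX.system hρ hρ' (Nat.zero_le K), controlProj (n + K) (n + 0) ∘ E, hq,
    isReduction_of_submersion e.open_source (hP.comp_contMDiffOn hE) (fun x hx v => ?_)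
      (fun y => ?_) (fun x hx => ?_) (fun x hx => ?_), ⟨rfl, rfl⟩,
    (hX.isControlSystem hρ hρ' (Nat.zero_le K)).isCTS, hX.cls_le hρ hρ' hlin'⟩
  · obtain ⟨w, hw⟩ := surjective_mfderiv_controlProj.{u} (show n + 0 ≤ n + K by omega) (E x) v
    obtain ⟨w', rfl⟩ := hEs x hx w
    exact ⟨w', (congrArg (fun T : Eu N.dim →L[ℝ] Eu (n + 0 + 3) => T w')
      (mfderiv_comp x (hP' _) (hE' x hx))).trans hw⟩
  -- The fibers are images under `f` of fibers of a linear projection of the whole Euclidean space,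
  -- which are connected because the target of the chart is everything.
  · have h1 : e.source ∩ controlProj (n + K) (n + 0) ∘ E ⁻¹' {y} =
        f '' (controlProj (n + K) (n + 0) ⁻¹' {y}) := by
      ext x
      constructor
      · rintro ⟨hx, hy⟩
        exact ⟨E x, hy, hfE x hx⟩
      · rintro ⟨z, hz, rfl⟩
        exact ⟨hfU z, (congrArg (controlProj (n + K) (n + 0)) (hEf z)).trans hz⟩
    exact (congrArg IsConnected h1).mpr
      ((isConnected_fiber_controlProj (by omega) y).image f hf.continuous.continuousOn)
  · refine (pullback_comp_apply (hP' _) (hE' x hx) _).trans ?_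
    refine Eq.trans ?_ (pullback_leftInverse (f := E) (g := f) (hE' x hx) (hf' _) (hinv x hx)
      (spanUpTo θ η 0))
    rw [hflag 0 (Nat.zero_le K)]
    rfl
  · refine (pullCov_comp_apply (hP' _) (hE' x hx) _).trans ?_
    refine Eq.trans ?_ (pullForm_leftInverse (f := E) (g := f) (hE' x hx) (hf' _) (hinv x hx) N.τ)
    rw [htime]
    exact congrArg (fun α : Eu (n + K + 3) →L[ℝ] ℝ => pullCov (d := n + K + 3) (e := N.dim) E x α)
      (pullCov_liftTime (E x))

end AbsEq

end

theorem mainTheorem4 (n K : ℕ) (hn : 2 ≤ n) :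
    (∀ (S N : PfSystem.{u}) (π : N.M → S.M),
      S.HasType n 2 → S.IsCTS → S.IsDynLinearizable → IsLinearizing N S π K →
      ∀ q : N.M, ∃ U : Set N.M, IsOpen U ∧ q ∈ U ∧
        ∃ (θ : Fin n → Form N.dim N.M) (η : Fin K → Form N.dim N.M) (ω₁ ω₂ : Form N.dim N.M),
          IsAdaptedCoframing U θ η ω₁ ω₂ N.τ ∧
          ∀ k ≤ K, ∀ x ∈ U, relExt N S π k x = spanUpTo θ η k x) ∧
    (∀ (N : PfSystem.{u}) (θ : Fin n → Form N.dim N.M) (η : Fin K → Form N.dim N.M)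
      (ω₁ ω₂ : Form N.dim N.M),
      N.IsStronglyLinear → IsAdaptedCoframing univ θ η ω₁ ω₂ N.τ →
      (∀ x, N.I x = spanUpTo θ η K x) →
      ∀ q : N.M, ∃ (U : Set N.M) (S : PfSystem.{u}) (p : N.M → S.M),
        q ∈ U ∧ IsReduction (spanUpTo θ η 0) N.τ U S p ∧
        S.HasType n 2 ∧ S.IsCTS ∧ S.cls ≤ (K : ℕ∞)) :=
  ⟨fun _ _ _ hS _ _ h q => h.exists_adaptedCoframing hS hn q,
    fun _ _ _ _ _ hlin h hI q => h.exists_reduction hn hlin hI q⟩
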